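/- **Setting.** Let $\mathcal A,\mathcal F\subset\mathbb Z^{d_*}$ be finite sets, $\mathcal L_\infty\subset\mathbb Z^{d_*}$ an infinite set, $\mathcal L=\mathcal A\sqcup\mathcal F\sqcup\mathcal L_\infty$, $s_*\ge1$ an integer, $0\le\varkappa\le m_*$, $\gamma_*=(0,m_*)$ and $\gamma=(\gamma_1,m_*)$ with $\gamma_1\ge0$. Let $|\cdot|$ be the Euclidean norm, $\langle a\rangle=\max(|a|,1)$, $[a-b]=\min(|a-b|,|a+b|)$. For $\gamma'=(\gamma'_1,\gamma'_2)\in\mathbb R^2$ let $Y_{\gamma'}$ be the space of sequences $\zeta=(\zeta_a)_{a\in\mathcal L}$, $\zeta_a=(p_a,q_a)\in\mathbb C^2$, with $\|\zeta\|_{\gamma'}^2=\sum_a|\zeta_a|^2e^{2\gamma_1'|a|}\langle a\rangle^{2\gamma_2'}<\infty$, and let $\Omega(\zeta,\zeta')=\sum_a(p_aq_a'-q_ap_a')$; for a linear form $\ell$, $J\ell$ is the sequence with $\Omega(J\ell,\cdot)=\ell$. For $a\in\mathcal A$ we write $\zeta_a=(r_a,\theta_a)$ with $\theta_a\in\mathbb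 C/2\pi\mathbb Z$, and $w$ for the remaining components; $\mathcal O_{\gamma'}(\sigma,\mu)$ is the set of the $x=(r,\theta,w)$ of finite $\gamma'$-norm with $\|(r/\mu,\ i\,\mathrm{Im}\,\theta/\sigma,\ w/\mu)\|_{\gamma'}<1$. A bounded operator $A$ of $Y_{\gamma'}$ is symplectic if it extends to a bounded operator of $Y_{-\gamma'}$ and $\Omega(A\zeta,A\zeta')=\Omega(\zeta,\zeta')$ for $\zeta\in Y_{\gamma'}$, $\zeta'\in Y_{-\gamma'}$; a holomorphic map is symplectic if its differential is symplectic at every point. For $\gamma'=(\gamma_1',m_*)$, $\gamma'_1\ge 0$, let $\mathcal M^b_{\gamma',\varkappa}$ be the space of bounded operators $A$ of $Y_{\gamma'}$, with $2\times2$ blocks $A_a^b$, for which $$\|A\|_{\gamma',\varkappa}=\|A\|_{\mathcal B(Y_{\gamma'};Y_{\gamma'})}+\max\Big(\sup_a\sum_b|A_a^b|\,e(a,b),\ \sup_b\sum_a|A_a^b|\,e(a,b)\Big)<\infty,$$ where $e(a,b)=K e^{\gamma'_1[a-b]}\max([a-b],1)^{\varkappa}\min(\langle a\rangle,\langle b\rangle)^{\varkappa}$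 and $K\ge4^{\varkappa}$ is a fixed constant. A map on an open set $\mathcal O$ is rhb if it takes real values at real points and extends holomorphically to a neighbourhood of $\overline{\mathcal O}$. $\mathcal T_{\gamma,\varkappa}(\sigma,\mu)$ is the space of rhb functions $f:\mathcal O_{\gamma_*}(\sigma,\mu)\to\mathbb C$ such that, for all $\gamma_*\le\gamma'\le\gamma$, the maps $J\,df:\mathcal O_{\gamma'}(\sigma,\mu)\to Y_{\gamma'}$ and $J\,d^2f:\mathcal O_{\gamma'}(\sigma,\mu)\to\mathcal M^b_{\gamma',\varkappa}$ exist and are rhb, and such that the norm $$|f|=\max\Big\{\sup_{\mathcal O_{\gamma_*}(\sigma,\mu)}|f|,\ \sup_{\gamma_*\le\gamma'\le\gamma}\ \sup_{\mathcal O_{\gamma'}(\sigma,\mu)}\|J\,df\|_{\gamma'},\ \sup_{\gamma_*\le\gamma'\le\gamma}\ \sup_{\mathcal O_{\gamma'}(\sigma,\mu)}\|J\,d^2f\|_{\gamma',\varkappa}\Big\}$$ is finite. Let $\mathcal D$ be the open unit ball of $\mathbb R^{\mathcal P}$, $\mathcal P$ finite. $\mathcal T_{\gamma,\varkappa,\mathcal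 D}(\sigma,\mu)$ is the space of functions $f(x,\rho)$ on $\mathcal O_{\gamma_*}(\sigma,\mu)\times\mathcal D$ such that $f$, and, for all $\gamma_*\le\gamma'\le\gamma$, the maps $J\,df:\mathcal O_{\gamma'}(\sigma,\mu)\times\mathcal D\to Y_{\gamma'}$ and $J\,d^2f:\mathcal O_{\gamma'}(\sigma,\mu)\times\mathcal D\to\mathcal M^b_{\gamma',\varkappa}$ are of class $\mathcal C^{s_*}$, $\partial_\rho^jf(\cdot,\rho)\in\mathcal T_{\gamma,\varkappa}(\sigma,\mu)$ for all $\rho\in\mathcal D$, $|j|\le s_*$, and $$|f|_{\sigma,\mu;\gamma,\varkappa,\mathcal D}=\max_{|j|\le s_*}\sup_{\rho\in\mathcal D}|\partial_\rho^jf(\cdot,\rho)|<\infty.$$ **Proposition.** There is a constant $C>0$, depending only on $\#\mathcal A,\#\mathcal F,\#\mathcal P,d_*,s_*,m_*$, such that the following holds. Let $0<\sigma'<\sigma$, $0<\mu'<\mu\le1$, and let $g\in\mathcal T_{\gamma,\varkappa,\mathcal D}(\sigma,\mu)$ with $$|g|_{\sigma,\mu;\gamma,\varkappa,\mathcal D}\le\frac1C\min\Big(\sigma-\sigma',\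 \mu-\mu',\ \frac\sigma\mu(\mu-\mu'),\ \frac\mu\sigma(\sigma-\sigma')\Big).$$ Then the Hamiltonian flow $\Phi^t=\Phi^t_g$ of the vector field $-J\,dg(\cdot,\rho)$ is defined on $\mathcal O_{\gamma_*}(\sigma',\mu')\times\mathcal D$ with values in $\mathcal O_{\gamma_*}(\sigma,\mu)$ for real $|t|\le1$, and (i) for all $|t|\le1$ and $\gamma_*\le\gamma'\le\gamma$, $\Phi^t$ is a $\mathcal C^{s_*}$ map $\mathcal O_{\gamma'}(\sigma',\mu')\times\mathcal D\to\mathcal O_{\gamma'}(\sigma,\mu)$, which is real holomorphic and symplectic for each fixed $\rho\in\mathcal D$; moreover $d\Phi^t-I$ is a $\mathcal C^{s_*}$ map $\mathcal O_{\gamma'}(\sigma',\mu')\times\mathcal D\to\mathcal M^b_{\gamma',\varkappa}$, and for all $x\in\mathcal O_{\gamma'}(\sigma',\mu')$, $\rho\in\mathcal D$, $0\le|j|\le s_*$, $$\|\partial_\rho^j(\Phi^t(x,\rho)-x)\|_{\gamma'}\le C|g|_{\sigma,\mu;\gamma,\varkappa,\mathcal D},\qquad \|\partial_\rho^j(d\Phi^t(x,\rho)-I)\|_{\gamma',\varkappa}\le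 C|g|_{\sigma,\mu;\gamma,\varkappa,\mathcal D};$$ (ii) for all $|t|\le1$ and $f\in\mathcal T_{\gamma,\varkappa,\mathcal D}(\sigma,\mu)$, $f\circ\Phi^t\in\mathcal T_{\gamma,\varkappa,\mathcal D}(\sigma',\mu')$ and $|f\circ\Phi^t|_{\sigma',\mu';\gamma,\varkappa,\mathcal D}\le C|f|_{\sigma,\mu;\gamma,\varkappa,\mathcal D}$. -/

import Mathlib

open Set
open scoped ENNReal

noncomputable section

/-! ## Modes and weights -/

/-- The index set of the modes: two finite sets `A`, `F` and an infinite set `Linf` in `ℤ^d`. -/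
structure Modes (d : ℕ) where
  A : Finset (Fin d → ℤ)
  F : Finset (Fin d → ℤ)
  Linf : Set (Fin d → ℤ)
  infinite : Linf.Infinite

/-- The disjoint union of `A`, `F` and `Linf`. -/
abbrev Modes.Idx {d : ℕ} (S : Modes d) : Type := ↥S.A ⊕ (↥S.F ⊕ ↥S.Linf)

/-- The lattice point of a mode. -/
def Modes.pos {d : ℕ} (S : Modes d) : S.Idx → (Fin d → ℤ)
  | Sum.inl a => a.1
  | Sum.inr (Sum.inl a) => a.1
  | Sum.inr (Sum.inr a) => a.1

/-- Euclidean norm `|a|` of a lattice point. -/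
def latNorm {d : ℕ} (a : Fin d → ℤ) : ℝ := Real.sqrt (∑ i, (a i : ℝ) ^ 2)

/-- `⟨a⟩ = max (|a|, 1)`. -/
def japan {d : ℕ} (a : Fin d → ℤ) : ℝ := max (latNorm a) 1

/-- The pseudo-metric `[a - b] = min (|a - b|, |a + b|)`. -/
def pdist {d : ℕ} (a b : Fin d → ℤ) : ℝ := min (latNorm (a - b)) (latNorm (a + b))

/-- `e^{γ₁|a|} ⟨a⟩^{γ₂}`. -/
def wt {d : ℕ} (γ : ℝ × ℝ) (a : Fin d → ℤ) : ℝ :=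
  Real.exp (γ.1 * latNorm a) * japan a ^ γ.2

/-- `e_{γ,ϰ}(a,b) = K e^{γ₁[a-b]} max([a-b],1)^{γ₂} min(⟨a⟩,⟨b⟩)^ϰ`, where `K` is the normalizing
constant. -/
def expWt {d : ℕ} (K : ℝ) (γ : ℝ × ℝ) (κ : ℝ) (a b : Fin d → ℤ) : ℝ :=
  K * Real.exp (γ.1 * pdist a b) * max (pdist a b) 1 ^ γ.2 * min (japan a) (japan b) ^ κ

theorem wt_pos {d : ℕ} (γ : ℝ × ℝ) (a : Fin d → ℤ) : 0 < wt γ a :=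
  mul_pos (Real.exp_pos _)
    (Real.rpow_pos_of_pos (lt_of_lt_of_le one_pos (le_max_right _ _)) _)

theorem wt_mono {d : ℕ} {γ γ' : ℝ × ℝ} (h₁ : γ.1 ≤ γ'.1) (h₂ : γ.2 ≤ γ'.2) (a : Fin d → ℤ) :
    wt γ a ≤ wt γ' a := by
  unfold wt
  have h0 : 0 ≤ latNorm a := Real.sqrt_nonneg _
  have h1 : 1 ≤ japan a := le_max_right _ _
  gcongr

/-! ## The spaces `Y_γ` -/

/-- `ℂ²` with its Hermitian norm; a mode `ζ_a = (p_a, q_a)`, respectively `(r_a, θ_a)`. -/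
abbrev C2 : Type := EuclideanSpace ℂ (Fin 2)

section Yspace

variable {d : ℕ} (S : Modes d) (γ : ℝ × ℝ)

/-- Multiplication of a sequence by the weight. -/
def weightMap : (S.Idx → C2) →ₗ[ℂ] (S.Idx → C2) where
  toFun ζ a := (wt γ (S.pos a) : ℂ) • ζ a
  map_add' _ _ := by ext1 a; simp
  map_smul' c ζ := by ext1 a; simp [smul_comm c]

/-- The sequences with `∑ |ζ_a|² e^{2γ₁|a|} ⟨a⟩^{2γ₂} < ∞`. -/
def ySubmodule : Submodule ℂ (S.Idx → C2) where
  carrier := {ζ | Memℓp (weightMap S γ ζ) 2}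
  zero_mem' := by
    change Memℓp (weightMap S γ 0) 2
    rw [map_zero]; exact zero_memℓp
  add_mem' := by
    intro x y hx hy
    change Memℓp (weightMap S γ (x + y)) 2
    rw [map_add]; exact Memℓp.add hx hy
  smul_mem' := by
    intro c x hx
    change Memℓp (weightMap S γ (c • x)) 2
    rw [map_smul]; exact Memℓp.const_smul hx c

/-- The Hilbert space `Y_γ`. -/
def Y : Type := ↥(ySubmodule S γ)

instance : AddCommGroup (Y S γ) := inferInstanceAs (AddCommGroup ↥(ySubmodule S γ))

instance : Module ℂ (Y S γ) := inferInstanceAs (Module ℂ ↥(ySubmodule S γ))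

instance : CoeFun (Y S γ) (fun _ => S.Idx → C2) := ⟨fun x => x.1⟩

/-- The identification of `Y_γ` with unweighted `ℓ²`, which defines the norm of `Y_γ`. -/
def Y.toLp : Y S γ →ₗ[ℂ] lp (fun _ : S.Idx => C2) 2 where
  toFun x := ⟨weightMap S γ x.1, x.2⟩
  map_add' x y := Subtype.ext (map_add (weightMap S γ) x.1 y.1)
  map_smul' c x := Subtype.ext (map_smul (weightMap S γ) c x.1)

theorem Y.toLp_injective : Function.Injective (Y.toLp S γ) := by
  intro x y h
  apply Subtype.ext
  funext a
  have h1 : weightMap S γ x.1 a = weightMap S γ y.1 a :=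
    congrFun (congrArg Subtype.val h) a
  have h2 : (wt γ (S.pos a) : ℂ) ≠ 0 := by exact_mod_cast (wt_pos γ (S.pos a)).ne'
  exact smul_right_injective C2 h2 h1

instance : NormedAddCommGroup (Y S γ) :=
  NormedAddCommGroup.induced (Y S γ) (lp (fun _ : S.Idx => C2) 2) (Y.toLp S γ)
    (Y.toLp_injective S γ)

instance : NormedSpace ℂ (Y S γ) :=
  NormedSpace.induced ℂ (Y S γ) (lp (fun _ : S.Idx => C2) 2) (Y.toLp S γ)

/-- `‖ζ‖_γ² = ∑ |ζ_a|² e^{2γ₁|a|} ⟨a⟩^{2γ₂}`, for an arbitrary sequence. -/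
def seqNormSq (ζ : S.Idx → C2) : ℝ := ∑' a, ‖ζ a‖ ^ 2 * wt γ (S.pos a) ^ 2

theorem Y.norm_sq (x : Y S γ) : ‖x‖ ^ 2 = seqNormSq S γ x := by
  have h : ‖x‖ = ‖Y.toLp S γ x‖ := rfl
  have h2 := lp.norm_rpow_eq_tsum (p := 2) (by norm_num) (Y.toLp S γ x)
  rw [h]
  simp only [ENNReal.toReal_ofNat, Real.rpow_ofNat] at h2
  rw [h2]
  unfold seqNormSq
  congr 1
  funext a
  change ‖(wt γ (S.pos a) : ℂ) • x a‖ ^ 2 = _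
  rw [norm_smul, Complex.norm_real, Real.norm_of_nonneg (wt_pos γ _).le]
  ring

/-- A sequence of finite norm as an element of `Y_γ`. -/
def Y.mk (ζ : S.Idx → C2) (h : ζ ∈ ySubmodule S γ) : Y S γ := ⟨ζ, h⟩

open Classical in
/-- A sequence as an element of `Y_γ` (and `0` if it does not belong to `Y_γ`). -/
def toY (ζ : S.Idx → C2) : Y S γ := if h : ζ ∈ ySubmodule S γ then Y.mk S γ ζ h else 0

theorem toY_coe {ζ : S.Idx → C2} (h : ζ ∈ ySubmodule S γ) : (toY S γ ζ : S.Idx → C2) = ζ := by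
  have h1 : toY S γ ζ = Y.mk S γ ζ h := dif_pos h
  rw [h1]; rfl

/-- `Y_{γ'} ⊆ Y_γ` for `γ ≤ γ'`. -/
theorem ySubmodule_mono {γ γ' : ℝ × ℝ} (h₁ : γ.1 ≤ γ'.1) (h₂ : γ.2 ≤ γ'.2) :
    ySubmodule S γ' ≤ ySubmodule S γ := by
  intro ζ hζ
  have hs := (memℓp_gen_iff (p := 2) (by norm_num)).1 (show Memℓp (weightMap S γ' ζ) 2 from hζ)
  refine (memℓp_gen_iff (p := 2) (by norm_num)).2 (Summable.of_nonneg_of_le ?_ ?_ hs)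
  · intro a; positivity
  · intro a
    have h3 : ‖weightMap S γ ζ a‖ ≤ ‖weightMap S γ' ζ a‖ := by
      change ‖(wt γ (S.pos a) : ℂ) • ζ a‖ ≤ ‖(wt γ' (S.pos a) : ℂ) • ζ a‖
      rw [norm_smul, norm_smul, Complex.norm_real, Complex.norm_real,
        Real.norm_of_nonneg (wt_pos γ _).le, Real.norm_of_nonneg (wt_pos γ' _).le]
      have := wt_mono h₁ h₂ (S.pos a)
      gcongr
    gcongr

open Classical in
/-- The sequence which is `v` at `b` and `0` elsewhere. -/
def singleSeq (b : S.Idx) (v : C2) : S.Idx → C2 := fun a => if a = b then v else 0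

/-- The embedding of the `b`-th mode. -/
def Y.single (b : S.Idx) : C2 →ₗ[ℂ] Y S γ where
  toFun v := ⟨singleSeq S b v, by
    change Memℓp (weightMap S γ (singleSeq S b v)) 2
    refine (memℓp_gen_iff (p := 2) (by norm_num)).2
      (summable_of_hasFiniteSupport ((Set.finite_singleton b).subset ?_))
    intro a ha
    by_contra hab
    have hab' : a ≠ b := hab
    apply ha
    change ‖(wt γ (S.pos a) : ℂ) • (singleSeq S b v) a‖ ^ _ = 0
    simp [singleSeq, hab']⟩
  map_add' v w := Subtype.ext (by
    change singleSeq S b (v + w) = singleSeq S b v + singleSeq S b w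
    funext a
    by_cases h : a = b <;> simp [singleSeq, h])
  map_smul' c v := Subtype.ext (by
    change singleSeq S b (c • v) = c • singleSeq S b v
    funext a
    by_cases h : a = b <;> simp [singleSeq, h])

/-- The points with real coordinates. -/
def Y.reals : Set (Y S γ) := {x | ∀ a i, (x a i).im = 0}

/-- `Ω(ζ,ζ') = ∑ p_a q'_a - q_a p'_a`. -/
def Omega (ζ ζ' : S.Idx → C2) : ℂ := ∑' a, (ζ a 0 * ζ' a 1 - ζ a 1 * ζ' a 0)

/-- The sequence `J ℓ` with `Ω(J ℓ, ·) = ℓ`, for a linear form `ℓ`. -/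
def Jseq (l : Y S γ →L[ℂ] ℂ) : S.Idx → C2 := fun a =>
  !₂[l (Y.single S γ a !₂[0, 1]), -l (Y.single S γ a !₂[1, 0])]

theorem Omega_Jseq_single (l : Y S γ →L[ℂ] ℂ) (b : S.Idx) (v : C2) :
    Omega S (Jseq S γ l) (Y.single S γ b v) = l (Y.single S γ b v) := by
  have hv : v = v 0 • !₂[(1 : ℂ), 0] + v 1 • !₂[(0 : ℂ), 1] := by
    ext i; fin_cases i <;> simp
  unfold Omega
  rw [tsum_eq_single b]
  · have hb : (Y.single S γ b v : S.Idx → C2) b = v := if_pos rfl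
    rw [hb]
    conv_rhs => rw [hv, map_add, map_smul, map_smul, map_add, map_smul, map_smul]
    simp [Jseq]; ring
  · intro a ha
    have hb : (Y.single S γ b v : S.Idx → C2) a = 0 := if_neg ha
    rw [hb]; simp

/-- A bounded map `T : Y_γ → Y_γ` is symplectic if it extends to a bounded map `T'` of `Y_{-γ}`
and `Ω(Tζ, T'ζ') = Ω(ζ,ζ')` for all `ζ ∈ Y_γ`, `ζ' ∈ Y_{-γ}`. -/
def IsSymplecticOp (T : Y S γ →L[ℂ] Y S γ) : Prop :=
  ∃ T' : Y S (-γ) →L[ℂ] Y S (-γ),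
    (∀ (ζ : Y S γ) (η : Y S (-γ)), (η : S.Idx → C2) = ζ → (T' η : S.Idx → C2) = T ζ) ∧
    ∀ (ζ : Y S γ) (η : Y S (-γ)), Omega S (T ζ) (T' η) = Omega S ζ η

/-! ## The complex neighbourhoods `O_γ(σ,μ)`

The angles are lifted to `ℂ^A`: a point `(r, θ = [z], w)` is represented by the sequence which is
`(r_a, z_a)` at `a ∈ A` and `w_a` at the other modes. Functions on the manifold are the functions
of the lifted variables which are invariant under `z ↦ z + 2πk`, `k ∈ ℤ^A`. -/

/-- The sequence `(r/μ, i Im z/σ, w/μ)`. -/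
def scaleSeq (σ μ : ℝ) (ζ : S.Idx → C2) : S.Idx → C2
  | Sum.inl a => !₂[ζ (Sum.inl a) 0 / μ, Complex.I * ((ζ (Sum.inl a) 1).im : ℂ) / σ]
  | Sum.inr b => (μ : ℂ)⁻¹ • ζ (Sum.inr b)

/-- `O_γ(σ,μ)`, lifted. -/
def dom (σ μ : ℝ) : Set (Y S γ) := {x | Real.sqrt (seqNormSq S γ (scaleSeq S σ μ x)) < 1}

/-- The translation vector `2πk`, `k ∈ ℤ^A`, in the angles. -/
def angleShift (k : ↥S.A → ℤ) : Y S γ :=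
  ∑ a : ↥S.A, Y.single S γ (Sum.inl a) !₂[0, 2 * (Real.pi : ℂ) * (k a : ℂ)]

/-! ## The operator spaces `M^b_{γ,ϰ}` -/

variable {S γ} in
/-- The `2 × 2` block `T_a^b` of an operator. -/
def block (T : Y S γ →L[ℂ] Y S γ) (a b : S.Idx) : C2 →L[ℂ] C2 :=
  LinearMap.toContinuousLinearMap
    { toFun := fun v => T (Y.single S γ b v) a
      map_add' := fun v w => by rw [map_add, map_add]; rfl
      map_smul' := fun c v => by rw [map_smul, map_smul]; rfl }

variable {S γ} in
/-- The matrix norm `|T|_{γ',ϰ}`: the larger one of the suprema of the weighted row sums and of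
the weighted column sums. -/
def decayNorm (K : ℝ) (γ' : ℝ × ℝ) (κ : ℝ) (T : Y S γ →L[ℂ] Y S γ) : ℝ≥0∞ :=
  max (⨆ a, ∑' b, ‖block T a b‖ₑ * ENNReal.ofReal (expWt K γ' κ (S.pos a) (S.pos b)))
    (⨆ b, ∑' a, ‖block T a b‖ₑ * ENNReal.ofReal (expWt K γ' κ (S.pos a) (S.pos b)))

variable {S γ} in
theorem block_add (T T' : Y S γ →L[ℂ] Y S γ) (a b : S.Idx) :
    block (T + T') a b = block T a b + block T' a b := rfl

variable {S γ} in
theorem block_smul (c : ℂ) (T : Y S γ →L[ℂ] Y S γ) (a b : S.Idx) :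
    block (c • T) a b = c • block T a b := rfl

variable {S γ} in
theorem block_zero (a b : S.Idx) : block (0 : Y S γ →L[ℂ] Y S γ) a b = 0 := rfl

variable {S γ} in
theorem decayNorm_zero (K : ℝ) (γ' : ℝ × ℝ) (κ : ℝ) :
    decayNorm K γ' κ (0 : Y S γ →L[ℂ] Y S γ) = 0 := by
  have h0 : ‖(0 : C2 →L[ℂ] C2)‖ₑ = 0 := by
    rw [← ofReal_norm, norm_zero, ENNReal.ofReal_zero]
  simp only [decayNorm, block_zero, h0, zero_mul, tsum_zero]
  simp only [ENNReal.iSup_zero, max_self]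

variable {S γ} in
theorem decayNorm_add_le (K : ℝ) (γ' : ℝ × ℝ) (κ : ℝ) (T T' : Y S γ →L[ℂ] Y S γ) :
    decayNorm K γ' κ (T + T') ≤ decayNorm K γ' κ T + decayNorm K γ' κ T' := by
  have key : ∀ a b, ‖block (T + T') a b‖ₑ * ENNReal.ofReal (expWt K γ' κ (S.pos a) (S.pos b)) ≤
      ‖block T a b‖ₑ * ENNReal.ofReal (expWt K γ' κ (S.pos a) (S.pos b)) +
      ‖block T' a b‖ₑ * ENNReal.ofReal (expWt K γ' κ (S.pos a) (S.pos b)) := by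
    intro a b
    rw [← add_mul, block_add]
    gcongr
    exact enorm_add_le (block T a b) (block T' a b)
  unfold decayNorm
  refine max_le (iSup_le fun a => ?_) (iSup_le fun b => ?_)
  · refine (ENNReal.tsum_le_tsum (key a)).trans ?_
    rw [ENNReal.tsum_add]
    refine add_le_add (le_max_of_le_left ?_) (le_max_of_le_left ?_)
    · exact le_iSup (fun a => ∑' b, ‖block T a b‖ₑ *
        ENNReal.ofReal (expWt K γ' κ (S.pos a) (S.pos b))) a
    · exact le_iSup (fun a => ∑' b, ‖block T' a b‖ₑ *
        ENNReal.ofReal (expWt K γ' κ (S.pos a) (S.pos b))) a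
  · refine (ENNReal.tsum_le_tsum fun a => key a b).trans ?_
    rw [ENNReal.tsum_add]
    refine add_le_add (le_max_of_le_right ?_) (le_max_of_le_right ?_)
    · exact le_iSup (fun b => ∑' a, ‖block T a b‖ₑ *
        ENNReal.ofReal (expWt K γ' κ (S.pos a) (S.pos b))) b
    · exact le_iSup (fun b => ∑' a, ‖block T' a b‖ₑ *
        ENNReal.ofReal (expWt K γ' κ (S.pos a) (S.pos b))) b

variable {S γ} in
theorem decayNorm_smul (K : ℝ) (γ' : ℝ × ℝ) (κ : ℝ) (c : ℂ) (T : Y S γ →L[ℂ] Y S γ) :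
    decayNorm K γ' κ (c • T) = ‖c‖ₑ * decayNorm K γ' κ T := by
  have hmax : ∀ x y z : ℝ≥0∞, x * max y z = max (x * y) (x * z) := fun x y z =>
    Monotone.map_max (f := fun y => x * y) (fun _ _ h => mul_le_mul_right h x)
  unfold decayNorm
  simp only [block_smul, enorm_smul, mul_assoc, ENNReal.tsum_mul_left, ← ENNReal.mul_iSup, hmax]

variable (K m κ : ℝ)

/-- `B(Y_γ;Y_γ) ∩ M_{(γ₁,γ₂+ϰ-m),ϰ}`. -/
def mbSubmodule : Submodule ℂ (Y S γ →L[ℂ] Y S γ) where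
  carrier := {T | decayNorm K (γ.1, γ.2 + κ - m) κ T < ⊤}
  zero_mem' := by
    change decayNorm K (γ.1, γ.2 + κ - m) κ 0 < ⊤
    rw [decayNorm_zero]; exact ENNReal.zero_lt_top
  add_mem' := fun {T T'} hT hT' =>
    (decayNorm_add_le K (γ.1, γ.2 + κ - m) κ T T').trans_lt (ENNReal.add_lt_top.2 ⟨hT, hT'⟩)
  smul_mem' := fun c T hT => by
    change decayNorm K (γ.1, γ.2 + κ - m) κ (c • T) < ⊤
    rw [decayNorm_smul]
    exact ENNReal.mul_lt_top enorm_lt_top hT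

/-- The space `M^b_{γ,ϰ}`. -/
def Mb : Type := ↥(mbSubmodule S γ K m κ)

instance : AddCommGroup (Mb S γ K m κ) := inferInstanceAs (AddCommGroup ↥(mbSubmodule S γ K m κ))

instance : Module ℂ (Mb S γ K m κ) := inferInstanceAs (Module ℂ ↥(mbSubmodule S γ K m κ))

/-- `‖T‖_{γ,ϰ} = ‖T‖_{B(Y_γ;Y_γ)} + |T|_{(γ₁,γ₂+ϰ-m),ϰ}`. -/
instance : Norm (Mb S γ K m κ) :=
  ⟨fun T => ‖T.1‖ + (decayNorm K (γ.1, γ.2 + κ - m) κ T.1).toReal⟩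

theorem Mb.core : NormedSpace.Core ℂ (Mb S γ K m κ) where
  norm_nonneg T := add_nonneg (norm_nonneg _) ENNReal.toReal_nonneg
  norm_smul c T := by
    change ‖c • T.1‖ + (decayNorm K (γ.1, γ.2 + κ - m) κ (c • T.1)).toReal =
      ‖c‖ * (‖T.1‖ + (decayNorm K (γ.1, γ.2 + κ - m) κ T.1).toReal)
    rw [decayNorm_smul, norm_smul, ENNReal.toReal_mul, toReal_enorm]
    ring
  norm_triangle T T' := by
    change ‖T.1 + T'.1‖ + (decayNorm K (γ.1, γ.2 + κ - m) κ (T.1 + T'.1)).toReal ≤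
      (‖T.1‖ + (decayNorm K (γ.1, γ.2 + κ - m) κ T.1).toReal) +
      (‖T'.1‖ + (decayNorm K (γ.1, γ.2 + κ - m) κ T'.1).toReal)
    have h1 := norm_add_le T.1 T'.1
    have h2 : (decayNorm K (γ.1, γ.2 + κ - m) κ (T.1 + T'.1)).toReal ≤
        (decayNorm K (γ.1, γ.2 + κ - m) κ T.1).toReal +
        (decayNorm K (γ.1, γ.2 + κ - m) κ T'.1).toReal := by
      have hT : decayNorm K (γ.1, γ.2 + κ - m) κ T.1 ≠ ⊤ := ne_of_lt T.2
      have hT' : decayNorm K (γ.1, γ.2 + κ - m) κ T'.1 ≠ ⊤ := ne_of_lt T'.2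
      rw [← ENNReal.toReal_add hT hT']
      exact ENNReal.toReal_mono (ENNReal.add_ne_top.2 ⟨hT, hT'⟩) (decayNorm_add_le _ _ _ _ _)
    linarith
  norm_eq_zero_iff T := by
    constructor
    · intro h
      have h' : ‖T.1‖ + (decayNorm K (γ.1, γ.2 + κ - m) κ T.1).toReal = 0 := h
      have h1 : ‖T.1‖ = 0 := by
        have := norm_nonneg T.1
        have := ENNReal.toReal_nonneg (a := decayNorm K (γ.1, γ.2 + κ - m) κ T.1)
        linarith
      exact Subtype.ext (norm_eq_zero.1 h1)
    · rintro rfl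
      change ‖(0 : Y S γ →L[ℂ] Y S γ)‖ +
        (decayNorm K (γ.1, γ.2 + κ - m) κ (0 : Y S γ →L[ℂ] Y S γ)).toReal = 0
      rw [decayNorm_zero]; simp

instance : NormedAddCommGroup (Mb S γ K m κ) :=
  NormedAddCommGroup.ofCore (Mb.core S γ K m κ)

instance : NormedSpace ℂ (Mb S γ K m κ) :=
  NormedSpace.ofCore (Mb.core S γ K m κ)

/-- A bounded operator with finite matrix norm as an element of `M^b_{γ,ϰ}`. -/
def Mb.mk (T : Y S γ →L[ℂ] Y S γ) (h : T ∈ mbSubmodule S γ K m κ) : Mb S γ K m κ := ⟨T, h⟩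

open Classical in
/-- A bounded operator as an element of `M^b_{γ,ϰ}` (and `0` if it is not in that space). -/
def toMb (T : Y S γ →L[ℂ] Y S γ) : Mb S γ K m κ :=
  if h : T ∈ mbSubmodule S γ K m κ then Mb.mk S γ K m κ T h else 0

theorem toMb_coe {T : Y S γ →L[ℂ] Y S γ} (h : T ∈ mbSubmodule S γ K m κ) :
    (toMb S γ K m κ T).1 = T := by
  have h1 : toMb S γ K m κ T = Mb.mk S γ K m κ T h := dif_pos h
  rw [h1]; rfl

/-- The elements of `M^b_{γ,ϰ}` whose matrices are real. -/
def Mb.reals : Set (Mb S γ K m κ) := {T | ∀ x ∈ Y.reals S γ, T.1 x ∈ Y.reals S γ}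

end Yspace

/-! ## Function spaces -/

/-- `f`, defined on `U`, is real holomorphic up to the boundary of `U`: it extends holomorphically
to a neighbourhood of the closure of `U`, and it takes real values at the real points of `U`. -/
def IsRHB {X E : Type*} [NormedAddCommGroup X] [NormedSpace ℂ X] [NormedAddCommGroup E]
    [NormedSpace ℂ E] (U realX : Set X) (realE : Set E) (f : X → E) : Prop :=
  (∃ (V : Set X) (f' : X → E), IsOpen V ∧ closure U ⊆ V ∧ DifferentiableOn ℂ f' V ∧ EqOn f' f U) ∧
    ∀ x ∈ U, x ∈ realX → f x ∈ realE

section Functions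

variable {d : ℕ} (S : Modes d) (K m κ : ℝ)

/-- `J df`, at the point `x ∈ Y_{(c,m)}`, as an element of `Y_{(c,m)}`. -/
def Jd (f : Y S (0, m) → ℂ) (c : ℝ) (x : Y S (c, m)) : Y S (c, m) :=
  toY S (c, m) (Jseq S (0, m) (fderiv ℂ f (toY S (0, m) x)))

/-- `J d²f`, at the point `x ∈ Y_{(c,m)}`, as an element of `M^b_{(c,m),ϰ}`. -/
def Jdd (f : Y S (0, m) → ℂ) (c : ℝ) (x : Y S (c, m)) : Mb S (c, m) K m κ :=
  toMb S (c, m) K m κ (fderiv ℂ (Jd S m f c) x)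

/-- The norm of `T_{γ,ϰ}(σ,μ)`, where `γ = (γ₁,m)`. -/
def normT (γ₁ σ μ : ℝ) (f : Y S (0, m) → ℂ) : ℝ≥0∞ :=
  max (⨆ x ∈ dom S (0, m) σ μ, ‖f x‖ₑ)
    (max (⨆ c ∈ Icc 0 γ₁, ⨆ x ∈ dom S (c, m) σ μ, ‖Jd S m f c x‖ₑ)
      (⨆ c ∈ Icc 0 γ₁, ⨆ x ∈ dom S (c, m) σ μ, ‖Jdd S K m κ f c x‖ₑ))

/-- The space `T_{γ,ϰ}(σ,μ)`, where `γ = (γ₁,m)`. -/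
structure IsT (γ₁ σ μ : ℝ) (f : Y S (0, m) → ℂ) : Prop where
  periodic : ∀ x ∈ dom S (0, m) σ μ, ∀ k, f (x + angleShift S (0, m) k) = f x
  rhb : IsRHB (dom S (0, m) σ μ) (Y.reals S (0, m)) {z | z.im = 0} f
  jd_mem : ∀ c ∈ Icc 0 γ₁, ∀ x ∈ dom S (c, m) σ μ,
    Jseq S (0, m) (fderiv ℂ f (toY S (0, m) x)) ∈ ySubmodule S (c, m)
  jd_rhb : ∀ c ∈ Icc 0 γ₁, IsRHB (dom S (c, m) σ μ) (Y.reals S (c, m)) (Y.reals S (c, m))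
    (Jd S m f c)
  jdd_mem : ∀ c ∈ Icc 0 γ₁, ∀ x ∈ dom S (c, m) σ μ,
    fderiv ℂ (Jd S m f c) x ∈ mbSubmodule S (c, m) K m κ
  jdd_rhb : ∀ c ∈ Icc 0 γ₁, IsRHB (dom S (c, m) σ μ) (Y.reals S (c, m))
    (Mb.reals S (c, m) K m κ) (Jdd S K m κ f c)
  norm_lt_top : normT S K m κ γ₁ σ μ f < ⊤

/-- The parameter space `ℝ^P`, where `p = #P`. -/
abbrev Par (p : ℕ) : Type := EuclideanSpace ℝ (Fin p)

/-- The unit ball `D` of the parameter space. -/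
def parBall (p : ℕ) : Set (Par p) := Metric.ball 0 1

/-- The partial derivative `∂_{k 0} ⋯ ∂_{k (n-1)} F` at `ρ`. -/
def pderiv {p n : ℕ} {E : Type*} [NormedAddCommGroup E] [NormedSpace ℝ E] (k : Fin n → Fin p)
    (F : Par p → E) (ρ : Par p) : E :=
  iteratedFDeriv ℝ n F ρ (fun i => EuclideanSpace.single (k i) (1 : ℝ))

/-- The norm of `T_{γ,ϰ,D}(σ,μ)`. -/
def normTD {p : ℕ} (s : ℕ) (γ₁ σ μ : ℝ) (f : Y S (0, m) → Par p → ℂ) : ℝ≥0∞ :=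
  ⨆ (n : ℕ) (_ : n ≤ s) (k : Fin n → Fin p), ⨆ ρ ∈ parBall p,
    normT S K m κ γ₁ σ μ (fun x => pderiv k (f x) ρ)

/-- The space `T_{γ,ϰ,D}(σ,μ)`. -/
structure IsTD {p : ℕ} (s : ℕ) (γ₁ σ μ : ℝ) (f : Y S (0, m) → Par p → ℂ) : Prop where
  contDiff : ContDiffOn ℝ s (fun y : Y S (0, m) × Par p => f y.1 y.2)
    (dom S (0, m) σ μ ×ˢ parBall p)
  jd_contDiff : ∀ c ∈ Icc 0 γ₁,
    ContDiffOn ℝ s (fun y : Y S (c, m) × Par p => Jd S m (fun x => f x y.2) c y.1)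
      (dom S (c, m) σ μ ×ˢ parBall p)
  jdd_contDiff : ∀ c ∈ Icc 0 γ₁,
    ContDiffOn ℝ s (fun y : Y S (c, m) × Par p => Jdd S K m κ (fun x => f x y.2) c y.1)
      (dom S (c, m) σ μ ×ˢ parBall p)
  deriv_mem : ∀ n ≤ s, ∀ (k : Fin n → Fin p), ∀ ρ ∈ parBall p,
    IsT S K m κ γ₁ σ μ (fun x => pderiv k (f x) ρ)
  norm_lt_top : normTD S K m κ s γ₁ σ μ f < ⊤

/-! ## The Hamiltonian flow -/

/-- `Φ t x ρ` is, for `|t| ≤ 1`, `x ∈ O_{γ_*}(σ',μ')` and `ρ ∈ D`, the Hamiltonian flow of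
`g(·,ρ)` in `O_{γ_*}(σ,μ)`: the solution of `dΦ/dt = -J dg(Φ)` starting at `x`. -/
def IsHamFlow {p : ℕ} (σ μ σ' μ' : ℝ) (g : Y S (0, m) → Par p → ℂ)
    (Φ : ℝ → Y S (0, m) → Par p → Y S (0, m)) : Prop :=
  ∀ ρ ∈ parBall p, ∀ x ∈ dom S (0, m) σ' μ',
    Φ 0 x ρ = x ∧
    ∀ t ∈ Icc (-1 : ℝ) 1, Φ t x ρ ∈ dom S (0, m) σ μ ∧
      HasDerivWithinAt (fun τ => Φ τ x ρ) (-(Jd S m (fun y => g y ρ) 0 (Φ t x ρ)))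
        (Icc (-1 : ℝ) 1) t

/-- The map `Φ` on `Y_{(0,m)} × D` as a map on `Y_{(c,m)} × D`. -/
def lev {p : ℕ} (Φ : Y S (0, m) → Par p → Y S (0, m)) (c : ℝ) (x : Y S (c, m)) (ρ : Par p) :
    Y S (c, m) :=
  toY S (c, m) (Φ (toY S (0, m) x) ρ)

/-- The element `dΦ(x) - I` of `M^b_{(c,m),ϰ}`. -/
def dlev {p : ℕ} (Φ : Y S (0, m) → Par p → Y S (0, m)) (c : ℝ) (x : Y S (c, m)) (ρ : Par p) :
    Mb S (c, m) K m κ :=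
  toMb S (c, m) K m κ
    (fderiv ℂ (fun y => lev S m Φ c y ρ) x - ContinuousLinearMap.id ℂ (Y S (c, m)))

/-- For `γ' = (c,m)`, the map `Φ` is a `C^s` map `O_{γ'}(σ',μ') × D → O_{γ'}(σ,μ)` (of the
manifolds, hence equivariant in the lifted angles), which is real holomorphic and symplectic for
each parameter. -/
structure IsSymplecticFamily {p : ℕ} (s : ℕ) (σ μ σ' μ' c : ℝ)
    (Φ : Y S (0, m) → Par p → Y S (0, m)) : Prop where
  mem : ∀ x ∈ dom S (c, m) σ' μ', ∀ ρ ∈ parBall p,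
    (Φ (toY S (0, m) x) ρ : S.Idx → C2) ∈ ySubmodule S (c, m)
  mapsTo : ∀ x ∈ dom S (c, m) σ' μ', ∀ ρ ∈ parBall p, lev S m Φ c x ρ ∈ dom S (c, m) σ μ
  equivariant : ∀ x ∈ dom S (c, m) σ' μ', ∀ ρ ∈ parBall p, ∀ k,
    lev S m Φ c (x + angleShift S (c, m) k) ρ = lev S m Φ c x ρ + angleShift S (c, m) k
  contDiff : ContDiffOn ℝ s (fun y : Y S (c, m) × Par p => lev S m Φ c y.1 y.2)
    (dom S (c, m) σ' μ' ×ˢ parBall p)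
  holomorphic : ∀ ρ ∈ parBall p,
    DifferentiableOn ℂ (fun x => lev S m Φ c x ρ) (dom S (c, m) σ' μ')
  real : ∀ ρ ∈ parBall p, ∀ x ∈ dom S (c, m) σ' μ', x ∈ Y.reals S (c, m) →
    lev S m Φ c x ρ ∈ Y.reals S (c, m)
  symplectic : ∀ ρ ∈ parBall p, ∀ x ∈ dom S (c, m) σ' μ',
    IsSymplecticOp S (c, m) (fderiv ℂ (fun y => lev S m Φ c y ρ) x)

end Functions

end

/-! For |t| ≤ 1 an integral curve of -X, X = J dg, is a solution of u = x - ∫ X(u) in the Banach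
space of continuous curves on [-1,1]. Both X and its differential are bounded by ε = |g|, which is
small against the distance δ between the domains, so the integral operator is a contraction with
factor 1/2 and no Gronwall estimate is needed. The operators u ↦ F ∘ u are as smooth as F
(`contDiffOn_nem`), and the implicit function theorem at the fixed point (`contDiffAt_fixedPoint`)
makes u of class C^s in (x,ρ) and holomorphic in x. Reality, equivariance under translation of the
angles and compatibility between the spaces Y_γ' come from uniqueness: constraints preserved by the
field are built into the fixed point space, and affine images of integral curves are integral
curves.

The differential of the flow is 1 + a, where a = -∫ η(1 + a) and η = J d²g along the curve. The
weights e(a,b) are submultiplicative (`expWt_mul_le`), which is the role of K ≥ 4^ϰ, so M^b is a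
Banach space closed under products with constant 1. The equation is therefore solved in M^b itself,
and the decay estimates of dΦ - 1 are plain norm estimates. This part is carried out for an abstract
`OpAlg`. The inverse of dΦ is 1 + b with b again in M^b.

Only parameter derivatives are bounded by hypothesis. Cauchy's estimate turns these bounds, uniform
on a complex ball of radius δ, into bounds of all joint derivatives, at the price of 1/δ for each
derivative in x (`HolFamBdd.norm_iteratedFDeriv_le`). In the formula for the derivatives of a
composition every derivative in x meets a derivative of the curve, of size O(ε) ≤ δ, so the powers
of δ cancel. The highest derivative of the curve stands on both sides of the resulting inequality
and is absorbed.

The differential of J dg is skew for Ω, because d²g is symmetric; hence dΦ preserves Ω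
(`OpAlg.form_propagator`). This has two consequences. An invertible operator preserving Ω is
symplectic: its extension to Y_{-γ} is the Ω-adjoint of its inverse. And J d(f ∘ Φ) = (dΦ)⁻¹ (J df ∘
Φ), so f ∘ Φ is controlled by the transported field w = (1 + b)(F ∘ Φ) with F = J df.

The decisive point is that dw again takes values in M^b (`NearId.opField_pullback`). Differentiating
(1 + a) w = F ∘ Φ in the direction ζ produces (da ζ) w, which is not visibly the action on ζ of an
element of M^b. Symmetry of d²Φ rewrites it as (da w) ζ, and da w is a directional derivative of an
M^b-valued map. A Cauchy integral over a circle expresses it through values of a, so no derivative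
in ρ is lost; it costs |w|/δ times |a| = O(δ), which leaves a bound of order |f|. -/

/-! ## Composition operators on spaces of continuous curves -/

section Nemytskii

open Filter Topology

open Classical in
/-- The composition (Nemytskii) operator `u ↦ F ∘ u` on continuous maps, set to `0` where
`F ∘ u` is not continuous. -/
noncomputable def nem {K E G : Type*} [TopologicalSpace K] [TopologicalSpace E]
    [TopologicalSpace G] [Zero G] (F : E → G) (u : C(K, E)) : C(K, G) :=
  if h : Continuous (F ∘ u) then ⟨F ∘ u, h⟩ else 0

/-- The continuous maps with values in `U`. -/
def curvesIn (K : Type*) {E : Type*} [TopologicalSpace K] [TopologicalSpace E] (U : Set E) :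
    Set C(K, E) := {u | ∀ t, u t ∈ U}

theorem nem_apply {K E G : Type*} [TopologicalSpace K] [TopologicalSpace E]
    [TopologicalSpace G] [Zero G] {F : E → G} {U : Set E} (hF : ContinuousOn F U)
    {u : C(K, E)} (hu : u ∈ curvesIn K U) (t : K) : nem F u t = F (u t) := by
  have h : Continuous (F ∘ u) := hF.comp_continuous u.continuous hu
  simp [nem, h]

theorem isOpen_curvesIn {K E : Type*} [TopologicalSpace K] [CompactSpace K] [TopologicalSpace E]
    {U : Set E} (hU : IsOpen U) : IsOpen (curvesIn K U) := by
  have h := ContinuousMap.isOpen_setOfPred_mapsTo (X := K) isCompact_univ hU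
  convert h using 1
  ext u; simp [curvesIn, MapsTo]

/-- In the compact-open topology no uniform continuity of `F` is needed: the condition that `F ∘ v`
maps a compact set `C` into an open `V` says that `v` maps `C` into `U ∩ F ⁻¹' V`, which is open. -/
theorem continuousOn_nem {K E G : Type*} [TopologicalSpace K] [TopologicalSpace E]
    [TopologicalSpace G] [Zero G] {F : E → G} {U : Set E} (hU : IsOpen U)
    (hF : ContinuousOn F U) [CompactSpace K] : ContinuousOn (nem F) (curvesIn K U) := by
  intro u hu
  refine ContinuousAt.continuousWithinAt ?_
  refine ContinuousMap.tendsto_nhds_compactOpen.2 fun C hC V hV hCV => ?_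
  have hW : IsOpen (U ∩ F ⁻¹' V) := hF.isOpen_inter_preimage hU hV
  have h1 : MapsTo u C (U ∩ F ⁻¹' V) := fun t ht => ⟨hu t, by
    have := hCV ht; rwa [nem_apply hF hu] at this⟩
  filter_upwards [ContinuousMap.tendsto_nhds_compactOpen.1 (tendsto_id (x := 𝓝 u)) C hC _ hW h1,
    (isOpen_curvesIn hU).mem_nhds hu] with v hv hv' t ht
  rw [nem_apply hF hv']
  exact (hv ht).2

variable {𝕜 : Type*} [RCLike 𝕜] {K : Type*} [TopologicalSpace K] [CompactSpace K]
  {E₁ E₂ G : Type*} [NormedAddCommGroup E₁] [NormedSpace 𝕜 E₁] [NormedAddCommGroup E₂]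
  [NormedSpace 𝕜 E₂] [NormedAddCommGroup G] [NormedSpace 𝕜 G]

variable (K) in
/-- The pointwise extension of a bounded bilinear map to continuous maps. -/
noncomputable def ptBilin (β : E₁ →L[𝕜] E₂ →L[𝕜] G) : C(K, E₁) →L[𝕜] C(K, E₂) →L[𝕜] C(K, G) :=
  LinearMap.mkContinuous₂
    (LinearMap.mk₂ 𝕜 (fun (u : C(K, E₁)) (v : C(K, E₂)) =>
        (⟨fun t => β (u t) (v t), by fun_prop⟩ : C(K, G)))
      (fun u u' v => by ext t; simp) (fun c u v => by ext t; simp)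
      (fun u v v' => by ext t; simp) (fun c u v => by ext t; simp)) ‖β‖
    (fun u v => by
      rw [ContinuousMap.norm_le _ (by positivity)]
      intro t
      refine (β.le_opNorm₂ _ _).trans ?_
      gcongr
      · exact u.norm_coe_le_norm t
      · exact v.norm_coe_le_norm t)

@[simp] theorem ptBilin_apply (β : E₁ →L[𝕜] E₂ →L[𝕜] G) (u : C(K, E₁)) (v : C(K, E₂)) (t : K) :
    ptBilin K β u v t = β (u t) (v t) := rfl

/-- At each `t` the remainder is bounded by `‖v‖` times the supremum over the segment of `‖F'(u + s
v) - F'(u)‖`. Its smallness uniformly in `t` and `s` is continuity of the composition operator of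
`F'` on curves over `K × [0,1]`. -/
theorem hasFDerivAt_nem {F : E₁ → G} {F' : E₁ → E₁ →L[𝕜] G} {U : Set E₁} (hU : IsOpen U)
    (hF : ∀ x ∈ U, HasFDerivAt F (F' x) x) (hF' : ContinuousOn F' U)
    {u : C(K, E₁)} (hu : u ∈ curvesIn K U) :
    HasFDerivAt (nem F) (ptBilin K (ContinuousLinearMap.id 𝕜 (E₁ →L[𝕜] G)) (nem F' u)) u := by
  let _ : NormedSpace ℝ E₁ := NormedSpace.restrictScalars ℝ 𝕜 E₁
  have hFc : ContinuousOn F U := fun x hx => (hF x hx).continuousAt.continuousWithinAt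
  let I := Icc (0 : ℝ) 1
  -- All segments from `u` to `u + v` at once, as one curve over the compact space `K × [0,1]`.
  let S : C(K, E₁) → C(K × I, E₁) := fun v =>
    ⟨fun p => u p.1 + (p.2 : ℝ) • v p.1, by fun_prop⟩
  have hS : Continuous S := by
    refine ContinuousMap.continuous_of_continuous_uncurry _ ?_
    change Continuous fun q : C(K, E₁) × K × I => u q.2.1 + (q.2.2 : ℝ) • q.1 q.2.1
    fun_prop
  have hS0 : ∀ p, S 0 p = u p.1 := fun p => by simp [S]
  have hS0U : S 0 ∈ curvesIn (K × I) U := fun p => by rw [hS0]; exact hu _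
  have hc : ContinuousAt (fun v => nem F' (S v)) 0 :=
    ContinuousAt.comp (f := S) ((continuousOn_nem hU hF').continuousAt
      ((isOpen_curvesIn hU).mem_nhds hS0U)) hS.continuousAt
  have hev : ∀ᶠ v in 𝓝 (0 : C(K, E₁)), S v ∈ curvesIn (K × I) U :=
    hS.continuousAt.eventually ((isOpen_curvesIn hU).mem_nhds hS0U)
  rw [hasFDerivAt_iff_isLittleO_nhds_zero, Asymptotics.isLittleO_iff]
  intro c hcpos
  have hd : ∀ᶠ v in 𝓝 (0 : C(K, E₁)), dist (nem F' (S v)) (nem F' (S 0)) < c :=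
    hc.eventually (Metric.ball_mem_nhds (nem F' (S 0)) hcpos)
  filter_upwards [hev, hd] with v hv hvd
  rw [ContinuousMap.norm_le _ (by positivity)]
  intro t
  have hmem : ∀ s : I, u t + (s : ℝ) • v t ∈ U := fun s => hv (t, s)
  have huv : (u + v) ∈ curvesIn K U := fun t => by
    simpa [S] using hv (t, ⟨1, by norm_num, le_rfl⟩)
  have hseg : ∀ x ∈ segment ℝ (u t) (u t + v t), ∃ s : I, x = u t + (s : ℝ) • v t := by
    intro x hx
    rw [segment_eq_image'] at hx
    obtain ⟨s, hs, rfl⟩ := hx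
    exact ⟨⟨s, hs⟩, by simp⟩
  have key := Convex.norm_image_sub_le_of_norm_hasFDerivWithin_le' (𝕜 := 𝕜) (f := F) (f' := F')
    (φ := F' (u t)) (C := c) (s := segment ℝ (u t) (u t + v t)) (x := u t) (y := u t + v t)
    (fun x hx => by
      obtain ⟨s, rfl⟩ := hseg x hx
      exact (hF _ (hmem s)).hasFDerivWithinAt)
    (fun x hx => by
      obtain ⟨s, rfl⟩ := hseg x hx
      have h1 := (ContinuousMap.dist_apply_le_dist (t, s)).trans hvd.le
      rw [nem_apply hF' hv, nem_apply hF' hS0U, hS0, dist_eq_norm] at h1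
      exact h1)
    (convex_segment _ _) (left_mem_segment _ _ _) (right_mem_segment _ _ _)
  simp only [add_sub_cancel_left] at key
  have h2 : (nem F (u + v) - nem F u -
      ptBilin K (ContinuousLinearMap.id 𝕜 (E₁ →L[𝕜] G)) (nem F' u) v) t =
      F (u t + v t) - F (u t) - F' (u t) (v t) := by
    simp [nem_apply hFc huv, nem_apply hFc hu, nem_apply hF' hu]
  rw [h2]
  refine key.trans ?_
  gcongr
  exact v.norm_coe_le_norm t

end Nemytskii

/-! ### Higher derivatives of composition operators -/

section NemytskiiSmooth

universe u

/-- The derivative of the composition operator of `F` is a bounded linear function of the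
composition operator of `fderiv 𝕜 F`, so induction applies. The induction replaces `G` by `E →L[𝕜]
G`; this is why `E` and `G` share a universe and `G` is quantified inside. -/
theorem contDiffOn_nem {𝕜 : Type*} [RCLike 𝕜] {K : Type*} [TopologicalSpace K] [CompactSpace K]
    {E : Type u} [NormedAddCommGroup E] [NormedSpace 𝕜 E] {U : Set E} (hU : IsOpen U) (n : ℕ) :
    ∀ {G : Type u} [NormedAddCommGroup G] [NormedSpace 𝕜 G] {F : E → G},
      ContDiffOn 𝕜 n F U → ContDiffOn 𝕜 n (nem F) (curvesIn K U) := by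
  induction n with
  | zero =>
    intro G _ _ F hF
    simp only [Nat.cast_zero, contDiffOn_zero] at hF ⊢
    exact continuousOn_nem hU hF
  | succ n ih =>
    intro G _ _ F hF
    have hF0 := hF
    simp only [Nat.cast_add, Nat.cast_one] at hF ⊢
    rw [contDiffOn_succ_iff_fderiv_of_isOpen hU] at hF
    obtain ⟨h1, -, h3⟩ := hF
    rw [contDiffOn_succ_iff_hasFDerivWithinAt_of_uniqueDiffOn (isOpen_curvesIn hU).uniqueDiffOn]
    refine ⟨by simp, fun v => ptBilin K (ContinuousLinearMap.id 𝕜 (E →L[𝕜] G))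
      (nem (fderiv 𝕜 F) v), ?_, ?_⟩
    · exact (ptBilin K (ContinuousLinearMap.id 𝕜 (E →L[𝕜] G))).contDiff.comp_contDiffOn (ih h3)
    · intro v hv
      exact (hasFDerivAt_nem hU (fun x hx => (h1.differentiableAt (hU.mem_nhds hx)).hasFDerivAt)
        h3.continuousOn hv).hasFDerivWithinAt

end NemytskiiSmooth

/-! ## Primitives and Cauchy integrals -/

section Primitive

open MeasureTheory

/-- The time interval. -/
abbrev TI : Type := Icc (-1 : ℝ) 1

/-- The initial time. -/
def TI.zero : TI := ⟨0, by norm_num, by norm_num⟩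

variable {E : Type*} [NormedAddCommGroup E]

/-- The extension of a curve on `[-1,1]` by constants. -/
noncomputable def extTI (u : C(TI, E)) : ℝ → E := IccExtend (by norm_num : (-1 : ℝ) ≤ 1) u

theorem continuous_extTI (u : C(TI, E)) : Continuous (extTI u) := u.continuous.Icc_extend'

theorem extTI_apply (u : C(TI, E)) (t : TI) : extTI u t = u t := by
  simp [extTI]

theorem norm_extTI_le (u : C(TI, E)) (t : ℝ) : ‖extTI u t‖ ≤ ‖u‖ := u.norm_coe_le_norm _

variable [NormedSpace ℂ E]

/-- Every time in `[-1,1]` is within distance `1` of the initial time `0`, so taking primitives does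
not increase the norm. -/
theorem norm_integral_extTI_le (u : C(TI, E)) (t : TI) : ‖∫ s in (0 : ℝ)..t, extTI u s‖ ≤ ‖u‖ := by
  refine (intervalIntegral.norm_integral_le_of_norm_le_const (C := ‖u‖)
    fun s _ => norm_extTI_le u s).trans ?_
  have : |(t : ℝ) - 0| ≤ 1 := by rw [sub_zero, abs_le]; exact t.2
  nlinarith [norm_nonneg u]

/-- The primitive vanishing at time `0`. -/
noncomputable def primL [CompleteSpace E] : C(TI, E) →L[ℂ] C(TI, E) :=
  LinearMap.mkContinuous
    { toFun := fun u => ⟨fun t => ∫ s in (0 : ℝ)..t, extTI u s,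
        (intervalIntegral.continuous_primitive
          (fun a b => (continuous_extTI u).intervalIntegrable a b) 0).comp continuous_subtype_val⟩
      map_add' := fun u v => by
        ext t
        have h : extTI (u + v) = fun s => extTI u s + extTI v s := by ext; simp [extTI, IccExtend]
        simp only [ContinuousMap.coe_mk, ContinuousMap.add_apply, h]
        exact intervalIntegral.integral_add ((continuous_extTI u).intervalIntegrable _ _)
          ((continuous_extTI v).intervalIntegrable _ _)
      map_smul' := fun c u => by
        ext t
        have h : extTI (c • u) = fun s => c • extTI u s := by ext; simp [extTI, IccExtend]
        simp only [ContinuousMap.coe_mk, ContinuousMap.smul_apply, h, RingHom.id_apply]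
        exact intervalIntegral.integral_smul _ _ } 1
    (fun u => by
      rw [one_mul, ContinuousMap.norm_le _ (norm_nonneg _)]
      exact norm_integral_extTI_le u)

variable [CompleteSpace E]

theorem primL_apply (u : C(TI, E)) (t : TI) : primL u t = ∫ s in (0 : ℝ)..t, extTI u s := rfl

theorem norm_primL_apply_le (u : C(TI, E)) : ‖primL u‖ ≤ ‖u‖ := by
  rw [ContinuousMap.norm_le _ (norm_nonneg _)]
  exact norm_integral_extTI_le u

theorem primL_zero_time (u : C(TI, E)) : primL u TI.zero = 0 := by
  simp [primL_apply, TI.zero]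

theorem hasDerivAt_primitive_extTI (u : C(TI, E)) (t : ℝ) :
    HasDerivAt (fun τ => ∫ s in (0 : ℝ)..τ, extTI u s) (extTI u t) t :=
  intervalIntegral.integral_hasDerivAt_right ((continuous_extTI u).intervalIntegrable _ _)
    (continuous_extTI u).stronglyMeasurable.stronglyMeasurableAtFilter
    (continuous_extTI u).continuousAt

/-- `L` is only real linear, so that the statement covers imaginary parts as well as inclusions and
bilinear actions. -/
theorem map_primL {F : Type*} [NormedAddCommGroup F] [NormedSpace ℂ F] [CompleteSpace F]
    (L : E →L[ℝ] F) (u : C(TI, E)) (v : C(TI, F)) (h : ∀ t, v t = L (u t)) (t : TI) :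
    primL v t = L (primL u t) := by
  rw [primL_apply, primL_apply, ← L.intervalIntegral_comp_comm
    ((continuous_extTI u).intervalIntegrable _ _)]
  congr 1
  ext s
  exact h _

/-- The Cauchy integral `(2π)⁻¹ ∫₀^{2π} e^{-iθ} f(θ) dθ`. -/
noncomputable def cauchyL : C(Icc (0 : ℝ) (2 * Real.pi), E) →L[ℂ] E :=
  LinearMap.mkContinuous
    { toFun := fun u => (2 * Real.pi)⁻¹ • ∫ θ in (0 : ℝ)..(2 * Real.pi),
        Complex.exp (-(θ * Complex.I)) • IccExtend Real.two_pi_pos.le u θ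
      map_add' := fun u v => by
        have h : ∀ θ, IccExtend Real.two_pi_pos.le (u + v) θ =
          IccExtend Real.two_pi_pos.le u θ + IccExtend Real.two_pi_pos.le v θ := by
            intro; simp [IccExtend]
        simp only [h, smul_add]
        rw [intervalIntegral.integral_add, smul_add]
        · exact Continuous.intervalIntegrable (by
            have := u.continuous.Icc_extend' (h := Real.two_pi_pos.le)
            fun_prop) _ _
        · exact Continuous.intervalIntegrable (by
            have := v.continuous.Icc_extend' (h := Real.two_pi_pos.le)
            fun_prop) _ _
      map_smul' := fun c u => by
        have h : ∀ θ, IccExtend Real.two_pi_pos.le (c • u) θ =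
          c • IccExtend Real.two_pi_pos.le u θ := by intro; simp [IccExtend]
        simp only [h, smul_comm _ c, RingHom.id_apply]
        rw [intervalIntegral.integral_smul, smul_comm] } 1
    (fun u => by
      have h := intervalIntegral.norm_integral_le_of_norm_le_const (a := 0) (b := 2 * Real.pi)
        (f := fun θ => Complex.exp (-(θ * Complex.I)) • IccExtend Real.two_pi_pos.le u θ)
        (C := ‖u‖) (fun θ _ => by
          rw [norm_smul, Complex.norm_exp]
          simp only [Complex.neg_re, Complex.mul_re, Complex.ofReal_re, Complex.I_re, mul_zero,
            Complex.ofReal_im, Complex.I_im, mul_one, sub_zero, neg_zero, Real.exp_zero, one_mul]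
          exact u.norm_coe_le_norm _)
      rw [sub_zero, abs_of_pos Real.two_pi_pos] at h
      simp only [LinearMap.coe_mk, AddHom.coe_mk, norm_smul, one_mul, norm_inv,
        Real.norm_of_nonneg Real.two_pi_pos.le]
      calc _ ≤ (2 * Real.pi)⁻¹ * (‖u‖ * (2 * Real.pi)) := by gcongr
        _ = ‖u‖ := by field_simp)

omit [CompleteSpace E] in
theorem norm_cauchyL_apply_le (u : C(Icc (0 : ℝ) (2 * Real.pi), E)) : ‖cauchyL u‖ ≤ ‖u‖ := by
  have := (cauchyL (E := E)).le_of_opNorm_le (LinearMap.mkContinuous_norm_le _ zero_le_one _) u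
  simpa using this

/-- Cauchy's formula for the derivative on the unit disc. -/
theorem cauchyL_eq_deriv {f : ℂ → E} {R : ℝ} (hR : 1 < R)
    (hf : DifferentiableOn ℂ f (Metric.ball 0 R)) (u : C(Icc (0 : ℝ) (2 * Real.pi), E))
    (hu : ∀ θ, u θ = f (Complex.exp ((θ : ℝ) * Complex.I))) : cauchyL u = deriv f 0 := by
  have h1 := Complex.two_pi_I_inv_smul_circleIntegral_sub_sq_inv_smul_of_differentiable
    (U := Metric.ball 0 R) (c := 0) (w₀ := 0) (R := 1) (f := f) Metric.isOpen_ball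
    (Metric.closedBall_subset_ball hR) hf (by simp)
  rw [← h1, circleIntegral]
  change (2 * Real.pi)⁻¹ • ∫ θ in (0 : ℝ)..(2 * Real.pi),
        Complex.exp (-(θ * Complex.I)) • IccExtend Real.two_pi_pos.le u θ = _
  have h2 : ∀ θ ∈ uIcc (0 : ℝ) (2 * Real.pi),
      deriv (circleMap 0 1) θ • ((circleMap 0 1 θ - 0) ^ 2)⁻¹ • f (circleMap 0 1 θ) =
      Complex.I • (Complex.exp (-(θ * Complex.I)) • IccExtend Real.two_pi_pos.le u θ) := by
    intro θ hθ
    rw [uIcc_of_le Real.two_pi_pos.le] at hθ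
    rw [IccExtend_of_mem _ _ hθ, hu]
    simp only [deriv_circleMap, circleMap_zero, Complex.ofReal_one, one_mul, sub_zero, smul_smul]
    congr 1
    rw [Complex.exp_neg]
    have := Complex.exp_ne_zero (θ * Complex.I)
    field_simp
  rw [intervalIntegral.integral_congr h2, intervalIntegral.integral_smul, smul_smul,
    ← Complex.coe_smul]
  congr 1
  have := Complex.I_ne_zero
  have h3 : (Real.pi : ℂ) ≠ 0 := by exact_mod_cast Real.pi_ne_zero
  push_cast
  field_simp

end Primitive

/-! ## Holomorphy along complex lines -/

section Gateaux

open Filter Topology Metric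

variable {E G : Type*} [NormedAddCommGroup E] [NormedSpace ℂ E] [NormedAddCommGroup G]
  [NormedSpace ℂ G]

theorem norm_deriv_le_of_bound {f : ℂ → G} {z : ℂ} {R B : ℝ} (hR : 0 < R)
    (hf : DifferentiableOn ℂ f (ball z (2 * R))) (hB : ∀ w ∈ ball z (2 * R), ‖f w‖ ≤ B) :
    ‖deriv f z‖ ≤ B / R := by
  have hsub : closedBall z R ⊆ ball z (2 * R) := closedBall_subset_ball (by linarith)
  refine Complex.norm_deriv_le_of_forall_mem_sphere_norm_le hR ?_
    fun w hw => hB w (hsub (sphere_subset_closedBall hw))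
  refine (hf.mono ?_).diffContOnCl
  exact closure_ball_subset_closedBall.trans hsub

variable [CompleteSpace G]

/-- Two Cauchy estimates and two mean value inequalities: the first derivative is at most `B / (R /
2)` on the disc of radius `R`, hence the second is at most `8 * B / R ^ 2` on the unit disc. The
hypothesis `2 ≤ R` makes discs of radius `R / 2` about points of the unit disc fit into radius `R`.
-/
theorem norm_sub_sub_deriv_le {f : ℂ → G} {R B : ℝ} (hR : 2 ≤ R)
    (hf : DifferentiableOn ℂ f (ball 0 (2 * R))) (hB : ∀ w ∈ ball 0 (2 * R), ‖f w‖ ≤ B) :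
    ‖f 1 - f 0 - deriv f 0‖ ≤ 8 * B / R ^ 2 := by
  have hR0 : 0 < R := by linarith
  have hB0 : 0 ≤ B := (norm_nonneg _).trans (hB 0 (by simp; linarith))
  have h1 : ∀ z ∈ ball (0 : ℂ) R, ‖deriv f z‖ ≤ B / (R / 2) := by
    intro z hz
    have hsub : ball z (2 * (R / 2)) ⊆ ball 0 (2 * R) := by
      refine ball_subset_ball' ?_
      have := mem_ball.1 hz
      linarith
    exact norm_deriv_le_of_bound (by linarith) (hf.mono hsub) fun w hw => hB w (hsub hw)
  have hd : DifferentiableOn ℂ (deriv f) (ball 0 (2 * R)) := hf.deriv isOpen_ball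
  have h2 : ∀ z ∈ closedBall (0 : ℂ) 1, ‖deriv (deriv f) z‖ ≤ 8 * B / R ^ 2 := by
    intro z hz
    have hsub : ball z (2 * (R / 4)) ⊆ ball 0 R := by
      refine ball_subset_ball' ?_
      have := mem_closedBall.1 hz
      linarith
    have hsub' : ball z (2 * (R / 4)) ⊆ ball 0 (2 * R) :=
      hsub.trans (ball_subset_ball (by linarith))
    refine (norm_deriv_le_of_bound (by linarith) (hd.mono hsub')
      fun w hw => h1 w (hsub hw)).trans (le_of_eq ?_)
    field_simp
    ring
  have hcb : closedBall (0 : ℂ) 1 ⊆ ball 0 (2 * R) := closedBall_subset_ball (by linarith)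
  have h3 : ∀ z ∈ closedBall (0 : ℂ) 1, ‖deriv f z - deriv f 0‖ ≤ 8 * B / R ^ 2 := by
    intro z hz
    have := (convex_closedBall (0 : ℂ) 1).norm_image_sub_le_of_norm_deriv_le
      (f := deriv f) (fun w hw => hd.differentiableAt (isOpen_ball.mem_nhds (hcb hw))) h2
      (mem_closedBall_self zero_le_one) hz
    refine this.trans ?_
    have h4 : ‖z - 0‖ ≤ 1 := by simpa using hz
    exact mul_le_of_le_one_right (by positivity) h4
  have h4 := (convex_closedBall (0 : ℂ) 1).norm_image_sub_le_of_norm_deriv_le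
    (f := fun z => f z - z • deriv f 0) (x := 0) (y := 1) (C := 8 * B / R ^ 2)
    (fun w hw => (hf.differentiableAt (isOpen_ball.mem_nhds (hcb hw))).sub (by fun_prop))
    (fun w hw => by
      have h5 : HasDerivAt (fun z => f z - z • deriv f 0) (deriv f w - (1 : ℂ) • deriv f 0) w :=
        (hf.differentiableAt (isOpen_ball.mem_nhds (hcb hw))).hasDerivAt.sub
          ((hasDerivAt_id w).smul_const _)
      rw [h5.deriv, one_smul]
      exact h3 w hw)
    (mem_closedBall_self zero_le_one) (by simp)
  simp only [one_smul, zero_smul, sub_zero, norm_one, mul_one] at h4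
  rwa [show f 1 - f 0 - deriv f 0 = f 1 - deriv f 0 - f 0 by abel]

/-- A continuous map which is holomorphic along complex lines is holomorphic. -/
theorem differentiableOn_of_lines {F : E → G} {U : Set E} (hU : IsOpen U)
    (hc : ContinuousOn F U)
    (hl : ∀ x ∈ U, ∀ v, DifferentiableAt ℂ (fun z : ℂ => F (x + z • v)) 0) :
    DifferentiableOn ℂ F U := by
  intro x₀ hx₀
  refine DifferentiableAt.differentiableWithinAt ?_
  obtain ⟨B, hBnd⟩ : ∃ B, ∀ᶠ x in 𝓝 x₀, ‖F x‖ ≤ B := by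
    refine ⟨‖F x₀‖ + 1, ?_⟩
    have h := (hc.continuousAt (hU.mem_nhds hx₀)).norm
    exact (h.eventually (gt_mem_nhds (lt_add_one _))).mono fun _ hx => le_of_lt hx
  obtain ⟨r₀, hr₀, hball⟩ := Metric.eventually_nhds_iff_ball.1 (hBnd.and (hU.mem_nhds hx₀))
  -- `F` is bounded by `B` on radius `4r`, which leaves room for a base point within `2r` of `x₀`
  -- and a complex displacement of length less than `2r`.
  obtain ⟨r, hr, hrr⟩ : ∃ r, 0 < r ∧ 4 * r ≤ r₀ := ⟨r₀ / 4, by linarith, by linarith⟩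
  have hB0 : 0 ≤ B := (norm_nonneg _).trans (hball x₀ (mem_ball_self hr₀)).1
  have hin : ∀ x ∈ ball x₀ (2 * r), ∀ v : E, ∀ R : ℝ, R * ‖v‖ ≤ r →
      ∀ z ∈ ball (0 : ℂ) (2 * R), x + z • v ∈ ball x₀ r₀ := by
    intro x hx v R hR z hz
    rw [mem_ball, dist_eq_norm] at hx ⊢
    rw [mem_ball_zero_iff] at hz
    calc ‖x + z • v - x₀‖ = ‖(x - x₀) + z • v‖ := by congr 1; abel
      _ ≤ ‖x - x₀‖ + ‖z‖ * ‖v‖ := (norm_add_le _ _).trans (by rw [norm_smul])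
      _ < 2 * r + 2 * r := by
          have : ‖z‖ * ‖v‖ ≤ 2 * R * ‖v‖ := by gcongr
          linarith
      _ ≤ r₀ := by linarith
  have hlin : ∀ x ∈ ball x₀ (2 * r), ∀ v : E, ∀ R : ℝ, R * ‖v‖ ≤ r →
      DifferentiableOn ℂ (fun z : ℂ => F (x + z • v)) (ball 0 (2 * R)) := by
    intro x hx v R hR z hz
    refine DifferentiableAt.differentiableWithinAt ?_
    have h1 := hl _ (hball _ (hin x hx v R hR z hz)).2 v
    have h2 : (fun w : ℂ => F (x + w • v)) = (fun w : ℂ => F (x + z • v + w • v)) ∘ (· - z) := by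
      ext w
      simp only [Function.comp]
      congr 1
      rw [sub_smul]
      abel
    rw [h2]
    refine DifferentiableAt.comp z ?_ (by fun_prop)
    rwa [sub_self]
  -- The candidate derivative along lines. It is homogeneous by construction and has a quadratic
  -- remainder with a constant uniform in the base point; only additivity requires an argument.
  let L : E → E → G := fun x v => deriv (fun z : ℂ => F (x + z • v)) 0
  have hrem : ∀ x ∈ ball x₀ (2 * r), ∀ v : E, ‖v‖ ≤ r / 2 →
      ‖F (x + v) - F x - L x v‖ ≤ 8 * B / r ^ 2 * ‖v‖ ^ 2 := by
    intro x hx v hv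
    rcases eq_or_ne v 0 with rfl | hv0
    · simp [L]
    have hvp : 0 < ‖v‖ := norm_pos_iff.2 hv0
    have hR : r / ‖v‖ * ‖v‖ ≤ r := (div_mul_cancel₀ _ hvp.ne').le
    -- On the line in direction `v` the disc may have radius `2r / ‖v‖`; with `R = r / ‖v‖` the
    -- constant `8B / R²` becomes quadratic in `‖v‖`, and `2 ≤ R` is `‖v‖ ≤ r / 2`.
    have h1 := norm_sub_sub_deriv_le (f := fun z : ℂ => F (x + z • v)) (R := r / ‖v‖) (B := B)
      (by rw [le_div_iff₀ hvp]; linarith) (hlin x hx v _ hR)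
      (fun w hw => (hball _ (hin x hx v _ hR w hw)).1)
    simp only [one_smul, zero_smul, add_zero] at h1
    refine h1.trans (le_of_eq ?_)
    field_simp
  have hbd : ∀ x ∈ ball x₀ (2 * r), ∀ v : E, ‖L x v‖ ≤ B / r * ‖v‖ := by
    intro x hx v
    rcases eq_or_ne v 0 with rfl | hv0
    · simp [L]
    have hvp : 0 < ‖v‖ := norm_pos_iff.2 hv0
    have hR : r / ‖v‖ * ‖v‖ ≤ r := (div_mul_cancel₀ _ hvp.ne').le
    refine (norm_deriv_le_of_bound (R := r / ‖v‖) (B := B) (by positivity) (hlin x hx v _ hR)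
      (fun w hw => (hball _ (hin x hx v _ hR w hw)).1)).trans (le_of_eq ?_)
    field_simp
  have hsm : ∀ x ∈ ball x₀ (2 * r), ∀ (c : ℂ) (v : E), L x (c • v) = c • L x v := by
    intro x hx c v
    have h1 : (fun z : ℂ => F (x + z • c • v)) = fun z => (fun w : ℂ => F (x + w • v)) (c * z) := by
      ext z; simp only [smul_smul, mul_comm]
    change deriv (fun z : ℂ => F (x + z • c • v)) 0 = _
    rw [h1, deriv_comp_mul_left c (fun w : ℂ => F (x + w • v)), mul_zero]
  have hxx : x₀ ∈ ball x₀ (2 * r) := mem_ball_self (by linarith)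
  -- `L x w` is a Cauchy integral of `F` over the circle `x + e^{iθ} w`, and this circle depends
  -- continuously on `x`; continuity of composition with `F` gives the claim.
  have hcont : ∀ w : E, ‖w‖ ≤ r / 2 → ContinuousAt (fun x => L x w) x₀ := by
    intro w hw
    let S : E → C(Icc (0 : ℝ) (2 * Real.pi), E) := fun x =>
      ⟨fun θ => x + Complex.exp ((θ : ℝ) * Complex.I) • w, by fun_prop⟩
    have hS : Continuous S := by
      refine ContinuousMap.continuous_of_continuous_uncurry _ ?_
      change Continuous fun q : E × Icc (0 : ℝ) (2 * Real.pi) =>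
        q.1 + Complex.exp ((q.2 : ℝ) * Complex.I) • w
      fun_prop
    have hSU : ∀ x ∈ ball x₀ (2 * r), S x ∈ curvesIn (Icc (0 : ℝ) (2 * Real.pi)) (ball x₀ r₀) := by
      intro x hx θ
      refine hin x hx w 2 (by linarith) _ ?_
      rw [mem_ball_zero_iff, Complex.norm_exp_ofReal_mul_I]
      norm_num
    have hFb : ContinuousOn F (ball x₀ r₀) := hc.mono fun x hx => (hball x hx).2
    have h1 : ContinuousAt (fun x => nem F (S x)) x₀ :=
      ContinuousAt.comp (f := S) ((continuousOn_nem isOpen_ball hFb).continuousAt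
        ((isOpen_curvesIn isOpen_ball).mem_nhds (hSU _ hxx))) hS.continuousAt
    have h2 : ContinuousAt (fun x => cauchyL (nem F (S x))) x₀ := cauchyL.continuous.continuousAt.comp h1
    refine h2.congr ?_
    filter_upwards [isOpen_ball.mem_nhds hxx] with x hx
    refine cauchyL_eq_deriv (R := 2 * 2) (by norm_num) (hlin x hx w 2 (by linarith)) _ fun θ => ?_
    rw [nem_apply hFb (hSU x hx)]
    rfl
  -- Go from `x₀` to `x₀ + τ(v + w)` directly, and through `x₀ + τ v`. Comparing the two expansions
  -- gives additivity up to `O(τ)`, with the last derivative taken at `x₀ + τ v`; continuity of `L`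
  -- in the base point removes this as `τ → 0`.
  have hadd' : ∀ v w : E, ‖v‖ ≤ r / 4 → ‖w‖ ≤ r / 4 → L x₀ (v + w) = L x₀ v + L x₀ w := by
    intro v w hv hw
    have hvw : ‖v + w‖ ≤ r / 2 := (norm_add_le _ _).trans (by linarith)
    have ht : Tendsto (fun τ : ℝ => L (x₀ + (τ : ℂ) • v) w) (𝓝[>] 0) (𝓝 (L x₀ w)) := by
      have h1 : Tendsto (fun τ : ℝ => x₀ + (τ : ℂ) • v) (𝓝[>] 0) (𝓝 x₀) := by
        have : Continuous fun τ : ℝ => x₀ + (τ : ℂ) • v := by fun_prop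
        have h := (this.tendsto 0).mono_left (nhdsWithin_le_nhds (s := Ioi 0))
        simpa using h
      exact (hcont w (by linarith)).tendsto.comp h1
    have hz : Tendsto (fun τ : ℝ => L x₀ (v + w) - L x₀ v - L (x₀ + (τ : ℂ) • v) w) (𝓝[>] 0)
        (𝓝 0) := by
      have hk : Tendsto (fun τ : ℝ => 8 * B / r ^ 2 * (3 * r ^ 2) * τ) (𝓝[>] 0) (𝓝 0) := by
        have : Continuous fun τ : ℝ => 8 * B / r ^ 2 * (3 * r ^ 2) * τ := by fun_prop
        have h := (this.tendsto 0).mono_left (nhdsWithin_le_nhds (s := Ioi 0))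
        simpa using h
      refine squeeze_zero_norm' ?_ hk
      have h1 : Ioo (0 : ℝ) 1 ∈ 𝓝[>] (0 : ℝ) := Ioo_mem_nhdsGT one_pos
      filter_upwards [h1] with τ hτ
      have hn : ∀ u : E, ‖(τ : ℂ) • u‖ = τ * ‖u‖ := fun u => by
        rw [norm_smul, Complex.norm_real, Real.norm_of_nonneg hτ.1.le]
      have hle : ∀ u : E, ‖u‖ ≤ r / 2 → ‖(τ : ℂ) • u‖ ≤ τ * r := fun u hu => by
        rw [hn]; have := hτ.1; nlinarith
      have hle' : ∀ u : E, ‖u‖ ≤ r / 2 → ‖(τ : ℂ) • u‖ ≤ r / 2 := fun u hu => by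
        rw [hn]; have := hτ.1; have := hτ.2; nlinarith [norm_nonneg u]
      have hxv : x₀ + (τ : ℂ) • v ∈ ball x₀ (2 * r) := by
        rw [mem_ball, dist_eq_norm, add_sub_cancel_left]
        exact (hle' v (by linarith)).trans_lt (by linarith)
      have hsq : ∀ u : E, ‖u‖ ≤ r / 2 → 8 * B / r ^ 2 * ‖(τ : ℂ) • u‖ ^ 2 ≤
          8 * B / r ^ 2 * r ^ 2 * τ ^ 2 := fun u hu => by
        rw [mul_assoc, ← mul_pow, mul_comm r]
        have := hle u hu
        gcongr
      have e1 := (hrem x₀ hxx _ (hle' _ hvw)).trans (hsq _ hvw)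
      have e2 := (hrem x₀ hxx _ (hle' v (by linarith))).trans (hsq v (by linarith))
      have e3 := (hrem _ hxv _ (hle' w (by linarith))).trans (hsq w (by linarith))
      rw [hsm _ hxx] at e1 e2
      rw [hsm _ hxv] at e3
      rw [show x₀ + (τ : ℂ) • v + (τ : ℂ) • w = x₀ + (τ : ℂ) • (v + w) by
        rw [smul_add, add_assoc]] at e3
      -- The values of `F` cancel and three quadratic remainders, each of order `τ²`, are left.
      have e4 : ‖(τ : ℂ) • (L x₀ (v + w) - L x₀ v - L (x₀ + (τ : ℂ) • v) w)‖ ≤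
          3 * (8 * B / r ^ 2 * r ^ 2 * τ ^ 2) := by
        rw [show (τ : ℂ) • (L x₀ (v + w) - L x₀ v - L (x₀ + (τ : ℂ) • v) w) =
          (F (x₀ + (τ : ℂ) • (v + w)) - F (x₀ + (τ : ℂ) • v) - (τ : ℂ) • L (x₀ + (τ : ℂ) • v) w) +
          (F (x₀ + (τ : ℂ) • v) - F x₀ - (τ : ℂ) • L x₀ v) -
          (F (x₀ + (τ : ℂ) • (v + w)) - F x₀ - (τ : ℂ) • L x₀ (v + w)) by
            simp only [smul_sub]; abel]
        refine (norm_sub_le _ _).trans ?_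
        have := norm_add_le (F (x₀ + (τ : ℂ) • (v + w)) - F (x₀ + (τ : ℂ) • v) -
          (τ : ℂ) • L (x₀ + (τ : ℂ) • v) w) (F (x₀ + (τ : ℂ) • v) - F x₀ - (τ : ℂ) • L x₀ v)
        linarith
      rw [norm_smul, Complex.norm_real, Real.norm_of_nonneg hτ.1.le] at e4
      have hτ0 := hτ.1
      refine le_of_mul_le_mul_left (e4.trans (le_of_eq ?_)) hτ0
      ring
    have h2 : Tendsto (fun τ : ℝ => L x₀ (v + w) - L x₀ v - L (x₀ + (τ : ℂ) • v) w) (𝓝[>] 0)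
        (𝓝 (L x₀ (v + w) - L x₀ v - L x₀ w)) := tendsto_const_nhds.sub ht
    have h3 := tendsto_nhds_unique h2 hz
    rw [sub_sub, sub_eq_zero] at h3
    exact h3
  have hadd : ∀ v w : E, L x₀ (v + w) = L x₀ v + L x₀ w := by
    intro v w
    -- Homogeneity reduces additivity to small vectors.
    obtain ⟨c, hc0, hcv, hcw⟩ : ∃ c : ℝ, 0 < c ∧ c * ‖v‖ ≤ r / 4 ∧ c * ‖w‖ ≤ r / 4 := by
      refine ⟨r / 4 / (‖v‖ + ‖w‖ + 1), by positivity, ?_, ?_⟩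
      · rw [div_mul_eq_mul_div, div_le_iff₀ (by positivity)]
        nlinarith [norm_nonneg v, norm_nonneg w]
      · rw [div_mul_eq_mul_div, div_le_iff₀ (by positivity)]
        nlinarith [norm_nonneg v, norm_nonneg w]
    have hn : ∀ u : E, ‖(c : ℂ) • u‖ = c * ‖u‖ := fun u => by
      rw [norm_smul, Complex.norm_real, Real.norm_of_nonneg hc0.le]
    have h1 := hadd' ((c : ℂ) • v) ((c : ℂ) • w) (by rwa [hn]) (by rwa [hn])
    rw [← smul_add, hsm _ hxx, hsm _ hxx, hsm _ hxx, ← smul_add] at h1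
    exact smul_right_injective G (by exact_mod_cast hc0.ne' : (c : ℂ) ≠ 0) h1
  let Φ : E →L[ℂ] G := LinearMap.mkContinuous
    { toFun := L x₀, map_add' := hadd, map_smul' := hsm x₀ hxx } (B / r) (hbd x₀ hxx)
  refine HasFDerivAt.differentiableAt (f' := Φ) ?_
  rw [hasFDerivAt_iff_isLittleO_nhds_zero]
  refine Asymptotics.IsBigO.trans_isLittleO (g := fun v : E => ‖v‖ ^ 2) ?_ ?_
  · refine Asymptotics.IsBigO.of_bound (8 * B / r ^ 2) ?_
    filter_upwards [closedBall_mem_nhds (0 : E) (by linarith : 0 < r / 2)] with v hv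
    rw [norm_pow, norm_norm]
    exact hrem x₀ hxx v (by simpa using hv)
  · simpa using Asymptotics.isLittleO_norm_pow_id one_lt_two

end Gateaux

/-! ## Families of holomorphic maps -/

section Quotient

open Filter Topology

/-- Strict differentiability allows the base point to move together with the step. This is what
yields locally uniform, not just pointwise, convergence of difference quotients. -/
theorem HasStrictFDerivAt.tendsto_quotient {V W ι : Type*} [NormedAddCommGroup V] [NormedSpace ℝ V]
    [NormedAddCommGroup W] [NormedSpace ℝ W] {f : V → W} {f' : V →L[ℝ] W} {p : V}
    (hf : HasStrictFDerivAt f f' p) {l : Filter ι} {b : ι → V} {τ : ι → ℝ}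
    (hb : Tendsto b l (𝓝 p)) (hτ : Tendsto τ l (𝓝[≠] 0)) (h : V) :
    Tendsto (fun q => (τ q)⁻¹ • (f (b q + τ q • h) - f (b q))) l (𝓝 (f' h)) := by
  have hτ0 : Tendsto τ l (𝓝 0) := hτ.mono_right nhdsWithin_le_nhds
  have hne : ∀ᶠ q in l, τ q ≠ 0 := hτ.eventually self_mem_nhdsWithin
  have h1 : Tendsto (fun q => (b q + τ q • h, b q)) l (𝓝 (p, p)) := by
    refine Tendsto.prodMk_nhds ?_ hb
    simpa using hb.add (hτ0.smul_const h)
  have h2 := hf.isLittleO.comp_tendsto h1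
  have h3 : (fun q => f (b q + τ q • h) - f (b q) - τ q • f' h) =o[l] τ := by
    refine (h2.congr_left fun q => ?_).trans_isBigO ?_
    · simp
    · refine Asymptotics.IsBigO.of_bound ‖h‖ (Eventually.of_forall fun q => ?_)
      simp [norm_smul, mul_comm]
  have h4 := h3.tendsto_inv_smul_nhds_zero
  have h5 := h4.add_const (f' h)
  rw [zero_add] at h5
  refine h5.congr' ?_
  filter_upwards [hne] with q hq
  rw [smul_sub, smul_smul, inv_mul_cancel₀ hq, one_smul]
  abel

theorem fderiv_apply_comm {V W : Type*} [NormedAddCommGroup V] [NormedSpace ℝ V]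
    [NormedAddCommGroup W] [NormedSpace ℝ W] {f : V → W} {p : V} (hf : ContDiffAt ℝ 2 f p)
    (a b : V) :
    fderiv ℝ (fun y => fderiv ℝ f y a) p b = fderiv ℝ (fun y => fderiv ℝ f y b) p a := by
  have h1 : IsSymmSndFDerivAt ℝ f p := hf.isSymmSndFDerivAt (by simp)
  have h2 : DifferentiableAt ℝ (fderiv ℝ f) p :=
    (hf.fderiv_right (m := 1) (by norm_num)).differentiableAt (by norm_num)
  have h3 : ∀ a b, fderiv ℝ (fun y => fderiv ℝ f y a) p b = fderiv ℝ (fderiv ℝ f) p b a := by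
    intro a b
    rw [fderiv_clm_apply h2 (differentiableAt_const a)]
    simp
  rw [h3, h3]
  exact h1 b a

end Quotient

/-! ### Joint directional derivatives of holomorphic families -/

section Families

open Filter Topology Metric

variable {E G G' P : Type*} [NormedAddCommGroup E] [NormedSpace ℂ E] [NormedAddCommGroup G]
  [NormedSpace ℂ G] [NormedAddCommGroup G'] [NormedSpace ℂ G'] [NormedAddCommGroup P]
  [NormedSpace ℝ P]

/-- A family `F(x,ρ)` of class `C^n` on `U × D` which is holomorphic in `x`. -/
structure HolFam (n : ℕ) (U : Set E) (D : Set P) (F : E → P → G) : Prop where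
  contDiffOn : ContDiffOn ℝ n (fun y : E × P => F y.1 y.2) (U ×ˢ D)
  hol : ∀ ρ ∈ D, DifferentiableOn ℂ (fun x => F x ρ) U

/-- The directional derivative of a family. -/
noncomputable def dirDeriv (w : E × P) (F : E → P → G) (x : E) (ρ : P) : G :=
  fderiv ℝ (fun y : E × P => F y.1 y.2) (x, ρ) w

variable {n : ℕ} {U : Set E} {D : Set P} {F : E → P → G}

theorem HolFam.mono {m : ℕ} {U' : Set E} {D' : Set P} (hF : HolFam n U D F) (hm : m ≤ n)
    (hU : U' ⊆ U) (hD : D' ⊆ D) : HolFam m U' D' F :=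
  ⟨(hF.contDiffOn.of_le (by exact_mod_cast hm)).mono (prod_mono hU hD),
    fun ρ hρ => (hF.hol ρ (hD hρ)).mono hU⟩

theorem HolFam.congr {F' : E → P → G} (hF : HolFam n U D F)
    (h : ∀ x ∈ U, ∀ ρ ∈ D, F' x ρ = F x ρ) : HolFam n U D F' :=
  ⟨hF.contDiffOn.congr fun y hy => h y.1 hy.1 y.2 hy.2,
    fun ρ hρ => (hF.hol ρ hρ).congr fun x hx => h x hx ρ hρ⟩

theorem HolFam.contDiffAt (hF : HolFam n U D F) (hU : IsOpen U) (hD : IsOpen D) {x : E} {ρ : P}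
    (hx : x ∈ U) (hρ : ρ ∈ D) : ContDiffAt ℝ n (fun y : E × P => F y.1 y.2) (x, ρ) :=
  hF.contDiffOn.contDiffAt ((hU.prod hD).mem_nhds ⟨hx, hρ⟩)

theorem HolFam.contDiffOn_right (hF : HolFam n U D F) {x : E} (hx : x ∈ U) :
    ContDiffOn ℝ n (F x) D :=
  hF.contDiffOn.comp (f := fun ρ => (x, ρ)) (by fun_prop) fun _ hρ => ⟨hx, hρ⟩

theorem HolFam.contDiffOn_left (hF : HolFam n U D F) {ρ : P} (hρ : ρ ∈ D) :
    ContDiffOn ℝ n (fun x => F x ρ) U :=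
  hF.contDiffOn.comp (f := fun x => (x, ρ)) (by fun_prop) fun _ hx => ⟨hx, hρ⟩

theorem HolFam.differentiableAt (hF : HolFam n U D F) (hU : IsOpen U) {x : E} {ρ : P}
    (hx : x ∈ U) (hρ : ρ ∈ D) : DifferentiableAt ℂ (fun x => F x ρ) x :=
  (hF.hol ρ hρ).differentiableAt (hU.mem_nhds hx)

theorem HolFam.hasFDerivAt_real (hF : HolFam n U D F) (hn : 1 ≤ n) (hU : IsOpen U) (hD : IsOpen D)
    {x : E} {ρ : P} (hx : x ∈ U) (hρ : ρ ∈ D) :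
    HasStrictFDerivAt (fun y : E × P => F y.1 y.2)
      (fderiv ℝ (fun y : E × P => F y.1 y.2) (x, ρ)) (x, ρ) :=
  (hF.contDiffAt hU hD hx hρ).hasStrictFDerivAt (by
    have : n ≠ 0 := by omega
    exact_mod_cast this)

theorem HolFam.dirDeriv_eq (hF : HolFam n U D F) (hn : 1 ≤ n) (hU : IsOpen U) (hD : IsOpen D)
    {x : E} {ρ : P} (hx : x ∈ U) (hρ : ρ ∈ D) (v : E) (l : P) :
    dirDeriv (v, l) F x ρ = fderiv ℂ (fun x => F x ρ) x v + fderiv ℝ (F x) ρ l := by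
  have h := (hF.hasFDerivAt_real hn hU hD hx hρ).hasFDerivAt
  have h1 : HasFDerivAt (fun x' => F x' ρ)
      ((fderiv ℝ (fun y : E × P => F y.1 y.2) (x, ρ)).comp (ContinuousLinearMap.inl ℝ E P)) x :=
    HasFDerivAt.comp (f := fun x' => (x', ρ)) x h (hasFDerivAt_prodMk_left x ρ)
  have h2 : HasFDerivAt (F x)
      ((fderiv ℝ (fun y : E × P => F y.1 y.2) (x, ρ)).comp (ContinuousLinearMap.inr ℝ E P)) ρ :=
    HasFDerivAt.comp (f := fun ρ' => (x, ρ')) ρ h (hasFDerivAt_prodMk_right x ρ)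
  have h3 := (hF.differentiableAt hU hx hρ).hasFDerivAt.restrictScalars ℝ
  have h4 := congrArg (fun L => L v) (h1.unique h3)
  have h5 := congrArg (fun L => L l) h2.fderiv
  simp only [ContinuousLinearMap.comp_apply, ContinuousLinearMap.inl_apply,
    ContinuousLinearMap.coe_restrictScalars', ContinuousLinearMap.inr_apply] at h4 h5
  rw [h5, ← h4, ← map_add]
  simp [dirDeriv]

/-- A real difference quotient in the direction `w` is holomorphic in `x`, since both of its terms
are values of holomorphic maps at translated arguments. On complex lines the quotients converge
locally uniformly, so the limit is holomorphic there, and `differentiableOn_of_lines` applies. -/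
theorem HolFam.dirDeriv [CompleteSpace G] (hF : HolFam (n + 1) U D F) (hU : IsOpen U)
    (hD : IsOpen D) (w : E × P) : HolFam n U D (dirDeriv w F) := by
  have hcd : ContDiffOn ℝ n (fun y : E × P => _root_.dirDeriv w F y.1 y.2) (U ×ˢ D) :=
    (hF.contDiffOn.fderiv_of_isOpen (hU.prod hD) (by norm_cast)).clm_apply contDiffOn_const
  refine ⟨hcd, fun ρ hρ => ?_⟩
  have hcont : ContinuousOn (fun x => _root_.dirDeriv w F x ρ) U :=
    hcd.continuousOn.comp (f := fun x => (x, ρ)) (by fun_prop) fun x hx => ⟨hx, hρ⟩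
  refine differentiableOn_of_lines hU hcont fun x hx v => ?_
  obtain ⟨η, hη, hball⟩ := Metric.isOpen_iff.1 hU x hx
  let Ω : Set ℂ := ball 0 (η / 2 / (‖v‖ + 1))
  have hv1 : 0 < ‖v‖ + 1 := by positivity
  have hΩ : ∀ z ∈ Ω, ‖z • v‖ < η / 2 := by
    intro z hz
    rw [mem_ball_zero_iff, lt_div_iff₀ hv1] at hz
    rw [norm_smul]
    nlinarith [norm_nonneg z, norm_nonneg v]
  have hΩU : ∀ z ∈ Ω, x + z • v ∈ U := fun z hz => hball (by
    rw [mem_ball, dist_eq_norm, add_sub_cancel_left]; linarith [hΩ z hz])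
  let Q : ℝ → ℂ → G := fun τ z =>
    τ⁻¹ • (F (x + z • v + τ • w.1) (ρ + τ • w.2) - F (x + z • v) ρ)
  have hlim : TendstoLocallyUniformlyOn Q (fun z => _root_.dirDeriv w F (x + z • v) ρ) (𝓝[≠] 0) Ω := by
    rw [tendstoLocallyUniformlyOn_iff_filter]
    intro z₀ hz₀
    rw [tendstoUniformlyOnFilter_iff_tendsto]
    have hb : Tendsto (fun q : ℝ × ℂ => (x + q.2 • v, ρ)) (𝓝[≠] 0 ×ˢ 𝓝[Ω] z₀)
        (𝓝 (x + z₀ • v, ρ)) := by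
      have h1 : Continuous fun z : ℂ => (x + z • v, ρ) := by fun_prop
      exact (h1.tendsto z₀).comp (tendsto_snd.mono_right nhdsWithin_le_nhds)
    have h1 := (hF.hasFDerivAt_real (by omega) hU hD (hΩU z₀ hz₀) hρ).tendsto_quotient hb
      tendsto_fst w
    have h2 : Tendsto (fun q : ℝ × ℂ => _root_.dirDeriv w F (x + q.2 • v) ρ) (𝓝[≠] 0 ×ˢ 𝓝[Ω] z₀)
        (𝓝 (_root_.dirDeriv w F (x + z₀ • v) ρ)) := by
      have h3 := hcd.continuousOn.continuousAt ((hU.prod hD).mem_nhds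
        (mk_mem_prod (hΩU z₀ hz₀) hρ))
      exact h3.tendsto.comp hb
    exact (h2.prodMk_nhds h1).mono_right (nhds_le_uniformity _)
  have hdiff : ∀ᶠ τ in 𝓝[≠] (0 : ℝ), DifferentiableOn ℂ (Q τ) Ω := by
    have h1 : ∀ᶠ τ in 𝓝 (0 : ℝ), ‖τ • w.1‖ < η / 2 := by
      have : Continuous fun τ : ℝ => ‖τ • w.1‖ := by fun_prop
      exact (this.tendsto 0).eventually (gt_mem_nhds (by simpa using half_pos hη))
    have h2 : ∀ᶠ τ in 𝓝 (0 : ℝ), ρ + τ • w.2 ∈ D := by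
      have : Continuous fun τ : ℝ => ρ + τ • w.2 := by fun_prop
      exact (this.tendsto 0).eventually (hD.mem_nhds (by simpa using hρ))
    filter_upwards [nhdsWithin_le_nhds h1, nhdsWithin_le_nhds h2] with τ hτ hτD z hz
    refine DifferentiableAt.differentiableWithinAt ?_
    have h3 : x + z • v + τ • w.1 ∈ U := hball (by
      rw [mem_ball, dist_eq_norm, add_assoc, add_sub_cancel_left]
      exact (norm_add_le _ _).trans_lt (by linarith [hΩ z hz]))
    refine DifferentiableAt.const_smul (DifferentiableAt.sub ?_ ?_) _
    · exact DifferentiableAt.comp (f := fun z : ℂ => x + z • v + τ • w.1) z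
        (hF.differentiableAt hU h3 hτD) (by fun_prop)
    · exact DifferentiableAt.comp (f := fun z : ℂ => x + z • v) z
        (hF.differentiableAt hU (hΩU z hz) hρ) (by fun_prop)
  have h0 : (0 : ℂ) ∈ Ω := mem_ball_self (by positivity)
  exact (hlim.differentiableOn hdiff isOpen_ball).differentiableAt (isOpen_ball.mem_nhds h0)

/-- Interchange of the holomorphic derivative with a parameter derivative. -/
theorem hasFDerivAt_dirDeriv {M : E → P → E →L[ℂ] G} (hU : IsOpen U) (hD : IsOpen D)
    (hF : ContDiffOn ℝ 1 (fun y : E × P => F y.1 y.2) (U ×ˢ D))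
    (hM : ContDiffOn ℝ 1 (fun y : E × P => M y.1 y.2) (U ×ˢ D))
    (h : ∀ x ∈ U, ∀ ρ ∈ D, HasFDerivAt (fun x => F x ρ) (M x ρ) x) (l : P)
    {x : E} {ρ : P} (hx : x ∈ U) (hρ : ρ ∈ D) :
    HasFDerivAt (fun x => dirDeriv (0, l) F x ρ) (dirDeriv (0, l) M x ρ) x := by
  have hsM := (hM.contDiffAt ((hU.prod hD).mem_nhds (mk_mem_prod hx hρ))).hasStrictFDerivAt one_ne_zero
  have hsF := fun y (hy : y ∈ U) =>
    (hF.contDiffAt ((hU.prod hD).mem_nhds (mk_mem_prod hy hρ))).hasStrictFDerivAt one_ne_zero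
  have hτD : ∀ᶠ τ in 𝓝[≠] (0 : ℝ), ρ + τ • l ∈ D := by
    have : Continuous fun τ : ℝ => ρ + τ • l := by fun_prop
    exact nhdsWithin_le_nhds ((this.tendsto 0).eventually (hD.mem_nhds (by simpa using hρ)))
  -- The difference quotients in `ρ` have the quotients of `M` as their `x`-derivatives. The latter
  -- converge uniformly near `x` by strict differentiability of `M`, which allows the limit to be
  -- differentiated.
  refine hasFDerivAt_of_tendstoUniformlyOnFilter (l := 𝓝[≠] (0 : ℝ))
    (f := fun τ y => τ⁻¹ • (F y (ρ + τ • l) - F y ρ))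
    (f' := fun τ y => τ⁻¹ • (M y (ρ + τ • l) - M y ρ))
    (g' := fun _ => dirDeriv (0, l) M x ρ) ?_ ?_ ?_
  · rw [tendstoUniformlyOnFilter_iff_tendsto]
    have hb : Tendsto (fun q : ℝ × E => (q.2, ρ)) (𝓝[≠] 0 ×ˢ 𝓝 x) (𝓝 (x, ρ)) :=
      tendsto_snd.prodMk_nhds tendsto_const_nhds
    have h1 := hsM.tendsto_quotient hb tendsto_fst (0, l)
    simp only [Prod.smul_mk, smul_zero, Prod.mk_add_mk, add_zero] at h1
    exact (tendsto_const_nhds.prodMk_nhds h1).mono_right (nhds_le_uniformity _)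
  · filter_upwards [hτD.prod_mk (hU.mem_nhds hx)] with q hq
    exact ((h _ hq.2 _ hq.1).sub (h _ hq.2 _ hρ)).const_smul _
  · filter_upwards [hU.mem_nhds hx] with y hy
    have h1 := (hsF y hy).tendsto_quotient (l := 𝓝[≠] (0 : ℝ)) (b := fun _ => (y, ρ))
      tendsto_const_nhds tendsto_id (0, l)
    simpa [dirDeriv] using h1

end Families

/-! ### Iterated derivatives in the parameter -/

section ParameterDerivatives

open Filter Topology Metric

variable {p : ℕ}

theorem pderiv_zero {E : Type*} [NormedAddCommGroup E] [NormedSpace ℝ E] (k : Fin 0 → Fin p)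
    (F : Par p → E) (ρ : Par p) : pderiv k F ρ = F ρ := by
  simp [pderiv]

theorem pderiv_congr {E : Type*} [NormedAddCommGroup E] [NormedSpace ℝ E] {n : ℕ}
    {F F' : Par p → E} {D : Set (Par p)} (hD : IsOpen D) (h : ∀ ρ ∈ D, F ρ = F' ρ)
    (k : Fin n → Fin p) {ρ : Par p} (hρ : ρ ∈ D) : pderiv k F ρ = pderiv k F' ρ := by
  have h1 : F =ᶠ[𝓝 ρ] F' := by
    filter_upwards [hD.mem_nhds hρ] with x hx using h x hx
  simp only [pderiv, (h1.iteratedFDeriv ℝ n).eq_of_nhds]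

/-- The direction `k 0` is the one of the outermost derivative; hence the recursion runs over
`Fin.tail k`. -/
theorem pderiv_succ {E : Type*} [NormedAddCommGroup E] [NormedSpace ℝ E] {n : ℕ}
    {F : Par p → E} {ρ : Par p} (hF : ContDiffAt ℝ (n + 1 : ℕ) F ρ) (k : Fin (n + 1) → Fin p) :
    pderiv k F ρ = fderiv ℝ (pderiv (Fin.tail k) F) ρ (EuclideanSpace.single (k 0) 1) := by
  have hd : DifferentiableAt ℝ (iteratedFDeriv ℝ n F) ρ :=
    hF.differentiableAt_iteratedFDeriv (by norm_cast; omega)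
  unfold pderiv
  rw [iteratedFDeriv_succ_apply_left]
  have := ((ContinuousMultilinearMap.apply ℝ (fun _ : Fin n => Par p) E
    (fun i => EuclideanSpace.single (Fin.tail k i) 1)).hasFDerivAt.comp ρ hd.hasFDerivAt).fderiv
  simp only [Function.comp_def, ContinuousMultilinearMap.apply_apply] at this
  rw [this]
  rfl

theorem pderiv_clm {E F : Type*} [NormedAddCommGroup E] [NormedSpace ℝ E] [NormedAddCommGroup F]
    [NormedSpace ℝ F] {n : ℕ} (L : E →L[ℝ] F) {f : Par p → E} {ρ : Par p}
    (hf : ContDiffAt ℝ n f ρ) (k : Fin n → Fin p) :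
    pderiv k (fun ρ => L (f ρ)) ρ = L (pderiv k f ρ) := by
  have := L.iteratedFDeriv_comp_left hf (i := n) le_rfl
  simp only [pderiv]
  change iteratedFDeriv ℝ n (L ∘ f) ρ _ = _
  rw [this]
  rfl

theorem norm_pderiv_le {E : Type*} [NormedAddCommGroup E] [NormedSpace ℝ E] {n : ℕ}
    (k : Fin n → Fin p) (F : Par p → E) (ρ : Par p) :
    ‖pderiv k F ρ‖ ≤ ‖iteratedFDeriv ℝ n F ρ‖ := by
  refine (ContinuousMultilinearMap.le_opNorm _ _).trans ?_
  simp

variable {E G : Type*} [NormedAddCommGroup E] [NormedSpace ℂ E] [NormedAddCommGroup G]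
  [NormedSpace ℂ G] {U : Set E} {D : Set (Par p)} {F : E → Par p → G}

/-- One parameter derivative is a joint directional derivative in the direction `(0, e)`. Through
this identity the results on `dirDeriv` propagate to all parameter derivatives by induction. -/
theorem pderiv_succ_eq_dirDeriv {n : ℕ} (hU : IsOpen U) (hD : IsOpen D)
    (hF : ContDiffOn ℝ (n + 1 : ℕ) (fun y : E × Par p => F y.1 y.2) (U ×ˢ D))
    (k : Fin (n + 1) → Fin p)
    (hT : ContDiffOn ℝ 1 (fun y : E × Par p => pderiv (Fin.tail k) (F y.1) y.2) (U ×ˢ D))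
    {x : E} (hx : x ∈ U) {ρ : Par p} (hρ : ρ ∈ D) :
    pderiv k (F x) ρ = dirDeriv (0, EuclideanSpace.single (k 0) 1)
      (fun x ρ => pderiv (Fin.tail k) (F x) ρ) x ρ := by
  have h1 : ContDiffAt ℝ (n + 1 : ℕ) (F x) ρ :=
    (hF.contDiffAt ((hU.prod hD).mem_nhds ⟨hx, hρ⟩)).comp (f := fun ρ => (x, ρ)) ρ (by fun_prop)
  rw [pderiv_succ h1]
  have h2 := ((hT.contDiffAt ((hU.prod hD).mem_nhds
    (mk_mem_prod hx hρ))).differentiableAt one_ne_zero).hasFDerivAt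
  have h3 : HasFDerivAt (fun ρ => pderiv (Fin.tail k) (F x) ρ) _ ρ :=
    h2.comp (f := fun ρ => (x, ρ)) ρ (hasFDerivAt_prodMk_right x ρ)
  rw [h3.fderiv]
  simp [dirDeriv]

theorem contDiffOn_pderiv (hU : IsOpen U) (hD : IsOpen D) {i : ℕ} (k : Fin i → Fin p) :
    ∀ {n : ℕ}, ContDiffOn ℝ (n + i : ℕ) (fun y : E × Par p => F y.1 y.2) (U ×ˢ D) →
    ContDiffOn ℝ n (fun y : E × Par p => pderiv k (F y.1) y.2) (U ×ˢ D) := by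
  induction i with
  | zero =>
    intro n hF
    exact hF.congr fun y _ => pderiv_zero _ _ _
  | succ i ih =>
    intro n hF
    have h1 := ih (Fin.tail k) (n := n + 1) (by rwa [show n + 1 + i = n + (i + 1) by ring])
    have h2 : ContDiffOn ℝ n (fun y : E × Par p => dirDeriv (0, EuclideanSpace.single (k 0) 1)
      (fun x ρ => pderiv (Fin.tail k) (F x) ρ) y.1 y.2) (U ×ˢ D) :=
      (h1.fderiv_of_isOpen (hU.prod hD) (by norm_cast)).clm_apply contDiffOn_const
    refine h2.congr fun y hy => ?_
    exact pderiv_succ_eq_dirDeriv hU hD (hF.of_le (by norm_cast; omega)) k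
      (h1.of_le (by norm_cast; omega)) hy.1 hy.2

theorem HolFam.pderiv [CompleteSpace G] (hU : IsOpen U) (hD : IsOpen D) {i : ℕ}
    (k : Fin i → Fin p) : ∀ {n : ℕ}, HolFam (n + i) U D F →
    HolFam n U D (fun x ρ => pderiv k (F x) ρ) := by
  induction i with
  | zero =>
    intro n hF
    exact hF.congr fun x _ ρ _ => pderiv_zero _ _ _
  | succ i ih =>
    intro n hF
    have h1 := ih (Fin.tail k) (n := n + 1) (by rwa [show n + 1 + i = n + (i + 1) by ring])
    refine (h1.dirDeriv hU hD (0, EuclideanSpace.single (k 0) 1)).congr fun x hx ρ hρ => ?_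
    exact pderiv_succ_eq_dirDeriv hU hD (hF.contDiffOn.of_le (by norm_cast; omega)) k
      (h1.contDiffOn.of_le (by norm_cast; omega)) hx hρ

/-- Interchange of the holomorphic derivative with the parameter derivatives. -/
theorem hasFDerivAt_pderiv (hU : IsOpen U) (hD : IsOpen D) {M : E → Par p → E →L[ℂ] G} {i : ℕ}
    (k : Fin i → Fin p)
    (hF : ContDiffOn ℝ i (fun y : E × Par p => F y.1 y.2) (U ×ˢ D))
    (hM : ContDiffOn ℝ i (fun y : E × Par p => M y.1 y.2) (U ×ˢ D))
    (h : ∀ x ∈ U, ∀ ρ ∈ D, HasFDerivAt (fun x => F x ρ) (M x ρ) x) :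
    ∀ {x : E}, x ∈ U → ∀ {ρ : Par p}, ρ ∈ D →
      HasFDerivAt (fun x => pderiv k (F x) ρ) (pderiv k (M x) ρ) x := by
  induction i with
  | zero =>
    intro x hx ρ hρ
    simpa only [pderiv_zero] using h x hx ρ hρ
  | succ i ih =>
    intro x hx ρ hρ
    have h1 := fun {x} (hx : x ∈ U) {ρ} (hρ : ρ ∈ D) => ih (Fin.tail k)
      (hF.of_le (by norm_cast; omega)) (hM.of_le (by norm_cast; omega)) hx hρ
    have hF1 := contDiffOn_pderiv hU hD (F := F) (Fin.tail k) (n := 1) (by rwa [add_comm])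
    rw [Nat.cast_one] at hF1
    have hM1 := contDiffOn_pderiv hU hD (F := M) (Fin.tail k) (n := 1) (by rwa [add_comm])
    rw [Nat.cast_one] at hM1
    have h2 := hasFDerivAt_dirDeriv hU hD hF1 hM1 (fun x hx ρ hρ => h1 hx hρ)
      (EuclideanSpace.single (k 0) 1) hx hρ
    rw [pderiv_succ_eq_dirDeriv hU hD hM k hM1 hx hρ]
    refine h2.congr_of_eventuallyEq ?_
    filter_upwards [hU.mem_nhds hx] with y hy
    exact pderiv_succ_eq_dirDeriv hU hD hF k hF1 hy hρ

end ParameterDerivatives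

/-! ## Bounds of derivatives -/

section JointBounds

open Filter Topology Metric

variable {p : ℕ} {E G : Type*} [NormedAddCommGroup E] [NormedSpace ℂ E] [NormedAddCommGroup G]
  [NormedSpace ℂ G] {U : Set E} {D : Set (Par p)} {F : E → Par p → G}

/-- Cauchy's estimate on the complex line in direction `v`. The factor `2` appears because the
circle has radius `r / (2 * ‖v‖)`, half of what the ball permits. -/
theorem norm_fderiv_apply_le_of_bound {H : E → G} {x : E} {r B : ℝ} (hr : 0 < r)
    (hH : DifferentiableOn ℂ H (ball x r)) (hB : ∀ y ∈ ball x r, ‖H y‖ ≤ B) (v : E) :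
    ‖fderiv ℂ H x v‖ ≤ 2 * B / r * ‖v‖ := by
  rcases eq_or_ne v 0 with rfl | hv0
  · simp
  have hvp : 0 < ‖v‖ := norm_pos_iff.2 hv0
  have hin : ∀ z ∈ ball (0 : ℂ) (2 * (r / (2 * ‖v‖))), x + z • v ∈ ball x r := by
    intro z hz
    rw [mem_ball_zero_iff] at hz
    rw [mem_ball, dist_eq_norm, add_sub_cancel_left, norm_smul]
    calc ‖z‖ * ‖v‖ < 2 * (r / (2 * ‖v‖)) * ‖v‖ := by gcongr
      _ = r := by field_simp
  have hd : ∀ z ∈ ball (0 : ℂ) (2 * (r / (2 * ‖v‖))),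
      HasDerivAt (fun z : ℂ => H (x + z • v)) (fderiv ℂ H (x + z • v) v) z := by
    intro z hz
    have h1 := (hH.differentiableAt (isOpen_ball.mem_nhds (hin z hz))).hasFDerivAt
    have h2 : HasDerivAt (fun z : ℂ => x + z • v) v z := by
      simpa using ((hasDerivAt_id z).smul_const v).const_add x
    exact h1.comp_hasDerivAt z h2
  have h0 : (0 : ℂ) ∈ ball (0 : ℂ) (2 * (r / (2 * ‖v‖))) := mem_ball_self (by positivity)
  have h1 := norm_deriv_le_of_bound (f := fun z : ℂ => H (x + z • v)) (z := 0)
    (R := r / (2 * ‖v‖)) (B := B) (by positivity)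
    (fun z hz => (hd z hz).differentiableAt.differentiableWithinAt) fun z hz => hB _ (hin z hz)
  rw [(hd 0 h0).deriv, zero_smul, add_zero] at h1
  refine h1.trans (le_of_eq ?_)
  field_simp

theorem dirDeriv_congr {F' : E → Par p → G} (hU : IsOpen U) (hD : IsOpen D)
    (h : ∀ x ∈ U, ∀ ρ ∈ D, F x ρ = F' x ρ) (w : E × Par p) {x : E} (hx : x ∈ U) {ρ : Par p}
    (hρ : ρ ∈ D) : dirDeriv w F x ρ = dirDeriv w F' x ρ := by
  have : (fun y : E × Par p => F y.1 y.2) =ᶠ[𝓝 (x, ρ)] fun y => F' y.1 y.2 := by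
    filter_upwards [(hU.prod hD).mem_nhds (mk_mem_prod hx hρ)] with y hy
    exact h y.1 hy.1 y.2 hy.2
  simp only [dirDeriv, this.fderiv_eq]

theorem contDiffOn_dirDeriv {n : ℕ} (hU : IsOpen U) (hD : IsOpen D)
    (hF : ContDiffOn ℝ (n + 1 : ℕ) (fun y : E × Par p => F y.1 y.2) (U ×ˢ D)) (w : E × Par p) :
    ContDiffOn ℝ n (fun y : E × Par p => dirDeriv w F y.1 y.2) (U ×ˢ D) :=
  (hF.fderiv_of_isOpen (hU.prod hD) (by norm_cast)).clm_apply contDiffOn_const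

theorem dirDeriv_comm (hU : IsOpen U) (hD : IsOpen D)
    (hF : ContDiffOn ℝ 2 (fun y : E × Par p => F y.1 y.2) (U ×ˢ D)) (w w' : E × Par p)
    {x : E} (hx : x ∈ U) {ρ : Par p} (hρ : ρ ∈ D) :
    dirDeriv w (dirDeriv w' F) x ρ = dirDeriv w' (dirDeriv w F) x ρ :=
  fderiv_apply_comm (hF.contDiffAt ((hU.prod hD).mem_nhds (mk_mem_prod hx hρ))) w' w

/-- Symmetry of second derivatives, applied once for each parameter derivative; this is why one
additional order of smoothness is assumed. -/
theorem pderiv_dirDeriv (hU : IsOpen U) (hD : IsOpen D) {i : ℕ} (k : Fin i → Fin p)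
    (w : E × Par p) (hF : ContDiffOn ℝ (i + 1 : ℕ) (fun y : E × Par p => F y.1 y.2) (U ×ˢ D)) :
    ∀ {x : E}, x ∈ U → ∀ {ρ : Par p}, ρ ∈ D →
      pderiv k (dirDeriv w F x) ρ = dirDeriv w (fun x ρ => pderiv k (F x) ρ) x ρ := by
  induction i with
  | zero =>
    intro x hx ρ hρ
    simp only [pderiv_zero]
  | succ i ih =>
    intro x hx ρ hρ
    have h1 : ContDiffOn ℝ 1 (fun y : E × Par p => pderiv (Fin.tail k) (dirDeriv w F y.1) y.2)
        (U ×ˢ D) := by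
      have := contDiffOn_pderiv hU hD (Fin.tail k) (n := 1) (F := dirDeriv w F)
        (by rw [add_comm]; exact contDiffOn_dirDeriv hU hD hF w)
      rwa [Nat.cast_one] at this
    have h2 : ContDiffOn ℝ 2 (fun y : E × Par p => pderiv (Fin.tail k) (F y.1) y.2) (U ×ˢ D) := by
      have := contDiffOn_pderiv hU hD (Fin.tail k) (n := 2) (F := F)
        (by convert hF using 2; ring)
      exact_mod_cast this
    rw [pderiv_succ_eq_dirDeriv hU hD (contDiffOn_dirDeriv hU hD hF w) k h1 hx hρ,
      dirDeriv_congr hU hD (fun x hx ρ hρ => ih (Fin.tail k) (hF.of_le (by norm_cast; omega)) hx hρ)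
        _ hx hρ, dirDeriv_comm hU hD h2 _ _ hx hρ]
    refine dirDeriv_congr hU hD (fun x hx ρ hρ => ?_) _ hx hρ
    exact (pderiv_succ_eq_dirDeriv hU hD (hF.of_le (by norm_cast; omega)) k
      (h2.of_le (by norm_cast)) hx hρ).symm

theorem norm_le_sum_of_basis {H : Type*} [NormedAddCommGroup H] [NormedSpace ℝ H]
    (L : Par p →L[ℝ] H) {B : ℝ} (hB : ∀ j, ‖L (EuclideanSpace.single j 1)‖ ≤ B) (l : Par p) :
    ‖L l‖ ≤ p * B * ‖l‖ := by
  have h : l = ∑ j, l j • EuclideanSpace.single j (1 : ℝ) := by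
    conv_lhs => rw [← (EuclideanSpace.basisFun (Fin p) ℝ).sum_repr l]
    simp
  conv_lhs => rw [h, map_sum]
  refine (norm_sum_le _ _).trans ?_
  calc ∑ j, ‖L (l j • EuclideanSpace.single j (1 : ℝ))‖ ≤ ∑ _j : Fin p, ‖l‖ * B := by
        refine Finset.sum_le_sum fun j _ => ?_
        rw [map_smul, norm_smul]
        gcongr
        · exact PiLp.norm_apply_le l j
        · exact hB j
    _ = p * B * ‖l‖ := by simp; ring

/-- A holomorphic family whose parameter derivatives of order at most `n` are bounded by `B`. -/
structure HolFamBdd (n : ℕ) (U : Set E) (D : Set (Par p)) (B : ℝ) (F : E → Par p → G) : Prop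
    extends HolFam n U D F where
  bound : ∀ i ≤ n, ∀ (k : Fin i → Fin p), ∀ x ∈ U, ∀ ρ ∈ D, ‖pderiv k (F x) ρ‖ ≤ B

theorem HolFamBdd.mono {n m : ℕ} {U' : Set E} {B B' : ℝ} (hF : HolFamBdd n U D B F) (hm : m ≤ n)
    (hU : U' ⊆ U) (hB : B ≤ B') : HolFamBdd m U' D B' F :=
  ⟨hF.toHolFam.mono hm hU Subset.rfl,
    fun i hi k x hx ρ hρ => (hF.bound i (hi.trans hm) k x (hU hx) ρ hρ).trans hB⟩

/-- The `x`-part costs `2 * B / (r / 2)` by Cauchy on balls of radius `r / 2`. The `ρ`-part is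
itself a parameter derivative of order at most `n + 1`, and costs `p * B` after expansion in the
basis; `r ≤ 1` lets both be written over `r`. Half of the radius and one order are given up. -/
theorem HolFamBdd.dirDeriv [CompleteSpace G] {n : ℕ} {x₀ : E} {r B : ℝ} (hr : 0 < r) (hr1 : r ≤ 1)
    (hB : 0 ≤ B) (hD : IsOpen D) (hF : HolFamBdd (n + 1) (ball x₀ r) D B F) (w : E × Par p) :
    HolFamBdd n (ball x₀ (r / 2)) D ((4 + p) / r * B * ‖w‖) (dirDeriv w F) := by
  have hsub : ball x₀ (r / 2) ⊆ ball x₀ r := ball_subset_ball (by linarith)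
  refine ⟨(hF.toHolFam.dirDeriv isOpen_ball hD w).mono le_rfl hsub Subset.rfl, ?_⟩
  intro i hi k x hx ρ hρ
  have hxr := hsub hx
  have hP : HolFam 1 (ball x₀ r) D (fun x ρ => pderiv k (F x) ρ) :=
    HolFam.pderiv isOpen_ball hD k (hF.toHolFam.mono (by omega) Subset.rfl Subset.rfl)
  rw [pderiv_dirDeriv isOpen_ball hD k w (hF.contDiffOn.of_le (by norm_cast; omega)) hxr hρ,
    show w = (w.1, w.2) from rfl, hP.dirDeriv_eq le_rfl isOpen_ball hD hxr hρ]
  have hsub2 : ball x (r / 2) ⊆ ball x₀ r := ball_subset_ball' (by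
    have := mem_ball.1 hx; linarith)
  have h1 := norm_fderiv_apply_le_of_bound (H := fun x => pderiv k (F x) ρ) (half_pos hr)
    ((hP.hol ρ hρ).mono hsub2)
    (fun y hy => hF.bound i (by omega) k y (hsub2 hy) ρ hρ) w.1
  have h2 := norm_le_sum_of_basis (fderiv ℝ (pderiv k (F x)) ρ) (B := B) (fun j => by
    have hc : ContDiffAt ℝ (i + 1 : ℕ) (F x) ρ :=
      ((hF.contDiffOn_right hxr).contDiffAt (hD.mem_nhds hρ)).of_le (by norm_cast; omega)
    have h3 := pderiv_succ hc (Fin.cons j k)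
    rw [Fin.tail_cons, Fin.cons_zero] at h3
    rw [← h3]
    exact hF.bound _ (by omega) _ x hxr ρ hρ) w.2
  have hw1 : ‖w.1‖ ≤ ‖w‖ := norm_fst_le w
  have hw2 : ‖w.2‖ ≤ ‖w‖ := norm_snd_le w
  calc _ ≤ 2 * B / (r / 2) * ‖w.1‖ + p * B * ‖w.2‖ := (norm_add_le _ _).trans (add_le_add h1 h2)
    _ ≤ 2 * B / (r / 2) * ‖w‖ + p * B * ‖w‖ := by gcongr
    _ ≤ 2 * B / (r / 2) * ‖w‖ + p * B * ‖w‖ / r := by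
        gcongr
        exact le_div_self (by positivity) hr hr1
    _ = (4 + p) / r * B * ‖w‖ := by field_simp; ring

/-- The constant in the bound of the joint derivatives. -/
noncomputable def jointC (p : ℕ) : ℕ → ℝ
  | 0 => 1
  | n + 1 => jointC p n * 2 ^ n * (4 + p)

theorem jointC_nonneg (p n : ℕ) : 0 ≤ jointC p n := by
  induction n with
  | zero => simp [jointC]
  | succ n ih => simp only [jointC]; positivity

/-- Bounds of parameter derivatives alone control every joint derivative, because derivatives in `x`
come from Cauchy's estimate. Each step strips off the innermost direction and halves the ball; the
powers of two accumulate in `jointC`. -/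
theorem HolFamBdd.norm_iteratedFDeriv_le [CompleteSpace G] (hD : IsOpen D) (n : ℕ) :
    ∀ {F : E → Par p → G} {x₀ : E} {r B : ℝ}, 0 < r → r ≤ 1 → 0 ≤ B →
    HolFamBdd n (ball x₀ r) D B F → ∀ ρ ∈ D,
    ‖iteratedFDeriv ℝ n (fun y : E × Par p => F y.1 y.2) (x₀, ρ)‖ ≤ jointC p n * B / r ^ n := by
  induction n with
  | zero =>
    intro F x₀ r B hr _ _ hF ρ hρ
    have := hF.bound 0 le_rfl Fin.elim0 x₀ (mem_ball_self hr) ρ hρ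
    rw [pderiv_zero] at this
    simpa [jointC] using this
  | succ n ih =>
    intro F x₀ r B hr hr1 hB hF ρ hρ
    have hx₀ := mem_ball_self (x := x₀) hr
    have hC := jointC_nonneg p n
    refine ContinuousMultilinearMap.opNorm_le_bound (by
      have := jointC_nonneg p (n + 1); positivity) fun m => ?_
    rw [iteratedFDeriv_succ_apply_right]
    have hcd : ContDiffAt ℝ n (fderiv ℝ (fun y : E × Par p => F y.1 y.2)) (x₀, ρ) :=
      (hF.toHolFam.contDiffAt isOpen_ball hD hx₀ hρ).fderiv_right (by norm_cast)
    have h1 := (ContinuousLinearMap.apply ℝ G (m (Fin.last n))).iteratedFDeriv_comp_left hcd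
      (i := n) le_rfl
    have h2 := congrArg (fun T => T (Fin.init m)) h1
    simp only [ContinuousLinearMap.compContinuousMultilinearMap_coe, Function.comp_apply,
      ContinuousLinearMap.apply_apply] at h2
    rw [← h2]
    have h3 := ih (half_pos hr) (by linarith) (by positivity)
      (hF.dirDeriv hr hr1 hB hD (m (Fin.last n))) ρ hρ
    refine (ContinuousMultilinearMap.le_of_opNorm_le h3 _).trans (le_of_eq ?_)
    rw [Fin.prod_univ_castSucc]
    simp only [jointC, Fin.init, div_pow]
    field_simp
    ring

end JointBounds

/-! ### Parameter derivatives of compositions -/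

section CompositionBounds

open Filter Topology Metric

variable {p : ℕ} {E G : Type*} [NormedAddCommGroup E] [NormedSpace ℂ E] [NormedAddCommGroup G]
  [NormedSpace ℂ G] {U : Set E} {D : Set (Par p)} {F : E → Par p → G}

theorem norm_iteratedFDeriv_id_le {V : Type*} [NormedAddCommGroup V] [NormedSpace ℝ V] {i : ℕ}
    (hi : 1 ≤ i) (x : V) : ‖iteratedFDeriv ℝ i (id : V → V) x‖ ≤ 1 := by
  obtain ⟨j, rfl⟩ : ∃ j, i = j + 1 := ⟨i - 1, by omega⟩
  rw [← norm_iteratedFDeriv_fderiv]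
  have h : fderiv ℝ (id : V → V) = fun _ => ContinuousLinearMap.id ℝ V := by
    ext1 x; exact fderiv_id
  rw [h]
  rcases j with _ | j
  · simpa using ContinuousLinearMap.norm_id_le
  · simp [iteratedFDeriv_succ_const]

/-- Measuring `x` in units of `δ` makes the radius `1` and leaves the parameter derivatives
untouched, so that no power of `δ` remains in the joint bounds. -/
theorem HolFamBdd.comp_smul {n : ℕ} {δ B : ℝ} (hδ : 0 < δ) {x₀ : E}
    (hF : HolFamBdd n (ball x₀ δ) D B F) :
    HolFamBdd n (ball (δ⁻¹ • x₀) 1) D B (fun ξ ρ => F (δ • ξ) ρ) := by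
  have hm : MapsTo (fun ξ : E => δ • ξ) (ball (δ⁻¹ • x₀) 1) (ball x₀ δ) := by
    intro ξ hξ
    rw [mem_ball, dist_eq_norm] at hξ ⊢
    have : δ • ξ - x₀ = δ • (ξ - δ⁻¹ • x₀) := by
      rw [smul_sub, smul_smul, mul_inv_cancel₀ hδ.ne', one_smul]
    rw [this, norm_smul, Real.norm_of_nonneg hδ.le]
    nlinarith
  refine ⟨⟨?_, fun ρ hρ => ?_⟩, fun i hi k x hx ρ hρ => hF.bound i hi k _ (hm hx) ρ hρ⟩
  · exact hF.contDiffOn.comp (f := fun y : E × Par p => (δ • y.1, y.2)) (by fun_prop)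
      fun y hy => ⟨hm hy.1, hy.2⟩
  · have h : DifferentiableOn ℂ (fun ξ : E => δ • ξ) (ball (δ⁻¹ • x₀) 1) := by
      have : (fun ξ : E => δ • ξ) = fun ξ => (δ : ℂ) • ξ := by ext; simp
      rw [this]; fun_prop
    exact (hF.hol ρ hρ).comp h hm

/-- Bound of the derivatives of `ρ ↦ F(y(ρ),ρ)`. -/
theorem HolFamBdd.norm_iteratedFDeriv_comp_le [CompleteSpace G] (hD : IsOpen D) {n : ℕ} {δ B Q : ℝ}
    (hδ : 0 < δ) (hB : 0 ≤ B) (hQ : 1 ≤ Q) {y : Par p → E} {ρ : Par p} (hρ : ρ ∈ D)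
    (hF : HolFamBdd n (ball (y ρ) δ) D B F) (hy : ContDiffOn ℝ n y D)
    (hb : ∀ i, 1 ≤ i → i ≤ n → ‖iteratedFDeriv ℝ i y ρ‖ ≤ δ * Q ^ i) :
    ‖iteratedFDeriv ℝ n (fun ρ => F (y ρ) ρ) ρ‖ ≤
      n.factorial * ((∑ i ∈ Finset.range (n + 1), jointC p i) * B) * Q ^ n := by
  -- In the rescaled variables the outer map has joint derivatives bounded by a multiple of `B`
  -- alone, and the inner map has derivatives of order `i` bounded by `Q ^ i`; `1 ≤ Q` takes care of
  -- its component `ρ`. The general estimate for derivatives of a composition then gives `n! * C * Q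
  -- ^ n` without `δ`.
  let y' : Par p → E × Par p := fun ρ => (δ⁻¹ • y ρ, ρ)
  let s : Set (Par p) := D ∩ y ⁻¹' ball (y ρ) δ
  have hs : IsOpen s := hy.continuousOn.isOpen_inter_preimage hD isOpen_ball
  have hρs : ρ ∈ s := ⟨hρ, mem_ball_self hδ⟩
  let t : Set (E × Par p) := ball (δ⁻¹ • y ρ) 1 ×ˢ D
  have ht : IsOpen t := isOpen_ball.prod hD
  have hF' := hF.comp_smul hδ
  have hm : MapsTo y' s t := by
    intro ρ' hρ'
    refine ⟨?_, hρ'.1⟩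
    have h1 : y ρ' ∈ ball (y ρ) δ := hρ'.2
    rw [mem_ball, dist_eq_norm] at h1 ⊢
    change ‖δ⁻¹ • y ρ' - δ⁻¹ • y ρ‖ < 1
    rw [← smul_sub, norm_smul, norm_inv, Real.norm_of_nonneg hδ.le, inv_mul_lt_iff₀ hδ, mul_one]
    exact h1
  have hy1 : ContDiffOn ℝ n (fun ρ => δ⁻¹ • y ρ) s := (hy.const_smul _).mono inter_subset_left
  have hy' : ContDiffOn ℝ n y' s := hy1.prodMk contDiffOn_id
  have hyρ : y' ρ ∈ t := hm hρs
  have key := norm_iteratedFDerivWithin_comp_le (n := n) (C := (∑ i ∈ Finset.range (n + 1),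
    jointC p i) * B) (D := Q) hF'.contDiffOn hy' le_rfl ht.uniqueDiffOn hs.uniqueDiffOn hm hρs
    (fun i hi => by
      rw [iteratedFDerivWithin_of_isOpen i ht hyρ]
      have h1 := HolFamBdd.norm_iteratedFDeriv_le hD i one_pos le_rfl hB
        (hF'.mono hi Subset.rfl le_rfl) ρ hρ
      rw [one_pow, div_one] at h1
      refine h1.trans ?_
      gcongr
      exact Finset.single_le_sum (f := jointC p) (fun j _ => jointC_nonneg p j)
        (Finset.mem_range.2 (by omega)))
    (fun i hi1 hi => by
      rw [iteratedFDerivWithin_of_isOpen i hs hρs]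
      have hca : ContDiffAt ℝ n (fun ρ => δ⁻¹ • y ρ) ρ := hy1.contDiffAt (hs.mem_nhds hρs)
      have hin : (i : WithTop ℕ∞) ≤ n := by exact_mod_cast hi
      have h1 := iteratedFDeriv_prodMk (𝕜 := ℝ) (f := fun ρ => δ⁻¹ • y ρ) (g := fun ρ : Par p => ρ)
        hca contDiffAt_id hin
      change ‖iteratedFDeriv ℝ i (fun ρ => (δ⁻¹ • y ρ, ρ)) ρ‖ ≤ _
      rw [h1, ContinuousMultilinearMap.opNorm_prod]
      refine max_le ?_ ?_
      · have h2 := iteratedFDeriv_const_smul_apply (𝕜 := ℝ) (i := i) (a := δ⁻¹) (x := ρ) (f := y)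
          ((hy.contDiffAt (hD.mem_nhds hρ)).of_le hin)
        change ‖iteratedFDeriv ℝ i (δ⁻¹ • y) ρ‖ ≤ _
        rw [h2, norm_smul, norm_inv, Real.norm_of_nonneg hδ.le, inv_mul_le_iff₀ hδ]
        exact hb i hi1 hi
      · change ‖iteratedFDeriv ℝ i (id : Par p → Par p) ρ‖ ≤ _
        refine (norm_iteratedFDeriv_id_le hi1 ρ).trans (one_le_pow₀ hQ))
  rw [iteratedFDerivWithin_of_isOpen n hs hρs] at key
  convert key using 3
  ext ρ'
  simp [y', smul_smul, mul_inv_cancel₀ hδ.ne']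

end CompositionBounds

/-! ## Functions of the parameter with bounded derivatives -/

section DerivBounds

variable {P E F G : Type*} [NormedAddCommGroup P] [NormedSpace ℝ P]
  [NormedAddCommGroup E] [NormedSpace ℂ E] [NormedAddCommGroup F] [NormedSpace ℂ F]
  [NormedAddCommGroup G] [NormedSpace ℂ G] {D : Set P} {s : ℕ}

/-- Functions of class `C^s` on `D` whose derivatives of order at most `s` are bounded by `B`. -/
structure DerivBdd (s : ℕ) (D : Set P) (B : ℝ) (f : P → E) : Prop where
  contDiffOn : ContDiffOn ℝ s f D
  bound : ∀ n ≤ s, ∀ ρ ∈ D, ‖iteratedFDeriv ℝ n f ρ‖ ≤ B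

theorem DerivBdd.mono {f : P → E} {B B' : ℝ} (hf : DerivBdd s D B f) (h : B ≤ B') :
    DerivBdd s D B' f :=
  ⟨hf.contDiffOn, fun n hn ρ hρ => (hf.bound n hn ρ hρ).trans h⟩

theorem DerivBdd.norm_le {f : P → E} {B : ℝ} (hf : DerivBdd s D B f) {ρ : P} (hρ : ρ ∈ D) :
    ‖f ρ‖ ≤ B := by
  simpa using hf.bound 0 (Nat.zero_le _) ρ hρ

theorem DerivBdd.congr {f g : P → E} {B : ℝ} (hf : DerivBdd s D B f) (hD : IsOpen D)
    (h : ∀ ρ ∈ D, g ρ = f ρ) : DerivBdd s D B g := by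
  refine ⟨hf.contDiffOn.congr h, fun n hn ρ hρ => ?_⟩
  have h1 : g =ᶠ[nhds ρ] f := by
    filter_upwards [hD.mem_nhds hρ] with x hx using h x hx
  rw [(h1.iteratedFDeriv ℝ n).eq_of_nhds]
  exact hf.bound n hn ρ hρ

theorem DerivBdd.add {f g : P → E} {B B' : ℝ} (hf : DerivBdd s D B f) (hg : DerivBdd s D B' g)
    (hD : IsOpen D) : DerivBdd s D (B + B') (fun ρ => f ρ + g ρ) := by
  refine ⟨hf.contDiffOn.add hg.contDiffOn, fun n hn ρ hρ => ?_⟩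
  have hns : (n : WithTop ℕ∞) ≤ s := by exact_mod_cast hn
  have h1 := iteratedFDeriv_add_apply (𝕜 := ℝ) (i := n)
    ((hf.contDiffOn.contDiffAt (hD.mem_nhds hρ)).of_le hns)
    ((hg.contDiffOn.contDiffAt (hD.mem_nhds hρ)).of_le hns)
  change ‖iteratedFDeriv ℝ n (f + g) ρ‖ ≤ _
  rw [h1]
  exact (norm_add_le _ _).trans (add_le_add (hf.bound n hn ρ hρ) (hg.bound n hn ρ hρ))

theorem DerivBdd.clm {f : P → E} {B c : ℝ} (hf : DerivBdd s D B f) (hD : IsOpen D)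
    (L : E →L[ℂ] F) (hc : 0 ≤ c) (hL : ∀ x, ‖L x‖ ≤ c * ‖x‖) :
    DerivBdd s D (c * B) (fun ρ => L (f ρ)) := by
  refine ⟨(L.restrictScalars ℝ).contDiff.comp_contDiffOn hf.contDiffOn, fun n hn ρ hρ => ?_⟩
  have hns : (n : WithTop ℕ∞) ≤ s := by exact_mod_cast hn
  have h1 := (L.restrictScalars ℝ).norm_iteratedFDeriv_comp_left
    (hf.contDiffOn.contDiffAt (hD.mem_nhds hρ)) hns
  change ‖iteratedFDeriv ℝ n (L.restrictScalars ℝ ∘ f) ρ‖ ≤ _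
  refine h1.trans ?_
  have h2 : ‖L.restrictScalars ℝ‖ ≤ c := ContinuousLinearMap.opNorm_le_bound _ hc hL
  gcongr
  exact hf.bound n hn ρ hρ

theorem DerivBdd.neg {f : P → E} {B : ℝ} (hf : DerivBdd s D B f) (hD : IsOpen D) :
    DerivBdd s D B (fun ρ => -f ρ) := by
  have := hf.clm hD (-ContinuousLinearMap.id ℂ E) zero_le_one (fun x => by simp)
  rw [one_mul] at this
  exact this

theorem norm_iteratedFDeriv_bilinear_le (β : E →L[ℂ] F →L[ℂ] G)
    (hβ : ∀ x y, ‖β x y‖ ≤ ‖x‖ * ‖y‖) {f : P → E} {g : P → F} (hD : IsOpen D)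
    (hf : ContDiffOn ℝ s f D) (hg : ContDiffOn ℝ s g D) {n : ℕ} (hn : n ≤ s) {ρ : P} (hρ : ρ ∈ D) :
    ‖iteratedFDeriv ℝ n (fun ρ => β (f ρ) (g ρ)) ρ‖ ≤ ∑ i ∈ Finset.range (n + 1),
      (n.choose i : ℝ) * ‖iteratedFDeriv ℝ i f ρ‖ * ‖iteratedFDeriv ℝ (n - i) g ρ‖ := by
  have h1 : ‖β.bilinearRestrictScalars ℝ‖ ≤ 1 :=
    ContinuousLinearMap.opNorm_le_bound₂ _ zero_le_one fun x y => by
      rw [one_mul]; exact hβ x y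
  have := (β.bilinearRestrictScalars ℝ).norm_iteratedFDerivWithin_le_of_bilinear_of_le_one
    hf hg hD.uniqueDiffOn hρ (n := n) (by exact_mod_cast hn) h1
  simp only [iteratedFDerivWithin_of_isOpen _ hD hρ] at this
  exact this

theorem DerivBdd.bilin (β : E →L[ℂ] F →L[ℂ] G) (hβ : ∀ x y, ‖β x y‖ ≤ ‖x‖ * ‖y‖)
    {f : P → E} {g : P → F} {A B : ℝ} (hf : DerivBdd s D A f) (hg : DerivBdd s D B g)
    (hD : IsOpen D) : DerivBdd s D (2 ^ s * A * B) (fun ρ => β (f ρ) (g ρ)) := by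
  refine ⟨(β.bilinearRestrictScalars ℝ).isBoundedBilinearMap.contDiff.comp_contDiffOn
    (hf.contDiffOn.prodMk hg.contDiffOn), fun n hn ρ hρ => ?_⟩
  have hA : 0 ≤ A := (norm_nonneg _).trans (hf.norm_le hρ)
  have hB : 0 ≤ B := (norm_nonneg _).trans (hg.norm_le hρ)
  refine (norm_iteratedFDeriv_bilinear_le β hβ hD hf.contDiffOn hg.contDiffOn hn hρ).trans ?_
  calc _ ≤ ∑ i ∈ Finset.range (n + 1), (n.choose i : ℝ) * A * B := by
        refine Finset.sum_le_sum fun i hi => ?_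
        have := Finset.mem_range.1 hi
        gcongr
        · exact hf.bound i (by omega) ρ hρ
        · exact hg.bound _ (by omega) ρ hρ
    _ = 2 ^ n * A * B := by
        rw [← Finset.sum_mul, ← Finset.sum_mul]
        congr 2
        exact_mod_cast Nat.sum_range_choose n
    _ ≤ 2 ^ s * A * B := by
        gcongr
        exact one_le_two

/-- The constant in the bound of solutions of linear equations. -/
noncomputable def linC : ℕ → ℝ
  | 0 => 2
  | n + 1 => 2 * (1 + 2 ^ (n + 1) * linC n)

theorem linC_pos (n : ℕ) : 0 < linC n := by
  induction n with
  | zero => simp [linC]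
  | succ n ih => simp only [linC]; positivity

theorem linC_le_succ (n : ℕ) : linC n ≤ linC (n + 1) := by
  have h := linC_pos n
  have : (1 : ℝ) ≤ 2 ^ (n + 1) := one_le_pow₀ one_le_two
  simp only [linC]
  nlinarith

/-- Bound of the derivatives of the solution of `z = α + β(η,z)`. -/
theorem DerivBdd.of_linear_eq (β : E →L[ℂ] F →L[ℂ] F) (hβ : ∀ x y, ‖β x y‖ ≤ ‖x‖ * ‖y‖)
    {η : P → E} {α z : P → F} {A : ℝ} (hD : IsOpen D) (hη : DerivBdd s D (1 / 2) η)
    (hα : DerivBdd s D A α) (hz : ContDiffOn ℝ s z D) (h : ∀ ρ ∈ D, z ρ = α ρ + β (η ρ) (z ρ)) :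
    DerivBdd s D (linC s * A) z := by
  refine ⟨hz, ?_⟩
  have hmono : Monotone linC := monotone_nat_of_le_succ linC_le_succ
  have hβz : ContDiffOn ℝ s (fun ρ => β (η ρ) (z ρ)) D :=
    (β.bilinearRestrictScalars ℝ).isBoundedBilinearMap.contDiff.comp_contDiffOn
      (hη.contDiffOn.prodMk hz)
  -- Leibniz' rule applied to the right side of the equation.
  have key : ∀ n ≤ s, ∀ ρ ∈ D, ‖iteratedFDeriv ℝ n z ρ‖ ≤ A +
      ∑ i ∈ Finset.range (n + 1), (n.choose i : ℝ) * ‖iteratedFDeriv ℝ i η ρ‖ *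
        ‖iteratedFDeriv ℝ (n - i) z ρ‖ := by
    intro n hn ρ hρ
    have hns : (n : WithTop ℕ∞) ≤ s := by exact_mod_cast hn
    have h1 : z =ᶠ[nhds ρ] α + fun ρ => β (η ρ) (z ρ) := by
      filter_upwards [hD.mem_nhds hρ] with x hx using h x hx
    rw [(h1.iteratedFDeriv ℝ n).eq_of_nhds, iteratedFDeriv_add_apply (𝕜 := ℝ) (i := n)
      ((hα.contDiffOn.contDiffAt (hD.mem_nhds hρ)).of_le hns)
      ((hβz.contDiffAt (hD.mem_nhds hρ)).of_le hns)]
    refine (norm_add_le _ _).trans (add_le_add (hα.bound n hn ρ hρ) ?_)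
    exact norm_iteratedFDeriv_bilinear_le β hβ hD hη.contDiffOn hz hn hρ
  have main : ∀ n ≤ s, ∀ m ≤ n, ∀ ρ ∈ D, ‖iteratedFDeriv ℝ m z ρ‖ ≤ linC n * A := by
    intro n
    induction n with
    | zero =>
      intro _ m hm ρ hρ
      obtain rfl : m = 0 := by omega
      have h1 := key 0 (by omega) ρ hρ
      have h2 := hη.bound 0 (by omega) ρ hρ
      simp only [zero_add, Finset.range_one, Finset.sum_singleton, Nat.choose_self, Nat.cast_one,
        one_mul] at h1
      have h3 := norm_nonneg (iteratedFDeriv ℝ 0 z ρ)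
      simp only [linC]
      nlinarith
    | succ n ih =>
      intro hn m hm ρ hρ
      have hA : 0 ≤ A := (norm_nonneg _).trans (hα.norm_le hρ)
      rcases Nat.lt_or_ge m (n + 1) with hlt | hge
      · refine (ih (by omega) m (by omega) ρ hρ).trans ?_
        gcongr
        exact linC_le_succ n
      obtain rfl : m = n + 1 := by omega
      have h1 := key (n + 1) hn ρ hρ
      have h2 := hη.bound 0 (by omega) ρ hρ
      -- The term `i = 0` is the only one with the top derivative of `z`. Its factor `‖η‖ ≤ 1/2`
      -- lets it be absorbed on the left, which explains the leading `2` in `linC`; the other terms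
      -- contain derivatives bounded by induction.
      rw [Finset.sum_range_succ'] at h1
      simp only [Nat.choose_zero_right, Nat.cast_one, one_mul, Nat.sub_zero] at h1
      have h3 := norm_nonneg (iteratedFDeriv ℝ (n + 1) z ρ)
      have h4 : ∑ i ∈ Finset.range (n + 1), ((n + 1).choose (i + 1) : ℝ) *
          ‖iteratedFDeriv ℝ (i + 1) η ρ‖ * ‖iteratedFDeriv ℝ (n + 1 - (i + 1)) z ρ‖ ≤
          2 ^ (n + 1) * (linC n * A) := by
        calc _ ≤ ∑ i ∈ Finset.range (n + 1), ((n + 1).choose (i + 1) : ℝ) * 1 * (linC n * A) := by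
              refine Finset.sum_le_sum fun i hi => ?_
              have := Finset.mem_range.1 hi
              have h5 := hη.bound (i + 1) (by omega) ρ hρ
              gcongr
              · exact h5.trans (by norm_num)
              · exact ih (by omega) _ (by omega) ρ hρ
          _ = (∑ i ∈ Finset.range (n + 1), ((n + 1).choose (i + 1) : ℝ)) * (linC n * A) := by
              rw [Finset.sum_mul]; simp
          _ ≤ 2 ^ (n + 1) * (linC n * A) := by
              have := linC_pos n
              gcongr
              have h6 : ∑ i ∈ Finset.range (n + 1 + 1), ((n + 1).choose i : ℝ) = 2 ^ (n + 1) := by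
                exact_mod_cast Nat.sum_range_choose (n + 1)
              rw [Finset.sum_range_succ'] at h6
              have : (0 : ℝ) ≤ ((n + 1).choose 0 : ℝ) := by positivity
              linarith
      simp only [linC]
      nlinarith
  exact fun n hn ρ hρ => (main s le_rfl n hn ρ hρ)

variable {K : Type*} [TopologicalSpace K] [CompactSpace K]

theorem iteratedFDeriv_curve_apply {u : P → C(K, E)} {ρ : P} {n : ℕ}
    (hu : ContDiffAt ℝ n u ρ) (m : Fin n → P) (t : K) :
    iteratedFDeriv ℝ n u ρ m t = iteratedFDeriv ℝ n (fun ρ => u ρ t) ρ m := by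
  have h := (ContinuousMap.evalCLM ℝ t : C(K, E) →L[ℝ] E).iteratedFDeriv_comp_left hu
    (i := n) le_rfl
  change _ = iteratedFDeriv ℝ n ((ContinuousMap.evalCLM ℝ t : C(K, E) →L[ℝ] E) ∘ u) ρ m
  rw [h]
  rfl

/-- Evaluation at `t` is a bounded linear map and commutes with the derivatives, so the supremum
norm of a derivative is a supremum of pointwise ones. Smoothness of the curve-valued map has to be
known beforehand. -/
theorem norm_iteratedFDeriv_curve_le {u : P → C(K, E)} {ρ : P} {n : ℕ}
    (hu : ContDiffAt ℝ n u ρ) {B : ℝ} (hB : 0 ≤ B)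
    (h : ∀ t, ‖iteratedFDeriv ℝ n (fun ρ => u ρ t) ρ‖ ≤ B) : ‖iteratedFDeriv ℝ n u ρ‖ ≤ B := by
  refine ContinuousMultilinearMap.opNorm_le_bound hB fun m => ?_
  rw [ContinuousMap.norm_le _ (by positivity)]
  intro t
  rw [iteratedFDeriv_curve_apply hu]
  exact ContinuousMultilinearMap.le_of_opNorm_le (h t) m

theorem norm_iteratedFDeriv_eval_le {u : P → C(K, E)} {ρ : P} {n : ℕ}
    (hu : ContDiffAt ℝ n u ρ) (t : K) :
    ‖iteratedFDeriv ℝ n (fun ρ => u ρ t) ρ‖ ≤ ‖iteratedFDeriv ℝ n u ρ‖ := by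
  refine ContinuousMultilinearMap.opNorm_le_bound (norm_nonneg _) fun m => ?_
  rw [← iteratedFDeriv_curve_apply hu]
  exact (ContinuousMap.norm_coe_le_norm _ t).trans (ContinuousMultilinearMap.le_opNorm _ m)

theorem DerivBdd.eval {u : P → C(K, E)} {B : ℝ} (hu : DerivBdd s D B u) (hD : IsOpen D) (t : K) :
    DerivBdd s D B (fun ρ => u ρ t) := by
  have := hu.clm hD (ContinuousMap.evalCLM ℂ t) zero_le_one (fun x => by
    rw [one_mul]; exact x.norm_coe_le_norm t)
  rw [one_mul] at this
  exact this

theorem DerivBdd.of_eval {u : P → C(K, E)} {B : ℝ} (hB : 0 ≤ B) (hc : ContDiffOn ℝ s u D)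
    (hD : IsOpen D)
    (h : ∀ t, ∀ n ≤ s, ∀ ρ ∈ D, ‖iteratedFDeriv ℝ n (fun ρ => u ρ t) ρ‖ ≤ B) :
    DerivBdd s D B u :=
  ⟨hc, fun n hn ρ hρ => norm_iteratedFDeriv_curve_le
    ((hc.contDiffAt (hD.mem_nhds hρ)).of_le (by exact_mod_cast hn)) hB fun t => h t n hn ρ hρ⟩

end DerivBounds

/-! ## Operations on holomorphic families -/

section FamilyOperations

variable {E E' F G : Type*} [NormedAddCommGroup E] [NormedSpace ℂ E] [NormedAddCommGroup E']
  [NormedSpace ℂ E'] [NormedAddCommGroup F] [NormedSpace ℂ F]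
  [NormedAddCommGroup G] [NormedSpace ℂ G] {P : Type*} [NormedAddCommGroup P] [NormedSpace ℝ P]
  {n : ℕ} {U : Set E} {U' : Set E'} {D : Set P}

theorem HolFam.id : HolFam n U D (fun (x : E) (_ : P) => x) :=
  ⟨contDiff_fst.contDiffOn, fun _ _ => differentiableOn_id⟩

theorem HolFam.comp {f : E → P → F} {y : E' → P → E} (hf : HolFam n U D f)
    (hy : HolFam n U' D y) (hm : ∀ x ∈ U', ∀ ρ ∈ D, y x ρ ∈ U) :
    HolFam n U' D (fun x ρ => f (y x ρ) ρ) :=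
  ⟨hf.contDiffOn.comp (f := fun z : E' × P => (y z.1 z.2, z.2))
      (hy.contDiffOn.prodMk contDiff_snd.contDiffOn) fun _ hz => ⟨hm _ hz.1 _ hz.2, hz.2⟩,
    fun ρ hρ => (hf.hol ρ hρ).comp (hy.hol ρ hρ) fun x hx => hm x hx ρ hρ⟩

/-- The order `max n 1` is there because holomorphy in `x` requires complex differentiability of `f`
even when `n = 0`. -/
theorem HolFam.comp_left {f : E → F} {y : E' → P → E} {V : Set E} (hf : ContDiffOn ℂ (max n 1 : ℕ) f V)
    (hy : HolFam n U' D y) (hm : ∀ x ∈ U', ∀ ρ ∈ D, y x ρ ∈ V) :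
    HolFam n U' D (fun x ρ => f (y x ρ)) :=
  ⟨((hf.restrict_scalars ℝ).of_le (by norm_cast; exact le_max_left _ _)).comp
      (f := fun z : E' × P => y z.1 z.2) hy.contDiffOn fun _ hz => hm _ hz.1 _ hz.2,
    fun ρ hρ => (hf.differentiableOn (by
      have : max n 1 ≠ 0 := by omega
      exact_mod_cast this)).comp (hy.hol ρ hρ) fun x hx => hm x hx ρ hρ⟩

theorem HolFam.add {f g : E → P → F} (hf : HolFam n U D f) (hg : HolFam n U D g) :
    HolFam n U D (fun x ρ => f x ρ + g x ρ) :=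
  ⟨hf.contDiffOn.add hg.contDiffOn, fun ρ hρ => (hf.hol ρ hρ).add (hg.hol ρ hρ)⟩

theorem HolFam.neg {f : E → P → F} (hf : HolFam n U D f) : HolFam n U D (fun x ρ => -f x ρ) :=
  ⟨hf.contDiffOn.neg, fun ρ hρ => (hf.hol ρ hρ).neg⟩

theorem HolFam.clm {f : E → P → F} (hf : HolFam n U D f) (L : F →L[ℂ] G) :
    HolFam n U D (fun x ρ => L (f x ρ)) :=
  ⟨(L.restrictScalars ℝ).contDiff.comp_contDiffOn hf.contDiffOn,
    fun ρ hρ => L.differentiable.comp_differentiableOn (hf.hol ρ hρ)⟩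

theorem HolFam.bilin {f : E → P → F} {g : E → P → E'} (hf : HolFam n U D f)
    (hg : HolFam n U D g) (β : F →L[ℂ] E' →L[ℂ] G) :
    HolFam n U D (fun x ρ => β (f x ρ) (g x ρ)) :=
  ⟨(β.bilinearRestrictScalars ℝ).isBoundedBilinearMap.contDiff.comp_contDiffOn
      (hf.contDiffOn.prodMk hg.contDiffOn),
    fun ρ hρ => β.isBoundedBilinearMap.differentiable.comp_differentiableOn
      ((hf.hol ρ hρ).prodMk (hg.hol ρ hρ))⟩

/-- The real derivative is the complex one with scalars restricted. Restriction of scalars is an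
isometric embedding of operator spaces, so continuity of the real derivative passes back to the
complex one. -/
theorem contDiffOn_complex_one {f : E → F} (hU : IsOpen U) (hr : ContDiffOn ℝ 1 f U)
    (hf : DifferentiableOn ℂ f U) : ContDiffOn ℂ 1 f U := by
  rw [show (1 : WithTop ℕ∞) = 0 + 1 by norm_num, contDiffOn_succ_iff_fderiv_of_isOpen hU]
  refine ⟨hf, by simp, contDiffOn_zero.2 ?_⟩
  have h1 : ContinuousOn (fderiv ℝ f) U := hr.continuousOn_fderiv_of_isOpen hU le_rfl
  have h2 : ContinuousOn (fun x => ContinuousLinearMap.restrictScalarsIsometry ℂ E F ℝ ℝ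
      (fderiv ℂ f x)) U := by
    refine h1.congr fun x hx => ?_
    exact ((hf.differentiableAt (hU.mem_nhds hx)).hasFDerivAt.restrictScalars ℝ).fderiv.symm
  exact ((ContinuousLinearMap.restrictScalarsIsometry ℂ E F ℝ ℝ).isometry.isEmbedding.isInducing.continuousOn_iff).2 h2

variable {K : Type*} [TopologicalSpace K] [CompactSpace K]

/-- Constant curves. -/
noncomputable def constL (𝕜 : Type*) (K : Type*) {E : Type*} [RCLike 𝕜] [TopologicalSpace K]
    [CompactSpace K] [NormedAddCommGroup E] [NormedSpace 𝕜 E] : E →L[𝕜] C(K, E) :=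
  LinearMap.mkContinuous
    { toFun := fun x => ContinuousMap.const K x
      map_add' := fun _ _ => rfl
      map_smul' := fun _ _ => rfl } 1 fun x => by
        rw [one_mul, ContinuousMap.norm_le _ (norm_nonneg _)]
        exact fun _ => le_rfl

@[simp] theorem constL_apply {𝕜 E : Type*} [RCLike 𝕜] [NormedAddCommGroup E] [NormedSpace 𝕜 E] (x : E) (t : K) :
    constL 𝕜 K x t = x := rfl

/-- The curve `t ↦ (u(t),ρ)`. -/
noncomputable def pairL (K : Type*) [TopologicalSpace K] [CompactSpace K] (E P : Type*)
    [NormedAddCommGroup E] [NormedSpace ℂ E] [NormedAddCommGroup P] [NormedSpace ℝ P] :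
    C(K, E) × P →L[ℝ] C(K, E × P) :=
  LinearMap.mkContinuous
    { toFun := fun y => ⟨fun t => (y.1 t, y.2), by fun_prop⟩
      map_add' := fun _ _ => rfl
      map_smul' := fun _ _ => rfl } 1 fun y => by
        rw [one_mul, ContinuousMap.norm_le _ (norm_nonneg _)]
        intro t
        exact max_le ((y.1.norm_coe_le_norm t).trans (norm_fst_le y)) (norm_snd_le y)

@[simp] theorem pairL_apply (y : C(K, E) × P) (t : K) : pairL K E P y t = (y.1 t, y.2) := rfl

end FamilyOperations

/-! ### Composition operators depending on a parameter -/

section FamilyNemytskii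

universe u

variable {E G P : Type u} [NormedAddCommGroup E] [NormedSpace ℂ E]
  [NormedAddCommGroup G] [NormedAddCommGroup P] [NormedSpace ℝ P]
  {E' : Type*} [NormedAddCommGroup E'] [NormedSpace ℂ E']
  {n : ℕ} {U : Set E} {U' : Set E'} {D : Set P} {K : Type*} [TopologicalSpace K] [CompactSpace K]

/-- Treating the parameter as a constant curve turns a family of composition operators into a single
one, preceded by a bounded linear map; smoothness in `(u, ρ)` follows. -/
theorem nem_pairL {f : E → P → G} (hf : ContinuousOn (fun y : E × P => f y.1 y.2) (U ×ˢ D))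
    {u : C(K, E)} (hu : u ∈ curvesIn K U) {ρ : P} (hρ : ρ ∈ D) :
    nem (fun y : E × P => f y.1 y.2) (pairL K E P (u, ρ)) = nem (fun x => f x ρ) u := by
  ext t
  have h1 : ContinuousOn (fun x => f x ρ) U :=
    hf.comp (f := fun x => (x, ρ)) (by fun_prop) fun x hx => ⟨hx, hρ⟩
  rw [nem_apply hf (U := U ×ˢ D) (fun t => ⟨hu t, hρ⟩), nem_apply h1 hu, pairL_apply]

variable [NormedSpace ℂ G]

theorem contDiffOn_nem_pair {f : E → P → G} (hU : IsOpen U) (hD : IsOpen D)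
    (hf : ContDiffOn ℝ n (fun y : E × P => f y.1 y.2) (U ×ˢ D)) :
    ContDiffOn ℝ n (fun y : C(K, E) × P => nem (fun x => f x y.2) y.1) (curvesIn K U ×ˢ D) := by
  refine ((contDiffOn_nem (hU.prod hD) n hf).comp (pairL K E P).contDiff.contDiffOn
    (s := curvesIn K U ×ˢ D) fun y hy t => ⟨hy.1 t, hy.2⟩).congr fun y hy => ?_
  exact (nem_pairL hf.continuousOn hy.1 hy.2).symm

/-- Holomorphy in `u` is `contDiffOn_nem` over `ℂ` with exponent one; the complex C¹ regularity it
requires is supplied by `contDiffOn_complex_one`, whence `1 ≤ n`. -/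
theorem HolFam.nem {f : E → P → G} (hn : 1 ≤ n) (hU : IsOpen U) (hD : IsOpen D)
    (hf : HolFam n U D f) : HolFam n (curvesIn K U) D (fun u ρ => nem (fun x => f x ρ) u) :=
  ⟨contDiffOn_nem_pair hU hD hf.contDiffOn, fun ρ hρ => by
    have h1 : ContDiffOn ℂ 1 (fun x => f x ρ) U := contDiffOn_complex_one hU
      ((hf.contDiffOn_left hρ).of_le (by exact_mod_cast hn)) (hf.hol ρ hρ)
    exact (contDiffOn_nem hU 1 (by rwa [Nat.cast_one])).differentiableOn (by simp)⟩

end FamilyNemytskii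

/-! ## Fixed points and linear equations depending on parameters -/

section FixedPoint

open Filter Topology

theorem isInvertible_one_sub {𝕜 Z : Type*} [RCLike 𝕜] [NormedAddCommGroup Z] [NormedSpace 𝕜 Z]
    [CompleteSpace Z] {T : Z →L[𝕜] Z} (hT : ‖T‖ < 1) :
    (ContinuousLinearMap.id 𝕜 Z - T).IsInvertible :=
  ⟨ContinuousLinearEquiv.unitsEquiv 𝕜 Z (Units.oneSub T hT), rfl⟩

/-- A fixed point of a contraction depends smoothly on the parameters. -/
theorem contDiffAt_fixedPoint {𝕜 Λ Z : Type*} [RCLike 𝕜] [NormedAddCommGroup Λ] [NormedSpace 𝕜 Λ]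
    [CompleteSpace Λ] [NormedAddCommGroup Z] [NormedSpace 𝕜 Z] [CompleteSpace Z]
    {Q : Λ × Z → Z} {v : Λ → Z} {l₀ : Λ} {n : ℕ} (hn : n ≠ 0)
    (hQ : ContDiffAt 𝕜 n Q (l₀, v l₀)) (hfix : ∀ᶠ l in 𝓝 l₀, v l = Q (l, v l))
    (hlip : ∀ᶠ l in 𝓝 l₀, ‖Q (l, v l) - Q (l, v l₀)‖ ≤ 1 / 2 * ‖v l - v l₀‖)
    (hlip₀ : ∀ᶠ z in 𝓝 (v l₀), ‖Q (l₀, z) - Q (l₀, v l₀)‖ ≤ 1 / 2 * ‖z - v l₀‖) :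
    ContDiffAt 𝕜 n v l₀ := by
  -- Continuity of `v` is not assumed. The contraction bounds `‖v l - v l₀‖` by twice the change of
  -- `Q` at the fixed second argument `v l₀`.
  have hcont : ContinuousAt v l₀ := by
    have h1 : Tendsto (fun l => 2 * ‖Q (l, v l₀) - Q (l₀, v l₀)‖) (𝓝 l₀) (𝓝 0) := by
      have h2 : ContinuousAt (fun l => Q (l, v l₀)) l₀ :=
        ContinuousAt.comp (f := fun l => (l, v l₀)) hQ.continuousAt (by fun_prop)
      have h3 := ((h2.sub (continuousAt_const (y := Q (l₀, v l₀)))).norm).const_mul 2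
      simpa [ContinuousAt] using h3
    rw [ContinuousAt, tendsto_iff_norm_sub_tendsto_zero]
    refine squeeze_zero' (Eventually.of_forall fun _ => norm_nonneg _) ?_ h1
    have h0 : v l₀ = Q (l₀, v l₀) := hfix.self_of_nhds
    filter_upwards [hfix, hlip] with l hl hl'
    have h2 : ‖v l - v l₀‖ ≤ ‖Q (l, v l) - Q (l, v l₀)‖ + ‖Q (l, v l₀) - Q (l₀, v l₀)‖ := by
      conv_lhs => rw [hl, h0]
      rw [← h0]
      exact norm_sub_le_norm_sub_add_norm_sub _ _ _
    linarith
  let f : Λ × Z → Z := fun y => y.2 - Q y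
  have hf : ContDiffAt 𝕜 n f (l₀, v l₀) := contDiffAt_snd.sub hQ
  have hn' : (n : WithTop ℕ∞) ≠ 0 := by exact_mod_cast hn
  have hQd : HasFDerivAt Q (fderiv 𝕜 Q (l₀, v l₀)) (l₀, v l₀) :=
    (hQ.differentiableAt hn').hasFDerivAt
  have hQz : HasFDerivAt (fun z => Q (l₀, z))
      ((fderiv 𝕜 Q (l₀, v l₀)).comp (ContinuousLinearMap.inr 𝕜 Λ Z)) (v l₀) :=
    HasFDerivAt.comp (f := fun z => (l₀, z)) _ hQd (hasFDerivAt_prodMk_right _ _)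
  -- The Lipschitz constant bounds the partial derivative of `Q` by `1/2`, so the derivative of `z -
  -- Q(l,z)` in `z` is invertible by the Neumann series.
  have hnorm : ‖(fderiv 𝕜 Q (l₀, v l₀)).comp (ContinuousLinearMap.inr 𝕜 Λ Z)‖ ≤ 1 / 2 := by
    rw [← hQz.fderiv]
    exact norm_fderiv_le_of_lip' 𝕜 (by norm_num) hlip₀
  have hfd : fderiv 𝕜 f (l₀, v l₀) ∘SL ContinuousLinearMap.inr 𝕜 Λ Z =
      ContinuousLinearMap.id 𝕜 Z -
        (fderiv 𝕜 Q (l₀, v l₀)).comp (ContinuousLinearMap.inr 𝕜 Λ Z) := by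
    have h1 : HasFDerivAt f (ContinuousLinearMap.snd 𝕜 Λ Z - fderiv 𝕜 Q (l₀, v l₀)) (l₀, v l₀) :=
      hasFDerivAt_snd.sub hQd
    rw [h1.fderiv]
    ext z
    simp
  have hinv : (fderiv 𝕜 f (l₀, v l₀) ∘SL ContinuousLinearMap.inr 𝕜 Λ Z).IsInvertible := by
    rw [hfd]
    exact isInvertible_one_sub (hnorm.trans_lt (by norm_num))
  refine (hf.contDiffAt_implicitFunction hn' hinv).congr_of_eventuallyEq ?_
  -- The implicit function gives all solutions near `(l₀, v l₀)` only. Continuity of `v` puts `(l, v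
  -- l)` in that neighbourhood, so the two functions coincide.
  have h1 := hf.eventually_apply_eq_iff_implicitFunction hn' hinv
  have h2 : Tendsto (fun l => (l, v l)) (𝓝 l₀) (𝓝 (l₀, v l₀)) :=
    tendsto_id.prodMk_nhds hcont
  have h0 : f (l₀, v l₀) = 0 := by
    change v l₀ - Q (l₀, v l₀) = 0
    rw [← hfix.self_of_nhds, sub_self]
  filter_upwards [h2.eventually h1, hfix] with l hl hl'
  refine (hl.1 ?_).symm
  rw [h0]
  change v l - Q (l, v l) = 0
  rw [← hl', sub_self]

variable {H Z : Type*} [NormedAddCommGroup H] [NormedSpace ℂ H] [NormedAddCommGroup Z]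
  [NormedSpace ℂ Z]

/-- The solution `z` of the linear equation `z = α + β(η,z)`. -/
noncomputable def linSolve (β : H →L[ℂ] Z →L[ℂ] Z) (y : H × Z) : Z :=
  Ring.inverse (1 - β y.1) y.2

variable [CompleteSpace Z] (β : H →L[ℂ] Z →L[ℂ] Z)

theorem contDiffOn_linSolve (n : ℕ) :
    ContDiffOn ℂ n (linSolve β) {y : H × Z | ‖β y.1‖ < 1} := by
  intro y hy
  refine ContDiffAt.contDiffWithinAt ?_
  have h1 : ContDiffAt ℂ n (Ring.inverse : (Z →L[ℂ] Z) → (Z →L[ℂ] Z)) (1 - β y.1) :=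
    contDiffAt_ringInverse ℂ (Units.oneSub (β y.1) hy)
  have h2 : ContDiffAt ℂ n (fun y : H × Z => 1 - β y.1) y := by fun_prop
  exact (h1.comp y h2).clm_apply contDiffAt_snd

theorem linSolve_eq {η : H} (hη : ‖β η‖ < 1) (α : Z) :
    linSolve β (η, α) = α + β η (linSolve β (η, α)) := by
  have h1 : (1 - β η) * Ring.inverse (1 - β η) = 1 :=
    Ring.mul_inverse_cancel _ (Units.oneSub (β η) hη).isUnit
  have h2 := DFunLike.congr_fun h1 α
  change linSolve β (η, α) - β η (linSolve β (η, α)) = α at h2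
  rwa [sub_eq_iff_eq_add] at h2

end FixedPoint

/-! ## Flows -/

section Flow

open Filter Topology Metric

/-- A Banach space `𝓜` of operators of `E`, closed under products. -/
structure OpAlg (E 𝓜 : Type*) [NormedAddCommGroup E] [NormedSpace ℂ E] [NormedAddCommGroup 𝓜]
    [NormedSpace ℂ 𝓜] where
  /-- The action on `E`. -/
  act : 𝓜 →L[ℂ] E →L[ℂ] E
  /-- The product. -/
  mul : 𝓜 →L[ℂ] 𝓜 →L[ℂ] 𝓜
  norm_act_le : ∀ A x, ‖act A x‖ ≤ ‖A‖ * ‖x‖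
  norm_mul_le : ∀ A B, ‖mul A B‖ ≤ ‖A‖ * ‖B‖
  act_mul : ∀ A B x, act (mul A B) x = act A (act B x)

variable {E 𝓜 : Type} [NormedAddCommGroup E] [NormedSpace ℂ E] [NormedAddCommGroup 𝓜]
  [NormedSpace ℂ 𝓜] {p : ℕ}

/-- A vector field, together with its derivative, which takes values in `𝓜`. -/
structure OpField (𝒜 : OpAlg E 𝓜) (s : ℕ) (U : Set E) (D : Set (Par p)) (ε : ℝ)
    (X : E → Par p → E) (h : E → Par p → 𝓜) : Prop where
  field : HolFamBdd s U D ε X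
  deriv : HolFamBdd s U D ε h
  hasFDerivAt : ∀ x ∈ U, ∀ ρ ∈ D, HasFDerivAt (fun x => X x ρ) (𝒜.act (h x ρ)) x

variable {𝒜 : OpAlg E 𝓜} {s : ℕ} {U : Set E} {D : Set (Par p)} {ε : ℝ}
  {X : E → Par p → E} {h : E → Par p → 𝓜}

theorem HolFamBdd.norm_le {G : Type*} [NormedAddCommGroup G] [NormedSpace ℂ G]
    {F : E → Par p → G} {B : ℝ} (hF : HolFamBdd s U D B F) {x : E} (hx : x ∈ U) {ρ : Par p}
    (hρ : ρ ∈ D) : ‖F x ρ‖ ≤ B := by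
  simpa [pderiv_zero] using hF.bound 0 (Nat.zero_le _) Fin.elim0 x hx ρ hρ

theorem HolFam.continuousOn_left {G : Type*} [NormedAddCommGroup G] [NormedSpace ℂ G]
    {F : E → Par p → G} (hF : HolFam s U D F) {ρ : Par p}
    (hρ : ρ ∈ D) : ContinuousOn (fun x => F x ρ) U :=
  (hF.hol ρ hρ).continuousOn

theorem OpField.norm_act_le (hX : OpField 𝒜 s U D ε X h) {x : E} (hx : x ∈ U) {ρ : Par p}
    (hρ : ρ ∈ D) : ‖𝒜.act (h x ρ)‖ ≤ ε := by
  have h1 := hX.deriv.norm_le hx hρ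
  refine ContinuousLinearMap.opNorm_le_bound _ ((norm_nonneg _).trans h1) fun v => ?_
  refine (𝒜.norm_act_le _ _).trans ?_
  gcongr

theorem OpField.lipschitz (hX : OpField 𝒜 s U D ε X h) (hU : Convex ℝ U) {x y : E} (hx : x ∈ U)
    (hy : y ∈ U) {ρ : Par p} (hρ : ρ ∈ D) : ‖X y ρ - X x ρ‖ ≤ ε * ‖y - x‖ :=
  hU.norm_image_sub_le_of_norm_hasFDerivWithin_le (𝕜 := ℂ) (f := fun x => X x ρ)
    (fun z hz => (hX.hasFDerivAt z hz ρ hρ).hasFDerivWithinAt)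
    (fun _ hz => hX.norm_act_le hz hρ) hx hy

theorem OpField.lipschitz_nem (hX : OpField 𝒜 s U D ε X h) (hU : Convex ℝ U) (hε : 0 ≤ ε)
    {u v : C(TI, E)}
    (hu : u ∈ curvesIn TI U) (hv : v ∈ curvesIn TI U) {ρ : Par p} (hρ : ρ ∈ D) :
    ‖nem (fun x => X x ρ) u - nem (fun x => X x ρ) v‖ ≤ ε * ‖u - v‖ := by
  have hc := hX.field.toHolFam.continuousOn_left hρ
  rw [ContinuousMap.norm_le _ (by positivity)]
  intro t
  rw [ContinuousMap.sub_apply, nem_apply hc hu, nem_apply hc hv]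
  refine (hX.lipschitz hU (hv t) (hu t) hρ).trans ?_
  gcongr
  exact (u - v).norm_coe_le_norm t

variable [CompleteSpace E]

/-- The integral equation of the flow of `-X(·,ρ)`. -/
def IsFlowCurve (U : Set E) (X : E → Par p → E) (x : E) (ρ : Par p) (u : C(TI, E)) : Prop :=
  u ∈ curvesIn TI U ∧ u = constL ℂ TI x - primL (nem (fun x => X x ρ) u)

/-- Times are bounded by `1` and the Lipschitz constant by `1/2`, hence two solutions satisfy `‖u -
v‖ ≤ ‖u - v‖ / 2`. -/
theorem OpField.flow_unique (hX : OpField 𝒜 s U D ε X h) (hU : Convex ℝ U) (hε : 0 ≤ ε)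
    (hε1 : ε ≤ 1 / 2) {ρ : Par p} (hρ : ρ ∈ D) {x : E} {u v : C(TI, E)}
    (hu : IsFlowCurve U X x ρ u) (hv : IsFlowCurve U X x ρ v) : u = v := by
  have h1 : ‖u - v‖ ≤ ε * ‖u - v‖ := by
    calc ‖u - v‖ = ‖primL (nem (fun x => X x ρ) v - nem (fun x => X x ρ) u)‖ := by
          conv_lhs => rw [hu.2, hv.2]
          rw [map_sub]; congr 1; abel
      _ ≤ ‖nem (fun x => X x ρ) v - nem (fun x => X x ρ) u‖ := norm_primL_apply_le _
      _ ≤ ε * ‖v - u‖ := hX.lipschitz_nem hU hε hv.1 hu.1 hρ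
      _ = ε * ‖u - v‖ := by rw [norm_sub_rev]
  have h2 : ‖u - v‖ = 0 := by nlinarith [norm_nonneg (u - v)]
  exact sub_eq_zero.1 (norm_eq_zero.1 h2)

/-- Contraction on the curves which stay in the ball of radius `ε` about `x` and satisfy the
constraints `φ i = 0`. These form a closed set, mapped to itself because `‖X‖ ≤ ε`, `|t| ≤ 1`, and
primitives commute with `φ i`. The constraints later express reality; an empty family gives plain
existence. -/
theorem OpField.flow_exists (hX : OpField 𝒜 s U D ε X h) (hU : Convex ℝ U) (hε : 0 ≤ ε)
    (hε1 : ε ≤ 1 / 2) {ρ : Par p} (hρ : ρ ∈ D) {x : E} (hxU : closedBall x ε ⊆ U)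
    {ι : Type*} (φ : ι → E →L[ℝ] ℂ) (hx : ∀ i, φ i x = 0)
    (hφ : ∀ y ∈ U, (∀ i, φ i y = 0) → ∀ i, φ i (X y ρ) = 0) :
    ∃ u, IsFlowCurve U X x ρ u ∧ (∀ t, ‖u t - x‖ ≤ ε) ∧ ∀ t i, φ i (u t) = 0 := by
  let T : C(TI, E) → C(TI, E) := fun u => constL ℂ TI x - primL (nem (fun x => X x ρ) u)
  let S : Set C(TI, E) := {u | ∀ t, u t ∈ closedBall x ε ∩ {y | ∀ i, φ i y = 0}}
  have hc := hX.field.toHolFam.continuousOn_left hρ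
  have hSU : S ⊆ curvesIn TI U := fun u hu t => hxU (hu t).1
  have hclosed : IsClosed (closedBall x ε ∩ {y | ∀ i, φ i y = 0}) := by
    refine isClosed_closedBall.inter ?_
    simp only [ofPred_forall]
    exact isClosed_iInter fun i => isClosed_eq (φ i).continuous continuous_const
  have hS : IsClosed S := by
    have h1 : S = ⋂ t, (fun u : C(TI, E) => u t) ⁻¹' (closedBall x ε ∩ {y | ∀ i, φ i y = 0}) := by
      ext u; simp [S]
    rw [h1]
    exact isClosed_iInter fun t => hclosed.preimage (ContinuousEvalConst.continuous_eval_const t)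
  have hmaps : MapsTo T S S := by
    intro u hu t
    refine ⟨?_, fun i => ?_⟩
    · rw [mem_closedBall, dist_eq_norm]
      have h1 : T u t - x = -(primL (nem (fun x => X x ρ) u) t) := by simp [T]
      rw [h1, norm_neg]
      refine (ContinuousMap.norm_coe_le_norm _ t).trans ((norm_primL_apply_le _).trans ?_)
      rw [ContinuousMap.norm_le _ hε]
      intro t
      rw [nem_apply hc (hSU hu)]
      exact hX.field.norm_le (hSU hu t) hρ
    · have h1 := map_primL (φ i) (nem (fun x => X x ρ) u) 0 (fun t => by
        rw [nem_apply hc (hSU hu), hφ _ (hSU hu t) (hu t).2]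
        rfl) t
      rw [map_zero] at h1
      simp only [T, ContinuousMap.sub_apply, constL_apply, map_sub, hx, ← h1]
      simp
  have hx0 : constL ℂ TI x ∈ S := fun t => ⟨by simpa using hε, fun i => by simpa using hx i⟩
  have hcontr : ContractingWith (1 / 2) (hmaps.restrict T S S) := by
    refine ⟨by norm_num, LipschitzWith.of_dist_le_mul fun u v => ?_⟩
    rw [Subtype.dist_eq, Subtype.dist_eq, dist_eq_norm, dist_eq_norm]
    change ‖T u.1 - T v.1‖ ≤ _
    have h1 : T u.1 - T v.1 = primL (nem (fun x => X x ρ) v.1 - nem (fun x => X x ρ) u.1) := by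
      simp only [T, map_sub]; abel
    rw [h1, norm_sub_rev u.1]
    refine (norm_primL_apply_le _).trans
      ((hX.lipschitz_nem hU hε (hSU v.2) (hSU u.2) hρ).trans ?_)
    gcongr
    simpa using hε1
  obtain ⟨u, huS, hu, -⟩ := hcontr.exists_fixedPoint' hS.isComplete hmaps hx0 (edist_ne_top _ _)
  refine ⟨u, ⟨hSU huS, hu.symm⟩, fun t => ?_, fun t => (huS t).2⟩
  have := (huS t).1
  rwa [mem_closedBall, dist_eq_norm] at this

/-- The fixed point theorem is used twice: over `ℝ` jointly in `(x, ρ)` for the class `C^s`, and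
over `ℂ` in `x` alone for holomorphy. -/
theorem OpField.holFam_flow (hX : OpField 𝒜 s U D ε X h) (hs : 1 ≤ s) (hUo : IsOpen U)
    (hD : IsOpen D) (hU : Convex ℝ U) (hε : 0 ≤ ε)
    (hε1 : ε ≤ 1 / 2) {T : Set E} (hT : IsOpen T) {u : E → Par p → C(TI, E)}
    (hu : ∀ x ∈ T, ∀ ρ ∈ D, IsFlowCurve U X x ρ (u x ρ)) : HolFam s T D u := by
  have hN := hX.field.toHolFam.nem (K := TI) hs hUo hD
  have hlip : ∀ x, ∀ ρ ∈ D, ∀ v ∈ curvesIn TI U, ∀ v' ∈ curvesIn TI U,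
      ‖(constL ℂ TI x - primL (nem (fun x => X x ρ) v)) -
        (constL ℂ TI x - primL (nem (fun x => X x ρ) v'))‖ ≤ 1 / 2 * ‖v - v'‖ := by
    intro x ρ hρ v hv v' hv'
    have h1 : (constL ℂ TI x - primL (nem (fun x => X x ρ) v)) -
        (constL ℂ TI x - primL (nem (fun x => X x ρ) v')) =
        primL (nem (fun x => X x ρ) v' - nem (fun x => X x ρ) v) := by
      rw [map_sub]; abel
    rw [h1, norm_sub_rev v]
    refine (norm_primL_apply_le _).trans ((hX.lipschitz_nem hU hε hv' hv hρ).trans ?_)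
    gcongr
  refine ⟨fun y hy => ContDiffAt.contDiffWithinAt ?_, fun ρ hρ x hx =>
    DifferentiableAt.differentiableWithinAt ?_⟩
  · let Q : (E × Par p) × C(TI, E) → C(TI, E) := fun q =>
      constL ℂ TI q.1.1 - primL (nem (fun x => X x q.1.2) q.2)
    refine contDiffAt_fixedPoint (𝕜 := ℝ) (Q := Q) (v := fun y : E × Par p => u y.1 y.2)
      (by omega) ?_ ?_ ?_ ?_
    · have h1 : ContDiffAt ℝ s (fun q : (E × Par p) × C(TI, E) => nem (fun x => X x q.1.2) q.2)
          (y, u y.1 y.2) :=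
        ContDiffAt.comp (f := fun q : (E × Par p) × C(TI, E) => (q.2, q.1.2)) _
          (hN.contDiffAt (isOpen_curvesIn hUo) hD (hu _ hy.1 _ hy.2).1 hy.2) (by fun_prop)
      exact ContDiffAt.sub (((constL ℂ TI).restrictScalars ℝ).contDiff.contDiffAt.comp _
        (by fun_prop : ContDiffAt ℝ s (fun q : (E × Par p) × C(TI, E) => q.1.1) _))
        ((primL.restrictScalars ℝ).contDiff.contDiffAt.comp _ h1)
    · filter_upwards [(hT.prod hD).mem_nhds hy] with y hy
      exact (hu _ hy.1 _ hy.2).2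
    · filter_upwards [(hT.prod hD).mem_nhds hy] with y' hy'
      exact hlip _ _ hy'.2 _ (hu _ hy'.1 _ hy'.2).1 _ (hu _ hy.1 _ hy.2).1
    · filter_upwards [(isOpen_curvesIn hUo).mem_nhds (hu _ hy.1 _ hy.2).1] with v hv
      exact hlip _ _ hy.2 _ hv _ (hu _ hy.1 _ hy.2).1
  · let Q : E × C(TI, E) → C(TI, E) := fun q => constL ℂ TI q.1 - primL (nem (fun x => X x ρ) q.2)
    refine (contDiffAt_fixedPoint (𝕜 := ℂ) (n := 1) (Q := Q) (v := fun x => u x ρ)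
      one_ne_zero ?_ ?_ ?_ ?_).differentiableAt (by simp)
    · have h0 : ContDiffOn ℂ 1 (nem (fun x => X x ρ)) (curvesIn TI U) :=
        contDiffOn_complex_one (isOpen_curvesIn hUo)
          ((hN.contDiffOn_left hρ).of_le (by exact_mod_cast hs)) (hN.hol ρ hρ)
      have h1 : ContDiffAt ℂ 1 (fun q : E × C(TI, E) => nem (fun x => X x ρ) q.2) (x, u x ρ) :=
        ContDiffAt.comp (f := fun q : E × C(TI, E) => q.2) _
          (h0.contDiffAt ((isOpen_curvesIn hUo).mem_nhds (hu _ hx _ hρ).1)) (by fun_prop)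
      rw [Nat.cast_one]
      have e1 : ContDiffAt ℂ 1 (fun q : E × C(TI, E) => constL ℂ TI q.1) (x, u x ρ) :=
        ((constL ℂ TI).comp (ContinuousLinearMap.fst ℂ E C(TI, E))).contDiff.contDiffAt
      have e2 : ContDiffAt ℂ 1 (fun q : E × C(TI, E) => primL (nem (fun x => X x ρ) q.2))
          (x, u x ρ) := (primL (E := E)).contDiff.contDiffAt.comp (x, u x ρ) h1
      exact e1.sub e2
    · filter_upwards [hT.mem_nhds hx] with y hy
      exact (hu _ hy _ hρ).2
    · filter_upwards [hT.mem_nhds hx] with y hy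
      exact hlip _ _ hρ _ (hu _ hy _ hρ).1 _ (hu _ hx _ hρ).1
    · filter_upwards [(isOpen_curvesIn hUo).mem_nhds (hu _ hx _ hρ).1] with v hv
      exact hlip _ _ hρ _ hv _ (hu _ hx _ hρ).1

end Flow

/-! ## The derivative of the flow -/

section FlowDerivative

open Filter Topology Metric

/-- The constant in the bound of the derivatives of compositions. -/
noncomputable def compC (p s : ℕ) : ℝ := s.factorial * ∑ i ∈ Finset.range (s + 1), jointC p i

theorem one_le_compC (p s : ℕ) : 1 ≤ compC p s := by
  have h1 : (1 : ℝ) ≤ s.factorial := by exact_mod_cast Nat.one_le_iff_ne_zero.2 s.factorial_ne_zero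
  have h2 : (1 : ℝ) ≤ ∑ i ∈ Finset.range (s + 1), jointC p i :=
    Finset.single_le_sum (f := jointC p) (fun j _ => jointC_nonneg p j)
      (Finset.mem_range.2 (Nat.succ_pos s))
  unfold compC
  nlinarith

theorem compC_mono (p : ℕ) {n s : ℕ} (h : n ≤ s) : compC p n ≤ compC p s := by
  unfold compC
  have h1 : ∑ i ∈ Finset.range (n + 1), jointC p i ≤ ∑ i ∈ Finset.range (s + 1), jointC p i :=
    Finset.sum_le_sum_of_subset_of_nonneg (Finset.range_mono (by omega))
      fun i _ _ => jointC_nonneg p i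
  have h2 : (n.factorial : ℝ) ≤ s.factorial := by exact_mod_cast Nat.factorial_le h
  have h3 : 0 ≤ ∑ i ∈ Finset.range (n + 1), jointC p i :=
    Finset.sum_nonneg fun i _ => jointC_nonneg p i
  gcongr

theorem HolFam.prodMk {E F G P : Type*} [NormedAddCommGroup E] [NormedSpace ℂ E]
    [NormedAddCommGroup F] [NormedSpace ℂ F] [NormedAddCommGroup G] [NormedSpace ℂ G]
    [NormedAddCommGroup P] [NormedSpace ℝ P] {n : ℕ} {U : Set E} {D : Set P}
    {f : E → P → F} {g : E → P → G} (hf : HolFam n U D f)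
    (hg : HolFam n U D g) : HolFam n U D (fun x ρ => (f x ρ, g x ρ)) :=
  ⟨hf.contDiffOn.prodMk hg.contDiffOn, fun ρ hρ => (hf.hol ρ hρ).prodMk (hg.hol ρ hρ)⟩

variable {E 𝓜 : Type} [NormedAddCommGroup E] [NormedSpace ℂ E] [NormedAddCommGroup 𝓜]
  [NormedSpace ℂ 𝓜] {p : ℕ} {s : ℕ} {U T : Set E} {D : Set (Par p)} {ε δ : ℝ}

/-- The case `Q = 1` of the composition bound: derivatives of `y` not exceeding the available radius
`δ` cost only the constant `compC`. -/
theorem DerivBdd.of_comp {G : Type*} [NormedAddCommGroup G] [NormedSpace ℂ G] [CompleteSpace G]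
    {F : E → Par p → G} {B : ℝ} (hF : HolFamBdd s U D B F) (hD : IsOpen D)
    (hδ : 0 < δ) {y : Par p → E} (hy : ContDiffOn ℝ s y D) (hball : ∀ ρ ∈ D, ball (y ρ) δ ⊆ U)
    (hb : ∀ i, 1 ≤ i → i ≤ s → ∀ ρ ∈ D, ‖iteratedFDeriv ℝ i y ρ‖ ≤ δ) :
    DerivBdd s D (compC p s * B) (fun ρ => F (y ρ) ρ) := by
  refine ⟨hF.contDiffOn.comp (f := fun ρ => (y ρ, ρ)) (hy.prodMk contDiffOn_id)
    fun ρ hρ => ⟨hball ρ hρ (mem_ball_self hδ), hρ⟩, fun n hn ρ hρ => ?_⟩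
  have hB : 0 ≤ B := (norm_nonneg _).trans (hF.norm_le (hball ρ hρ (mem_ball_self hδ)) hρ)
  have h1 := HolFamBdd.norm_iteratedFDeriv_comp_le (Q := 1) hD hδ hB le_rfl hρ
    (hF.mono hn (hball ρ hρ) le_rfl) (hy.of_le (by exact_mod_cast hn)) (fun i hi hin => by
      rw [one_pow, mul_one]; exact hb i hi (hin.trans hn) ρ hρ)
  refine h1.trans ?_
  rw [one_pow, mul_one, ← mul_assoc]
  exact mul_le_mul_of_nonneg_right (compC_mono p hn) hB

theorem HolFamBdd.of_derivBdd {G : Type*} [NormedAddCommGroup G] [NormedSpace ℂ G]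
    {F : E → Par p → G} {B : ℝ} (hF : HolFam s U D F) (h : ∀ x ∈ U, DerivBdd s D B (F x)) :
    HolFamBdd s U D B F :=
  ⟨hF, fun i hi k x hx ρ hρ => (norm_pderiv_le k _ _).trans ((h x hx).bound i hi ρ hρ)⟩

variable {𝒜 : OpAlg E 𝓜} {X : E → Par p → E} {h : E → Par p → 𝓜}

theorem OpField.norm_nem_deriv_le (hX : OpField 𝒜 s U D ε X h) (hε : 0 ≤ ε) {u : C(TI, E)}
    (hu : u ∈ curvesIn TI U) {ρ : Par p} (hρ : ρ ∈ D) : ‖nem (fun x => h x ρ) u‖ ≤ ε := by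
  rw [ContinuousMap.norm_le _ hε]
  intro t
  rw [nem_apply (hX.deriv.toHolFam.continuousOn_left hρ) hu]
  exact hX.deriv.norm_le (hu t) hρ

variable (𝒜) [CompleteSpace 𝓜]

/-- The bilinear map `(η,z) ↦ -∫ ηz`. -/
noncomputable def OpAlg.negPrimMul : C(TI, 𝓜) →L[ℂ] C(TI, 𝓜) →L[ℂ] C(TI, 𝓜) :=
  (ContinuousLinearMap.compL ℂ C(TI, 𝓜) C(TI, 𝓜) C(TI, 𝓜) (-primL)).comp (ptBilin TI 𝒜.mul)

theorem OpAlg.negPrimMul_apply (η z : C(TI, 𝓜)) :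
    𝒜.negPrimMul η z = -primL (ptBilin TI 𝒜.mul η z) := rfl

theorem norm_ptBilin_le {E₁ E₂ G K : Type*} [NormedAddCommGroup E₁] [NormedSpace ℂ E₁]
    [NormedAddCommGroup E₂] [NormedSpace ℂ E₂] [NormedAddCommGroup G] [NormedSpace ℂ G]
    [TopologicalSpace K] [CompactSpace K]
    {β : E₁ →L[ℂ] E₂ →L[ℂ] G} (hβ : ∀ x y, ‖β x y‖ ≤ ‖x‖ * ‖y‖) (u : C(K, E₁)) (v : C(K, E₂)) :
    ‖ptBilin K β u v‖ ≤ ‖u‖ * ‖v‖ := by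
  rw [ContinuousMap.norm_le _ (by positivity)]
  intro t
  refine (hβ _ _).trans ?_
  gcongr
  · exact u.norm_coe_le_norm t
  · exact v.norm_coe_le_norm t

theorem OpAlg.norm_negPrimMul_le (η z : C(TI, 𝓜)) : ‖𝒜.negPrimMul η z‖ ≤ ‖η‖ * ‖z‖ := by
  rw [𝒜.negPrimMul_apply, norm_neg]
  exact (norm_primL_apply_le _).trans (norm_ptBilin_le 𝒜.norm_mul_le η z)

theorem norm_le_of_bilinear_le {E₁ E₂ G : Type*} [NormedAddCommGroup E₁] [NormedSpace ℂ E₁]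
    [NormedAddCommGroup E₂] [NormedSpace ℂ E₂] [NormedAddCommGroup G] [NormedSpace ℂ G]
    {β : E₁ →L[ℂ] E₂ →L[ℂ] G} (hβ : ∀ x y, ‖β x y‖ ≤ ‖x‖ * ‖y‖) (x : E₁) : ‖β x‖ ≤ ‖x‖ :=
  ContinuousLinearMap.opNorm_le_bound _ (norm_nonneg _) (hβ x)

/-- The solution of `a' = -η(1 + a)`, `a(0) = 0`. -/
noncomputable def OpAlg.propagator (η : C(TI, 𝓜)) : C(TI, 𝓜) :=
  linSolve 𝒜.negPrimMul (η, -primL η)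

theorem OpAlg.propagator_eq {η : C(TI, 𝓜)} (hη : ‖η‖ ≤ 1 / 2) :
    𝒜.propagator η = -primL η + 𝒜.negPrimMul η (𝒜.propagator η) :=
  linSolve_eq _ (((norm_le_of_bilinear_le 𝒜.norm_negPrimMul_le η).trans hη).trans_lt
    (by norm_num)) _

variable {𝒜}

variable [CompleteSpace E]

-- The propagator is obtained from `η` by inverting `1 - β(η)`, a complex-smooth operation on the
-- region `‖β(η)‖ < 1`; it therefore inherits the regularity of `η`.
omit [CompleteSpace E] in
theorem OpField.holFam_propagator (hX : OpField 𝒜 s U D ε X h) (hs : 1 ≤ s) (hUo : IsOpen U)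
    (hD : IsOpen D) (hε : 0 ≤ ε) (hε1 : ε ≤ 1 / 2) {u : E → Par p → C(TI, E)}
    (huf : HolFam s T D u) (hu : ∀ x ∈ T, ∀ ρ ∈ D, u x ρ ∈ curvesIn TI U) :
    HolFam s T D (fun x ρ => nem (fun x => h x ρ) (u x ρ)) ∧
    HolFam s T D (fun x ρ => 𝒜.propagator (nem (fun x => h x ρ) (u x ρ))) := by
  have h1 : HolFam s T D (fun x ρ => nem (fun x => h x ρ) (u x ρ)) :=
    (hX.deriv.toHolFam.nem hs hUo hD).comp huf hu
  refine ⟨h1, HolFam.comp_left (f := linSolve 𝒜.negPrimMul) (contDiffOn_linSolve 𝒜.negPrimMul _)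
    (y := fun x ρ => (nem (fun x => h x ρ) (u x ρ), -primL (nem (fun x => h x ρ) (u x ρ))))
    (h1.prodMk (h1.clm primL).neg) fun x hx ρ hρ => ?_⟩
  refine (norm_le_of_bilinear_le 𝒜.norm_negPrimMul_le _).trans_lt ?_
  exact (hX.norm_nem_deriv_le hε (hu x hx ρ hρ) hρ).trans_lt (by linarith)

/-- The derivative of the flow in the initial point. -/
theorem OpField.hasFDerivAt_flow (hX : OpField 𝒜 s U D ε X h) (hUo : IsOpen U)
    (hε : 0 ≤ ε) (hε1 : ε ≤ 1 / 2) (hT : IsOpen T)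
    {u : E → Par p → C(TI, E)} (huf : HolFam s T D u)
    (hu : ∀ x ∈ T, ∀ ρ ∈ D, IsFlowCurve U X x ρ (u x ρ)) {x : E} (hx : x ∈ T) {ρ : Par p}
    (hρ : ρ ∈ D) (t : TI) :
    HasFDerivAt (fun x => u x ρ t) (ContinuousLinearMap.id ℂ E +
      𝒜.act (𝒜.propagator (nem (fun x => h x ρ) (u x ρ)) t)) x := by
  set η := nem (fun x => h x ρ) (u x ρ) with hη
  have hc := hX.deriv.toHolFam.continuousOn_left hρ
  have hηn : ‖η‖ ≤ ε := hX.norm_nem_deriv_le hε (hu x hx ρ hρ).1 hρ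
  have hL := (huf.differentiableAt hT hx hρ).hasFDerivAt
  set L := fderiv ℂ (fun x => u x ρ) x with hLdef
  have hactc : ContinuousOn (fun y => 𝒜.act (h y ρ)) U := 𝒜.act.continuous.comp_continuousOn hc
  have hN := hasFDerivAt_nem (𝕜 := ℂ) (F := fun x => X x ρ) (F' := fun x => 𝒜.act (h x ρ)) hUo
    (fun y hy => hX.hasFDerivAt y hy ρ hρ) hactc (hu x hx ρ hρ).1
  -- Differentiate the integral equation: `L ζ = ζ - ∫ η (L ζ)`.
  have hR : HasFDerivAt (fun x => u x ρ) (constL ℂ TI - primL.comp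
      ((ptBilin TI (ContinuousLinearMap.id ℂ (E →L[ℂ] E)) (nem (fun x => 𝒜.act (h x ρ)) (u x ρ))).comp
        L)) x := by
    have h1 : HasFDerivAt (fun x' => constL ℂ TI x' - primL (nem (fun x => X x ρ) (u x' ρ)))
        (constL ℂ TI - primL.comp ((ptBilin TI (ContinuousLinearMap.id ℂ (E →L[ℂ] E))
          (nem (fun x => 𝒜.act (h x ρ)) (u x ρ))).comp L)) x :=
      (constL ℂ TI).hasFDerivAt.sub (primL.hasFDerivAt.comp x (hN.comp x hL))
    refine h1.congr_of_eventuallyEq ?_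
    filter_upwards [hT.mem_nhds hx] with y hy
    exact (hu y hy ρ hρ).2
  have hLe := hL.unique hR
  have hpt : ∀ v : C(TI, E), ptBilin TI (ContinuousLinearMap.id ℂ (E →L[ℂ] E))
      (nem (fun x => 𝒜.act (h x ρ)) (u x ρ)) v = ptBilin TI 𝒜.act η v := by
    intro v
    ext t
    simp only [ptBilin_apply, hη, nem_apply hc (hu x hx ρ hρ).1, nem_apply hactc (hu x hx ρ hρ).1]
    rfl
  -- `L ζ` and `ζ + a ζ` solve the same linear integral equation, and its integral operator has norm
  -- at most `ε ≤ 1/2`. The gain is that `a` was built inside `𝓜`, while `L` is a priori only a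
  -- bounded operator.
  have key : ∀ ζ : E, L ζ = constL ℂ TI ζ + ptBilin TI 𝒜.act (𝒜.propagator η) (constL ℂ TI ζ) := by
    intro ζ
    set m := constL ℂ TI ζ + ptBilin TI 𝒜.act (𝒜.propagator η) (constL ℂ TI ζ) with hm
    have h1 : L ζ = constL ℂ TI ζ - primL (ptBilin TI 𝒜.act η (L ζ)) := by
      conv_lhs => rw [hLe]
      simp only [_root_.sub_apply, ContinuousLinearMap.comp_apply, hpt]
    have h2 : m = constL ℂ TI ζ - primL (ptBilin TI 𝒜.act η m) := by
      have h3 := 𝒜.propagator_eq (hηn.trans hε1)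
      rw [𝒜.negPrimMul_apply, ← neg_add, ← map_add] at h3
      have h4 : ∀ v : C(TI, 𝓜), ptBilin TI 𝒜.act (primL v) (constL ℂ TI ζ) =
          primL (ptBilin TI 𝒜.act v (constL ℂ TI ζ)) := by
        intro v
        ext t
        exact (map_primL ((𝒜.act.flip ζ).restrictScalars ℝ) v _ (fun t => rfl) t).symm
      have h5 : ptBilin TI 𝒜.act (η + ptBilin TI 𝒜.mul η (𝒜.propagator η)) (constL ℂ TI ζ) =
          ptBilin TI 𝒜.act η m := by
        ext t
        simp [hm, 𝒜.act_mul]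
      calc m = constL ℂ TI ζ + ptBilin TI 𝒜.act (-primL (η + ptBilin TI 𝒜.mul η
              (𝒜.propagator η))) (constL ℂ TI ζ) := by rw [← h3]
        _ = _ := by
            rw [map_neg, _root_.neg_apply, h4, h5, sub_eq_add_neg]
    have h6 : ‖L ζ - m‖ ≤ ε * ‖L ζ - m‖ := by
      calc ‖L ζ - m‖ = ‖primL (ptBilin TI 𝒜.act η (m - L ζ))‖ := by
            conv_lhs => rw [h1, h2]
            rw [map_sub, map_sub]; congr 1; abel
        _ ≤ ‖η‖ * ‖m - L ζ‖ := (norm_primL_apply_le _).trans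
            (norm_ptBilin_le 𝒜.norm_act_le η _)
        _ ≤ ε * ‖m - L ζ‖ := by gcongr
        _ = ε * ‖L ζ - m‖ := by rw [norm_sub_rev]
    have h7 : ‖L ζ - m‖ = 0 := by nlinarith [norm_nonneg (L ζ - m)]
    exact sub_eq_zero.1 (norm_eq_zero.1 h7)
  have h8 : HasFDerivAt (fun x => u x ρ t) ((ContinuousMap.evalCLM ℂ t : C(TI, E) →L[ℂ] E).comp L)
      x := (ContinuousMap.evalCLM ℂ t : C(TI, E) →L[ℂ] E).hasFDerivAt.comp x hL
  convert h8 using 1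
  ext ζ
  have := congrArg (fun v : C(TI, E) => v t) (key ζ)
  exact this.symm

end FlowDerivative

/-! ### Estimates of the parameter derivatives of the flow -/

section FlowBounds

open Filter Topology Metric

variable {E 𝓜 : Type} [NormedAddCommGroup E] [NormedSpace ℂ E] [NormedAddCommGroup 𝓜]
  [NormedSpace ℂ 𝓜] {p : ℕ} {s : ℕ} {U T : Set E} {D : Set (Par p)} {ε δ : ℝ}
  {𝒜 : OpAlg E 𝓜} [CompleteSpace 𝓜] [CompleteSpace E] {X : E → Par p → E} {h : E → Par p → 𝓜}

omit [CompleteSpace 𝓜] in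
/-- Bounds of the parameter derivatives of the flow. -/
theorem OpField.norm_iteratedFDeriv_flow_le (hX : OpField 𝒜 s U D ε X h) (hs : 1 ≤ s)
    (hUo : IsOpen U) (hD : IsOpen D) (hε : 0 ≤ ε) (hδ : 0 < δ) (hεδ : compC p s * ε ≤ δ / 2)
    {u : E → Par p → C(TI, E)} (huf : HolFam s T D u)
    (hu : ∀ x ∈ T, ∀ ρ ∈ D, IsFlowCurve U X x ρ (u x ρ))
    (hball : ∀ x ∈ T, ∀ ρ ∈ D, ∀ t, ball (u x ρ t) δ ⊆ U) {x : E} (hx : x ∈ T) (n : ℕ) :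
    1 ≤ n → n ≤ s → ∀ ρ ∈ D, ‖iteratedFDeriv ℝ n (u x) ρ‖ ≤ compC p s * ε := by
  induction n using Nat.strong_induction_on with
  | _ n ih =>
  intro hn1 hns ρ hρ
  have hns' : (n : WithTop ℕ∞) ≤ s := by exact_mod_cast hns
  have huc : ContDiffOn ℝ s (u x) D := huf.contDiffOn_right hx
  have hua : ContDiffAt ℝ n (u x) ρ := (huc.contDiffAt (hD.mem_nhds hρ)).of_le hns'
  have hNf : HolFam s T D (fun x ρ => nem (fun x => X x ρ) (u x ρ)) :=
    (hX.field.toHolFam.nem hs hUo hD).comp huf fun x hx ρ hρ => (hu x hx ρ hρ).1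
  have hNa : ContDiffAt ℝ n (fun ρ => nem (fun x => X x ρ) (u x ρ)) ρ :=
    ((hNf.contDiffOn_right hx).contDiffAt (hD.mem_nhds hρ)).of_le hns'
  set S := ‖iteratedFDeriv ℝ n (u x) ρ‖ with hS
  -- The unknown derivative of order `n` also enters the right side. With `Q = M ^ (1/n)` the
  -- composition bound is applicable: lower orders are at most `δ ≤ δ * Q ^ i` by induction, and
  -- order `n` satisfies `S ≤ δ * M = δ * Q ^ n`. The outcome is linear in `M`.
  set M := max 1 (S / δ) with hM
  have hM1 : 1 ≤ M := le_max_left _ _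
  have hcC := one_le_compC p s
  have hQ1 : 1 ≤ M ^ ((n : ℝ)⁻¹) := Real.one_le_rpow hM1 (by positivity)
  have hQn : (M ^ ((n : ℝ)⁻¹)) ^ n = M := Real.rpow_inv_natCast_pow (by linarith) (by omega)
  have hNt : ∀ t, ‖iteratedFDeriv ℝ n (fun ρ => nem (fun x => X x ρ) (u x ρ) t) ρ‖ ≤
      compC p s * ε * M := by
    intro t
    have e1 : (fun ρ => nem (fun x => X x ρ) (u x ρ) t) =ᶠ[𝓝 ρ] fun ρ => X (u x ρ t) ρ := by
      filter_upwards [hD.mem_nhds hρ] with ρ' hρ'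
      exact nem_apply (hX.field.toHolFam.continuousOn_left hρ') (hu x hx ρ' hρ').1 t
    rw [(e1.iteratedFDeriv ℝ n).eq_of_nhds]
    have hyc : ContDiffOn ℝ n (fun ρ => u x ρ t) D :=
      ((ContinuousMap.evalCLM ℝ t : C(TI, E) →L[ℝ] E).contDiff.comp_contDiffOn huc).of_le hns'
    have h1 := HolFamBdd.norm_iteratedFDeriv_comp_le (y := fun ρ => u x ρ t)
      (Q := M ^ ((n : ℝ)⁻¹)) hD hδ hε hQ1 hρ
      (hX.field.mono hns (hball x hx ρ hρ t) le_rfl) hyc (fun i hi1 hin => by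
        have hi2 := norm_iteratedFDeriv_eval_le ((huc.contDiffAt (hD.mem_nhds hρ)).of_le
          (show (i : WithTop ℕ∞) ≤ s by exact_mod_cast hin.trans hns)) t
        rcases hin.lt_or_eq with hlt | rfl
        · calc _ ≤ δ := by linarith [ih i hlt hi1 (by omega) ρ hρ]
            _ ≤ _ := le_mul_of_one_le_right hδ.le (one_le_pow₀ hQ1)
        · rw [hQn]
          refine hi2.trans ?_
          have : S / δ ≤ M := le_max_right _ _
          rw [div_le_iff₀ hδ] at this
          linarith)
    rw [hQn, ← mul_assoc] at h1
    refine h1.trans ?_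
    have := compC_mono p hns
    unfold compC at this ⊢
    gcongr
  have hSle : S ≤ compC p s * ε * M := by
    have e1 : u x =ᶠ[𝓝 ρ] (fun _ => constL ℂ TI x) +
        ((-primL : C(TI, E) →L[ℂ] C(TI, E)).restrictScalars ℝ ∘
          fun ρ => nem (fun x => X x ρ) (u x ρ)) := by
      filter_upwards [hD.mem_nhds hρ] with ρ' hρ'
      change u x ρ' = constL ℂ TI x + -primL (nem (fun x => X x ρ') (u x ρ'))
      rw [← sub_eq_add_neg]
      exact (hu x hx ρ' hρ').2
    have h2 : ‖((-primL : C(TI, E) →L[ℂ] C(TI, E)).restrictScalars ℝ)‖ ≤ 1 :=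
      ContinuousLinearMap.opNorm_le_bound _ zero_le_one fun v => by
        rw [one_mul]
        change ‖-primL v‖ ≤ _
        rw [norm_neg]
        exact norm_primL_apply_le v
    have h3 := ((-primL : C(TI, E) →L[ℂ] C(TI, E)).restrictScalars ℝ).norm_iteratedFDeriv_comp_left
      hNa le_rfl
    have h4 : iteratedFDeriv ℝ n (fun _ : Par p => constL ℂ TI x) ρ = 0 := by
      obtain ⟨j, rfl⟩ : ∃ j, n = j + 1 := ⟨n - 1, by omega⟩
      rw [iteratedFDeriv_succ_const]
      rfl
    rw [hS, (e1.iteratedFDeriv ℝ n).eq_of_nhds, iteratedFDeriv_add_apply contDiffAt_const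
      (((-primL : C(TI, E) →L[ℂ] C(TI, E)).restrictScalars ℝ).contDiff.contDiffAt.comp ρ hNa), h4,
      zero_add]
    refine h3.trans ((mul_le_of_le_one_left (norm_nonneg _) h2).trans ?_)
    exact norm_iteratedFDeriv_curve_le hNa (by positivity) hNt
  -- If `S > δ`, then `M = S / δ` and the estimate reads `S ≤ (δ / 2) * (S / δ) = S / 2`, which is
  -- absurd. Hence `M = 1`.
  rcases le_or_gt (S / δ) 1 with hcase | hcase
  · rwa [hM, max_eq_left hcase, mul_one] at hSle
  · exfalso
    rw [hM, max_eq_right hcase.le] at hSle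
    have h5 : 0 < S / δ := by linarith
    have h6 : S = δ * (S / δ) := by field_simp
    have h7 : compC p s * ε * (S / δ) ≤ δ / 2 * (S / δ) := by gcongr
    nlinarith

/-- The parameter derivatives of the flow and of its derivative at a fixed initial point. -/
theorem OpField.derivBdd_flow (hX : OpField 𝒜 s U D ε X h) (hs : 1 ≤ s)
    (hUo : IsOpen U) (hD : IsOpen D) (hε : 0 ≤ ε) (hδ : 0 < δ) (hδ1 : δ ≤ 1)
    (hεδ : compC p s * ε ≤ δ / 2)
    {u : E → Par p → C(TI, E)} (huf : HolFam s T D u)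
    (hu : ∀ x ∈ T, ∀ ρ ∈ D, IsFlowCurve U X x ρ (u x ρ))
    (hd : ∀ x ∈ T, ∀ ρ ∈ D, ∀ t, ‖u x ρ t - x‖ ≤ ε)
    (hball : ∀ x ∈ T, ∀ ρ ∈ D, ∀ t, ball (u x ρ t) δ ⊆ U) {x : E} (hx : x ∈ T) (t : TI) :
    DerivBdd s D (compC p s * ε) (fun ρ => u x ρ t - x) ∧
    DerivBdd s D (linC s * (compC p s * ε))
      (fun ρ => 𝒜.propagator (nem (fun x => h x ρ) (u x ρ)) t) := by
  have hcC := one_le_compC p s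
  have hb := hX.norm_iteratedFDeriv_flow_le hs hUo hD hε hδ hεδ huf hu hball hx
  have huc : ContDiffOn ℝ s (u x) D := huf.contDiffOn_right hx
  have hut : ∀ t : TI, ContDiffOn ℝ s (fun ρ => u x ρ t) D := fun t =>
    (ContinuousMap.evalCLM ℝ t : C(TI, E) →L[ℝ] E).contDiff.comp_contDiffOn huc
  have hbt : ∀ t, ∀ i, 1 ≤ i → i ≤ s → ∀ ρ ∈ D,
      ‖iteratedFDeriv ℝ i (fun ρ => u x ρ t) ρ‖ ≤ compC p s * ε := fun t i hi1 his ρ hρ =>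
    (norm_iteratedFDeriv_eval_le ((huc.contDiffAt (hD.mem_nhds hρ)).of_le
      (by exact_mod_cast his)) t).trans (hb i hi1 his ρ hρ)
  -- In order zero the displacement bound is used, in positive order the bound of the derivatives of
  -- the curve, from which the constant `x` has disappeared.
  refine ⟨⟨(hut t).sub contDiffOn_const, fun n hn ρ hρ => ?_⟩, ?_⟩
  · rcases Nat.eq_zero_or_pos n with rfl | hpos
    · rw [norm_iteratedFDeriv_zero]
      refine (hd x hx ρ hρ t).trans ?_
      nlinarith
    · have h1 := iteratedFDeriv_sub_apply (𝕜 := ℝ) (i := n) (x := ρ) (f := fun ρ => u x ρ t)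
        (g := fun _ => x) (((hut t).contDiffAt (hD.mem_nhds hρ)).of_le (by exact_mod_cast hn))
        contDiffAt_const
      change ‖iteratedFDeriv ℝ n ((fun ρ => u x ρ t) - fun _ => x) ρ‖ ≤ _
      rw [h1]
      have h4 : iteratedFDeriv ℝ n (fun _ : Par p => x) ρ = 0 := by
        obtain ⟨j, rfl⟩ : ∃ j, n = j + 1 := ⟨n - 1, by omega⟩
        rw [iteratedFDeriv_succ_const]
        rfl
      rw [h4, sub_zero]
      exact hbt t n hpos hn ρ hρ
  · have hε1 : ε ≤ 1 / 2 := by nlinarith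
    obtain ⟨hη, ha⟩ := hX.holFam_propagator hs hUo hD hε hε1 huf fun x hx ρ hρ => (hu x hx ρ hρ).1
    have hηb : DerivBdd s D (compC p s * ε) (fun ρ => nem (fun x => h x ρ) (u x ρ)) := by
      refine DerivBdd.of_eval (by positivity) (hη.contDiffOn_right hx) hD fun t n hn ρ hρ => ?_
      have h1 : DerivBdd s D (compC p s * ε) (fun ρ => h (u x ρ t) ρ) :=
        DerivBdd.of_comp hX.deriv hD hδ (hut t) (fun ρ hρ => hball x hx ρ hρ t)
          fun i hi1 his ρ hρ => (hbt t i hi1 his ρ hρ).trans (by linarith)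
      exact (h1.congr hD fun ρ hρ => nem_apply (hX.deriv.toHolFam.continuousOn_left hρ)
        (hu x hx ρ hρ).1 t).bound n hn ρ hρ
    have hp : DerivBdd s D (compC p s * ε) (fun ρ => -primL (nem (fun x => h x ρ) (u x ρ))) := by
      have := (hηb.clm hD primL zero_le_one fun v => by
        rw [one_mul]; exact norm_primL_apply_le v).neg hD
      rwa [one_mul] at this
    refine DerivBdd.eval (DerivBdd.of_linear_eq 𝒜.negPrimMul 𝒜.norm_negPrimMul_le hD
      (hηb.mono (by linarith)) hp (ha.contDiffOn_right hx) fun ρ hρ => ?_) hD t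
    exact 𝒜.propagator_eq ((hX.norm_nem_deriv_le hε (hu x hx ρ hρ).1 hρ).trans hε1)

end FlowBounds

/-! ## Transport of vector fields by maps close to the identity -/

section NearId

open Filter Topology Metric

variable {E 𝓜 : Type} [NormedAddCommGroup E] [NormedSpace ℂ E] [NormedAddCommGroup 𝓜]
  [NormedSpace ℂ 𝓜] {p : ℕ} {s : ℕ} {U T T' : Set E} {D : Set (Par p)} {B ε δ φ : ℝ}

/-- A family of maps close to the identity: its derivative is `1 + a`, the inverse of which
is `1 + b`. -/
structure NearId (𝒜 : OpAlg E 𝓜) (s : ℕ) (T : Set E) (D : Set (Par p)) (B : ℝ)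
    (Φ : E → Par p → E) (a b : E → Par p → 𝓜) : Prop where
  map : HolFam s T D Φ
  holFam_a : HolFam s T D a
  holFam_b : HolFam s T D b
  map_bdd : ∀ x ∈ T, DerivBdd s D B (fun ρ => Φ x ρ - x)
  a_bdd : ∀ x ∈ T, DerivBdd s D B (a x)
  b_bdd : ∀ x ∈ T, DerivBdd s D B (b x)
  hasFDerivAt : ∀ x ∈ T, ∀ ρ ∈ D,
    HasFDerivAt (fun x => Φ x ρ) (ContinuousLinearMap.id ℂ E + 𝒜.act (a x ρ)) x
  left_inv : ∀ x ∈ T, ∀ ρ ∈ D, ∀ v, (v + 𝒜.act (a x ρ) v) + 𝒜.act (b x ρ) (v + 𝒜.act (a x ρ) v) = v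
  right_inv : ∀ x ∈ T, ∀ ρ ∈ D, ∀ v,
    (v + 𝒜.act (b x ρ) v) + 𝒜.act (a x ρ) (v + 𝒜.act (b x ρ) v) = v

variable {𝒜 : OpAlg E 𝓜}

/-- The bilinear map `(η,z) ↦ -zη`. -/
noncomputable def OpAlg.negMulFlip (𝒜 : OpAlg E 𝓜) : 𝓜 →L[ℂ] 𝓜 →L[ℂ] 𝓜 := -𝒜.mul.flip

theorem OpAlg.norm_negMulFlip_le (η z : 𝓜) : ‖𝒜.negMulFlip η z‖ ≤ ‖η‖ * ‖z‖ := by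
  change ‖-𝒜.mul z η‖ ≤ _
  rw [norm_neg, mul_comm]
  exact 𝒜.norm_mul_le z η

theorem one_le_linC (n : ℕ) : 1 ≤ linC n := by
  cases n with
  | zero => norm_num [linC]
  | succ n =>
    have := linC_pos n
    simp only [linC]
    nlinarith [show 0 < 2 ^ (n + 1) * linC n by positivity]

theorem norm_iteratedFDeriv_of_sub_const {P F : Type*} [NormedAddCommGroup P] [NormedSpace ℝ P]
    [NormedAddCommGroup F] [NormedSpace ℝ F] {D : Set P} (hD : IsOpen D) {y : P → F} {c : F}
    (hy : ContDiffOn ℝ s (fun ρ => y ρ - c) D) {i : ℕ} (hi : 1 ≤ i) (his : i ≤ s) {ρ : P}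
    (hρ : ρ ∈ D) : iteratedFDeriv ℝ i y ρ = iteratedFDeriv ℝ i (fun ρ => y ρ - c) ρ := by
  have h1 := iteratedFDeriv_add_apply (𝕜 := ℝ) (i := i) (x := ρ) (f := fun ρ => y ρ - c)
    (g := fun _ => c) ((hy.contDiffAt (hD.mem_nhds hρ)).of_le (by exact_mod_cast his))
    contDiffAt_const
  have h2 : (fun ρ => y ρ - c) + (fun _ => c) = y := by ext; simp
  have h4 : iteratedFDeriv ℝ i (fun _ : P => c) ρ = 0 := by
    obtain ⟨j, rfl⟩ : ∃ j, i = j + 1 := ⟨i - 1, by omega⟩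
    rw [iteratedFDeriv_succ_const]
    rfl
  rw [h2, h4, add_zero] at h1
  exact h1

/-- The constant in the bounds of the flow. -/
noncomputable def flowC (p s : ℕ) : ℝ := linC s ^ 2 * compC p s

theorem one_le_flowC (p s : ℕ) : 1 ≤ flowC p s := by
  have h1 := one_le_linC s
  have h2 := one_le_compC p s
  unfold flowC
  nlinarith [mul_le_mul h1 h1 zero_le_one (by linarith)]

/-- The rotation curve of a vector. -/
noncomputable def rotL (E : Type*) [NormedAddCommGroup E] [NormedSpace ℂ E] :
    E →L[ℂ] C(Icc (0 : ℝ) (2 * Real.pi), E) :=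
  (ptBilin (Icc (0 : ℝ) (2 * Real.pi)) (ContinuousLinearMap.lsmul ℂ ℂ)
    (⟨fun θ => Complex.exp ((θ : ℝ) * Complex.I), by fun_prop⟩ :
      C(Icc (0 : ℝ) (2 * Real.pi), ℂ))).comp (constL ℂ (Icc (0 : ℝ) (2 * Real.pi)))

theorem rotL_apply (w : E) (θ : Icc (0 : ℝ) (2 * Real.pi)) :
    rotL E w θ = Complex.exp ((θ : ℝ) * Complex.I) • w := rfl

theorem NearId.derivBdd_comp {Φ : E → Par p → E} {a b : E → Par p → 𝓜}
    (hΦ : NearId 𝒜 s T D B Φ a b) (hD : IsOpen D) (hδ : 0 < δ) (hBδ : B ≤ δ)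
    (hball : ∀ x ∈ T, ∀ ρ ∈ D, ball (Φ x ρ) δ ⊆ U) {G : Type*} [NormedAddCommGroup G]
    [NormedSpace ℂ G] [CompleteSpace G] {F : E → Par p → G} (hF : HolFamBdd s U D φ F) {x : E}
    (hx : x ∈ T) : DerivBdd s D (compC p s * φ) (fun ρ => F (Φ x ρ) ρ) :=
  DerivBdd.of_comp hF hD hδ (hΦ.map.contDiffOn_right hx) (hball x hx) fun i hi1 his ρ hρ => by
    rw [norm_iteratedFDeriv_of_sub_const hD (hΦ.map_bdd x hx).contDiffOn hi1 his hρ]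
    exact ((hΦ.map_bdd x hx).bound i his ρ hρ).trans hBδ

variable [CompleteSpace E] [CompleteSpace 𝓜]
variable {X : E → Par p → E} {h : E → Par p → 𝓜}

/-- `a` is the propagator at time `t`, and `b` solves `b = -a - b a`, that is `(1 + b)(1 + a) = 1`.
Each of the two linear equations contributes a factor `linC`, whence `flowC = linC² * compC`.
Smallness of `flowC p s * ε` keeps `a` below `1/2`, so that the second equation is solvable. -/
theorem OpField.nearId_flow (hX : OpField 𝒜 s U D ε X h) (hs : 1 ≤ s)
    (hUo : IsOpen U) (hD : IsOpen D) (hU : Convex ℝ U) (hε : 0 ≤ ε) (hδ : 0 < δ) (hδ1 : δ ≤ 1)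
    (hεδ : flowC p s * ε ≤ δ / 2) (hT : IsOpen T)
    {u : E → Par p → C(TI, E)}
    (hu : ∀ x ∈ T, ∀ ρ ∈ D, IsFlowCurve U X x ρ (u x ρ))
    (hd : ∀ x ∈ T, ∀ ρ ∈ D, ∀ t, ‖u x ρ t - x‖ ≤ ε)
    (hball : ∀ x ∈ T, ∀ ρ ∈ D, ∀ t, ball (u x ρ t) δ ⊆ U) (t : TI) :
    ∃ a b, NearId 𝒜 s T D (flowC p s * ε) (fun x ρ => u x ρ t) a b := by
  have hl := one_le_linC s
  have hc := one_le_compC p s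
  have hcε : 0 ≤ compC p s * ε := by positivity
  have e1 : compC p s * ε ≤ linC s * (compC p s * ε) := le_mul_of_one_le_left hcε hl
  have e2 : linC s * (compC p s * ε) ≤ linC s * (linC s * (compC p s * ε)) :=
    le_mul_of_one_le_left (by positivity) hl
  have e3 : linC s * (linC s * (compC p s * ε)) = flowC p s * ε := by unfold flowC; ring
  have hε0 : ε ≤ compC p s * ε := le_mul_of_one_le_left hε hc
  have hε1 : ε ≤ 1 / 2 := by linarith
  have huf := hX.holFam_flow hs hUo hD hU hε hε1 hT hu
  obtain ⟨hη, hprop⟩ := hX.holFam_propagator hs hUo hD hε hε1 huf fun x hx ρ hρ => (hu x hx ρ hρ).1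
  let a : E → Par p → 𝓜 := fun x ρ => 𝒜.propagator (nem (fun x => h x ρ) (u x ρ)) t
  let b : E → Par p → 𝓜 := fun x ρ => linSolve 𝒜.negMulFlip (a x ρ, -a x ρ)
  have ha : HolFam s T D a := hprop.clm (ContinuousMap.evalCLM ℂ t : C(TI, 𝓜) →L[ℂ] 𝓜)
  have hbdd : ∀ x ∈ T, _ := fun x hx => hX.derivBdd_flow hs hUo hD hε hδ hδ1 (by linarith) huf hu
    hd hball hx t
  have hab : ∀ x ∈ T, DerivBdd s D (linC s * (compC p s * ε)) (a x) := fun x hx => (hbdd x hx).2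
  have han : ∀ x ∈ T, ∀ ρ ∈ D, ‖a x ρ‖ ≤ 1 / 2 := fun x hx ρ hρ =>
    ((hab x hx).norm_le hρ).trans (by linarith)
  have hβ : ∀ x ∈ T, ∀ ρ ∈ D, ‖𝒜.negMulFlip (a x ρ)‖ < 1 := fun x hx ρ hρ =>
    (norm_le_of_bilinear_le 𝒜.norm_negMulFlip_le _).trans_lt
      ((han x hx ρ hρ).trans_lt (by norm_num))
  have hb : HolFam s T D b := HolFam.comp_left (f := linSolve 𝒜.negMulFlip)
    (y := fun x ρ => (a x ρ, -a x ρ)) (contDiffOn_linSolve _ _) (ha.prodMk ha.neg) hβ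
  have hbeq : ∀ x ∈ T, ∀ ρ ∈ D, b x ρ = -a x ρ + 𝒜.negMulFlip (a x ρ) (b x ρ) :=
    fun x hx ρ hρ => linSolve_eq _ (hβ x hx ρ hρ) _
  have hbb : ∀ x ∈ T, DerivBdd s D (linC s * (linC s * (compC p s * ε))) (b x) := fun x hx =>
    DerivBdd.of_linear_eq 𝒜.negMulFlip 𝒜.norm_negMulFlip_le hD ((hab x hx).mono (by linarith))
      ((hab x hx).neg hD) (hb.contDiffOn_right hx) fun ρ hρ => hbeq x hx ρ hρ
  have hleft : ∀ x ∈ T, ∀ ρ ∈ D, ∀ v,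
      (v + 𝒜.act (a x ρ) v) + 𝒜.act (b x ρ) (v + 𝒜.act (a x ρ) v) = v := by
    intro x hx ρ hρ v
    have h1 : b x ρ = -a x ρ - 𝒜.mul (b x ρ) (a x ρ) := by
      rw [sub_eq_add_neg]; exact hbeq x hx ρ hρ
    have h2 := DFunLike.congr_fun (congrArg 𝒜.act h1) v
    simp only [map_sub, map_neg, _root_.sub_apply, _root_.neg_apply, 𝒜.act_mul] at h2
    rw [map_add, h2]; abel
  refine ⟨a, b, huf.clm (ContinuousMap.evalCLM ℂ t : C(TI, E) →L[ℂ] E), ha, hb,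
    fun x hx => (hbdd x hx).1.mono (by linarith), fun x hx => (hab x hx).mono (by linarith),
    fun x hx => (hbb x hx).mono e3.le,
    fun x hx ρ hρ => hX.hasFDerivAt_flow hUo hε hε1 hT huf hu hx hρ t, hleft, ?_⟩
  intro x hx ρ hρ v
  have hact : ‖-𝒜.act (a x ρ)‖ < 1 := by
    rw [norm_neg]
    exact (norm_le_of_bilinear_le 𝒜.norm_act_le _).trans_lt
      ((han x hx ρ hρ).trans_lt (by norm_num))
  -- `1 + a` is invertible among the bounded operators, so its left inverse `1 + b` is also a right
  -- inverse.
  obtain ⟨e, he⟩ := isInvertible_one_sub hact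
  have he' : ∀ v, e v = v + 𝒜.act (a x ρ) v := fun v => by
    have := DFunLike.congr_fun he v
    simpa using this
  have h1 := hleft x hx ρ hρ (e.symm v)
  rw [← he', e.apply_symm_apply] at h1
  rw [h1, ← he', e.apply_symm_apply]

/-- The constant in the bounds of the transported fields. -/
noncomputable def pullC (p s : ℕ) : ℝ :=
  (1 + 2 ^ s) * (compC p s + 2 ^ s * compC p s + 2 * ((1 + 2 ^ s) * compC p s) * compC p s)

omit [CompleteSpace E] in
/-- The derivative of a bounded family in the direction of another one. -/
theorem exists_holFam_fderiv_apply {a : E → Par p → 𝓜} {w : E → Par p → E} {W : ℝ} (hs : 1 ≤ s)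
    (hD : IsOpen D) (hT : IsOpen T) (hδ : 0 < δ) (hTT' : ∀ x ∈ T', ball x δ ⊆ T) (hB : 0 ≤ B)
    (ha : HolFam s T D a) (hab : ∀ x ∈ T, DerivBdd s D B (a x)) (hw : HolFam s T D w) (hW : 0 < W)
    (hwb : ∀ x ∈ T, DerivBdd s D W (w x)) :
    HolFam s T' D (fun x ρ => fderiv ℂ (fun x => a x ρ) x (w x ρ)) ∧
    ∀ x ∈ T', DerivBdd s D (2 * W / δ * (compC p s * B))
      (fun ρ => fderiv ℂ (fun x => a x ρ) x (w x ρ)) := by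
  -- Since `‖w‖ ≤ W`, the circle `x + r e^{iθ} w` stays within `δ / 2` of `x`, and balls of radius
  -- `δ / 2` about its points still lie in `T`.
  set r : ℝ := δ / (2 * W) with hr
  have hr0 : 0 < r := by positivity
  have hrW : r * W = δ / 2 := by rw [hr]; field_simp
  have hsub : T' ⊆ T := fun x hx => hTT' x hx (mem_ball_self hδ)
  let v : E → Par p → C(Icc (0 : ℝ) (2 * Real.pi), E) := fun x ρ =>
    constL ℂ _ x + (rotL E) ((r : ℂ) • w x ρ)
  have hvapp : ∀ x ρ θ, v x ρ θ = x + (r * Complex.exp ((θ : ℝ) * Complex.I) : ℂ) • w x ρ := by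
    intro x ρ θ
    simp only [v, ContinuousMap.add_apply, constL_apply, rotL_apply, smul_smul]
    rw [mul_comm (r : ℂ)]
  have hvd : ∀ x ∈ T', ∀ ρ ∈ D, ∀ θ, ‖v x ρ θ - x‖ ≤ δ / 2 := by
    intro x hx ρ hρ θ
    rw [hvapp, add_sub_cancel_left, norm_smul, norm_mul, Complex.norm_exp_ofReal_mul_I, mul_one,
      Complex.norm_real, Real.norm_of_nonneg hr0.le, ← hrW]
    have := (hwb x (hsub hx)).norm_le hρ
    gcongr
  have hvball : ∀ x ∈ T', ∀ ρ ∈ D, ∀ θ, ball (v x ρ θ) (δ / 2) ⊆ T := by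
    intro x hx ρ hρ θ
    refine (ball_subset_ball' ?_).trans (hTT' x hx)
    rw [dist_eq_norm]
    linarith [hvd x hx ρ hρ θ]
  have hvT : ∀ x ∈ T', ∀ ρ ∈ D, v x ρ ∈ curvesIn _ T := fun x hx ρ hρ θ =>
    hvball x hx ρ hρ θ (mem_ball_self (by positivity))
  have hv : HolFam s T' D v := by
    have h1 : HolFam s T' D w := hw.mono le_rfl hsub Subset.rfl
    exact (HolFam.id.clm (constL ℂ (Icc (0 : ℝ) (2 * Real.pi)))).add
      (h1.clm ((rotL E).comp ((r : ℂ) • ContinuousLinearMap.id ℂ E)))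
  have hN : HolFam s T' D (fun x ρ => nem (fun x => a x ρ) (v x ρ)) :=
    (ha.nem hs hT hD).comp hv hvT
  -- The directional derivative is `r⁻¹` times a Cauchy integral of values of `a`. It is thus a
  -- bounded linear function of a composition, and no order of differentiability in `ρ` is lost.
  have hval : ∀ x ∈ T', ∀ ρ ∈ D, fderiv ℂ (fun x => a x ρ) x (w x ρ) =
      (((r : ℂ)⁻¹) • cauchyL) (nem (fun x => a x ρ) (v x ρ)) := by
    intro x hx ρ hρ
    have hc : ContinuousOn (fun x => a x ρ) T := ha.continuousOn_left hρ
    let f : ℂ → 𝓜 := fun z => a (x + (z * r) • w x ρ) ρ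
    have hm : ∀ z ∈ ball (0 : ℂ) 2, x + (z * r) • w x ρ ∈ T := by
      intro z hz
      refine hTT' x hx ?_
      rw [mem_ball_zero_iff] at hz
      rw [mem_ball, dist_eq_norm, add_sub_cancel_left, norm_smul, norm_mul, Complex.norm_real,
        Real.norm_of_nonneg hr0.le, mul_assoc]
      have h1 := (hwb x (hsub hx)).norm_le hρ
      have h2 : r * ‖w x ρ‖ ≤ δ / 2 := by rw [← hrW]; gcongr
      calc ‖z‖ * (r * ‖w x ρ‖) ≤ ‖z‖ * (δ / 2) := by gcongr
        _ < 2 * (δ / 2) := by gcongr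
        _ = δ := by ring
    have hin : ∀ z : ℂ, HasDerivAt (fun z : ℂ => x + (z * r) • w x ρ) ((r : ℂ) • w x ρ) z := by
      intro z
      have h1 := ((hasDerivAt_id z).mul_const (r : ℂ)).smul_const (w x ρ)
      rw [one_mul] at h1
      exact h1.const_add x
    have hf : ∀ z ∈ ball (0 : ℂ) 2, HasDerivAt f
        (fderiv ℂ (fun x => a x ρ) (x + (z * r) • w x ρ) ((r : ℂ) • w x ρ)) z := fun z hz =>
      HasFDerivAt.comp_hasDerivAt (l := fun x => a x ρ) z
        ((ha.differentiableAt hT (hm z hz) hρ).hasFDerivAt) (hin z)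
    have h1 := cauchyL_eq_deriv (f := f) (R := 2) (by norm_num)
      (fun z hz => (hf z hz).differentiableAt.differentiableWithinAt)
      (nem (fun x => a x ρ) (v x ρ)) (fun θ => by
        rw [nem_apply hc (hvT x hx ρ hρ), hvapp, mul_comm (r : ℂ)])
    rw [_root_.smul_apply, h1, (hf 0 (by simp)).deriv, zero_mul, zero_smul, add_zero, map_smul,
      smul_smul, inv_mul_cancel₀ (by exact_mod_cast hr0.ne'), one_smul]
  refine ⟨(hN.clm (((r : ℂ)⁻¹) • cauchyL)).congr hval, fun x hx => ?_⟩
  have haB : HolFamBdd s T D B a := HolFamBdd.of_derivBdd ha hab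
  have hNb : DerivBdd s D (compC p s * B) (fun ρ => nem (fun x => a x ρ) (v x ρ)) := by
    have := one_le_compC p s
    refine DerivBdd.of_eval (by positivity) (hN.contDiffOn_right hx) hD fun θ n hn ρ hρ => ?_
    have hy : DerivBdd s D (δ / 2) (fun ρ => v x ρ θ - x) := by
      have h1 := (hwb x (hsub hx)).clm hD
        ((r * Complex.exp ((θ : ℝ) * Complex.I) : ℂ) • ContinuousLinearMap.id ℂ E) hr0.le
        (fun y => by
          rw [_root_.smul_apply, ContinuousLinearMap.id_apply, norm_smul, norm_mul,
            Complex.norm_exp_ofReal_mul_I, mul_one, Complex.norm_real, Real.norm_of_nonneg hr0.le])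
      rw [hrW] at h1
      exact h1.congr hD fun ρ _ => by rw [hvapp, add_sub_cancel_left]; rfl
    have h1 : DerivBdd s D (compC p s * B) (fun ρ => a (v x ρ θ) ρ) := by
      refine DerivBdd.of_comp haB hD (half_pos hδ) ?_ (fun ρ hρ => hvball x hx ρ hρ θ)
        fun i hi1 his ρ hρ => ?_
      · exact (ContinuousMap.evalCLM ℝ θ : C(Icc (0 : ℝ) (2 * Real.pi), E) →L[ℝ] E).contDiff.comp_contDiffOn
          (hv.contDiffOn_right hx)
      · rw [norm_iteratedFDeriv_of_sub_const hD hy.contDiffOn hi1 his hρ]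
        exact hy.bound i his ρ hρ
    exact (h1.congr hD fun ρ hρ => nem_apply (ha.continuousOn_left hρ) (hvT x hx ρ hρ) θ).bound
      n hn ρ hρ
  have h2 := hNb.clm hD (((r : ℂ)⁻¹) • cauchyL) (c := r⁻¹) (by positivity) (fun y => by
    rw [_root_.smul_apply, norm_smul, norm_inv, Complex.norm_real, Real.norm_of_nonneg hr0.le]
    gcongr
    exact norm_cauchyL_apply_le y)
  rw [hr, inv_div] at h2
  exact h2.congr hD fun ρ hρ => hval x hx ρ hρ

/-- The transport of a vector field. -/
theorem NearId.opField_pullback {Φ : E → Par p → E} {a b : E → Par p → 𝓜}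
    (hΦ : NearId 𝒜 s T D B Φ a b) (hs : 1 ≤ s) (hD : IsOpen D) (hT : IsOpen T)
    (hδ : 0 < δ) (hδ1 : δ ≤ 1) (hB : 0 ≤ B) (hBδ : B ≤ δ)
    (hTT' : ∀ x ∈ T', ball x δ ⊆ T) (hball : ∀ x ∈ T, ∀ ρ ∈ D, ball (Φ x ρ) δ ⊆ U)
    {F : E → Par p → E} {k : E → Par p → 𝓜} (hφ : 0 < φ) (hF : OpField 𝒜 s U D φ F k) :
    ∃ M, OpField 𝒜 s T' D (pullC p s * φ)
      (fun x ρ => F (Φ x ρ) ρ + 𝒜.act (b x ρ) (F (Φ x ρ) ρ)) M := by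
  have hc := one_le_compC p s
  have h2s : (0 : ℝ) < 2 ^ s := by positivity
  have hsub : T' ⊆ T := fun x hx => hTT' x hx (mem_ball_self hδ)
  have hΦU : ∀ x ∈ T, ∀ ρ ∈ D, Φ x ρ ∈ U := fun x hx ρ hρ => hball x hx ρ hρ (mem_ball_self hδ)
  have hB1 : B ≤ 1 := hBδ.trans hδ1
  -- `1 + b` inverts `dΦ = 1 + a`, so `w` is `(dΦ)⁻¹` applied to `F ∘ Φ`.
  set w : E → Par p → E := fun x ρ => F (Φ x ρ) ρ + 𝒜.act (b x ρ) (F (Φ x ρ) ρ) with hwdef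
  have hFΦ : HolFam s T D (fun x ρ => F (Φ x ρ) ρ) := hF.field.toHolFam.comp hΦ.map hΦU
  have hkΦ : HolFam s T D (fun x ρ => k (Φ x ρ) ρ) := hF.deriv.toHolFam.comp hΦ.map hΦU
  have hFb : ∀ x ∈ T, DerivBdd s D (compC p s * φ) (fun ρ => F (Φ x ρ) ρ) := fun x hx =>
    hΦ.derivBdd_comp hD hδ hBδ hball hF.field hx
  have hkb : ∀ x ∈ T, DerivBdd s D (compC p s * φ) (fun ρ => k (Φ x ρ) ρ) := fun x hx =>
    hΦ.derivBdd_comp hD hδ hBδ hball hF.deriv hx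
  have hw : HolFam s T D w := hFΦ.add (hΦ.holFam_b.bilin hFΦ 𝒜.act)
  set W : ℝ := (1 + 2 ^ s) * compC p s * φ with hWdef
  have hW : 0 < W := by positivity
  have hone : ∀ A : ℝ, 0 ≤ A → 2 ^ s * B * A ≤ 2 ^ s * A := fun A hA => by
    rw [mul_assoc]
    have : B * A ≤ A := mul_le_of_le_one_left hA hB1
    gcongr
  have hcφ : 0 ≤ compC p s * φ := by positivity
  have hwb : ∀ x ∈ T, DerivBdd s D W (w x) := fun x hx =>
    ((hFb x hx).add ((hΦ.b_bdd x hx).bilin 𝒜.act 𝒜.norm_act_le (hFb x hx) hD) hD).mono (by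
      have := hone _ hcφ
      rw [hWdef]; linarith)
  obtain ⟨hq, hqb⟩ := exists_holFam_fderiv_apply hs hD hT hδ hTT' hB hΦ.holFam_a hΦ.a_bdd hw hW hwb
  -- Differentiating `(1 + a) w = F ∘ Φ` formally gives `(1 + a) dw = k(Φ)(1 + a) - da w`. Here `q`
  -- is `da w`, `q₁` is the right side and `M = (1 + b) q₁` is the candidate for `dw`; all of them
  -- lie in `𝓜`.
  let q : E → Par p → 𝓜 := fun x ρ => fderiv ℂ (fun x => a x ρ) x (w x ρ)
  let q₁ : E → Par p → 𝓜 := fun x ρ => (k (Φ x ρ) ρ + 𝒜.mul (k (Φ x ρ) ρ) (a x ρ)) + -q x ρ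
  let M : E → Par p → 𝓜 := fun x ρ => q₁ x ρ + 𝒜.mul (b x ρ) (q₁ x ρ)
  have hq₁ : HolFam s T' D q₁ := ((hkΦ.add (hkΦ.bilin hΦ.holFam_a 𝒜.mul)).mono le_rfl hsub
    Subset.rfl).add hq.neg
  set Q₁ : ℝ := (compC p s + 2 ^ s * compC p s + 2 * ((1 + 2 ^ s) * compC p s) * compC p s) * φ
    with hQ₁
  have hQ₁0 : 0 ≤ Q₁ := by positivity
  have hq₁b : ∀ x ∈ T', DerivBdd s D Q₁ (q₁ x) := fun x hx =>
    (((hkb x (hsub hx)).add ((hkb x (hsub hx)).bilin 𝒜.mul 𝒜.norm_mul_le (hΦ.a_bdd x (hsub hx)) hD)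
      hD).add ((hqb x hx).neg hD) hD).mono (by
        have h1 := hone _ hcφ
        have h2 : 2 * W / δ * (compC p s * B) ≤ 2 * W * compC p s := by
          rw [div_mul_eq_mul_div, div_le_iff₀ hδ]
          have : compC p s * B ≤ compC p s * δ := by gcongr
          calc 2 * W * (compC p s * B) ≤ 2 * W * (compC p s * δ) := by gcongr
            _ = _ := by ring
        have h3 : Q₁ = compC p s * φ + 2 ^ s * (compC p s * φ) + 2 * W * compC p s := by
          rw [hQ₁, hWdef]; ring
        rw [h3]; linarith)
  have hM : HolFam s T' D M := hq₁.add ((hΦ.holFam_b.mono le_rfl hsub Subset.rfl).bilin hq₁ 𝒜.mul)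
  have hMb : ∀ x ∈ T', DerivBdd s D (pullC p s * φ) (M x) := fun x hx =>
    ((hq₁b x hx).add ((hΦ.b_bdd x (hsub hx)).bilin 𝒜.mul 𝒜.norm_mul_le (hq₁b x hx) hD) hD).mono (by
      have h1 := hone _ hQ₁0
      have h3 : pullC p s * φ = Q₁ + 2 ^ s * Q₁ := by rw [hQ₁]; unfold pullC; ring
      linarith)
  have hWC : W ≤ pullC p s * φ := by
    have e1 : compC p s ≤
      compC p s + 2 ^ s * compC p s + 2 * ((1 + 2 ^ s) * compC p s) * compC p s := by
      have : 0 ≤ 2 ^ s * compC p s + 2 * ((1 + 2 ^ s) * compC p s) * compC p s := by positivity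
      linarith
    rw [hWdef]; unfold pullC
    gcongr
  refine ⟨M, (HolFamBdd.of_derivBdd hw hwb).mono le_rfl hsub hWC, HolFamBdd.of_derivBdd hM hMb,
    fun x hx ρ hρ => ?_⟩
  have hxT := hsub hx
  have hwd := (hw.differentiableAt hT hxT hρ).hasFDerivAt
  have had := (hΦ.holFam_a.differentiableAt hT hxT hρ).hasFDerivAt
  set L := fderiv ℂ (fun x => w x ρ) x
  set A := fderiv ℂ (fun x => a x ρ) x with hA
  -- The product rule produces `(da ζ) w` as a map of `ζ`. Symmetry of the second derivative of `Φ`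
  -- exchanges `ζ` and `w` and makes it the action on `ζ` of `da w`, an element of `𝓜`.
  have hsymm : ∀ ζ η, 𝒜.act (A ζ) η = 𝒜.act (A η) ζ := by
    have h1 : HasFDerivAt (fun x => ContinuousLinearMap.id ℂ E + 𝒜.act (a x ρ)) (𝒜.act.comp A) x :=
      (𝒜.act.hasFDerivAt.comp x had).const_add _
    intro ζ η
    refine second_derivative_symmetric_of_eventually (𝕜 := ℂ) (f := fun x => Φ x ρ) ?_ h1 ζ η
    filter_upwards [hT.mem_nhds hxT] with y hy using hΦ.hasFDerivAt y hy ρ hρ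
  have hFd : HasFDerivAt (fun x => F (Φ x ρ) ρ)
      ((𝒜.act (k (Φ x ρ) ρ)).comp (ContinuousLinearMap.id ℂ E + 𝒜.act (a x ρ))) x :=
    HasFDerivAt.comp (g := fun x => F x ρ) x (hF.hasFDerivAt _ (hΦU x hxT ρ hρ) ρ hρ)
      (hΦ.hasFDerivAt x hxT ρ hρ)
  have hFw : (fun x => F (Φ x ρ) ρ) =ᶠ[𝓝 x] fun x => w x ρ + 𝒜.act (a x ρ) (w x ρ) := by
    filter_upwards [hT.mem_nhds hxT] with y hy
    exact (hΦ.right_inv y hy ρ hρ _).symm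
  have hbil : HasFDerivAt (fun x => 𝒜.act (a x ρ) (w x ρ))
      ((𝒜.act (a x ρ)).comp L + ((𝒜.act.comp A).flip (w x ρ))) x :=
    (𝒜.act.hasFDerivAt.comp x had).clm_apply hwd
  have heq := hFd.unique ((hwd.add hbil).congr_of_eventuallyEq hFw)
  convert hwd using 1
  ext ζ
  have h1 := DFunLike.congr_fun heq ζ
  simp only [ContinuousLinearMap.comp_apply, _root_.add_apply, ContinuousLinearMap.id_apply,
    ContinuousLinearMap.flip_apply, map_add] at h1
  rw [hsymm] at h1
  have h2 : L ζ + 𝒜.act (a x ρ) (L ζ) = 𝒜.act (q₁ x ρ) ζ := by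
    simp only [q₁, q, map_add, map_neg, _root_.add_apply, _root_.neg_apply, 𝒜.act_mul, ← hA]
    rw [h1]; abel
  have h3 := hΦ.left_inv x hxT ρ hρ (L ζ)
  rw [h2] at h3
  rw [← h3]
  simp only [M, map_add, _root_.add_apply, 𝒜.act_mul]

end NearId

/-! ## The Hilbert spaces `Y_γ` -/

section SequenceSpace

open Filter Topology Metric

variable {d : ℕ} {S : Modes d} {γ γ' : ℝ × ℝ}

theorem Y.ext {x y : Y S γ} (h : ∀ a, x a = y a) : x = y := Subtype.ext (funext h)

@[simp] theorem Y.add_apply (x y : Y S γ) (a : S.Idx) : (x + y) a = x a + y a := rfl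

@[simp] theorem Y.smul_apply (c : ℂ) (x : Y S γ) (a : S.Idx) : (c • x) a = c • x a := rfl

theorem Y.single_apply_self (b : S.Idx) (v : C2) : (Y.single S γ b v) b = v := if_pos rfl

theorem Y.single_apply_ne {a b : S.Idx} (h : a ≠ b) (v : C2) : (Y.single S γ b v) a = 0 := if_neg h

theorem norm_weightMap_apply (ζ : S.Idx → C2) (a : S.Idx) :
    ‖weightMap S γ ζ a‖ = wt γ (S.pos a) * ‖ζ a‖ := by
  change ‖(wt γ (S.pos a) : ℂ) • ζ a‖ = _
  rw [norm_smul, Complex.norm_real, Real.norm_of_nonneg (wt_pos γ _).le]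

theorem Y.hasSum_norm (x : Y S γ) :
    HasSum (fun a => (wt γ (S.pos a) * ‖x a‖) ^ (2 : ℝ)) (‖x‖ ^ (2 : ℝ)) := by
  have h := lp.hasSum_norm (p := 2) (by norm_num) (Y.toLp S γ x)
  rw [ENNReal.toReal_ofNat] at h
  have h2 : (fun a => (wt γ (S.pos a) * ‖x a‖) ^ (2 : ℝ)) =
      fun a => ‖Y.toLp S γ x a‖ ^ (2 : ℝ) := by
    funext a
    rw [← norm_weightMap_apply]
    rfl
  rw [h2]
  exact h

theorem Y.norm_apply_le (x : Y S γ) (a : S.Idx) : wt γ (S.pos a) * ‖x a‖ ≤ ‖x‖ := by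
  have h := lp.norm_apply_le_norm (p := 2) (by norm_num) (Y.toLp S γ x) a
  rw [← norm_weightMap_apply]
  exact h

theorem Y.toLp_surjective : Function.Surjective (Y.toLp S γ) := by
  intro f
  have hw : ∀ a, (wt γ (S.pos a) : ℂ) ≠ 0 := fun a => by exact_mod_cast (wt_pos γ (S.pos a)).ne'
  have h1 : weightMap S γ (fun a => (wt γ (S.pos a) : ℂ)⁻¹ • f a) = f := by
    funext a
    change (wt γ (S.pos a) : ℂ) • ((wt γ (S.pos a) : ℂ)⁻¹ • f a) = f a
    rw [smul_smul, mul_inv_cancel₀ (hw a), one_smul]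
  refine ⟨⟨fun a => (wt γ (S.pos a) : ℂ)⁻¹ • f a, ?_⟩, Subtype.ext h1⟩
  change Memℓp (weightMap S γ _) 2
  rw [h1]
  exact f.2

/-- `Y_γ` is isometric to `ℓ²`. -/
noncomputable def Y.equivLp : Y S γ ≃ₗᵢ[ℂ] lp (fun _ : S.Idx => C2) 2 :=
  LinearIsometryEquiv.ofSurjective ⟨Y.toLp S γ, fun _ => rfl⟩ Y.toLp_surjective

instance : CompleteSpace (Y S γ) :=
  (completeSpace_iff_isComplete_range (Y.equivLp (S := S) (γ := γ)).isometry.isUniformInducing).2 (by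
    rw [Y.equivLp.surjective.range_eq]
    exact isComplete_univ)

open Classical in
theorem Y.equivLp_single (b : S.Idx) (v : C2) : Y.equivLp (Y.single S γ b v) =
    lp.single 2 b ((wt γ (S.pos b) : ℂ) • v) := by
  apply Subtype.ext
  funext a
  change (wt γ (S.pos a) : ℂ) • (Y.single S γ b v) a =
    Pi.single (M := fun _ => C2) b ((wt γ (S.pos b) : ℂ) • v) a
  by_cases h : a = b
  · subst h; rw [Y.single_apply_self, Pi.single_eq_same]
  · rw [Y.single_apply_ne h, Pi.single_eq_of_ne h, smul_zero]

theorem Y.norm_single (b : S.Idx) (v : C2) : ‖Y.single S γ b v‖ = wt γ (S.pos b) * ‖v‖ := by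
  classical
  rw [← Y.equivLp.norm_map, Y.equivLp_single, lp.norm_single (by norm_num), norm_smul,
    Complex.norm_real, Real.norm_of_nonneg (wt_pos γ _).le]

theorem Y.hasSum_single (x : Y S γ) : HasSum (fun a => Y.single S γ a (x a)) x := by
  classical
  have h := lp.hasSum_single (p := 2) (by norm_num) (Y.equivLp x)
  have h2 := h.mapL (Y.equivLp (S := S) (γ := γ)).symm.toContinuousLinearEquiv.toContinuousLinearMap
  convert h2 using 1
  · funext a
    change _ = Y.equivLp.symm (lp.single 2 a _)
    rw [LinearIsometryEquiv.eq_symm_apply, Y.equivLp_single]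
    rfl
  · exact (Y.equivLp.symm_apply_apply x).symm

/-- Bounded maps which agree at the modes are equal. -/
theorem Y.clm_ext {G : Type*} [NormedAddCommGroup G] [NormedSpace ℂ G] {A B : Y S γ →L[ℂ] G}
    (h : ∀ b v, A (Y.single S γ b v) = B (Y.single S γ b v)) : A = B := by
  ext x
  have hA := x.hasSum_single.mapL A
  have hB := x.hasSum_single.mapL B
  simp only [h] at hA
  exact hA.unique hB

/-- The `a`-th mode. -/
noncomputable def Y.coordL (a : S.Idx) : Y S γ →L[ℂ] C2 :=
  LinearMap.mkContinuous
    { toFun := fun x => x a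
      map_add' := fun _ _ => rfl
      map_smul' := fun _ _ => rfl } (wt γ (S.pos a))⁻¹ fun x => by
        have h := x.norm_apply_le a
        have h0 := wt_pos γ (S.pos a)
        rw [inv_mul_eq_div, le_div_iff₀ h0, mul_comm]
        exact h

@[simp] theorem Y.coordL_apply (a : S.Idx) (x : Y S γ) : Y.coordL a x = x a := rfl

/-- The `b`-th mode, as a bounded map. -/
noncomputable def Y.singleL (b : S.Idx) : C2 →L[ℂ] Y S γ :=
  LinearMap.mkContinuous (Y.single S γ b) (wt γ (S.pos b)) fun v => (Y.norm_single b v).le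

@[simp] theorem Y.singleL_apply (b : S.Idx) (v : C2) :
    Y.singleL b v = Y.single S γ b v := rfl

/-- The imaginary part of a component. -/
noncomputable def Y.imL (a : S.Idx) (i : Fin 2) : Y S γ →L[ℝ] ℂ :=
  Complex.ofRealCLM.comp (Complex.imCLM.comp
    (((EuclideanSpace.proj i : C2 →L[ℂ] ℂ).comp (Y.coordL a)).restrictScalars ℝ))

@[simp] theorem Y.imL_apply (a : S.Idx) (i : Fin 2) (x : Y S γ) :
    Y.imL a i x = ((x a i).im : ℂ) := rfl

/-- The embedding of `Y_{γ'}` into `Y_γ`, for `γ ≤ γ'`, as a linear map. -/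
def Y.inclₗ (h₁ : γ.1 ≤ γ'.1) (h₂ : γ.2 ≤ γ'.2) : Y S γ' →ₗ[ℂ] Y S γ where
  toFun x := ⟨x.1, ySubmodule_mono S h₁ h₂ x.2⟩
  map_add' _ _ := rfl
  map_smul' _ _ := rfl

theorem Y.norm_inclₗ_le (h₁ : γ.1 ≤ γ'.1) (h₂ : γ.2 ≤ γ'.2) (x : Y S γ') :
    ‖Y.inclₗ h₁ h₂ x‖ ≤ 1 * ‖x‖ := by
  have h : ‖Y.inclₗ h₁ h₂ x‖ ^ (2 : ℝ) ≤ ‖x‖ ^ (2 : ℝ) := by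
    refine hasSum_le (fun a => ?_) (Y.inclₗ h₁ h₂ x).hasSum_norm x.hasSum_norm
    have hm := wt_mono h₁ h₂ (S.pos a)
    have hp := wt_pos γ (S.pos a)
    exact Real.rpow_le_rpow (mul_nonneg hp.le (norm_nonneg _))
      (mul_le_mul_of_nonneg_right hm (norm_nonneg _)) (by norm_num)
  rw [one_mul]
  exact (Real.rpow_le_rpow_iff (norm_nonneg _) (norm_nonneg _) (by norm_num)).1 h

/-- The embedding of `Y_{γ'}` into `Y_γ`, for `γ ≤ γ'`. -/
noncomputable def Y.incl (h₁ : γ.1 ≤ γ'.1) (h₂ : γ.2 ≤ γ'.2) : Y S γ' →L[ℂ] Y S γ :=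
  LinearMap.mkContinuous (Y.inclₗ h₁ h₂) 1 (Y.norm_inclₗ_le h₁ h₂)

theorem Y.incl_coe (h₁ : γ.1 ≤ γ'.1) (h₂ : γ.2 ≤ γ'.2) (x : Y S γ') :
    (Y.incl h₁ h₂ x : S.Idx → C2) = x :=
  funext fun _ => rfl

theorem Y.incl_apply (h₁ : γ.1 ≤ γ'.1) (h₂ : γ.2 ≤ γ'.2) (x : Y S γ') (a : S.Idx) :
    Y.incl h₁ h₂ x a = x a := rfl

theorem Y.norm_incl_le (h₁ : γ.1 ≤ γ'.1) (h₂ : γ.2 ≤ γ'.2) (x : Y S γ') :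
    ‖Y.incl h₁ h₂ x‖ ≤ ‖x‖ := by
  have h := Y.norm_inclₗ_le h₁ h₂ x
  rwa [one_mul] at h

theorem Y.incl_single (h₁ : γ.1 ≤ γ'.1) (h₂ : γ.2 ≤ γ'.2) (b : S.Idx) (v : C2) :
    Y.incl h₁ h₂ (Y.single S γ' b v) = Y.single S γ b v :=
  Y.ext fun _ => rfl

theorem Y.incl_injective (h₁ : γ.1 ≤ γ'.1) (h₂ : γ.2 ≤ γ'.2) :
    Function.Injective (Y.incl (S := S) h₁ h₂) := fun x y h =>
  Subtype.ext (by rw [← Y.incl_coe h₁ h₂, h, Y.incl_coe])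

theorem toY_eq_of_coe {ζ : S.Idx → C2} {x : Y S γ} (h : (x : S.Idx → C2) = ζ) : toY S γ ζ = x := by
  subst h
  exact Subtype.ext (toY_coe S γ x.2)

end SequenceSpace

/-! ## The symplectic form -/

section SymplecticForm

variable {d : ℕ} {S : Modes d} {γ γ' : ℝ × ℝ}

theorem norm_mul_sub_mul_le (v w : C2) : ‖v 0 * w 1 - v 1 * w 0‖ ≤ ‖v‖ * ‖w‖ := by
  have h1 : ‖v 0 * w 1 - v 1 * w 0‖ ≤ ‖v 0‖ * ‖w 1‖ + ‖v 1‖ * ‖w 0‖ := by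
    refine (norm_sub_le _ _).trans ?_
    rw [norm_mul, norm_mul]
  refine h1.trans (abs_le_of_sq_le_sq' ?_ (by positivity)).2
  rw [mul_pow, EuclideanSpace.norm_sq_eq, EuclideanSpace.norm_sq_eq, Fin.sum_univ_two,
    Fin.sum_univ_two]
  nlinarith [sq_nonneg (‖v 0‖ * ‖w 0‖ - ‖v 1‖ * ‖w 1‖)]

/-- Nonnegative sums of the exponents cover both uses of `Ω`: the duality between `Y_γ` and
`Y_{-γ}`, and the form on `Y_γ` itself when `γ ≥ 0`. -/
theorem one_le_wt_mul_wt (h₁ : 0 ≤ γ.1 + γ'.1) (h₂ : 0 ≤ γ.2 + γ'.2) (a : Fin d → ℤ) :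
    1 ≤ wt γ a * wt γ' a := by
  have h1 : 1 ≤ japan a := le_max_right _ _
  have h2 : wt γ a * wt γ' a =
      Real.exp ((γ.1 + γ'.1) * latNorm a) * japan a ^ (γ.2 + γ'.2) := by
    unfold wt
    rw [Real.rpow_add (by linarith), add_mul, Real.exp_add]
    ring
  rw [h2]
  exact one_le_mul_of_one_le_of_one_le
    (Real.one_le_exp (mul_nonneg h₁ (Real.sqrt_nonneg _))) (Real.one_le_rpow h1 h₂)

theorem summable_norm_mul_norm (h₁ : 0 ≤ γ.1 + γ'.1) (h₂ : 0 ≤ γ.2 + γ'.2) (ζ : Y S γ)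
    (η : Y S γ') : ∃ C ≤ ‖ζ‖ * ‖η‖, Summable (fun a => ‖ζ a‖ * ‖η a‖) ∧
      ∑' a, ‖ζ a‖ * ‖η a‖ ≤ C := by
  obtain ⟨C, _, hC, hs⟩ := Real.inner_le_Lp_mul_Lq_hasSum_of_nonneg Real.HolderConjugate.two_two
    (norm_nonneg ζ) (norm_nonneg η)
    (fun a => mul_nonneg (wt_pos γ (S.pos a)).le (norm_nonneg (ζ a)))
    (fun a => mul_nonneg (wt_pos γ' (S.pos a)).le (norm_nonneg (η a))) ζ.hasSum_norm η.hasSum_norm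
  have hle : ∀ a, ‖ζ a‖ * ‖η a‖ ≤
      (wt γ (S.pos a) * ‖ζ a‖) * (wt γ' (S.pos a) * ‖η a‖) := by
    intro a
    have h := one_le_wt_mul_wt h₁ h₂ (S.pos a)
    calc ‖ζ a‖ * ‖η a‖ ≤ (wt γ (S.pos a) * wt γ' (S.pos a)) * (‖ζ a‖ * ‖η a‖) :=
          le_mul_of_one_le_left (by positivity) h
      _ = _ := by ring
  have hsum : Summable (fun a => ‖ζ a‖ * ‖η a‖) :=
    Summable.of_nonneg_of_le (fun a => by positivity) hle hs.summable
  exact ⟨C, hC, hsum, hs.tsum_eq ▸ hsum.tsum_le_tsum hle hs.summable⟩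

theorem summable_Omega (h₁ : 0 ≤ γ.1 + γ'.1) (h₂ : 0 ≤ γ.2 + γ'.2) (ζ : Y S γ) (η : Y S γ') :
    Summable (fun a => ζ a 0 * η a 1 - ζ a 1 * η a 0) := by
  obtain ⟨C, _, hs, _⟩ := summable_norm_mul_norm h₁ h₂ ζ η
  exact Summable.of_norm_bounded hs fun a => norm_mul_sub_mul_le _ _

/-- `Ω` as a bounded bilinear form on `Y_γ × Y_{γ'}`. -/
noncomputable def OmegaL (h₁ : 0 ≤ γ.1 + γ'.1) (h₂ : 0 ≤ γ.2 + γ'.2) :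
    Y S γ →L[ℂ] Y S γ' →L[ℂ] ℂ :=
  LinearMap.mkContinuous₂
    (LinearMap.mk₂ ℂ (fun (ζ : Y S γ) (η : Y S γ') => Omega S ζ η)
      (fun ζ ζ' η => by
        unfold Omega
        rw [← (summable_Omega h₁ h₂ ζ η).tsum_add (summable_Omega h₁ h₂ ζ' η)]
        congr 1; funext a; simp; ring)
      (fun c ζ η => by
        unfold Omega
        rw [smul_eq_mul, ← tsum_mul_left]
        congr 1; funext a; simp; ring)
      (fun ζ η η' => by
        unfold Omega
        rw [← (summable_Omega h₁ h₂ ζ η).tsum_add (summable_Omega h₁ h₂ ζ η')]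
        congr 1; funext a; simp; ring)
      (fun c ζ η => by
        unfold Omega
        rw [smul_eq_mul, ← tsum_mul_left]
        congr 1; funext a; simp; ring)) 1
    (fun ζ η => by
      obtain ⟨C, hC, hs, hs'⟩ := summable_norm_mul_norm h₁ h₂ ζ η
      rw [one_mul]
      exact (tsum_of_norm_bounded hs.hasSum fun a => norm_mul_sub_mul_le _ _).trans (hs'.trans hC))

@[simp] theorem OmegaL_apply (h₁ : 0 ≤ γ.1 + γ'.1) (h₂ : 0 ≤ γ.2 + γ'.2) (ζ : Y S γ) (η : Y S γ') :
    OmegaL h₁ h₂ ζ η = Omega S ζ η := rfl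

theorem Omega_neg_swap (ζ η : S.Idx → C2) : Omega S ζ η = -Omega S η ζ := by
  unfold Omega
  rw [← tsum_neg]
  congr 1; funext a; ring

theorem Omega_single (ζ : S.Idx → C2) (b : S.Idx) (v : C2) :
    Omega S ζ (Y.single S γ b v) = ζ b 0 * v 1 - ζ b 1 * v 0 := by
  unfold Omega
  rw [tsum_eq_single b]
  · rw [Y.single_apply_self]
  · intro a ha
    rw [Y.single_apply_ne ha]; simp

/-- A sequence which represents `l` is `J l`. -/
theorem Jseq_eq {l : Y S γ →L[ℂ] ℂ} {ζ : S.Idx → C2}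
    (h : ∀ b v, Omega S ζ (Y.single S γ b v) = l (Y.single S γ b v)) : Jseq S γ l = ζ := by
  funext a
  ext i
  fin_cases i
  · change l (Y.single S γ a !₂[0, 1]) = ζ a 0
    rw [← h, Omega_single]; simp
  · change -l (Y.single S γ a !₂[1, 0]) = ζ a 1
    rw [← h, Omega_single]; simp

theorem OmegaL_eq_of_Jseq (h₁ : 0 ≤ γ'.1 + γ.1) (h₂ : 0 ≤ γ'.2 + γ.2) {l : Y S γ →L[ℂ] ℂ}
    {ζ : Y S γ'} (h : (ζ : S.Idx → C2) = Jseq S γ l) : OmegaL h₁ h₂ ζ = l :=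
  Y.clm_ext fun b v => by rw [OmegaL_apply, h, Omega_Jseq_single]

theorem wt_neg (γ : ℝ × ℝ) (a : Fin d → ℤ) : wt (-γ) a = (wt γ a)⁻¹ := by
  have h1 : (1 : ℝ) ≤ japan a := le_max_right _ _
  unfold wt
  simp only [Prod.fst_neg, Prod.snd_neg, neg_mul]
  rw [Real.exp_neg, Real.rpow_neg (by linarith), mul_inv]

/-- The Riesz representation of a linear form on `Y_γ` by an element of `Y_{-γ}`. -/
theorem exists_Jseq (l : Y S γ →L[ℂ] ℂ) :
    ∃ ζ : Y S (-γ), (ζ : S.Idx → C2) = Jseq S γ l ∧ ‖ζ‖ ≤ ‖l‖ := by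
  classical
  let e := (Y.equivLp (S := S) (γ := γ))
  let l' : lp (fun _ : S.Idx => C2) 2 →L[ℂ] ℂ :=
    l.comp e.symm.toContinuousLinearEquiv.toContinuousLinearMap
  obtain ⟨v, hv⟩ := (InnerProductSpace.toDual ℂ (lp (fun _ : S.Idx => C2) 2)).surjective l'
  have hvn : ‖v‖ ≤ ‖l‖ := by
    rw [← (InnerProductSpace.toDual ℂ (lp (fun _ : S.Idx => C2) 2)).norm_map v, hv]
    refine ContinuousLinearMap.opNorm_le_bound _ (norm_nonneg _) fun f => ?_
    have h1 := l.le_opNorm (e.symm f)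
    rwa [e.symm.norm_map] at h1
  have hl : ∀ b w, l (Y.single S γ b w) = (wt γ (S.pos b) : ℂ) * inner ℂ (v b) w := by
    intro b w
    have h1 : l (Y.single S γ b w) = l' (e (Y.single S γ b w)) := by
      change _ = l (e.symm (e _))
      rw [e.symm_apply_apply]
    rw [h1, ← hv, InnerProductSpace.toDual_apply_apply]
    change inner ℂ v (Y.equivLp _) = _
    rw [Y.equivLp_single, lp.inner_single_right, inner_smul_right]
  have hin0 : ∀ b, inner ℂ (v b) (!₂[(1 : ℂ), 0] : C2) = star (v b 0) := fun b => by
    simp [PiLp.inner_apply, Fin.sum_univ_two]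
  have hin1 : ∀ b, inner ℂ (v b) (!₂[(0 : ℂ), 1] : C2) = star (v b 1) := fun b => by
    simp [PiLp.inner_apply, Fin.sum_univ_two]
  -- The weight of `Y_γ` enters the components of `J l` once, through the isometry with `ℓ²`; the
  -- inverse weight of `Y_{-γ}` cancels it exactly.
  have hJ : ∀ a, ‖weightMap S (-γ) (Jseq S γ l) a‖ = ‖v a‖ := by
    intro a
    have hp := wt_pos γ (S.pos a)
    rw [norm_weightMap_apply, wt_neg]
    have h1 : Jseq S γ l a = (wt γ (S.pos a) : ℂ) • (!₂[star (v a 1), -star (v a 0)] : C2) := by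
      ext i
      fin_cases i
      · change l (Y.single S γ a !₂[0, 1]) = _
        rw [hl, hin1]; simp
      · change -l (Y.single S γ a !₂[1, 0]) = _
        rw [hl, hin0]; simp
    rw [h1, norm_smul, Complex.norm_real, Real.norm_of_nonneg hp.le, inv_mul_cancel_left₀ hp.ne',
      EuclideanSpace.norm_eq, EuclideanSpace.norm_eq, Fin.sum_univ_two, Fin.sum_univ_two]
    congr 1
    simp [add_comm]
  have hmem : Jseq S γ l ∈ ySubmodule S (-γ) := by
    change Memℓp (weightMap S (-γ) (Jseq S γ l)) 2
    refine (memℓp_gen_iff (p := 2) (by norm_num)).2 ?_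
    have := (memℓp_gen_iff (p := 2) (by norm_num)).1 v.2
    simp only [hJ]
    exact this
  refine ⟨Y.mk S (-γ) _ hmem, rfl, le_trans (le_of_eq ?_) hvn⟩
  change ‖Y.toLp S (-γ) _‖ = _
  rw [lp.norm_eq_tsum_rpow (by norm_num), lp.norm_eq_tsum_rpow (by norm_num)]
  congr 2
  funext a
  change ‖weightMap S (-γ) (Jseq S γ l) a‖ ^ _ = _
  rw [hJ]

/-- An invertible map which preserves `Ω` on `Y_γ` is symplectic. -/
theorem isSymplecticOp_of_Omega {T R : Y S γ →L[ℂ] Y S γ} (hRT : ∀ x, R (T x) = x) (hTR : ∀ x, T (R x) = x)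
    (hT : ∀ x y : Y S γ, Omega S (T x) (T y) = Omega S x y) : IsSymplecticOp S γ T := by
  have h0₁ : 0 ≤ (-γ).1 + γ.1 := by simp
  have h0₂ : 0 ≤ (-γ).2 + γ.2 := by simp
  choose J hJ hJn using fun l : Y S γ →L[ℂ] ℂ => exists_Jseq l
  have hΩJ : ∀ l, OmegaL h0₁ h0₂ (J l) = l := fun l => OmegaL_eq_of_Jseq h0₁ h0₂ (hJ l)
  have hJeq : ∀ (l : Y S γ →L[ℂ] ℂ) (ζ : Y S (-γ)), OmegaL h0₁ h0₂ ζ = l → J l = ζ := by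
    intro l ζ h
    refine Subtype.ext ((hJ l).trans (Jseq_eq fun b v => ?_))
    rw [← h, OmegaL_apply]
  let JL : (Y S γ →L[ℂ] ℂ) →L[ℂ] Y S (-γ) := LinearMap.mkContinuous
    { toFun := J
      map_add' := fun l l' => hJeq _ _ (by rw [map_add, hΩJ, hΩJ])
      map_smul' := fun c l => hJeq _ _ (by rw [map_smul, hΩJ, RingHom.id_apply]) } 1
    fun l => by rw [one_mul]; exact hJn l
  -- The Ω-adjoint of `R = T⁻¹`: `Ω(T' η, x) = Ω(η, R x)`. It extends `T`, because invariance of `Ω`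
  -- gives the same identity for `T` on `Y_γ`.
  let T' : Y S (-γ) →L[ℂ] Y S (-γ) :=
    JL.comp (((ContinuousLinearMap.compL ℂ (Y S γ) (Y S γ) ℂ).flip R).comp (OmegaL h0₁ h0₂))
  have hT' : ∀ (η : Y S (-γ)) (x : Y S γ), Omega S (T' η) x = Omega S η (R x) := fun η x =>
    DFunLike.congr_fun (hΩJ ((OmegaL h0₁ h0₂ η).comp R)) x
  refine ⟨T', fun ζ η h => ?_, fun ζ η => ?_⟩
  · refine (hJ ((OmegaL h0₁ h0₂ η).comp R)).trans (Jseq_eq fun b v => ?_)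
    change Omega S (T ζ) (Y.single S γ b v) = Omega S η (R (Y.single S γ b v))
    rw [h, ← hT ζ (R (Y.single S γ b v)), hTR]
  · rw [Omega_neg_swap, hT', hRT, ← Omega_neg_swap]

end SymplecticForm

/-! ## The operator spaces `M^b_{γ,ϰ}` -/

section Weights

variable {d : ℕ}

theorem latNorm_eq_norm (a : Fin d → ℤ) :
    latNorm a = ‖(WithLp.toLp 2 (fun i => (a i : ℝ)) : EuclideanSpace ℝ (Fin d))‖ := by
  rw [EuclideanSpace.norm_eq]
  simp [latNorm]

theorem latNorm_add_le (a b : Fin d → ℤ) : latNorm (a + b) ≤ latNorm a + latNorm b := by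
  simp only [latNorm_eq_norm]
  refine le_trans (le_of_eq ?_) (norm_add_le _ _)
  congr 1
  ext i
  simp

theorem latNorm_neg (a : Fin d → ℤ) : latNorm (-a) = latNorm a := by
  simp [latNorm]

theorem latNorm_nonneg (a : Fin d → ℤ) : 0 ≤ latNorm a := Real.sqrt_nonneg _

theorem pdist_nonneg (a b : Fin d → ℤ) : 0 ≤ pdist a b :=
  le_min (latNorm_nonneg _) (latNorm_nonneg _)

theorem pdist_comm (a b : Fin d → ℤ) : pdist a b = pdist b a := by
  unfold pdist
  rw [← latNorm_neg (a - b), neg_sub, add_comm]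

/-- `pdist` is the distance modulo sign; each of the four choices of signs is a triangle inequality
for the Euclidean norm. -/
theorem pdist_triangle (a b c : Fin d → ℤ) : pdist a c ≤ pdist a b + pdist b c := by
  have h1 : latNorm (a - c) ≤ latNorm (a - b) + latNorm (b - c) := by
    have := latNorm_add_le (a - b) (b - c)
    rwa [sub_add_sub_cancel] at this
  have h2 : latNorm (a + c) ≤ latNorm (a - b) + latNorm (b + c) := by
    have := latNorm_add_le (a - b) (b + c)
    rwa [show a - b + (b + c) = a + c by abel] at this
  have h3 : latNorm (a + c) ≤ latNorm (a + b) + latNorm (b - c) := by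
    have := latNorm_add_le (a + b) (-(b - c))
    rwa [latNorm_neg, show a + b + -(b - c) = a + c by abel] at this
  have h4 : latNorm (a - c) ≤ latNorm (a + b) + latNorm (b + c) := by
    have := latNorm_add_le (a + b) (-(b + c))
    rwa [latNorm_neg, show a + b + -(b + c) = a - c by abel] at this
  unfold pdist
  rcases min_cases (latNorm (a - b)) (latNorm (a + b)) with h | h <;>
  rcases min_cases (latNorm (b - c)) (latNorm (b + c)) with h' | h' <;> rw [h.1, h'.1]
  · exact (min_le_left _ _).trans h1
  · exact (min_le_right _ _).trans h2
  · exact (min_le_right _ _).trans h3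
  · exact (min_le_left _ _).trans h4

theorem one_le_japan (a : Fin d → ℤ) : 1 ≤ japan a := le_max_right _ _

theorem japan_le_add_pdist (a b : Fin d → ℤ) : japan a ≤ japan b + pdist a b := by
  have h1 : latNorm a ≤ latNorm b + latNorm (a - b) := by
    have := latNorm_add_le b (a - b)
    rwa [show b + (a - b) = a by abel] at this
  have h2 : latNorm a ≤ latNorm b + latNorm (a + b) := by
    have := latNorm_add_le (a + b) (-b)
    rw [latNorm_neg, show a + b + -b = a by abel] at this
    linarith
  have h3 : latNorm b ≤ japan b := le_max_left _ _
  refine max_le ?_ (by have := one_le_japan b; have := pdist_nonneg a b; linarith)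
  unfold pdist
  rcases min_cases (latNorm (a - b)) (latNorm (a + b)) with h | h <;> rw [h.1] <;> linarith

/-- Let `x`, `y` be the two distances on the right and `M` the minimum on the left; then `x + y ≤
2xy`. If `M ≤ ⟨b⟩`, then `M` is at most the product of the two minima. Otherwise both minima equal
`⟨b⟩`, and `M ≤ ⟨b⟩ + min(x,y) ≤ 2 ⟨b⟩ min(x,y)`, while `x + y ≤ 2 max(x,y)`; the product of these
two bounds is the worst case, with constant `4`. -/
theorem max_pdist_mul_min_japan_le (a b c : Fin d → ℤ) :
    max (pdist a c) 1 * min (japan a) (japan c) ≤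
      4 * ((max (pdist a b) 1 * min (japan a) (japan b)) *
        (max (pdist b c) 1 * min (japan b) (japan c))) := by
  set x := max (pdist a b) 1 with hx
  set y := max (pdist b c) 1 with hy
  set A := japan a
  set B := japan b
  set C := japan c
  have hx1 : 1 ≤ x := le_max_right _ _
  have hy1 : 1 ≤ y := le_max_right _ _
  have hA : 1 ≤ A := one_le_japan a
  have hB : 1 ≤ B := one_le_japan b
  have hC : 1 ≤ C := one_le_japan c
  have hxd : pdist a b ≤ x := le_max_left _ _
  have hyd : pdist b c ≤ y := le_max_left _ _
  have hz : max (pdist a c) 1 ≤ x + y :=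
    max_le ((pdist_triangle a b c).trans (add_le_add hxd hyd)) (by linarith)
  have hAB : A ≤ B + x := (japan_le_add_pdist a b).trans (by linarith)
  have hCB : C ≤ B + y := (japan_le_add_pdist c b).trans (by rw [pdist_comm]; linarith)
  have hm1 : 1 ≤ min A C := le_min hA hC
  have hmA : min A C ≤ A := min_le_left _ _
  have hmC : min A C ≤ C := min_le_right _ _
  set M := min A C
  have hz' : max (pdist a c) 1 * M ≤ (x + y) * M := by gcongr
  refine hz'.trans ?_
  have hxy : x + y ≤ 2 * (x * y) := by nlinarith [mul_nonneg (sub_nonneg.2 hx1) (sub_nonneg.2 hy1)]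
  rcases le_total M B with hMB | hMB
  · have hc : M ≤ min A B * min B C := by
      have h1 : M ≤ min A B := le_min hmA hMB
      have h2 : 1 ≤ min B C := le_min hB hC
      nlinarith
    calc (x + y) * M ≤ (2 * (x * y)) * (min A B * min B C) := by gcongr
      _ ≤ 4 * ((x * min A B) * (y * min B C)) := by
          have : 0 ≤ x * y * (min A B * min B C) := by positivity
          nlinarith
  · have e1 : min A B = B := min_eq_right (hMB.trans hmA)
    have e2 : min B C = B := min_eq_left (hMB.trans hmC)
    rw [e1, e2]
    have key : ∀ u v : ℝ, 1 ≤ u → 1 ≤ v → u ≤ v → M ≤ B + u →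
        (u + v) * M ≤ 4 * ((u * B) * (v * B)) := by
      intro u v hu hv huv hM
      have h1 : B + u ≤ 2 * (B * u) := by
        nlinarith [mul_nonneg (sub_nonneg.2 hB) (sub_nonneg.2 hu)]
      have h3 : M ≤ 2 * (B * u) := hM.trans h1
      have h2 : B * u * v * 1 ≤ B * u * v * B := by gcongr
      calc (u + v) * M ≤ (2 * v) * (2 * (B * u)) := by gcongr; linarith
        _ ≤ _ := by nlinarith
    rcases le_total x y with hle | hle
    · exact key x y hx1 hy1 hle (hmA.trans hAB)
    · have := key y x hy1 hx1 hle (hmC.trans hCB)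
      rw [add_comm y x] at this
      linarith

theorem expWt_nonneg {K κ : ℝ} (hK : 0 ≤ K) (γ : ℝ × ℝ) (a b : Fin d → ℤ) :
    0 ≤ expWt K γ κ a b := by
  unfold expWt
  have h1 : (0 : ℝ) ≤ max (pdist a b) 1 := le_max_of_le_right zero_le_one
  have h2 : 0 ≤ min (japan a) (japan b) :=
    le_min (zero_le_one.trans (one_le_japan a)) (zero_le_one.trans (one_le_japan b))
  have := Real.exp_nonneg (γ.1 * pdist a b)
  positivity

/-- The exponents of the distance and of the minimum agree, so both factors merge into one power,
submultiplicative up to `4 ^ κ`. On the right the constant `K` occurs twice, and the second copy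
pays for `4 ^ κ`. -/
theorem expWt_mul_le {K κ c : ℝ} (hκ : 0 ≤ κ) (hK : 4 ^ κ ≤ K) (hc : 0 ≤ c) (a b e : Fin d → ℤ) :
    expWt K (c, κ) κ a e ≤ expWt K (c, κ) κ a b * expWt K (c, κ) κ b e := by
  have hK0 : 0 < K := lt_of_lt_of_le (by positivity) hK
  have hform : ∀ a b : Fin d → ℤ, expWt K (c, κ) κ a b =
      K * Real.exp (c * pdist a b) * (max (pdist a b) 1 * min (japan a) (japan b)) ^ κ := by
    intro a b
    have h1 : (0 : ℝ) ≤ max (pdist a b) 1 := le_max_of_le_right zero_le_one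
    have h2 : 0 ≤ min (japan a) (japan b) :=
      le_min (zero_le_one.trans (one_le_japan a)) (zero_le_one.trans (one_le_japan b))
    rw [Real.mul_rpow h1 h2, ← mul_assoc]
    rfl
  have hpos : ∀ a b : Fin d → ℤ, 0 ≤ max (pdist a b) 1 * min (japan a) (japan b) := fun a b =>
    mul_nonneg (le_max_of_le_right zero_le_one)
      (le_min (zero_le_one.trans (one_le_japan a)) (zero_le_one.trans (one_le_japan b)))
  rw [hform, hform, hform]
  have h1 : Real.exp (c * pdist a e) ≤ Real.exp (c * pdist a b) * Real.exp (c * pdist b e) := by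
    rw [← Real.exp_add, ← mul_add]
    exact Real.exp_le_exp.2 (mul_le_mul_of_nonneg_left (pdist_triangle a b e) hc)
  have h2 := Real.rpow_le_rpow (hpos a e) (max_pdist_mul_min_japan_le a b e) hκ
  rw [Real.mul_rpow (by norm_num) (mul_nonneg (hpos a b) (hpos b e)),
    Real.mul_rpow (hpos a b) (hpos b e)] at h2
  set P := (max (pdist a b) 1 * min (japan a) (japan b)) ^ κ
  set Q := (max (pdist b e) 1 * min (japan b) (japan e)) ^ κ
  have hP : 0 ≤ P := Real.rpow_nonneg (hpos _ _) _
  have hQ : 0 ≤ Q := Real.rpow_nonneg (hpos _ _) _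
  have h3 : (max (pdist a e) 1 * min (japan a) (japan e)) ^ κ ≤ K * (P * Q) :=
    h2.trans (mul_le_mul_of_nonneg_right hK (mul_nonneg hP hQ))
  calc K * Real.exp (c * pdist a e) * (max (pdist a e) 1 * min (japan a) (japan e)) ^ κ
      ≤ K * (Real.exp (c * pdist a b) * Real.exp (c * pdist b e)) * (K * (P * Q)) := by
        have := Real.rpow_nonneg (hpos a e) κ
        gcongr
    _ = _ := by ring

end Weights

/-! ### Products and limits in the matrix norm -/

section OperatorSpace

open Filter Topology Metric

variable {d : ℕ} {S : Modes d} {γ : ℝ × ℝ}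

theorem block_eq_comp (T : Y S γ →L[ℂ] Y S γ) (a b : S.Idx) :
    block T a b = (Y.coordL a).comp (T.comp (Y.singleL b)) := rfl

theorem continuous_block (a b : S.Idx) :
    Continuous fun T : Y S γ →L[ℂ] Y S γ => block T a b := by
  simp only [block_eq_comp]
  fun_prop

theorem enorm_block_comp_le (A B : Y S γ →L[ℂ] Y S γ) (a e : S.Idx) :
    ‖block (A.comp B) a e‖ₑ ≤ ∑' b, ‖block A a b‖ₑ * ‖block B b e‖ₑ := by
  refine ContinuousLinearMap.opENorm_le_bound _ fun v => ?_
  have h := ((B (Y.single S γ e v)).hasSum_single.mapL A).mapL (Y.coordL a)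
  have h2 : block (A.comp B) a e v = ∑' b, block A a b (block B b e v) := h.tsum_eq.symm
  rw [h2, ← ENNReal.tsum_mul_right]
  refine enorm_tsum_le_tsum_enorm.trans (ENNReal.tsum_le_tsum fun b => ?_)
  refine ((block A a b).le_opENorm _).trans ?_
  rw [mul_assoc]
  gcongr
  exact (block B b e).le_opENorm _

variable {K κ : ℝ}

/-- The weight splits at every intermediate index, so weighted row sums of a product are bounded by
products of weighted row sums after exchanging the summations; likewise for columns. -/
theorem decayNorm_comp_le {c : ℝ} (hκ : 0 ≤ κ) (hK : 4 ^ κ ≤ K) (hc : 0 ≤ c)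
    (A B : Y S γ →L[ℂ] Y S γ) :
    decayNorm K (c, κ) κ (A.comp B) ≤ decayNorm K (c, κ) κ A * decayNorm K (c, κ) κ B := by
  have hK0 : 0 ≤ K := le_trans (by positivity) hK
  let e : S.Idx → S.Idx → ℝ≥0∞ := fun a b =>
    ENNReal.ofReal (expWt K (c, κ) κ (S.pos a) (S.pos b))
  have he : ∀ a b f, e a f ≤ e a b * e b f := fun a b f => by
    simp only [e]
    rw [← ENNReal.ofReal_mul (expWt_nonneg hK0 _ _ _)]
    exact ENNReal.ofReal_le_ofReal (expWt_mul_le hκ hK hc _ _ _)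
  have hterm : ∀ a f, ‖block (A.comp B) a f‖ₑ * e a f ≤
      ∑' b, (‖block A a b‖ₑ * e a b) * (‖block B b f‖ₑ * e b f) := by
    intro a f
    refine (mul_le_mul_left (enorm_block_comp_le A B a f) _).trans ?_
    rw [← ENNReal.tsum_mul_right]
    refine ENNReal.tsum_le_tsum fun b => ?_
    calc _ ≤ ‖block A a b‖ₑ * ‖block B b f‖ₑ * (e a b * e b f) := by gcongr; exact he a b f
      _ = _ := by ring
  have hrow : ∀ (T : Y S γ →L[ℂ] Y S γ) a, ∑' b, ‖block T a b‖ₑ * e a b ≤ decayNorm K (c, κ) κ T :=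
    fun T a => le_max_of_le_left (le_iSup (fun a => ∑' b, ‖block T a b‖ₑ * e a b) a)
  have hcol : ∀ (T : Y S γ →L[ℂ] Y S γ) b, ∑' a, ‖block T a b‖ₑ * e a b ≤ decayNorm K (c, κ) κ T :=
    fun T b => le_max_of_le_right (le_iSup (fun b => ∑' a, ‖block T a b‖ₑ * e a b) b)
  refine max_le (iSup_le fun a => ?_) (iSup_le fun f => ?_)
  · calc ∑' f, ‖block (A.comp B) a f‖ₑ * e a f
        ≤ ∑' f, ∑' b, (‖block A a b‖ₑ * e a b) * (‖block B b f‖ₑ * e b f) :=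
          ENNReal.tsum_le_tsum (hterm a)
      _ = ∑' b, (‖block A a b‖ₑ * e a b) * ∑' f, ‖block B b f‖ₑ * e b f := by
          rw [ENNReal.tsum_comm]
          simp only [ENNReal.tsum_mul_left]
      _ ≤ ∑' b, (‖block A a b‖ₑ * e a b) * decayNorm K (c, κ) κ B :=
          ENNReal.tsum_le_tsum fun b => mul_le_mul_right (hrow B b) _
      _ ≤ _ := by
          rw [ENNReal.tsum_mul_right]
          exact mul_le_mul_left (hrow A a) _
  · calc ∑' a, ‖block (A.comp B) a f‖ₑ * e a f
        ≤ ∑' a, ∑' b, (‖block A a b‖ₑ * e a b) * (‖block B b f‖ₑ * e b f) :=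
          ENNReal.tsum_le_tsum fun a => hterm a f
      _ = ∑' b, (∑' a, ‖block A a b‖ₑ * e a b) * (‖block B b f‖ₑ * e b f) := by
          rw [ENNReal.tsum_comm]
          simp only [ENNReal.tsum_mul_right]
      _ ≤ ∑' b, decayNorm K (c, κ) κ A * (‖block B b f‖ₑ * e b f) :=
          ENNReal.tsum_le_tsum fun b => mul_le_mul_left (hcol A b) _
      _ ≤ _ := by
          rw [ENNReal.tsum_mul_left]
          exact mul_le_mul_right (hcol B f) _

/-- The matrix norm is a supremum of finite sums of functions continuous in the operator norm, hence
lower semicontinuous. -/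
theorem isClosed_decayNorm_le (γ' : ℝ × ℝ) (C : ℝ≥0∞) :
    IsClosed {T : Y S γ →L[ℂ] Y S γ | decayNorm K γ' κ T ≤ C} := by
  have hsum : ∀ (f : (Y S γ →L[ℂ] Y S γ) → S.Idx → ℝ≥0∞), (∀ a, Continuous fun T => f T a) →
      IsClosed {T | ∑' a, f T a ≤ C} := by
    intro f hf
    have h1 : {T | ∑' a, f T a ≤ C} = ⋂ s : Finset S.Idx, {T | ∑ a ∈ s, f T a ≤ C} := by
      ext T
      simp only [ENNReal.tsum_eq_iSup_sum, mem_ofPred_eq, mem_iInter, iSup_le_iff]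
    rw [h1]
    exact isClosed_iInter fun s => isClosed_le (continuous_finsetSum _ fun a _ => hf a)
      continuous_const
  have hc : ∀ a b, Continuous fun T : Y S γ →L[ℂ] Y S γ =>
      ‖block T a b‖ₑ * ENNReal.ofReal (expWt K γ' κ (S.pos a) (S.pos b)) := fun a b =>
    ENNReal.continuous_mul_const ENNReal.ofReal_ne_top |>.comp (continuous_block a b).enorm
  have h2 : {T : Y S γ →L[ℂ] Y S γ | decayNorm K γ' κ T ≤ C} =
      (⋂ a, {T | ∑' b, ‖block T a b‖ₑ * ENNReal.ofReal (expWt K γ' κ (S.pos a) (S.pos b)) ≤ C}) ∩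
      ⋂ b, {T | ∑' a, ‖block T a b‖ₑ * ENNReal.ofReal (expWt K γ' κ (S.pos a) (S.pos b)) ≤ C} := by
    ext T
    simp only [decayNorm, mem_ofPred_eq, max_le_iff, iSup_le_iff, mem_inter_iff, mem_iInter]
  rw [h2]
  exact (isClosed_iInter fun a => hsum _ fun b => hc a b).inter
    (isClosed_iInter fun b => hsum _ fun a => hc a b)

variable {m : ℝ}

theorem Mb.norm_def (T : Mb S γ K m κ) :
    ‖T‖ = ‖T.1‖ + (decayNorm K (γ.1, γ.2 + κ - m) κ T.1).toReal := rfl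

theorem Mb.decayNorm_lt_top (T : Mb S γ K m κ) : decayNorm K (γ.1, γ.2 + κ - m) κ T.1 < ⊤ := T.2

theorem Mb.norm_val_le (T : Mb S γ K m κ) : ‖T.1‖ ≤ ‖T‖ := by
  rw [Mb.norm_def]
  exact le_add_of_nonneg_right ENNReal.toReal_nonneg

theorem Mb.decayNorm_le (T : Mb S γ K m κ) :
    decayNorm K (γ.1, γ.2 + κ - m) κ T.1 ≤ ENNReal.ofReal ‖T‖ := by
  rw [← ENNReal.ofReal_toReal T.decayNorm_lt_top.ne]
  refine ENNReal.ofReal_le_ofReal ?_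
  rw [Mb.norm_def]
  exact le_add_of_nonneg_left (norm_nonneg _)

/-- The action of `M^b_{γ,ϰ}` on `Y_γ`. -/
noncomputable def Mb.act : Mb S γ K m κ →L[ℂ] Y S γ →L[ℂ] Y S γ :=
  LinearMap.mkContinuous
    { toFun := fun T => T.1
      map_add' := fun _ _ => rfl
      map_smul' := fun _ _ => rfl } 1 fun T => by rw [one_mul]; exact T.norm_val_le

@[simp] theorem Mb.act_apply (T : Mb S γ K m κ) : Mb.act T = T.1 := rfl

theorem Mb.act_injective : Function.Injective (Mb.act : Mb S γ K m κ → _) := fun _ _ h =>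
  Subtype.ext h

theorem toMb_eq {T : Y S γ →L[ℂ] Y S γ} {M : Mb S γ K m κ} (h : Mb.act M = T) :
    toMb S γ K m κ T = M := by
  have h1 : M.1 = T := h
  subst h1
  exact Subtype.ext (toMb_coe S γ K m κ M.2)

/-- A Cauchy sequence converges in operator norm, and lower semicontinuity of the matrix norm
carries the Cauchy inequalities over to the limit. -/
instance : CompleteSpace (Mb S γ K m κ) := by
  refine Metric.complete_of_cauchySeq_tendsto fun u hu => ?_
  have hc : CauchySeq fun n => Mb.act (u n) :=
    hu.map (Mb.act (S := S) (γ := γ) (K := K) (m := m) (κ := κ)).uniformContinuous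
  obtain ⟨T, hT⟩ := cauchySeq_tendsto_of_complete hc
  have key : ∀ ε > 0, ∃ N, ∀ n ≥ N,
      decayNorm K (γ.1, γ.2 + κ - m) κ ((u n).1 - T) ≤ ENNReal.ofReal ε := by
    intro ε hε
    obtain ⟨N, hN⟩ := Metric.cauchySeq_iff.1 hu ε hε
    refine ⟨N, fun n hn => ?_⟩
    have h1 : Tendsto (fun k => (u n).1 - Mb.act (u k)) atTop (𝓝 ((u n).1 - T)) :=
      tendsto_const_nhds.sub hT
    refine (isClosed_decayNorm_le (γ.1, γ.2 + κ - m) (ENNReal.ofReal ε)).mem_of_tendsto h1 ?_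
    filter_upwards [eventually_ge_atTop N] with k hk
    have h2 := hN n hn k hk
    rw [dist_eq_norm] at h2
    exact (Mb.decayNorm_le (u n - u k)).trans (ENNReal.ofReal_le_ofReal h2.le)
  have hmem : T ∈ mbSubmodule S γ K m κ := by
    obtain ⟨N, hN⟩ := key 1 one_pos
    have h1 : (u N).1 - T ∈ mbSubmodule S γ K m κ := (hN N le_rfl).trans_lt ENNReal.ofReal_lt_top
    have h2 := Submodule.sub_mem _ (u N).2 h1
    rwa [sub_sub_cancel] at h2
  refine ⟨Mb.mk S γ K m κ T hmem, ?_⟩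
  rw [Metric.tendsto_atTop]
  intro ε hε
  obtain ⟨N, hN⟩ := key (ε / 3) (by positivity)
  obtain ⟨N', hN'⟩ := Metric.tendsto_atTop.1 hT (ε / 3) (by positivity)
  refine ⟨max N N', fun n hn => ?_⟩
  have h1 := hN n ((le_max_left _ _).trans hn)
  have h2 := hN' n ((le_max_right _ _).trans hn)
  rw [dist_eq_norm] at h2 ⊢
  rw [Mb.norm_def]
  have h3 : (decayNorm K (γ.1, γ.2 + κ - m) κ ((u n).1 - T)).toReal ≤ ε / 3 :=
    ENNReal.toReal_le_of_le_ofReal (by positivity) h1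
  change ‖(u n).1 - T‖ + (decayNorm K (γ.1, γ.2 + κ - m) κ ((u n).1 - T)).toReal < ε
  change ‖(u n).1 - T‖ < ε / 3 at h2
  linarith

end OperatorSpace

/-! ### The algebra structure of the operator space -/

section OperatorAlgebra

variable {d : ℕ} {S : Modes d} {K κ m c : ℝ}

/-- For the weight `(c, m)` the exponent `m + κ - m` in the norm is just `κ`, the case in which the
weights are submultiplicative. -/
theorem decayNorm_comp_le_of_mem (hκ : 0 ≤ κ) (hK : 4 ^ κ ≤ K) (hc : 0 ≤ c)
    (A B : Mb S (c, m) K m κ) :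
    decayNorm K (c, m + κ - m) κ (A.1.comp B.1) ≤
      decayNorm K (c, m + κ - m) κ A.1 * decayNorm K (c, m + κ - m) κ B.1 := by
  rw [add_sub_cancel_left]
  exact decayNorm_comp_le hκ hK hc A.1 B.1

/-- The product in `M^b_{γ,ϰ}`. -/
noncomputable def Mb.comp (hκ : 0 ≤ κ) (hK : 4 ^ κ ≤ K) (hc : 0 ≤ c) (A B : Mb S (c, m) K m κ) :
    Mb S (c, m) K m κ :=
  Mb.mk S (c, m) K m κ (A.1.comp B.1) ((decayNorm_comp_le_of_mem hκ hK hc A B).trans_lt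
    (ENNReal.mul_lt_top A.2 B.2))

theorem Mb.norm_comp_le (hκ : 0 ≤ κ) (hK : 4 ^ κ ≤ K) (hc : 0 ≤ c) (A B : Mb S (c, m) K m κ) :
    ‖Mb.comp hκ hK hc A B‖ ≤ 1 * ‖A‖ * ‖B‖ := by
  rw [one_mul, Mb.norm_def, Mb.norm_def, Mb.norm_def]
  have h1 : ‖(Mb.comp hκ hK hc A B).1‖ ≤ ‖A.1‖ * ‖B.1‖ := A.1.opNorm_comp_le B.1
  have h2 : (decayNorm K (c, m + κ - m) κ (Mb.comp hκ hK hc A B).1).toReal ≤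
      (decayNorm K (c, m + κ - m) κ A.1).toReal * (decayNorm K (c, m + κ - m) κ B.1).toReal := by
    rw [← ENNReal.toReal_mul]
    exact ENNReal.toReal_mono (ENNReal.mul_lt_top A.2 B.2).ne
      (decayNorm_comp_le_of_mem hκ hK hc A B)
  have h3 := norm_nonneg A.1
  have h4 := norm_nonneg B.1
  have h5 := ENNReal.toReal_nonneg (a := decayNorm K (c, m + κ - m) κ A.1)
  have h6 := ENNReal.toReal_nonneg (a := decayNorm K (c, m + κ - m) κ B.1)
  simp only
  nlinarith [mul_nonneg h3 h6, mul_nonneg h5 h4]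

/-- `M^b_{γ,ϰ}` as an algebra of operators of `Y_γ`. -/
noncomputable def mbAlg (S : Modes d) (m : ℝ) (hκ : 0 ≤ κ) (hK : 4 ^ κ ≤ K) (hc : 0 ≤ c) :
    OpAlg (Y S (c, m)) (Mb S (c, m) K m κ) where
  act := Mb.act
  mul := LinearMap.mkContinuous₂
    (LinearMap.mk₂ ℂ (Mb.comp hκ hK hc)
      (fun A A' B => Mb.act_injective (ContinuousLinearMap.add_comp A.1 A'.1 B.1))
      (fun c A B => Mb.act_injective (ContinuousLinearMap.smul_comp c A.1 B.1))
      (fun A B B' => Mb.act_injective (ContinuousLinearMap.comp_add A.1 B.1 B'.1))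
      (fun c A B => Mb.act_injective (ContinuousLinearMap.comp_smul A.1 c B.1))) 1
    (Mb.norm_comp_le hκ hK hc)
  norm_act_le A x := (A.1.le_opNorm x).trans
    (mul_le_mul_of_nonneg_right A.norm_val_le (norm_nonneg x))
  norm_mul_le A B := (Mb.norm_comp_le hκ hK hc A B).trans_eq (by rw [one_mul])
  act_mul _ _ _ := rfl

end OperatorAlgebra

/-! ## The domains `O_γ(σ,μ)` -/

section Domains

open Filter Topology Metric

variable {d : ℕ} {S : Modes d} {γ γ' : ℝ × ℝ} {σ μ σ' μ' : ℝ}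

theorem norm_sq_C2 (v : C2) : ‖v‖ ^ 2 = ‖v 0‖ ^ 2 + ‖v 1‖ ^ 2 := by
  rw [EuclideanSpace.norm_sq_eq, Fin.sum_univ_two]

theorem norm_C2_le {v w : C2} {c : ℝ} (hc : 0 ≤ c) (h0 : ‖v 0‖ ≤ c * ‖w 0‖)
    (h1 : ‖v 1‖ ≤ c * ‖w 1‖) : ‖v‖ ≤ c * ‖w‖ := by
  refine (abs_le_of_sq_le_sq' ?_ (by positivity)).2
  rw [mul_pow, norm_sq_C2, norm_sq_C2 w, mul_add, ← mul_pow, ← mul_pow]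
  gcongr

/-- Termwise bounds of sequences. -/
theorem memℓp_of_norm_le {ζ : S.Idx → C2} {x : Y S γ} {c : ℝ} (h : ∀ a, ‖ζ a‖ ≤ c * ‖x a‖) :
    ζ ∈ ySubmodule S γ := by
  change Memℓp (weightMap S γ ζ) 2
  refine (memℓp_gen_iff (p := 2) (by norm_num)).2 ?_
  rw [ENNReal.toReal_ofNat]
  refine Summable.of_nonneg_of_le (fun a => by positivity) (fun a => ?_)
    (x.hasSum_norm.summable.mul_left (c ^ (2 : ℝ)))
  have hp := wt_pos γ (S.pos a)
  rw [norm_weightMap_apply, Real.rpow_ofNat, Real.rpow_ofNat, Real.rpow_ofNat, ← mul_pow]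
  refine pow_le_pow_left₀ (by positivity) ?_ 2
  calc wt γ (S.pos a) * ‖ζ a‖ ≤ wt γ (S.pos a) * (c * ‖x a‖) := by gcongr; exact h a
    _ = _ := by ring

theorem Y.norm_le_of_apply_le {y x : Y S γ} {c : ℝ} (hc : 0 ≤ c) (h : ∀ a, ‖y a‖ ≤ c * ‖x a‖) :
    ‖y‖ ≤ c * ‖x‖ := by
  have h1 : ‖y‖ ^ (2 : ℝ) ≤ c ^ (2 : ℝ) * ‖x‖ ^ (2 : ℝ) := by
    refine hasSum_le (fun a => ?_) y.hasSum_norm (x.hasSum_norm.mul_left (c ^ (2 : ℝ)))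
    have hp := wt_pos γ (S.pos a)
    rw [Real.rpow_ofNat, Real.rpow_ofNat, Real.rpow_ofNat, ← mul_pow]
    refine pow_le_pow_left₀ (by positivity) ?_ 2
    calc wt γ (S.pos a) * ‖y a‖ ≤ wt γ (S.pos a) * (c * ‖x a‖) := by gcongr; exact h a
      _ = _ := by ring
  rw [← Real.mul_rpow hc (norm_nonneg _)] at h1
  exact (Real.rpow_le_rpow_iff (norm_nonneg _) (by positivity) (by norm_num)).1 h1

theorem scaleSeq_inl_zero (ζ : S.Idx → C2) (a : ↥S.A) :
    scaleSeq S σ μ ζ (Sum.inl a) 0 = ζ (Sum.inl a) 0 / μ := rfl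

theorem scaleSeq_inl_one (ζ : S.Idx → C2) (a : ↥S.A) :
    scaleSeq S σ μ ζ (Sum.inl a) 1 = Complex.I * ((ζ (Sum.inl a) 1).im : ℂ) / σ := rfl

theorem scaleSeq_inr (ζ : S.Idx → C2) (b : ↥S.F ⊕ ↥S.Linf) :
    scaleSeq S σ μ ζ (Sum.inr b) = (μ : ℂ)⁻¹ • ζ (Sum.inr b) := rfl

theorem norm_scaleSeq_le_of_le (hσ : 0 < σ) (hμ : 0 < μ) {c : ℝ} (h₁ : σ⁻¹ ≤ c) (h₂ : μ⁻¹ ≤ c)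
    (ζ : S.Idx → C2) (a : S.Idx) : ‖scaleSeq S σ μ ζ a‖ ≤ c * ‖ζ a‖ := by
  have hc : 0 ≤ c := le_trans (inv_nonneg.2 hσ.le) h₁
  rcases a with a | b
  · refine norm_C2_le hc ?_ ?_
    · rw [scaleSeq_inl_zero, norm_div, Complex.norm_real, Real.norm_of_nonneg hμ.le,
        div_eq_inv_mul]
      gcongr
    · rw [scaleSeq_inl_one, norm_div, norm_mul, Complex.norm_I, one_mul, Complex.norm_real,
        Complex.norm_real, Real.norm_of_nonneg hσ.le, div_eq_inv_mul]
      gcongr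
      exact Complex.abs_im_le_norm _
  · rw [scaleSeq_inr, norm_smul, norm_inv, Complex.norm_real, Real.norm_of_nonneg hμ.le]
    gcongr

theorem norm_scaleSeq_le_scaleSeq (hσ : 0 < σ) (hμ : 0 < μ) (hσ' : 0 < σ') (hμ' : 0 < μ') {c : ℝ}
    (h₁ : σ' / σ ≤ c) (h₂ : μ' / μ ≤ c) (ζ : S.Idx → C2) (a : S.Idx) :
    ‖scaleSeq S σ μ ζ a‖ ≤ c * ‖scaleSeq S σ' μ' ζ a‖ := by
  have hc : 0 ≤ c := le_trans (by positivity) h₁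
  have e1 : ∀ x : ℝ, 0 ≤ x → x / σ ≤ c * (x / σ') := fun x hx => by
    calc x / σ = σ' / σ * (x / σ') := by field_simp
      _ ≤ _ := by gcongr
  have e2 : ∀ x : ℝ, 0 ≤ x → x / μ ≤ c * (x / μ') := fun x hx => by
    calc x / μ = μ' / μ * (x / μ') := by field_simp
      _ ≤ _ := by gcongr
  rcases a with a | b
  · refine norm_C2_le hc ?_ ?_
    · rw [scaleSeq_inl_zero, scaleSeq_inl_zero, norm_div, norm_div, Complex.norm_real,
        Complex.norm_real, Real.norm_of_nonneg hμ.le, Real.norm_of_nonneg hμ'.le]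
      exact e2 _ (norm_nonneg _)
    · rw [scaleSeq_inl_one, scaleSeq_inl_one, norm_div, norm_div, norm_mul, Complex.norm_I, one_mul,
        Complex.norm_real, Complex.norm_real, Complex.norm_real, Real.norm_of_nonneg hσ.le,
        Real.norm_of_nonneg hσ'.le]
      exact e1 _ (norm_nonneg _)
  · rw [scaleSeq_inr, scaleSeq_inr, norm_smul, norm_smul, norm_inv, norm_inv, Complex.norm_real,
      Complex.norm_real, Real.norm_of_nonneg hμ.le, Real.norm_of_nonneg hμ'.le, inv_mul_eq_div,
      inv_mul_eq_div]
    exact e2 _ (norm_nonneg _)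

theorem scaleSeq_add (ζ ζ' : S.Idx → C2) (a : S.Idx) :
    scaleSeq S σ μ (fun b => ζ b + ζ' b) a = scaleSeq S σ μ ζ a + scaleSeq S σ μ ζ' a := by
  rcases a with a | b
  · ext i
    fin_cases i
    · simp [scaleSeq, add_div]
    · simp [scaleSeq, mul_add, add_div]
  · simp [scaleSeq]

theorem scaleSeq_smul (c : ℝ) (ζ : S.Idx → C2) (a : S.Idx) :
    scaleSeq S σ μ (fun b => (c : ℂ) • ζ b) a = (c : ℂ) • scaleSeq S σ μ ζ a := by
  rcases a with a | b
  · ext i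
    fin_cases i
    · simp [scaleSeq, mul_div_assoc]
    · simp [scaleSeq]; ring
  · rw [scaleSeq_inr, scaleSeq_inr, smul_comm]

/-- The rescaling as a real linear map. -/
noncomputable def scaleₗ (hσ : 0 < σ) (hμ : 0 < μ) : Y S γ →ₗ[ℝ] Y S γ where
  toFun x := ⟨scaleSeq S σ μ x, memℓp_of_norm_le (x := x)
    (norm_scaleSeq_le_of_le hσ hμ (le_max_left σ⁻¹ μ⁻¹) (le_max_right σ⁻¹ μ⁻¹) x)⟩
  map_add' x y := Y.ext fun a => scaleSeq_add x y a
  map_smul' c x := Y.ext fun a => scaleSeq_smul c x a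

/-- The rescaling as a bounded map. -/
noncomputable def scaleL (hσ : 0 < σ) (hμ : 0 < μ) : Y S γ →L[ℝ] Y S γ :=
  LinearMap.mkContinuous (scaleₗ hσ hμ) (max σ⁻¹ μ⁻¹) fun x =>
    Y.norm_le_of_apply_le (le_max_of_le_left (inv_nonneg.2 hσ.le))
      (norm_scaleSeq_le_of_le hσ hμ (le_max_left σ⁻¹ μ⁻¹) (le_max_right σ⁻¹ μ⁻¹) x)

theorem scaleL_apply (hσ : 0 < σ) (hμ : 0 < μ) (x : Y S γ) (a : S.Idx) :
    scaleL hσ hμ x a = scaleSeq S σ μ x a := rfl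

theorem mem_dom_iff (hσ : 0 < σ) (hμ : 0 < μ) {x : Y S γ} :
    x ∈ dom S γ σ μ ↔ ‖scaleL hσ hμ x‖ < 1 := by
  have h : (scaleL hσ hμ x : S.Idx → C2) = scaleSeq S σ μ x := funext fun a => rfl
  rw [← Real.sqrt_sq (norm_nonneg (scaleL hσ hμ x)), Y.norm_sq, h]
  rfl

theorem dom_eq_preimage (hσ : 0 < σ) (hμ : 0 < μ) :
    dom S γ σ μ = scaleL hσ hμ ⁻¹' ball 0 1 := by
  ext x
  rw [mem_dom_iff hσ hμ, mem_preimage, mem_ball_zero_iff]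

theorem isOpen_dom (hσ : 0 < σ) (hμ : 0 < μ) : IsOpen (dom S γ σ μ) := by
  rw [dom_eq_preimage hσ hμ]
  exact isOpen_ball.preimage (scaleL hσ hμ).continuous

theorem convex_dom (hσ : 0 < σ) (hμ : 0 < μ) : Convex ℝ (dom S γ σ μ) := by
  rw [dom_eq_preimage hσ hμ]
  exact (convex_ball (0 : Y S γ) 1).linear_preimage (scaleL hσ hμ).toLinearMap

/-- In the norm defining the larger domain, a point of the smaller one has size below `max (σ'/σ)
(μ'/μ)`, and a displacement is multiplied by at most `max σ⁻¹ μ⁻¹`. The four entries of the minimum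
are what the four combinations of these maxima require. -/
theorem thickening_dom_subset (hσ : 0 < σ) (hμ : 0 < μ) (hσ' : 0 < σ') (hμ' : 0 < μ') :
    thickening (min (min (σ - σ') (μ - μ')) (min (σ / μ * (μ - μ')) (μ / σ * (σ - σ'))))
      (dom S γ σ' μ') ⊆ dom S γ σ μ := by
  set m₀ := min (min (σ - σ') (μ - μ')) (min (σ / μ * (μ - μ')) (μ / σ * (σ - σ')))
  intro y hy
  obtain ⟨x, hx, hxy⟩ := mem_thickening_iff.1 hy
  rw [dist_eq_norm] at hxy
  rw [mem_dom_iff hσ' hμ'] at hx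
  rw [mem_dom_iff hσ hμ]
  set q := max (σ' / σ) (μ' / μ)
  set e := max σ⁻¹ μ⁻¹
  have he : 0 < e := lt_max_of_lt_left (inv_pos.2 hσ)
  have hq : 0 < q := lt_max_of_lt_left (by positivity)
  have h1 : ‖scaleL hσ hμ x‖ ≤ q * ‖scaleL hσ' hμ' x‖ :=
    Y.norm_le_of_apply_le hq.le fun a =>
      norm_scaleSeq_le_scaleSeq hσ hμ hσ' hμ' (le_max_left _ _) (le_max_right _ _) x a
  have h2 : ‖scaleL hσ hμ (y - x)‖ ≤ e * ‖y - x‖ :=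
    Y.norm_le_of_apply_le he.le fun a =>
      norm_scaleSeq_le_of_le hσ hμ (le_max_left _ _) (le_max_right _ _) (y - x : Y S γ) a
  have h3 : ‖scaleL hσ hμ y‖ ≤ ‖scaleL hσ hμ x‖ + ‖scaleL hσ hμ (y - x)‖ := by
    have : y = x + (y - x) := by abel
    conv_lhs => rw [this, map_add]
    exact norm_add_le _ _
  have hm : q + e * m₀ ≤ 1 := by
    have a1 : m₀ ≤ σ - σ' := (min_le_left _ _).trans (min_le_left _ _)
    have a2 : m₀ ≤ μ - μ' := (min_le_left _ _).trans (min_le_right _ _)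
    have a3 : m₀ ≤ σ / μ * (μ - μ') := (min_le_right _ _).trans (min_le_left _ _)
    have a4 : m₀ ≤ μ / σ * (σ - σ') := (min_le_right _ _).trans (min_le_right _ _)
    have b1 : σ' / σ + σ⁻¹ * m₀ ≤ 1 := by
      calc σ' / σ + σ⁻¹ * m₀ ≤ σ' / σ + σ⁻¹ * (σ - σ') := by gcongr
        _ = 1 := by field_simp; ring
    have b2 : σ' / σ + μ⁻¹ * m₀ ≤ 1 := by
      calc σ' / σ + μ⁻¹ * m₀ ≤ σ' / σ + μ⁻¹ * (μ / σ * (σ - σ')) := by gcongr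
        _ = 1 := by field_simp; ring
    have b3 : μ' / μ + σ⁻¹ * m₀ ≤ 1 := by
      calc μ' / μ + σ⁻¹ * m₀ ≤ μ' / μ + σ⁻¹ * (σ / μ * (μ - μ')) := by gcongr
        _ = 1 := by field_simp; ring
    have b4 : μ' / μ + μ⁻¹ * m₀ ≤ 1 := by
      calc μ' / μ + μ⁻¹ * m₀ ≤ μ' / μ + μ⁻¹ * (μ - μ') := by gcongr
        _ = 1 := by field_simp; ring
    rcases max_cases (σ' / σ) (μ' / μ) with h | h <;> rcases max_cases σ⁻¹ μ⁻¹ with h' | h' <;>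
      · simp only [q, e]
        rw [h.1, h'.1]
        assumption
  have h4 : e * ‖y - x‖ < e * m₀ := by gcongr
  have h5 : q * ‖scaleL hσ' hμ' x‖ ≤ q * 1 := by gcongr
  linarith

theorem scaleL_incl (hσ : 0 < σ) (hμ : 0 < μ) (h₁ : γ.1 ≤ γ'.1) (h₂ : γ.2 ≤ γ'.2) (x : Y S γ') :
    scaleL hσ hμ (Y.incl h₁ h₂ x) = Y.incl h₁ h₂ (scaleL hσ hμ x) :=
  Y.ext fun a => by rw [scaleL_apply, Y.incl_apply, scaleL_apply, Y.incl_coe]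

theorem incl_mem_dom (hσ : 0 < σ) (hμ : 0 < μ) (h₁ : γ.1 ≤ γ'.1) (h₂ : γ.2 ≤ γ'.2) {x : Y S γ'}
    (hx : x ∈ dom S γ' σ μ) : Y.incl h₁ h₂ x ∈ dom S γ σ μ := by
  rw [mem_dom_iff hσ hμ] at hx ⊢
  rw [scaleL_incl]
  exact (Y.norm_incl_le h₁ h₂ _).trans_lt hx

theorem incl_mem_thickening (hσ : 0 < σ) (hμ : 0 < μ) (h₁ : γ.1 ≤ γ'.1) (h₂ : γ.2 ≤ γ'.2) {δ : ℝ}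
    {x : Y S γ'} (hx : x ∈ thickening δ (dom S γ' σ μ)) :
    Y.incl h₁ h₂ x ∈ thickening δ (dom S γ σ μ) := by
  obtain ⟨y, hy, hxy⟩ := mem_thickening_iff.1 hx
  refine mem_thickening_iff.2 ⟨_, incl_mem_dom hσ hμ h₁ h₂ hy, ?_⟩
  rw [dist_eq_norm] at hxy ⊢
  rw [← map_sub]
  exact (Y.norm_incl_le h₁ h₂ _).trans_lt hxy

/-- The domains see only the imaginary parts of the angles, and the shift is real. -/
theorem scaleL_angleShift (hσ : 0 < σ) (hμ : 0 < μ) (k : ↥S.A → ℤ) :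
    scaleL hσ hμ (angleShift S γ k) = 0 := by
  unfold angleShift
  rw [map_sum]
  refine Finset.sum_eq_zero fun a _ => Y.ext fun b => ?_
  rw [scaleL_apply]
  change _ = 0
  rcases b with b | b
  · by_cases h : b = a
    · subst h
      have h1 := Y.single_apply_self (S := S) (γ := γ) (Sum.inl b)
        !₂[0, 2 * (Real.pi : ℂ) * (k b : ℂ)]
      ext i
      fin_cases i
      · change scaleSeq S σ μ _ (Sum.inl b) 0 = 0
        rw [scaleSeq_inl_zero, h1]; simp
      · change scaleSeq S σ μ _ (Sum.inl b) 1 = 0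
        rw [scaleSeq_inl_one, h1]
        have h2 : (2 * (Real.pi : ℂ) * (k b : ℂ)).im = 0 := by
          have : (2 * (Real.pi : ℂ) * (k b : ℂ)) = ((2 * Real.pi * (k b : ℝ) : ℝ) : ℂ) := by
            push_cast; ring
          rw [this, Complex.ofReal_im]
        simp only [Matrix.cons_val_one, Matrix.cons_val_fin_one]
        rw [h2]; simp
    · have h1 := Y.single_apply_ne (S := S) (γ := γ) (a := Sum.inl b) (b := Sum.inl a)
        (fun h' => h (Sum.inl_injective h')) !₂[0, 2 * (Real.pi : ℂ) * (k a : ℂ)]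
      ext i
      fin_cases i
      · change scaleSeq S σ μ _ (Sum.inl b) 0 = 0
        rw [scaleSeq_inl_zero, h1]; simp
      · change scaleSeq S σ μ _ (Sum.inl b) 1 = 0
        rw [scaleSeq_inl_one, h1]; simp
  · rw [scaleSeq_inr, Y.single_apply_ne (by simp), smul_zero]

theorem add_angleShift_mem_dom (hσ : 0 < σ) (hμ : 0 < μ) {x : Y S γ} (hx : x ∈ dom S γ σ μ)
    (k : ↥S.A → ℤ) : x + angleShift S γ k ∈ dom S γ σ μ := by
  rw [mem_dom_iff hσ hμ] at hx ⊢
  rwa [map_add, scaleL_angleShift, add_zero]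

theorem add_angleShift_mem_thickening (hσ : 0 < σ) (hμ : 0 < μ) {δ : ℝ} {x : Y S γ}
    (hx : x ∈ thickening δ (dom S γ σ μ))
    (k : ↥S.A → ℤ) : x + angleShift S γ k ∈ thickening δ (dom S γ σ μ) := by
  obtain ⟨y, hy, hxy⟩ := mem_thickening_iff.1 hx
  refine mem_thickening_iff.2 ⟨_, add_angleShift_mem_dom hσ hμ hy k, ?_⟩
  rwa [dist_add_right]

theorem incl_angleShift (h₁ : γ.1 ≤ γ'.1) (h₂ : γ.2 ≤ γ'.2) (k : ↥S.A → ℤ) :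
    Y.incl h₁ h₂ (angleShift S γ' k) = angleShift S γ k := by
  unfold angleShift
  rw [map_sum]
  simp only [Y.incl_single]

theorem incl_mem_reals (h₁ : γ.1 ≤ γ'.1) (h₂ : γ.2 ≤ γ'.2) {x : Y S γ'} (hx : x ∈ Y.reals S γ') :
    Y.incl h₁ h₂ x ∈ Y.reals S γ := fun a i => by
  rw [Y.incl_apply]
  exact hx a i

theorem mem_reals_iff {x : Y S γ} :
    x ∈ Y.reals S γ ↔ ∀ ai : S.Idx × Fin 2, Y.imL ai.1 ai.2 x = 0 := by
  simp only [Y.reals, mem_ofPred_eq, Y.imL_apply, Complex.ofReal_eq_zero, Prod.forall]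

end Domains

/-! ## The vector fields of the functions of class `T` -/

section FieldsOfFunctions

open Filter Topology Metric

variable {d : ℕ} {S : Modes d} {K m κ γ₁ σ μ c : ℝ} {p s : ℕ}

theorem isOpen_parBall (p : ℕ) : IsOpen (parBall p) := isOpen_ball

/-- The embedding of `Y_{(c,m)}` into `Y_{(0,m)}`. -/
noncomputable def lowL (S : Modes d) (m : ℝ) (hc : 0 ≤ c) : Y S (c, m) →L[ℂ] Y S (0, m) :=
  Y.incl (γ := (0, m)) (γ' := (c, m)) hc le_rfl

theorem lowL_coe (hc : 0 ≤ c) (x : Y S (c, m)) : (lowL S m hc x : S.Idx → C2) = x :=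
  Y.incl_coe (γ := (0, m)) (γ' := (c, m)) hc le_rfl x

theorem toY_eq_lowL (hc : 0 ≤ c) (x : Y S (c, m)) : toY S (0, m) x = lowL S m hc x :=
  toY_eq_of_coe (lowL_coe hc x)

theorem toY_self {γ : ℝ × ℝ} (x : Y S γ) : toY S γ x = x := toY_eq_of_coe rfl

theorem lowL_injective (hc : 0 ≤ c) : Function.Injective (lowL S m hc) := Y.incl_injective _ _

/-- The symplectic form on `Y_{(c,m)}`. -/
noncomputable def sympL (S : Modes d) (hm : 0 ≤ m) (hc : 0 ≤ c) :
    Y S (c, m) →L[ℂ] Y S (c, m) →L[ℂ] ℂ :=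
  OmegaL (γ := (c, m)) (γ' := (c, m)) (add_nonneg hc hc) (add_nonneg hm hm)

theorem sympL_apply (hm : 0 ≤ m) (hc : 0 ≤ c) (x y : Y S (c, m)) :
    sympL S hm hc x y = Omega S x y := rfl

theorem sympL_eq_of_Jseq (hm : 0 ≤ m) {l : Y S (0, m) →L[ℂ] ℂ} {ζ : Y S (0, m)}
    (h : (ζ : S.Idx → C2) = Jseq S (0, m) l) : sympL S hm le_rfl ζ = l :=
  OmegaL_eq_of_Jseq _ _ h

theorem Jseq_sympL (hm : 0 ≤ m) (ζ : Y S (0, m)) :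
    Jseq S (0, m) (sympL S hm le_rfl ζ) = (ζ : S.Idx → C2) :=
  Jseq_eq fun _ _ => rfl

theorem IsRHB.differentiableOn {X E : Type*} [NormedAddCommGroup X] [NormedSpace ℂ X]
    [NormedAddCommGroup E] [NormedSpace ℂ E] {U rX : Set X} {rE : Set E} {f : X → E}
    (h : IsRHB U rX rE f) : DifferentiableOn ℂ f U := by
  obtain ⟨⟨V, f', _, hUV, hd, he⟩, _⟩ := h
  exact (hd.mono (subset_closure.trans hUV)).congr he.symm

theorem IsT.Jd_coe {f : Y S (0, m) → ℂ} (hf : IsT S K m κ γ₁ σ μ f) (hc : c ∈ Icc 0 γ₁)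
    {x : Y S (c, m)} (hx : x ∈ dom S (c, m) σ μ) :
    (Jd S m f c x : S.Idx → C2) = Jseq S (0, m) (fderiv ℂ f (lowL S m hc.1 x)) := by
  have h := hf.jd_mem c hc x hx
  rw [toY_eq_lowL hc.1] at h
  rw [← toY_coe S (c, m) h, Jd, toY_eq_lowL hc.1]

theorem lowL_mem_dom (hσ : 0 < σ) (hμ : 0 < μ) (hc : 0 ≤ c) {x : Y S (c, m)}
    (hx : x ∈ dom S (c, m) σ μ) : lowL S m hc x ∈ dom S (0, m) σ μ :=
  incl_mem_dom hσ hμ _ _ hx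

/-- At every level `c` the field is the same sequence; only the space in which it is measured
changes. -/
theorem IsT.lowL_Jd {f : Y S (0, m) → ℂ} (hf : IsT S K m κ γ₁ σ μ f) (hc : c ∈ Icc 0 γ₁)
    {x : Y S (c, m)} (hx : x ∈ dom S (c, m) σ μ) :
    lowL S m hc.1 (Jd S m f c x) = Jd S m f 0 (lowL S m hc.1 x) := by
  have h : (lowL S m hc.1 (Jd S m f c x) : S.Idx → C2) =
      Jseq S (0, m) (fderiv ℂ f (lowL S m hc.1 x)) := by
    rw [lowL_coe, hf.Jd_coe hc hx]
  conv_rhs => rw [Jd, toY_self]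
  exact (toY_eq_of_coe h).symm

theorem IsT.hasFDerivAt {f : Y S (0, m) → ℂ} (hf : IsT S K m κ γ₁ σ μ f) (hσ : 0 < σ)
    (hμ : 0 < μ) (hm : 0 ≤ m) (hγ : 0 ≤ γ₁) {x : Y S (0, m)} (hx : x ∈ dom S (0, m) σ μ) :
    HasFDerivAt f (sympL S hm le_rfl (Jd S m f 0 x)) x := by
  have h1 := (hf.rhb.differentiableOn.differentiableAt
    ((isOpen_dom hσ hμ).mem_nhds hx)).hasFDerivAt
  have h2 := hf.jd_mem 0 ⟨le_rfl, hγ⟩ x hx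
  rw [toY_self] at h2
  rw [sympL_eq_of_Jseq hm (l := fderiv ℂ f x)]
  · exact h1
  · rw [Jd, toY_self, toY_coe S (0, m) h2]

theorem IsT.hasFDerivAt_Jd {f : Y S (0, m) → ℂ} (hf : IsT S K m κ γ₁ σ μ f) (hσ : 0 < σ)
    (hμ : 0 < μ) (hc : c ∈ Icc 0 γ₁) {x : Y S (c, m)} (hx : x ∈ dom S (c, m) σ μ) :
    HasFDerivAt (Jd S m f c) (Mb.act (Jdd S K m κ f c x)) x := by
  have h1 := ((hf.jd_rhb c hc).differentiableOn.differentiableAt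
    ((isOpen_dom hσ hμ).mem_nhds hx)).hasFDerivAt
  rw [Mb.act_apply, Jdd, toMb_coe S (c, m) K m κ (hf.jdd_mem c hc x hx)]
  exact h1

variable {f : Y S (0, m) → Par p → ℂ}

theorem IsTD.isT (hf : IsTD S K m κ s γ₁ σ μ f) {ρ : Par p} (hρ : ρ ∈ parBall p) :
    IsT S K m κ γ₁ σ μ (fun x => f x ρ) := by
  have h := hf.deriv_mem 0 (Nat.zero_le _) Fin.elim0 ρ hρ
  simpa only [pderiv_zero] using h

theorem IsTD.holFam_Jd (hf : IsTD S K m κ s γ₁ σ μ f) (hc : c ∈ Icc 0 γ₁) :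
    HolFam s (dom S (c, m) σ μ) (parBall p) (fun x ρ => Jd S m (fun x => f x ρ) c x) :=
  ⟨hf.jd_contDiff c hc, fun _ hρ => ((hf.isT hρ).jd_rhb c hc).differentiableOn⟩

theorem IsTD.holFam_Jdd (hf : IsTD S K m κ s γ₁ σ μ f) (hc : c ∈ Icc 0 γ₁) :
    HolFam s (dom S (c, m) σ μ) (parBall p) (fun x ρ => Jdd S K m κ (fun x => f x ρ) c x) :=
  ⟨hf.jdd_contDiff c hc, fun _ hρ => ((hf.isT hρ).jdd_rhb c hc).differentiableOn⟩

/-- The class `T` bounds `J d ∂f`, whereas `OpField` asks for bounds of `∂ J d f`. The two agree at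
level `0` by interchange of derivatives, and the bounded inclusion `lowL` carries the derivative
taken at level `c` to the one at level `0`, so the underlying sequences coincide. -/
theorem IsTD.pderiv_Jd (hf : IsTD S K m κ s γ₁ σ μ f) (hσ : 0 < σ) (hμ : 0 < μ) (hm : 0 ≤ m)
    (hc : c ∈ Icc 0 γ₁) {n : ℕ} (hn : n ≤ s) (k : Fin n → Fin p) {x : Y S (c, m)}
    (hx : x ∈ dom S (c, m) σ μ) {ρ : Par p} (hρ : ρ ∈ parBall p) :
    pderiv k (fun ρ => Jd S m (fun x => f x ρ) c x) ρ =
      Jd S m (fun x => pderiv k (f x) ρ) c x := by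
  have hD := isOpen_parBall p
  have hγ : 0 ≤ γ₁ := hc.1.trans hc.2
  have hns : (n : WithTop ℕ∞) ≤ s := by exact_mod_cast hn
  have hx0 := lowL_mem_dom hσ hμ hc.1 hx
  have hcd : ∀ {c : ℝ}, c ∈ Icc 0 γ₁ → ∀ {x : Y S (c, m)}, x ∈ dom S (c, m) σ μ →
      ContDiffAt ℝ n (fun ρ => Jd S m (fun x => f x ρ) c x) ρ := fun hc x hx =>
    (((hf.holFam_Jd hc).contDiffOn_right hx).contDiffAt (hD.mem_nhds hρ)).of_le hns
  have h1 := hasFDerivAt_pderiv (F := f)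
    (M := fun x ρ => sympL S hm le_rfl (Jd S m (fun x => f x ρ) 0 x)) (isOpen_dom hσ hμ) hD k
    (hf.contDiff.of_le hns)
    (((sympL S hm le_rfl).restrictScalars ℝ).contDiff.comp_contDiffOn
      ((hf.jd_contDiff 0 ⟨le_rfl, hγ⟩).of_le hns))
    (fun x hx ρ hρ => (hf.isT hρ).hasFDerivAt hσ hμ hm hγ hx) hx0 hρ
  have h2 := pderiv_clm ((sympL S hm le_rfl).restrictScalars ℝ) (hcd ⟨le_rfl, hγ⟩ hx0) k
  have h3 : pderiv k (fun ρ => Jd S m (fun x => f x ρ) 0 (lowL S m hc.1 x)) ρ =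
      lowL S m hc.1 (pderiv k (fun ρ => Jd S m (fun x => f x ρ) c x) ρ) := by
    have h4 := pderiv_clm ((lowL S m hc.1).restrictScalars ℝ) (hcd hc hx) k
    refine Eq.trans ?_ h4
    exact pderiv_congr hD (fun ρ hρ => ((hf.isT hρ).lowL_Jd hc hx).symm) k hρ
  have h5 : fderiv ℂ (fun x => pderiv k (f x) ρ) (lowL S m hc.1 x) =
      sympL S hm le_rfl (lowL S m hc.1 (pderiv k (fun ρ => Jd S m (fun x => f x ρ) c x) ρ)) := by
    rw [h1.fderiv, ← h3]
    exact h2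
  symm
  rw [Jd, toY_eq_lowL hc.1, h5, Jseq_sympL, lowL_coe]
  exact toY_self _

theorem IsTD.hasFDerivAt_Jd (hf : IsTD S K m κ s γ₁ σ μ f) (hσ : 0 < σ) (hμ : 0 < μ)
    (hc : c ∈ Icc 0 γ₁) {x : Y S (c, m)}
    (hx : x ∈ dom S (c, m) σ μ) {ρ : Par p} (hρ : ρ ∈ parBall p) :
    HasFDerivAt (Jd S m (fun x => f x ρ) c) (Mb.act (Jdd S K m κ (fun x => f x ρ) c x)) x :=
  (hf.isT hρ).hasFDerivAt_Jd hσ hμ hc hx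

theorem IsTD.pderiv_Jdd (hf : IsTD S K m κ s γ₁ σ μ f) (hσ : 0 < σ) (hμ : 0 < μ) (hm : 0 ≤ m)
    (hc : c ∈ Icc 0 γ₁) {n : ℕ} (hn : n ≤ s) (k : Fin n → Fin p) {x : Y S (c, m)}
    (hx : x ∈ dom S (c, m) σ μ) {ρ : Par p} (hρ : ρ ∈ parBall p) :
    pderiv k (fun ρ => Jdd S K m κ (fun x => f x ρ) c x) ρ =
      Jdd S K m κ (fun x => pderiv k (f x) ρ) c x := by
  have hD := isOpen_parBall p
  have hU : IsOpen (dom S (c, m) σ μ) := isOpen_dom hσ hμ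
  have hns : (n : WithTop ℕ∞) ≤ s := by exact_mod_cast hn
  have h1 := hasFDerivAt_pderiv (F := fun x ρ => Jd S m (fun x => f x ρ) c x)
    (M := fun x ρ => Mb.act (Jdd S K m κ (fun x => f x ρ) c x)) hU hD k
    ((hf.jd_contDiff c hc).of_le hns)
    (((Mb.act (S := S) (γ := (c, m)) (K := K) (m := m) (κ := κ)).restrictScalars ℝ).contDiff.comp_contDiffOn
      ((hf.jdd_contDiff c hc).of_le hns))
    (fun x hx ρ hρ => hf.hasFDerivAt_Jd hσ hμ hc hx hρ) hx hρ
  have h2 := pderiv_clm ((Mb.act (S := S) (γ := (c, m)) (K := K) (m := m) (κ := κ)).restrictScalars ℝ)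
    ((((hf.holFam_Jdd hc).contDiffOn_right hx).contDiffAt (hD.mem_nhds hρ)).of_le hns) k
  have h3 : HasFDerivAt (Jd S m (fun x => pderiv k (f x) ρ) c)
      (Mb.act (pderiv k (fun ρ => Jdd S K m κ (fun x => f x ρ) c x) ρ)) x := by
    have h4 := h1.congr_of_eventuallyEq (f₁ := Jd S m (fun x => pderiv k (f x) ρ) c) (by
      filter_upwards [hU.mem_nhds hx] with y hy
      exact (hf.pderiv_Jd hσ hμ hm hc hn k hy hρ).symm)
    have e : Mb.act (pderiv k (fun ρ => Jdd S K m κ (fun x => f x ρ) c x) ρ) =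
        pderiv k (fun ρ => Mb.act (Jdd S K m κ (fun x => f x ρ) c x)) ρ := h2.symm
    rw [e]
    exact h4
  rw [Jdd, h3.fderiv]
  exact (toMb_eq rfl).symm

theorem normT_le_normTD {n : ℕ} (hn : n ≤ s) (k : Fin n → Fin p) {ρ : Par p} (hρ : ρ ∈ parBall p) :
    normT S K m κ γ₁ σ μ (fun x => pderiv k (f x) ρ) ≤ normTD S K m κ s γ₁ σ μ f :=
  le_iSup_of_le n <| le_iSup_of_le hn <| le_iSup_of_le k <| le_iSup₂_of_le ρ hρ le_rfl

theorem enorm_le_normT {f : Y S (0, m) → ℂ} {x : Y S (0, m)} (hx : x ∈ dom S (0, m) σ μ) :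
    ‖f x‖ₑ ≤ normT S K m κ γ₁ σ μ f :=
  le_max_of_le_left (le_iSup₂ (f := fun x (_ : x ∈ dom S (0, m) σ μ) => ‖f x‖ₑ) x hx)

theorem enorm_Jd_le_normT {f : Y S (0, m) → ℂ} (hc : c ∈ Icc 0 γ₁) {x : Y S (c, m)}
    (hx : x ∈ dom S (c, m) σ μ) : ‖Jd S m f c x‖ₑ ≤ normT S K m κ γ₁ σ μ f :=
  le_max_of_le_right (le_max_of_le_left (le_iSup₂_of_le c hc
    (le_iSup₂ (f := fun x (_ : x ∈ dom S (c, m) σ μ) => ‖Jd S m f c x‖ₑ) x hx)))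

theorem enorm_Jdd_le_normT {f : Y S (0, m) → ℂ} (hc : c ∈ Icc 0 γ₁) {x : Y S (c, m)}
    (hx : x ∈ dom S (c, m) σ μ) : ‖Jdd S K m κ f c x‖ₑ ≤ normT S K m κ γ₁ σ μ f :=
  le_max_of_le_right (le_max_of_le_right (le_iSup₂_of_le c hc
    (le_iSup₂ (f := fun x (_ : x ∈ dom S (c, m) σ μ) => ‖Jdd S K m κ f c x‖ₑ) x hx)))

theorem norm_le_of_enorm_le {E : Type*} [NormedAddCommGroup E] {x : E} {M : ℝ≥0∞} (hM : M < ⊤)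
    {φ : ℝ} (hφ : M.toReal ≤ φ) (h : ‖x‖ₑ ≤ M) : ‖x‖ ≤ φ := by
  rw [← toReal_enorm x]
  exact (ENNReal.toReal_mono hM.ne h).trans hφ

theorem IsTD.holFamBdd (hf : IsTD S K m κ s γ₁ σ μ f) {φ : ℝ}
    (hφ : (normTD S K m κ s γ₁ σ μ f).toReal ≤ φ) :
    HolFamBdd s (dom S (0, m) σ μ) (parBall p) φ f :=
  ⟨⟨hf.contDiff, fun _ hρ => (hf.isT hρ).rhb.differentiableOn⟩, fun _ hn k _ hx _ hρ =>
    norm_le_of_enorm_le hf.norm_lt_top hφ (le_trans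
      (enorm_le_normT (f := fun x => pderiv k (f x) _) hx) (normT_le_normTD hn k hρ))⟩

theorem IsTD.opField (hf : IsTD S K m κ s γ₁ σ μ f) (hσ : 0 < σ) (hμ : 0 < μ) (hm : 0 ≤ m)
    (hκ : 0 ≤ κ) (hK : 4 ^ κ ≤ K) (hc : c ∈ Icc 0 γ₁) {φ : ℝ}
    (hφ : (normTD S K m κ s γ₁ σ μ f).toReal ≤ φ) :
    OpField (mbAlg S m hκ hK hc.1) s (dom S (c, m) σ μ) (parBall p) φ
      (fun x ρ => Jd S m (fun x => f x ρ) c x)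
      (fun x ρ => Jdd S K m κ (fun x => f x ρ) c x) := by
  refine ⟨⟨hf.holFam_Jd hc, fun n hn k x hx ρ hρ => ?_⟩, ⟨hf.holFam_Jdd hc,
    fun n hn k x hx ρ hρ => ?_⟩, fun x hx ρ hρ => hf.hasFDerivAt_Jd hσ hμ hc hx hρ⟩
  · rw [hf.pderiv_Jd hσ hμ hm hc hn k hx hρ]
    exact norm_le_of_enorm_le hf.norm_lt_top hφ
      ((enorm_Jd_le_normT hc hx).trans (normT_le_normTD hn k hρ))
  · rw [hf.pderiv_Jdd hσ hμ hm hc hn k hx hρ]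
    exact norm_le_of_enorm_le hf.norm_lt_top hφ
      ((enorm_Jdd_le_normT hc hx).trans (normT_le_normTD hn k hρ))

/-- Periodicity of the vector field. -/
theorem IsT.Jd_add_angleShift {f : Y S (0, m) → ℂ} (hf : IsT S K m κ γ₁ σ μ f) (hσ : 0 < σ)
    (hμ : 0 < μ) {x : Y S (0, m)} (hx : x ∈ dom S (0, m) σ μ) (k : ↥S.A → ℤ) :
    Jd S m f 0 (x + angleShift S (0, m) k) = Jd S m f 0 x := by
  have h1 : fderiv ℂ f (x + angleShift S (0, m) k) = fderiv ℂ f x := by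
    rw [← fderiv_comp_add_right]
    refine Filter.EventuallyEq.fderiv_eq ?_
    filter_upwards [(isOpen_dom hσ hμ).mem_nhds hx] with y hy
    exact hf.periodic y hy k
  unfold Jd
  rw [toY_self, toY_self, h1]

/-- The second differential is symmetric. -/
theorem IsTD.sympL_Jdd_symm (hf : IsTD S K m κ s γ₁ σ μ f) (hσ : 0 < σ) (hμ : 0 < μ) (hm : 0 ≤ m)
    (hc : c ∈ Icc 0 γ₁) {x : Y S (c, m)} (hx : x ∈ dom S (c, m) σ μ) {ρ : Par p}
    (hρ : ρ ∈ parBall p) (v w : Y S (c, m)) :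
    sympL S hm hc.1 (Mb.act (Jdd S K m κ (fun x => f x ρ) c x) v) w =
      sympL S hm hc.1 (Mb.act (Jdd S K m κ (fun x => f x ρ) c x) w) v := by
  have hγ : 0 ≤ γ₁ := hc.1.trans hc.2
  have hT := hf.isT hρ
  let L := lowL S m hc.1
  have h1 : ∀ᶠ y in 𝓝 x, HasFDerivAt (fun y => f (L y) ρ)
      (sympL S hm hc.1 (Jd S m (fun x => f x ρ) c y)) y := by
    filter_upwards [(isOpen_dom hσ hμ).mem_nhds hx] with y hy
    have h2 := HasFDerivAt.comp y (f := L) (hT.hasFDerivAt hσ hμ hm hγ (lowL_mem_dom hσ hμ hc.1 hy))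
      L.hasFDerivAt
    have e : sympL S hm hc.1 (Jd S m (fun x => f x ρ) c y) =
        (sympL S hm le_rfl (Jd S m (fun x => f x ρ) 0 (L y))).comp L := by
      refine ContinuousLinearMap.ext fun v => ?_
      rw [ContinuousLinearMap.comp_apply, sympL_apply, sympL_apply, ← hT.lowL_Jd hc hy, lowL_coe,
        lowL_coe]
    rw [e]
    exact h2
  have h2 : HasFDerivAt (fun y => sympL S hm hc.1 (Jd S m (fun x => f x ρ) c y))
      ((sympL S hm hc.1).comp (Mb.act (Jdd S K m κ (fun x => f x ρ) c x))) x :=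
    (sympL S hm hc.1).hasFDerivAt.comp x (hT.hasFDerivAt_Jd hσ hμ hc hx)
  exact second_derivative_symmetric_of_eventually (𝕜 := ℂ) h1 h2 v w

theorem sympL_swap (hm : 0 ≤ m) (hc : 0 ≤ c) (x y : Y S (c, m)) :
    sympL S hm hc x y = -sympL S hm hc y x := Omega_neg_swap _ _

end FieldsOfFunctions

/-! ## A criterion for membership in the class `T` -/

section Criterion

open Filter Topology Metric

variable {d : ℕ} {S : Modes d} {K m κ γ₁ σ μ c δ B : ℝ} {p s : ℕ}

/-- Derivatives of a map with values in a closed real subspace. -/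
theorem apply_fderiv_eq_zero_of_eventually {E F : Type*} [NormedAddCommGroup E] [NormedSpace ℂ E]
    [NormedAddCommGroup F] [NormedSpace ℂ F] {f : E → F} {L : E →L[ℂ] F} {x v : E}
    (hf : HasFDerivAt f L x) (ψ : F →L[ℝ] ℂ)
    (h : ∀ᶠ t : ℝ in 𝓝 0, ψ (f (x + (t : ℂ) • v)) = 0) : ψ (L v) = 0 := by
  have h1 : HasDerivAt (fun t : ℝ => x + (t : ℂ) • v) v 0 := by
    have h2 := ((Complex.ofRealCLM.hasDerivAt (x := (0 : ℝ))).smul_const v).const_add x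
    rw [Complex.ofRealCLM_apply, Complex.ofReal_one, one_smul] at h2
    exact h2
  have hf' : HasFDerivAt f (L.restrictScalars ℝ) (x + ((0 : ℝ) : ℂ) • v) := by
    rw [Complex.ofReal_zero, zero_smul, add_zero]
    exact hf.restrictScalars ℝ
  have h2 : HasDerivAt (fun t : ℝ => f (x + (t : ℂ) • v)) ((L.restrictScalars ℝ) v) 0 :=
    HasFDerivAt.comp_hasDerivAt (l := f) (0 : ℝ) hf' h1
  have h3 : HasDerivAt (fun t : ℝ => ψ (f (x + (t : ℂ) • v))) (ψ (L v)) 0 :=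
    ψ.hasFDerivAt.comp_hasDerivAt (0 : ℝ) h2
  exact h3.unique ((hasDerivAt_const (0 : ℝ) (0 : ℂ)).congr_of_eventuallyEq h)

theorem add_smul_mem_reals {γ : ℝ × ℝ} {x v : Y S γ} (hx : x ∈ Y.reals S γ) (hv : v ∈ Y.reals S γ)
    (t : ℝ) : x + (t : ℂ) • v ∈ Y.reals S γ := by
  intro a i
  rw [Y.add_apply, Y.smul_apply, PiLp.add_apply, PiLp.smul_apply, smul_eq_mul, Complex.add_im,
    Complex.im_ofReal_mul, hx a i, hv a i, mul_zero, add_zero]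

theorem single_mem_reals {γ : ℝ × ℝ} (b : S.Idx) {v : C2} (hv : ∀ i, (v i).im = 0) :
    Y.single S γ b v ∈ Y.reals S γ := by
  intro a i
  by_cases h : a = b
  · subst h; rw [Y.single_apply_self]; exact hv i
  · rw [Y.single_apply_ne h]; rfl

theorem eventually_add_smul_mem {E : Type*} [NormedAddCommGroup E] [NormedSpace ℂ E] {U : Set E}
    (hU : IsOpen U) {x : E} (hx : x ∈ U) (v : E) : ∀ᶠ t : ℝ in 𝓝 0, x + (t : ℂ) • v ∈ U := by
  have h1 : ContinuousAt (fun t : ℝ => x + (t : ℂ) • v) 0 := by fun_prop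
  refine h1.eventually (hU.mem_nhds ?_)
  beta_reduce
  rwa [Complex.ofReal_zero, zero_smul, add_zero]

/-- The imaginary part. -/
noncomputable def imCL : ℂ →L[ℝ] ℂ := Complex.ofRealCLM.comp Complex.imCLM

theorem imCL_eq_zero {z : ℂ} : imCL z = 0 ↔ z.im = 0 := Complex.ofReal_eq_zero

theorem enorm_le_ofReal_of_norm_le {E : Type*} [NormedAddCommGroup E] {x : E} (h : ‖x‖ ≤ B) :
    ‖x‖ₑ ≤ ENNReal.ofReal B := by
  rw [← ofReal_norm]
  exact ENNReal.ofReal_le_ofReal h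

/-- Holomorphy of `G₀`, `W` and `M` on a thickening gives the extensions beyond the closure. `G` is
only required to agree with `G₀` on the domain, since a flow is unconstrained outside it. Reality is
assumed for `G` alone: it passes to `W` by pairing `dG` with real unit vectors, and to `M` by
differentiating `W` along real directions. -/
theorem isT_of_fields (hσ : 0 < σ) (hμ : 0 < μ) (hm : 0 ≤ m) (hδ : 0 < δ)
    {G G₀ : Y S (0, m) → ℂ} {W : ∀ c, Y S (c, m) → Y S (c, m)}
    {M : ∀ c, Y S (c, m) → Mb S (c, m) K m κ}
    (hG : EqOn G G₀ (dom S (0, m) σ μ))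
    (hG₀ : DifferentiableOn ℂ G₀ (thickening δ (dom S (0, m) σ μ)))
    (hd : ∀ x ∈ dom S (0, m) σ μ, HasFDerivAt G₀ (sympL S hm le_rfl (W 0 x)) x)
    (hWd : ∀ c ∈ Icc 0 γ₁, DifferentiableOn ℂ (W c) (thickening δ (dom S (c, m) σ μ)))
    (hMd : ∀ c ∈ Icc 0 γ₁, DifferentiableOn ℂ (M c) (thickening δ (dom S (c, m) σ μ)))
    (hWM : ∀ c ∈ Icc 0 γ₁, ∀ x ∈ dom S (c, m) σ μ, HasFDerivAt (W c) (Mb.act (M c x)) x)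
    (hlow : ∀ c (hc : c ∈ Icc 0 γ₁), ∀ x ∈ dom S (c, m) σ μ,
      lowL S m hc.1 (W c x) = W 0 (lowL S m hc.1 x))
    (hGb : ∀ x ∈ dom S (0, m) σ μ, ‖G x‖ ≤ B)
    (hWb : ∀ c ∈ Icc 0 γ₁, ∀ x ∈ dom S (c, m) σ μ, ‖W c x‖ ≤ B)
    (hMb : ∀ c ∈ Icc 0 γ₁, ∀ x ∈ dom S (c, m) σ μ, ‖M c x‖ ≤ B)
    (hper : ∀ x ∈ dom S (0, m) σ μ, ∀ k, G (x + angleShift S (0, m) k) = G x)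
    (hreal : ∀ x ∈ dom S (0, m) σ μ, x ∈ Y.reals S (0, m) → (G x).im = 0) :
    (IsT S K m κ γ₁ σ μ G ∧ normT S K m κ γ₁ σ μ G ≤ ENNReal.ofReal B) ∧
      ∀ c ∈ Icc 0 γ₁, ∀ x ∈ dom S (c, m) σ μ, Jd S m G c x = W c x ∧ Jdd S K m κ G c x = M c x := by
  have hopen : ∀ c, IsOpen (dom S (c, m) σ μ) := fun c => isOpen_dom hσ hμ
  have hGd : ∀ x ∈ dom S (0, m) σ μ, HasFDerivAt G (sympL S hm le_rfl (W 0 x)) x := fun x hx =>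
    (hd x hx).congr_of_eventuallyEq (by
      filter_upwards [(hopen 0).mem_nhds hx] with y hy using hG hy)
  have hJs : ∀ c (hc : c ∈ Icc 0 γ₁), ∀ x ∈ dom S (c, m) σ μ,
      Jseq S (0, m) (fderiv ℂ G (toY S (0, m) x)) = (W c x : S.Idx → C2) := by
    intro c hc x hx
    have hx0 := lowL_mem_dom hσ hμ hc.1 hx
    rw [toY_eq_lowL hc.1, (hGd _ hx0).fderiv, Jseq_sympL, ← hlow c hc x hx, lowL_coe]
  have hJd : ∀ c (hc : c ∈ Icc 0 γ₁), ∀ x ∈ dom S (c, m) σ μ, Jd S m G c x = W c x :=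
    fun c hc x hx => toY_eq_of_coe (hJs c hc x hx).symm
  have hJdd' : ∀ c (hc : c ∈ Icc 0 γ₁), ∀ x ∈ dom S (c, m) σ μ,
      fderiv ℂ (Jd S m G c) x = (M c x).1 := by
    intro c hc x hx
    have h1 : HasFDerivAt (Jd S m G c) (Mb.act (M c x)) x :=
      (hWM c hc x hx).congr_of_eventuallyEq (by
        filter_upwards [(hopen c).mem_nhds hx] with y hy using hJd c hc y hy)
    exact h1.fderiv
  have hJdd : ∀ c (hc : c ∈ Icc 0 γ₁), ∀ x ∈ dom S (c, m) σ μ, Jdd S K m κ G c x = M c x :=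
    fun c hc x hx => toMb_eq (hJdd' c hc x hx).symm
  have hW0real : ∀ x ∈ dom S (0, m) σ μ, x ∈ Y.reals S (0, m) → W 0 x ∈ Y.reals S (0, m) := by
    intro x hx hxr
    -- The differential of a function real at real points is real on real vectors; its values on the
    -- two unit vectors at a mode are, up to sign, the components of `W`.
    have key : ∀ v ∈ Y.reals S (0, m), (sympL S hm le_rfl (W 0 x) v).im = 0 := by
      intro v hv
      refine imCL_eq_zero.1 (apply_fderiv_eq_zero_of_eventually (hGd x hx) imCL ?_)
      filter_upwards [eventually_add_smul_mem (hopen 0) hx v] with t ht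
      exact imCL_eq_zero.2 (hreal _ ht (add_smul_mem_reals hxr hv t))
    have h0 : ∀ a, ((W 0 x : S.Idx → C2) a 0).im = 0 := fun a => by
      have h1 := key (Y.single S (0, m) a !₂[0, 1])
        (single_mem_reals a fun i => by fin_cases i <;> simp)
      rw [sympL_apply, Omega_single] at h1
      simpa using h1
    have h1 : ∀ a, ((W 0 x : S.Idx → C2) a 1).im = 0 := fun a => by
      have h1 := key (Y.single S (0, m) a !₂[1, 0])
        (single_mem_reals a fun i => by fin_cases i <;> simp)
      rw [sympL_apply, Omega_single] at h1
      simpa using h1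
    intro a i
    fin_cases i
    · exact h0 a
    · exact h1 a
  have hWreal : ∀ c (hc : c ∈ Icc 0 γ₁), ∀ x ∈ dom S (c, m) σ μ, x ∈ Y.reals S (c, m) →
      W c x ∈ Y.reals S (c, m) := by
    intro c hc x hx hxr a i
    have h1 := hW0real _ (lowL_mem_dom hσ hμ hc.1 hx) (incl_mem_reals _ _ hxr) a i
    rw [← hlow c hc x hx, lowL_coe] at h1
    exact h1
  have hMreal : ∀ c (hc : c ∈ Icc 0 γ₁), ∀ x ∈ dom S (c, m) σ μ, x ∈ Y.reals S (c, m) →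
      M c x ∈ Mb.reals S (c, m) K m κ := by
    intro c hc x hx hxr v hv a i
    have h1 := apply_fderiv_eq_zero_of_eventually (v := v) (hWM c hc x hx) (Y.imL a i) (by
      filter_upwards [eventually_add_smul_mem (hopen c) hx v] with t ht
      rw [Y.imL_apply, Complex.ofReal_eq_zero]
      exact hWreal c hc _ ht (add_smul_mem_reals hxr hv t) a i)
    rw [Y.imL_apply, Complex.ofReal_eq_zero] at h1
    exact h1
  have hnorm : normT S K m κ γ₁ σ μ G ≤ ENNReal.ofReal B := by
    refine max_le (iSup₂_le fun x hx => enorm_le_ofReal_of_norm_le (hGb x hx)) (max_le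
      (iSup₂_le fun c hc => iSup₂_le fun x hx => ?_) (iSup₂_le fun c hc => iSup₂_le fun x hx => ?_))
    · rw [hJd c hc x hx]
      exact enorm_le_ofReal_of_norm_le (hWb c hc x hx)
    · rw [hJdd c hc x hx]
      exact enorm_le_ofReal_of_norm_le (hMb c hc x hx)
  refine ⟨⟨⟨hper, ⟨⟨_, G₀, isOpen_thickening, closure_subset_thickening hδ _, hG₀, hG.symm⟩,
    hreal⟩, fun c hc x hx => ?_, fun c hc => ⟨⟨_, W c, isOpen_thickening,
    closure_subset_thickening hδ _, hWd c hc, fun x hx => (hJd c hc x hx).symm⟩,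
    fun x hx hxr => ?_⟩, fun c hc x hx => ?_, fun c hc => ⟨⟨_, M c, isOpen_thickening,
    closure_subset_thickening hδ _, hMd c hc, fun x hx => (hJdd c hc x hx).symm⟩,
    fun x hx hxr => ?_⟩, hnorm.trans_lt ENNReal.ofReal_lt_top⟩, hnorm⟩,
    fun c hc x hx => ⟨hJd c hc x hx, hJdd c hc x hx⟩⟩
  · rw [hJs c hc x hx]
    exact (W c x).2
  · rw [hJd c hc x hx]
    exact hWreal c hc x hx hxr
  · rw [hJdd' c hc x hx]
    exact (M c x).2
  · rw [hJdd c hc x hx]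
    exact hMreal c hc x hx hxr

theorem HolFam.differentiableOn_pderiv {E G : Type*} [NormedAddCommGroup E] [NormedSpace ℂ E]
    [NormedAddCommGroup G] [NormedSpace ℂ G] [CompleteSpace G] {U : Set E} {D : Set (Par p)}
    {F : E → Par p → G} (hF : HolFam s U D F) (hU : IsOpen U) (hD : IsOpen D) {n : ℕ} (hn : n ≤ s)
    (k : Fin n → Fin p) {ρ : Par p} (hρ : ρ ∈ D) :
    DifferentiableOn ℂ (fun x => _root_.pderiv k (F x) ρ) U :=
  (HolFam.pderiv hU hD k (n := 0) (hF.mono (by omega) Subset.rfl Subset.rfl)).hol ρ hρ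

/-- Each parameter derivative is submitted to `isT_of_fields`: every hypothesis there is linear in
the data or stable under `pderiv`, because parameter derivatives commute with holomorphic
derivatives and with bounded linear maps. -/
theorem isTD_of_fields (hσ : 0 < σ) (hμ : 0 < μ) (hm : 0 ≤ m) (hκ : 0 ≤ κ) (hK : 4 ^ κ ≤ K)
    (hγ : 0 ≤ γ₁) (hδ : 0 < δ) {F F₀ : Y S (0, m) → Par p → ℂ}
    {W : ∀ c, Y S (c, m) → Par p → Y S (c, m)} {M : ∀ c, Y S (c, m) → Par p → Mb S (c, m) K m κ}
    (hF : ∀ x ∈ dom S (0, m) σ μ, ∀ ρ ∈ parBall p, F x ρ = F₀ x ρ)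
    (hF₀ : HolFamBdd s (thickening δ (dom S (0, m) σ μ)) (parBall p) B F₀)
    (hd : ∀ x ∈ dom S (0, m) σ μ, ∀ ρ ∈ parBall p,
      HasFDerivAt (fun x => F₀ x ρ) (sympL S hm le_rfl (W 0 x ρ)) x)
    (hW : ∀ c (hc : c ∈ Icc 0 γ₁), OpField (mbAlg S m hκ hK hc.1) s
      (thickening δ (dom S (c, m) σ μ)) (parBall p) B (W c) (M c))
    (hlow : ∀ c (hc : c ∈ Icc 0 γ₁), ∀ x ∈ dom S (c, m) σ μ, ∀ ρ ∈ parBall p,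
      lowL S m hc.1 (W c x ρ) = W 0 (lowL S m hc.1 x) ρ)
    (hper : ∀ x ∈ dom S (0, m) σ μ, ∀ ρ ∈ parBall p, ∀ k, F (x + angleShift S (0, m) k) ρ = F x ρ)
    (hreal : ∀ x ∈ dom S (0, m) σ μ, x ∈ Y.reals S (0, m) → ∀ ρ ∈ parBall p, (F x ρ).im = 0) :
    IsTD S K m κ s γ₁ σ μ F ∧ normTD S K m κ s γ₁ σ μ F ≤ ENNReal.ofReal B := by
  have hD := isOpen_parBall p
  have hopen : ∀ c, IsOpen (dom S (c, m) σ μ) := fun c => isOpen_dom hσ hμ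
  have hsub : ∀ c, dom S (c, m) σ μ ⊆ thickening δ (dom S (c, m) σ μ) := fun c =>
    self_subset_thickening hδ _
  have h00 : (0 : ℝ) ∈ Icc 0 γ₁ := ⟨le_rfl, hγ⟩
  have hF₀' : HolFam s (dom S (0, m) σ μ) (parBall p) F₀ :=
    hF₀.toHolFam.mono le_rfl (hsub 0) Subset.rfl
  have hW' : ∀ c, c ∈ Icc 0 γ₁ → HolFam s (dom S (c, m) σ μ) (parBall p) (W c) := fun c hc =>
    (hW c hc).field.toHolFam.mono le_rfl (hsub c) Subset.rfl
  have hM' : ∀ c, c ∈ Icc 0 γ₁ → HolFam s (dom S (c, m) σ μ) (parBall p) (M c) := fun c hc =>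
    (hW c hc).deriv.toHolFam.mono le_rfl (hsub c) Subset.rfl
  have hFc : HolFam s (dom S (0, m) σ μ) (parBall p) F := hF₀'.congr hF
  have key : ∀ n ≤ s, ∀ (k : Fin n → Fin p), ∀ ρ ∈ parBall p, _ := fun n hn k ρ hρ =>
    isT_of_fields (B := B) (K := K) (κ := κ) hσ hμ hm hδ (G := fun x => pderiv k (F x) ρ)
      (G₀ := fun x => pderiv k (F₀ x) ρ) (W := fun c x => pderiv k (W c x) ρ)
      (M := fun c x => pderiv k (M c x) ρ)
      (fun x hx => pderiv_congr hD (hF x hx) k hρ)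
      (hF₀.toHolFam.differentiableOn_pderiv isOpen_thickening hD hn k hρ)
      (fun x hx => by
        have hns : (n : WithTop ℕ∞) ≤ s := by exact_mod_cast hn
        have h1 := hasFDerivAt_pderiv (F := F₀) (M := fun x ρ => sympL S hm le_rfl (W 0 x ρ))
          (hopen 0) hD k (hF₀'.contDiffOn.of_le hns)
          (((hW' 0 h00).clm (sympL S hm le_rfl)).contDiffOn.of_le hns) hd hx hρ
        have h2 := pderiv_clm ((sympL S hm le_rfl).restrictScalars ℝ)
          ((((hW' 0 h00).contDiffOn_right hx).contDiffAt (hD.mem_nhds hρ)).of_le hns) k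
        have e : sympL S hm le_rfl (pderiv k (W 0 x) ρ) =
          pderiv k (fun ρ => sympL S hm le_rfl (W 0 x ρ)) ρ := h2.symm
        rw [e]
        exact h1)
      (fun c hc => (hW c hc).field.toHolFam.differentiableOn_pderiv isOpen_thickening hD hn k hρ)
      (fun c hc => (hW c hc).deriv.toHolFam.differentiableOn_pderiv isOpen_thickening hD hn k hρ)
      (fun c hc x hx => by
        have hns : (n : WithTop ℕ∞) ≤ s := by exact_mod_cast hn
        have h1 := hasFDerivAt_pderiv (F := W c) (M := fun x ρ => Mb.act (M c x ρ))
          (hopen c) hD k ((hW' c hc).contDiffOn.of_le hns)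
          (((hM' c hc).clm Mb.act).contDiffOn.of_le hns)
          (fun x hx ρ hρ => (hW c hc).hasFDerivAt x (hsub c hx) ρ hρ) hx hρ
        have h2 := pderiv_clm ((Mb.act (S := S) (γ := (c, m)) (K := K) (m := m)
          (κ := κ)).restrictScalars ℝ)
          ((((hM' c hc).contDiffOn_right hx).contDiffAt (hD.mem_nhds hρ)).of_le hns) k
        have e : Mb.act (pderiv k (M c x) ρ) = pderiv k (fun ρ => Mb.act (M c x ρ)) ρ := h2.symm
        rw [e]
        exact h1)
      (fun c hc x hx => by
        have hns : (n : WithTop ℕ∞) ≤ s := by exact_mod_cast hn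
        have h4 := pderiv_clm ((lowL S m hc.1).restrictScalars ℝ)
          ((((hW' c hc).contDiffOn_right hx).contDiffAt (hD.mem_nhds hρ)).of_le hns) k
        refine Eq.trans h4.symm ?_
        exact pderiv_congr hD (fun ρ hρ => hlow c hc x hx ρ hρ) k hρ)
      (fun x hx => by
        rw [pderiv_congr hD (hF x hx) k hρ]
        exact hF₀.bound n hn k x (hsub 0 hx) ρ hρ)
      (fun c hc x hx => (hW c hc).field.bound n hn k x (hsub c hx) ρ hρ)
      (fun c hc x hx => (hW c hc).deriv.bound n hn k x (hsub c hx) ρ hρ)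
      (fun x hx j => pderiv_congr hD (fun ρ hρ => hper x hx ρ hρ j) k hρ)
      (fun x hx hxr => by
        have hns : (n : WithTop ℕ∞) ≤ s := by exact_mod_cast hn
        have h1 := pderiv_clm imCL
          (((hFc.contDiffOn_right hx).contDiffAt (hD.mem_nhds hρ)).of_le hns) k
        rw [pderiv_congr hD (F' := fun _ => 0)
          (fun ρ hρ => imCL_eq_zero.2 (hreal x hx hxr ρ hρ)) k hρ] at h1
        refine imCL_eq_zero.1 (h1.symm.trans ?_)
        simp [pderiv])
  have hnorm : normTD S K m κ s γ₁ σ μ F ≤ ENNReal.ofReal B :=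
    iSup_le fun n => iSup_le fun hn => iSup_le fun k => iSup₂_le fun ρ hρ => (key n hn k ρ hρ).1.2
  have hkey0 : ∀ ρ ∈ parBall p, ∀ c ∈ Icc 0 γ₁, ∀ x ∈ dom S (c, m) σ μ,
      Jd S m (fun x => F x ρ) c x = W c x ρ ∧ Jdd S K m κ (fun x => F x ρ) c x = M c x ρ := by
    intro ρ hρ c hc x hx
    have h1 := (key 0 (Nat.zero_le _) Fin.elim0 ρ hρ).2 c hc x hx
    simpa only [pderiv_zero] using h1
  refine ⟨⟨hFc.contDiffOn, fun c hc => ?_, fun c hc => ?_, fun n hn k ρ hρ => (key n hn k ρ hρ).1.1,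
    hnorm.trans_lt ENNReal.ofReal_lt_top⟩, hnorm⟩
  · exact (hW' c hc).contDiffOn.congr fun y hy => (hkey0 y.2 hy.2 c hc y.1 hy.1).1
  · exact (hM' c hc).contDiffOn.congr fun y hy => (hkey0 y.2 hy.2 c hc y.1 hy.1).2

end Criterion

/-! ## Properties of flow curves -/

section FlowCurves

open Filter Topology Metric

variable {E F 𝓜 : Type} [NormedAddCommGroup E] [NormedSpace ℂ E] [NormedAddCommGroup F]
  [NormedSpace ℂ F] [NormedAddCommGroup 𝓜] [NormedSpace ℂ 𝓜] {p : ℕ}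

theorem eq_of_hasDerivWithinAt_zero {f f' : ℝ → E}
    (hf : ∀ t ∈ Icc (-1 : ℝ) 1, HasDerivWithinAt f (f' t) (Icc (-1) 1) t)
    (h0 : ∀ t ∈ Icc (-1 : ℝ) 1, f' t = 0) {t : ℝ} (ht : t ∈ Icc (-1 : ℝ) 1) : f t = f 0 := by
  let _ : NormedSpace ℝ E := NormedSpace.complexToReal
  have h1 := (convex_Icc (-1 : ℝ) 1).norm_image_sub_le_of_norm_hasDerivWithin_le (C := 0) hf
    (fun t ht => by rw [h0 t ht, norm_zero]) (show (0 : ℝ) ∈ Icc (-1 : ℝ) 1 by norm_num) ht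
  rw [zero_mul] at h1
  exact sub_eq_zero.1 (norm_le_zero_iff.1 h1)

variable [CompleteSpace E] [CompleteSpace F]

/-- `φ + ∫ X(φ)` has derivative zero, hence is constant. This makes the uniqueness of solutions of
the integral equation available for arbitrary differentiable flows. -/
theorem isFlowCurve_of_hasDerivWithinAt {U : Set E} {X : E → Par p → E} {x : E} {ρ : Par p}
    {φ : ℝ → E} (hX : ContinuousOn (fun x => X x ρ) U) (h0 : φ 0 = x)
    (hφ : ∀ t ∈ Icc (-1 : ℝ) 1, φ t ∈ U ∧ HasDerivWithinAt φ (-(X (φ t) ρ)) (Icc (-1 : ℝ) 1) t) :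
    ∃ u, IsFlowCurve U X x ρ u ∧ ∀ t : TI, u t = φ t := by
  have hc : ContinuousOn φ (Icc (-1 : ℝ) 1) := fun t ht => (hφ t ht).2.continuousWithinAt
  let u : C(TI, E) := ⟨fun t => φ t, hc.domRestrict⟩
  have hu : u ∈ curvesIn TI U := fun t => (hφ t t.2).1
  have hut : ∀ t, u t = φ t := fun _ => rfl
  refine ⟨u, ⟨hu, ?_⟩, hut⟩
  ext t
  have h1 := eq_of_hasDerivWithinAt_zero
    (f := fun t => φ t + ∫ τ in (0 : ℝ)..t, extTI (nem (fun x => X x ρ) u) τ)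
    (fun t ht => (hφ t ht).2.add
      (hasDerivAt_primitive_extTI (nem (fun x => X x ρ) u) t).hasDerivWithinAt)
    (fun t ht => by
      have h2 := extTI_apply (nem (fun x => X x ρ) u) ⟨t, ht⟩
      rw [nem_apply hX hu] at h2
      change extTI _ t = _ at h2
      rw [h2, hut, neg_add_cancel]) t.2
  rw [intervalIntegral.integral_same, add_zero, h0] at h1
  rw [ContinuousMap.sub_apply, constL_apply, primL_apply, ← h1, add_sub_cancel_right, hut]

theorem IsFlowCurve.hasDerivWithinAt {U : Set E} {X : E → Par p → E} {x : E} {ρ : Par p}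
    {u : C(TI, E)} (hX : ContinuousOn (fun x => X x ρ) U) (hu : IsFlowCurve U X x ρ u) {t : ℝ}
    (ht : t ∈ Icc (-1 : ℝ) 1) :
    HasDerivWithinAt (extTI u) (-(X (extTI u t) ρ)) (Icc (-1 : ℝ) 1) t := by
  have h1 : ∀ t ∈ Icc (-1 : ℝ) 1,
      extTI u t = x - ∫ τ in (0 : ℝ)..t, extTI (nem (fun x => X x ρ) u) τ := by
    intro t ht
    have h2 := extTI_apply u ⟨t, ht⟩
    change extTI u t = _ at h2
    rw [h2]
    conv_lhs => rw [hu.2]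
    rw [ContinuousMap.sub_apply, constL_apply, primL_apply]
  have h3 := ((hasDerivAt_primitive_extTI (nem (fun x => X x ρ) u) t).const_sub x).hasDerivWithinAt
    (s := Icc (-1 : ℝ) 1)
  have h4 : extTI (nem (fun x => X x ρ) u) t = X (extTI u t) ρ := by
    have h2 := extTI_apply (nem (fun x => X x ρ) u) ⟨t, ht⟩
    have h5 := extTI_apply u ⟨t, ht⟩
    rw [nem_apply hX hu.1, ← h5] at h2
    exact h2
  rw [h4] at h3
  exact h3.congr h1 (h1 t ht)

theorem IsFlowCurve.apply_zero {U : Set E} {X : E → Par p → E} {x : E} {ρ : Par p}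
    {u : C(TI, E)} (hu : IsFlowCurve U X x ρ u) : u TI.zero = x := by
  rw [hu.2, ContinuousMap.sub_apply, constL_apply, primL_zero_time, sub_zero]

/-- Affine images of flow curves. -/
theorem IsFlowCurve.map {U : Set E} {X : E → Par p → E} {x : E} {ρ : Par p} {u : C(TI, E)}
    (hX : ContinuousOn (fun x => X x ρ) U) (hu : IsFlowCurve U X x ρ u) {U' : Set F}
    {X' : F → Par p → F} (hX' : ContinuousOn (fun x => X' x ρ) U') (L : E →L[ℂ] F) (z : F)
    (hL : ∀ y ∈ U, L y + z ∈ U') (hXL : ∀ y ∈ U, X' (L y + z) ρ = L (X y ρ)) :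
    ∃ v, IsFlowCurve U' X' (L x + z) ρ v ∧ ∀ t, v t = L (u t) + z := by
  let v : C(TI, F) := ⟨fun t => L (u t) + z, by fun_prop⟩
  have hvt : ∀ t, v t = L (u t) + z := fun _ => rfl
  have hv : v ∈ curvesIn TI U' := fun t => hL _ (hu.1 t)
  refine ⟨v, ⟨hv, ?_⟩, hvt⟩
  ext t
  have h1 := map_primL (L.restrictScalars ℝ) (nem (fun x => X x ρ) u) (nem (fun x => X' x ρ) v)
    (fun t => by
      rw [nem_apply hX hu.1, nem_apply hX' hv, hvt]
      exact hXL _ (hu.1 t)) t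
  have h2 : u t = x - primL (nem (fun x => X x ρ) u) t := by
    conv_lhs => rw [hu.2]
    rw [ContinuousMap.sub_apply, constL_apply]
  rw [ContinuousMap.sub_apply, constL_apply, h1, hvt, h2, map_sub]
  change _ = L x + z - L _
  abel

omit [CompleteSpace E] in
/-- Invariance of a bilinear form under the propagator. -/
theorem OpAlg.form_propagator {𝒜 : OpAlg E 𝓜} [CompleteSpace 𝓜] {η : C(TI, 𝓜)} (hη : ‖η‖ ≤ 1 / 2)
    (ω : E →L[ℂ] E →L[ℂ] ℂ)
    (hω : ∀ t v w, ω (𝒜.act (η t) v) w + ω v (𝒜.act (η t) w) = 0) (t : TI) (v w : E) :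
    ω (v + 𝒜.act (𝒜.propagator η t) v) (w + 𝒜.act (𝒜.propagator η t) w) = ω v w := by
  set a := 𝒜.propagator η with ha
  set ξ := η + ptBilin TI 𝒜.mul η a with hξ
  -- The propagator as a primitive of `-η(1 + a)`, extended to the whole line by means of `extTI`,
  -- so that it has two-sided derivatives even at the end points.
  obtain ⟨A, hA, haA, hA0⟩ : ∃ A : ℝ → 𝓜, (∀ τ, HasDerivAt A (-extTI ξ τ) τ) ∧
      (∀ t : TI, a t = A t) ∧ A 0 = 0 := by
    refine ⟨fun τ => -∫ σ in (0 : ℝ)..τ, extTI ξ σ,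
      fun τ => (hasDerivAt_primitive_extTI ξ τ).neg, fun t => ?_, ?_⟩
    · have h1 := 𝒜.propagator_eq hη
      rw [𝒜.negPrimMul_apply, ← neg_add, ← map_add] at h1
      have h2 := congrArg (fun u : C(TI, 𝓜) => u t) h1
      exact h2
    · simp only [intervalIntegral.integral_same, neg_zero]
  have hV : ∀ (v : E) (τ : ℝ), HasDerivAt (fun τ => v + 𝒜.act (A τ) v)
      (𝒜.act (-extTI ξ τ) v) τ := by
    intro v τ
    have h1 := (((𝒜.act.flip v).restrictScalars ℝ).hasFDerivAt.comp_hasDerivAt τ (hA τ)).const_add v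
    exact h1
  have hξV : ∀ (v : E), ∀ τ, (hτ : τ ∈ Icc (-1 : ℝ) 1) →
      𝒜.act (-extTI ξ τ) v = -𝒜.act (η ⟨τ, hτ⟩) (v + 𝒜.act (A τ) v) := by
    intro v τ hτ
    have h1 := extTI_apply ξ ⟨τ, hτ⟩
    have h2 := haA ⟨τ, hτ⟩
    change extTI ξ τ = _ at h1
    change a ⟨τ, hτ⟩ = A τ at h2
    rw [h1, ← h2, hξ, ContinuousMap.add_apply, ptBilin_apply, map_neg, map_add, map_add,
      _root_.neg_apply, _root_.add_apply, 𝒜.act_mul]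
  have hωV : ∀ τ, HasDerivAt (fun τ => ω (v + 𝒜.act (A τ) v) (w + 𝒜.act (A τ) w))
      (ω (v + 𝒜.act (A τ) v) (𝒜.act (-extTI ξ τ) w) +
        ω (𝒜.act (-extTI ξ τ) v) (w + 𝒜.act (A τ) w)) τ := by
    intro τ
    have h2 := (ω.bilinearRestrictScalars ℝ).isBoundedBilinearMap.hasFDerivAt
      (v + 𝒜.act (A τ) v, w + 𝒜.act (A τ) w)
    have h3 : HasDerivAt (fun τ => (v + 𝒜.act (A τ) v, w + 𝒜.act (A τ) w)) _ τ :=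
      (hV v τ).prodMk (hV w τ)
    exact HasFDerivAt.comp_hasDerivAt (f := fun τ => (v + 𝒜.act (A τ) v, w + 𝒜.act (A τ) w)) τ h2 h3
  -- On `[-1,1]` the vectors `V = (1 + A) v` and `W = (1 + A) w` satisfy `V' = -ηV` and `W' = -ηW`;
  -- the derivative of `ω(V, W)` is `-(ω(ηV, W) + ω(V, ηW)) = 0`.
  have h1 := eq_of_hasDerivWithinAt_zero
    (f := fun τ => ω (v + 𝒜.act (A τ) v) (w + 𝒜.act (A τ) w))
    (f' := fun τ => ω (v + 𝒜.act (A τ) v) (𝒜.act (-extTI ξ τ) w) +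
      ω (𝒜.act (-extTI ξ τ) v) (w + 𝒜.act (A τ) w))
    (fun τ _ => (hωV τ).hasDerivWithinAt)
    (fun τ hτ => by
      rw [hξV v τ hτ, hξV w τ hτ, map_neg, map_neg, _root_.neg_apply, ← neg_add, add_comm,
        hω ⟨τ, hτ⟩, neg_zero]) t.2
  rw [haA, h1, hA0, map_zero, _root_.zero_apply, _root_.zero_apply, add_zero, add_zero]

end FlowCurves

/-! ## The Hamiltonian flow on the scale of spaces -/

section HamiltonianFlow

open Filter Topology Metric

variable {d : ℕ} {S : Modes d} {K m κ γ₁ σ μ σ' μ' ε δ c : ℝ} {p s : ℕ}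
  {g : Y S (0, m) → Par p → ℂ}

open Classical in
/-- The integral curve, on `Y_{(c,m)}`, of the Hamiltonian vector field of `g`. -/
noncomputable def hamCurve (σ μ : ℝ) (g : Y S (0, m) → Par p → ℂ) (c : ℝ) (x : Y S (c, m))
    (ρ : Par p) : C(TI, Y S (c, m)) :=
  if h : ∃ u, IsFlowCurve (dom S (c, m) σ μ) (fun x ρ => Jd S m (fun y => g y ρ) c x) x ρ u
  then h.choose else 0

/-- A small Hamiltonian, together with the parameters of the domains. -/
structure SmallHam (S : Modes d) (K m κ γ₁ σ μ σ' μ' ε δ : ℝ) (s : ℕ)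
    (g : Y S (0, m) → Par p → ℂ) : Prop where
  one_le : 1 ≤ s
  hκ : 0 ≤ κ
  hm : 0 ≤ m
  hK : 4 ^ κ ≤ K
  hγ : 0 ≤ γ₁
  hσ' : 0 < σ'
  hσ : 0 < σ
  hμ' : 0 < μ'
  hμ : 0 < μ
  isTD : IsTD S K m κ s γ₁ σ μ g
  hε : 0 ≤ ε
  norm_le : (normTD S K m κ s γ₁ σ μ g).toReal ≤ ε
  hδ : 0 < δ
  hδ1 : δ ≤ 1
  small : flowC p s * ε ≤ δ / 2
  le_min : 4 * δ ≤ min (min (σ - σ') (μ - μ')) (min (σ / μ * (μ - μ')) (μ / σ * (σ - σ')))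

namespace SmallHam

variable (h : SmallHam S K m κ γ₁ σ μ σ' μ' ε δ s g)

include h

theorem eps_le : ε ≤ δ / 2 := by
  have h1 := one_le_flowC p s
  nlinarith [h.hε, h.small]

theorem eps_le_half : ε ≤ 1 / 2 := by linarith [h.eps_le, h.hδ1]

theorem zero_mem_Icc : (0 : ℝ) ∈ Icc 0 γ₁ := ⟨le_rfl, h.hγ⟩

theorem opField (hc : c ∈ Icc 0 γ₁) :
    OpField (mbAlg S m h.hκ h.hK hc.1) s (dom S (c, m) σ μ) (parBall p) ε
      (fun x ρ => Jd S m (fun x => g x ρ) c x) (fun x ρ => Jdd S K m κ (fun x => g x ρ) c x) :=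
  h.isTD.opField h.hσ h.hμ h.hm h.hκ h.hK hc h.norm_le

theorem continuousOn_Jd (hc : c ∈ Icc 0 γ₁) {ρ : Par p} (hρ : ρ ∈ parBall p) :
    ContinuousOn (fun x => Jd S m (fun x => g x ρ) c x) (dom S (c, m) σ μ) :=
  (h.opField hc).field.toHolFam.continuousOn_left hρ

/-- Initial points range over a `2δ`-neighbourhood of the smaller domain, and a further `2δ` is left
for the motion, at most `δ / 2`, and for a ball of radius `δ` about the curve on which Cauchy's
estimates operate. This is the origin of `4δ` in `SmallHam`. -/
theorem ball_subset_dom {x y : Y S (c, m)} (hx : x ∈ thickening (2 * δ) (dom S (c, m) σ' μ'))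
    {r : ℝ} (hy : ‖y - x‖ + r ≤ 2 * δ) : ball y r ⊆ dom S (c, m) σ μ := by
  intro z hz
  refine thickening_dom_subset h.hσ h.hμ h.hσ' h.hμ' (thickening_mono h.le_min _ ?_)
  obtain ⟨w, hw, hxw⟩ := mem_thickening_iff.1 hx
  refine mem_thickening_iff.2 ⟨w, hw, ?_⟩
  rw [mem_ball] at hz
  rw [← dist_eq_norm] at hy
  linarith [dist_triangle z y w, dist_triangle y x w]

theorem exists_flow (hc : c ∈ Icc 0 γ₁) {x : Y S (c, m)}
    (hx : x ∈ thickening (2 * δ) (dom S (c, m) σ' μ')) {ρ : Par p} (hρ : ρ ∈ parBall p)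
    {ι : Type*} (φ : ι → Y S (c, m) →L[ℝ] ℂ) (hφx : ∀ i, φ i x = 0)
    (hφ : ∀ y ∈ dom S (c, m) σ μ, (∀ i, φ i y = 0) →
      ∀ i, φ i (Jd S m (fun x => g x ρ) c y) = 0) :
    ∃ u, IsFlowCurve (dom S (c, m) σ μ) (fun x ρ => Jd S m (fun y => g y ρ) c x) x ρ u ∧
      (∀ t, ‖u t - x‖ ≤ ε) ∧ ∀ t i, φ i (u t) = 0 := by
  refine (h.opField hc).flow_exists (convex_dom h.hσ h.hμ) h.hε h.eps_le_half hρ ?_ φ hφx hφ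
  refine (closedBall_subset_ball (ε₂ := 2 * δ) ?_).trans (h.ball_subset_dom hx ?_)
  · linarith [h.eps_le, h.hδ]
  · rw [sub_self, norm_zero, zero_add]

theorem hamCurve_eq (hc : c ∈ Icc 0 γ₁) {x : Y S (c, m)} {ρ : Par p} (hρ : ρ ∈ parBall p)
    {u : C(TI, Y S (c, m))}
    (hu : IsFlowCurve (dom S (c, m) σ μ) (fun x ρ => Jd S m (fun y => g y ρ) c x) x ρ u) :
    hamCurve σ μ g c x ρ = u := by
  have h1 : ∃ u, IsFlowCurve (dom S (c, m) σ μ) (fun x ρ => Jd S m (fun y => g y ρ) c x) x ρ u :=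
    ⟨u, hu⟩
  rw [hamCurve, dif_pos h1]
  exact (h.opField hc).flow_unique (convex_dom h.hσ h.hμ) h.hε h.eps_le_half hρ h1.choose_spec hu

theorem isFlowCurve (hc : c ∈ Icc 0 γ₁) {x : Y S (c, m)}
    (hx : x ∈ thickening (2 * δ) (dom S (c, m) σ' μ')) {ρ : Par p} (hρ : ρ ∈ parBall p) :
    IsFlowCurve (dom S (c, m) σ μ) (fun x ρ => Jd S m (fun y => g y ρ) c x) x ρ
      (hamCurve σ μ g c x ρ) := by
  obtain ⟨u, hu, -⟩ := h.exists_flow hc hx hρ (ι := Empty) (fun i => i.elim) (fun i => i.elim)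
    (fun _ _ _ i => i.elim)
  rwa [h.hamCurve_eq hc hρ hu]

theorem norm_hamCurve_sub_le (hc : c ∈ Icc 0 γ₁) {x : Y S (c, m)}
    (hx : x ∈ thickening (2 * δ) (dom S (c, m) σ' μ')) {ρ : Par p} (hρ : ρ ∈ parBall p) (t : TI) :
    ‖hamCurve σ μ g c x ρ t - x‖ ≤ ε := by
  obtain ⟨u, hu, hu1, -⟩ := h.exists_flow hc hx hρ (ι := Empty) (fun i => i.elim) (fun i => i.elim)
    (fun _ _ _ i => i.elim)
  rw [h.hamCurve_eq hc hρ hu]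
  exact hu1 t

theorem ball_hamCurve_subset (hc : c ∈ Icc 0 γ₁) {x : Y S (c, m)}
    (hx : x ∈ thickening (2 * δ) (dom S (c, m) σ' μ')) {ρ : Par p} (hρ : ρ ∈ parBall p) (t : TI) :
    ball (hamCurve σ μ g c x ρ t) δ ⊆ dom S (c, m) σ μ :=
  h.ball_subset_dom hx (by linarith [h.norm_hamCurve_sub_le hc hx hρ t, h.eps_le, h.hδ])

theorem hamCurve_mem_dom (hc : c ∈ Icc 0 γ₁) {x : Y S (c, m)}
    (hx : x ∈ thickening (2 * δ) (dom S (c, m) σ' μ')) {ρ : Par p} (hρ : ρ ∈ parBall p) (t : TI) :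
    hamCurve σ μ g c x ρ t ∈ dom S (c, m) σ μ :=
  h.ball_hamCurve_subset hc hx hρ t (mem_ball_self h.hδ)

/-- Existence is applied with the imaginary parts of all components as constraints; uniqueness
identifies the resulting real curve with `hamCurve`. -/
theorem hamCurve_mem_reals (hc : c ∈ Icc 0 γ₁) {x : Y S (c, m)}
    (hx : x ∈ thickening (2 * δ) (dom S (c, m) σ' μ')) (hxr : x ∈ Y.reals S (c, m)) {ρ : Par p}
    (hρ : ρ ∈ parBall p) (t : TI) : hamCurve σ μ g c x ρ t ∈ Y.reals S (c, m) := by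
  obtain ⟨u, hu, -, hu2⟩ := h.exists_flow hc hx hρ
    (fun ai : S.Idx × Fin 2 => Y.imL ai.1 ai.2) (mem_reals_iff.1 hxr) fun y hy hyr =>
      mem_reals_iff.1 (((h.isTD.isT hρ).jd_rhb c hc).2 y hy (mem_reals_iff.2 hyr))
  rw [h.hamCurve_eq hc hρ hu]
  exact mem_reals_iff.2 (hu2 t)

/-- The inclusion intertwines the fields, so it maps an integral curve at level `c` to one at level
`0`, and curves there are unique. -/
theorem lowL_hamCurve (hc : c ∈ Icc 0 γ₁) {x : Y S (c, m)}
    (hx : x ∈ thickening (2 * δ) (dom S (c, m) σ' μ')) {ρ : Par p} (hρ : ρ ∈ parBall p) (t : TI) :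
    lowL S m hc.1 (hamCurve σ μ g c x ρ t) = hamCurve σ μ g 0 (lowL S m hc.1 x) ρ t := by
  have h0 := h.zero_mem_Icc
  obtain ⟨v, hv, hvt⟩ := (h.isFlowCurve hc hx hρ).map
    (X' := fun x ρ => Jd S m (fun y => g y ρ) 0 x) (h.continuousOn_Jd hc hρ)
    (h.continuousOn_Jd h0 hρ) (lowL S m hc.1) 0
    (fun y hy => by rw [add_zero]; exact lowL_mem_dom h.hσ h.hμ hc.1 hy)
    (fun y hy => by rw [add_zero]; exact ((h.isTD.isT hρ).lowL_Jd hc hy).symm)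
  rw [add_zero] at hv
  rw [h.hamCurve_eq h0 hρ hv, hvt, add_zero]

theorem lowL_mem_thickening (hc : c ∈ Icc 0 γ₁) {x : Y S (c, m)} {r : ℝ}
    (hx : x ∈ thickening r (dom S (c, m) σ' μ')) :
    lowL S m hc.1 x ∈ thickening r (dom S (0, m) σ' μ') :=
  incl_mem_thickening h.hσ' h.hμ' _ _ hx

theorem hamCurve_zero_add_angleShift {x : Y S (0, m)}
    (hx : x ∈ thickening (2 * δ) (dom S (0, m) σ' μ')) {ρ : Par p} (hρ : ρ ∈ parBall p)
    (k : ↥S.A → ℤ) (t : TI) :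
    hamCurve σ μ g 0 (x + angleShift S (0, m) k) ρ t =
      hamCurve σ μ g 0 x ρ t + angleShift S (0, m) k := by
  have h0 := h.zero_mem_Icc
  obtain ⟨v, hv, hvt⟩ := (h.isFlowCurve h0 hx hρ).map
    (X' := fun x ρ => Jd S m (fun y => g y ρ) 0 x) (h.continuousOn_Jd h0 hρ)
    (h.continuousOn_Jd h0 hρ) (ContinuousLinearMap.id ℂ _) (angleShift S (0, m) k)
    (fun y hy => add_angleShift_mem_dom h.hσ h.hμ hy k)
    (fun y hy => (h.isTD.isT hρ).Jd_add_angleShift h.hσ h.hμ hy k)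
  rw [ContinuousLinearMap.id_apply] at hv
  rw [h.hamCurve_eq h0 hρ hv, hvt, ContinuousLinearMap.id_apply]

/-- Periodicity of `g`, and hence of its field, is available at level `0`; injectivity of the
inclusion brings the conclusion back to level `c`. -/
theorem hamCurve_add_angleShift (hc : c ∈ Icc 0 γ₁) {x : Y S (c, m)}
    (hx : x ∈ thickening (2 * δ) (dom S (c, m) σ' μ')) {ρ : Par p} (hρ : ρ ∈ parBall p)
    (k : ↥S.A → ℤ) (t : TI) :
    hamCurve σ μ g c (x + angleShift S (c, m) k) ρ t =
      hamCurve σ μ g c x ρ t + angleShift S (c, m) k := by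
  have hk : lowL S m hc.1 (angleShift S (c, m) k) = angleShift S (0, m) k := incl_angleShift _ _ k
  refine lowL_injective hc.1 ?_
  rw [h.lowL_hamCurve hc (add_angleShift_mem_thickening h.hσ' h.hμ' hx k) hρ, map_add, map_add,
    h.lowL_hamCurve hc hx hρ, hk, h.hamCurve_zero_add_angleShift (h.lowL_mem_thickening hc hx) hρ]

theorem nearId (hc : c ∈ Icc 0 γ₁) (t : TI) :
    ∃ a b, NearId (mbAlg S m h.hκ h.hK hc.1) s (thickening (2 * δ) (dom S (c, m) σ' μ'))
      (parBall p) (flowC p s * ε) (fun x ρ => hamCurve σ μ g c x ρ t) a b :=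
  (h.opField hc).nearId_flow h.one_le (isOpen_dom h.hσ h.hμ) (isOpen_parBall p)
    (convex_dom h.hσ h.hμ) h.hε h.hδ h.hδ1 h.small isOpen_thickening
    (fun _ hx _ hρ => h.isFlowCurve hc hx hρ)
    (fun _ hx _ hρ t => h.norm_hamCurve_sub_le hc hx hρ t)
    (fun _ hx _ hρ t => h.ball_hamCurve_subset hc hx hρ t) t

/-- The differential of the flow preserves the symplectic form. -/
theorem sympL_fderiv (hc : c ∈ Icc 0 γ₁) {t : TI} {x : Y S (c, m)}
    (hx : x ∈ thickening (2 * δ) (dom S (c, m) σ' μ')) {ρ : Par p} (hρ : ρ ∈ parBall p)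
    {L : Y S (c, m) →L[ℂ] Y S (c, m)}
    (hL : HasFDerivAt (fun x => hamCurve σ μ g c x ρ t) L x) (v w : Y S (c, m)) :
    sympL S h.hm hc.1 (L v) (L w) = sympL S h.hm hc.1 v w := by
  have hX := h.opField hc
  have hU : IsOpen (dom S (c, m) σ μ) := isOpen_dom h.hσ h.hμ
  have huf := hX.holFam_flow h.one_le hU (isOpen_parBall p) (convex_dom h.hσ h.hμ) h.hε
    h.eps_le_half isOpen_thickening (fun _ hx _ hρ => h.isFlowCurve hc hx hρ)
  have h1 := hX.hasFDerivAt_flow hU h.hε h.eps_le_half isOpen_thickening huf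
    (fun _ hx _ hρ => h.isFlowCurve hc hx hρ) hx hρ t
  rw [hL.unique h1]
  have hu := (h.isFlowCurve hc hx hρ).1
  refine OpAlg.form_propagator
    ((hX.norm_nem_deriv_le h.hε hu hρ).trans h.eps_le_half)
    (sympL S h.hm hc.1) (fun τ v w => ?_) t v w
  -- After exchanging the arguments of `Ω` in the second term, the skewness condition becomes
  -- symmetry of `Ω(J d²g v, w)`, that is of the second differential.
  rw [nem_apply (hX.deriv.toHolFam.continuousOn_left hρ) hu, sympL_swap h.hm hc.1 v]
  have h2 := h.isTD.sympL_Jdd_symm h.hσ h.hμ h.hm hc (hu τ) hρ v w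
  exact sub_eq_zero.2 h2

/-- With `L = dΦ` and `L w = J df(Φ)` one has `d(f ∘ Φ) v = Ω(J df(Φ), L v) = Ω(L w, L v) = Ω(w,
v)`. Invariance of `Ω` thus replaces the transpose of `L` by its inverse and gives `J d(f ∘ Φ) = L⁻¹
J df(Φ)`. -/
theorem hasFDerivAt_comp_hamCurve {f : Y S (0, m) → Par p → ℂ} (hf : IsTD S K m κ s γ₁ σ μ f)
    {t : TI} {x : Y S (0, m)} (hx : x ∈ thickening (2 * δ) (dom S (0, m) σ' μ')) {ρ : Par p}
    (hρ : ρ ∈ parBall p) {L : Y S (0, m) →L[ℂ] Y S (0, m)}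
    (hL : HasFDerivAt (fun x => hamCurve σ μ g 0 x ρ t) L x) {w : Y S (0, m)}
    (hw : L w = Jd S m (fun y => f y ρ) 0 (hamCurve σ μ g 0 x ρ t)) :
    HasFDerivAt (fun x => f (hamCurve σ μ g 0 x ρ t) ρ) (sympL S h.hm le_rfl w) x := by
  have h00 := h.zero_mem_Icc
  have h1 := (hf.isT hρ).hasFDerivAt h.hσ h.hμ h.hm h.hγ (h.hamCurve_mem_dom h00 hx hρ t)
  have h2 := HasFDerivAt.comp (g := fun x => f x ρ) (f := fun x => hamCurve σ μ g 0 x ρ t) x h1 hL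
  have e : sympL S h.hm le_rfl w =
      (sympL S h.hm le_rfl (Jd S m (fun y => f y ρ) 0 (hamCurve σ μ g 0 x ρ t))).comp L := by
    refine ContinuousLinearMap.ext fun v => ?_
    rw [ContinuousLinearMap.comp_apply, ← h.sympL_fderiv h00 hx hρ hL w v, hw]
  rw [e]
  exact h2

theorem lowL_fderiv_hamCurve (hc : c ∈ Icc 0 γ₁) {t : TI} {x : Y S (c, m)}
    (hx : x ∈ thickening (2 * δ) (dom S (c, m) σ' μ')) {ρ : Par p} (hρ : ρ ∈ parBall p)
    {L : Y S (c, m) →L[ℂ] Y S (c, m)} {L₀ : Y S (0, m) →L[ℂ] Y S (0, m)}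
    (hL : HasFDerivAt (fun x => hamCurve σ μ g c x ρ t) L x)
    (hL₀ : HasFDerivAt (fun x => hamCurve σ μ g 0 x ρ t) L₀ (lowL S m hc.1 x)) (v : Y S (c, m)) :
    L₀ (lowL S m hc.1 v) = lowL S m hc.1 (L v) := by
  have h1 := (lowL S m hc.1).hasFDerivAt.comp x hL
  have h2 := HasFDerivAt.comp (g := fun x => hamCurve σ μ g 0 x ρ t) x
    hL₀ (lowL S m hc.1).hasFDerivAt
  have h3 := h2.unique (h1.congr_of_eventuallyEq (by
    filter_upwards [isOpen_thickening.mem_nhds hx] with y hy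
    exact (h.lowL_hamCurve hc hy hρ t).symm))
  exact DFunLike.congr_fun h3 v

/-- The composition of a function of class `T` with the flow. -/
theorem isTD_comp {f : Y S (0, m) → Par p → ℂ} (hf : IsTD S K m κ s γ₁ σ μ f) {φ : ℝ} (hφ : 0 < φ)
    (hfφ : (normTD S K m κ s γ₁ σ μ f).toReal ≤ φ) {t : TI} {F : Y S (0, m) → Par p → ℂ}
    (hF : ∀ x ∈ dom S (0, m) σ' μ', ∀ ρ ∈ parBall p, F x ρ = f (hamCurve σ μ g 0 x ρ t) ρ) :
    IsTD S K m κ s γ₁ σ' μ' F ∧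
      normTD S K m κ s γ₁ σ' μ' F ≤ ENNReal.ofReal ((compC p s + pullC p s) * φ) := by
  have hD := isOpen_parBall p
  have h00 := h.zero_mem_Icc
  have hB : 0 ≤ flowC p s * ε := mul_nonneg (zero_le_one.trans (one_le_flowC p s)) h.hε
  have hBδ : flowC p s * ε ≤ δ := by linarith [h.small, h.hδ]
  have hcC := one_le_compC p s
  have hpC : 0 ≤ pullC p s := by unfold pullC; positivity
  have hsub : ∀ c, dom S (c, m) σ' μ' ⊆ thickening (2 * δ) (dom S (c, m) σ' μ') := fun c =>
    self_subset_thickening (by linarith [h.hδ]) _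
  have hTT' : ∀ c, ∀ x ∈ thickening δ (dom S (c, m) σ' μ'),
      ball x δ ⊆ thickening (2 * δ) (dom S (c, m) σ' μ') := by
    intro c x hx y hy
    obtain ⟨z, hz, hxz⟩ := mem_thickening_iff.1 hx
    refine mem_thickening_iff.2 ⟨z, hz, ?_⟩
    rw [mem_ball] at hy
    linarith [dist_triangle y x z]
  have hmono : ∀ c, thickening δ (dom S (c, m) σ' μ') ⊆ thickening (2 * δ) (dom S (c, m) σ' μ') :=
    fun c x hx => hTT' c x hx (mem_ball_self h.hδ)
  -- The fields are needed as functions of all real `c`, so they are chosen for every `c` and set to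
  -- zero outside `[0, γ₁]`. The near-identity data are kept, since the identity `(1 + a) W = J
  -- df(Φ)` identifies `W` afterwards.
  have hex : ∀ c, ∃ (W : Y S (c, m) → Par p → Y S (c, m)) (M : Y S (c, m) → Par p →
      Mb S (c, m) K m κ), ∀ (hc : c ∈ Icc 0 γ₁),
      OpField (mbAlg S m h.hκ h.hK hc.1) s (thickening δ (dom S (c, m) σ' μ')) (parBall p)
        ((compC p s + pullC p s) * φ) W M ∧
      ∃ a : Y S (c, m) → Par p → Mb S (c, m) K m κ, ∃ b,
        NearId (mbAlg S m h.hκ h.hK hc.1) s (thickening (2 * δ) (dom S (c, m) σ' μ'))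
        (parBall p) (flowC p s * ε) (fun x ρ => hamCurve σ μ g c x ρ t) a b ∧
        ∀ x ∈ dom S (c, m) σ' μ', ∀ ρ ∈ parBall p, W x ρ + Mb.act (a x ρ) (W x ρ) =
          Jd S m (fun y => f y ρ) c (hamCurve σ μ g c x ρ t) := by
    intro c
    by_cases hc : c ∈ Icc 0 γ₁
    · obtain ⟨a, b, hab⟩ := h.nearId hc t
      obtain ⟨M, hM⟩ := hab.opField_pullback h.one_le hD isOpen_thickening h.hδ h.hδ1 hB hBδ
        (hTT' c) (fun x hx ρ hρ => h.ball_hamCurve_subset hc hx hρ t) hφ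
        (hf.opField h.hσ h.hμ h.hm h.hκ h.hK hc hfφ)
      have hle : pullC p s * φ ≤ (compC p s + pullC p s) * φ := by
        have : 0 ≤ compC p s * φ := by positivity
        linarith
      refine ⟨_, M, fun _ => ⟨⟨hM.field.mono le_rfl Subset.rfl hle,
        hM.deriv.mono le_rfl Subset.rfl hle, hM.hasFDerivAt⟩, a, b, hab, fun x hx ρ hρ => ?_⟩⟩
      exact hab.right_inv x (hsub c hx) ρ hρ _
    · exact ⟨fun _ _ => 0, fun _ _ => 0, fun h => absurd h hc⟩
  choose W M hWM using hex
  obtain ⟨-, a₀, b₀, hab₀, hW₀⟩ := hWM 0 h00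
  refine isTD_of_fields (F₀ := fun x ρ => f (hamCurve σ μ g 0 x ρ t) ρ) (W := W) (M := M)
    h.hσ' h.hμ' h.hm h.hκ h.hK h.hγ h.hδ hF ?_ ?_ (fun c hc => (hWM c hc).1) ?_ ?_ ?_
  · have hfb := hf.holFamBdd hfφ
    refine (HolFamBdd.of_derivBdd (hfb.toHolFam.comp hab₀.map fun x hx ρ hρ =>
      h.hamCurve_mem_dom h00 hx hρ t) fun x hx => hab₀.derivBdd_comp hD h.hδ hBδ
      (fun x hx ρ hρ => h.ball_hamCurve_subset h00 hx hρ t) hfb hx).mono le_rfl (hmono 0) ?_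
    have : 0 ≤ pullC p s * φ := by positivity
    linarith
  · intro x hx ρ hρ
    exact h.hasFDerivAt_comp_hamCurve hf (hsub 0 hx) hρ (hab₀.hasFDerivAt x (hsub 0 hx) ρ hρ)
      (hW₀ x hx ρ hρ)
  · intro c hc x hx ρ hρ
    obtain ⟨-, a, b, hab, hW⟩ := hWM c hc
    have hx0 := lowL_mem_dom h.hσ' h.hμ' hc.1 hx
    -- Compatibility of the fields at levels `c` and `0`: both have the same image under the
    -- invertible operator `1 + a₀`, which is then cancelled by its left inverse.
    have h4 : lowL S m hc.1 (W c x ρ) + Mb.act (a₀ (lowL S m hc.1 x) ρ) (lowL S m hc.1 (W c x ρ)) =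
        lowL S m hc.1 (W c x ρ + Mb.act (a x ρ) (W c x ρ)) :=
      h.lowL_fderiv_hamCurve hc (hsub c hx) hρ (hab.hasFDerivAt x (hsub c hx) ρ hρ)
        (hab₀.hasFDerivAt _ (hsub 0 hx0) ρ hρ) (W c x ρ)
    rw [hW x hx ρ hρ, (hf.isT hρ).lowL_Jd hc (h.hamCurve_mem_dom hc (hsub c hx) hρ t),
      h.lowL_hamCurve hc (hsub c hx) hρ, ← hW₀ _ hx0 ρ hρ] at h4
    have h5 : ∀ v, (v + Mb.act (a₀ (lowL S m hc.1 x) ρ) v) + Mb.act (b₀ (lowL S m hc.1 x) ρ)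
      (v + Mb.act (a₀ (lowL S m hc.1 x) ρ) v) = v := hab₀.left_inv _ (hsub 0 hx0) ρ hρ
    rw [← h5 (lowL S m hc.1 (W c x ρ)), h4, h5]
  · intro x hx ρ hρ k
    rw [hF x hx ρ hρ, hF _ (add_angleShift_mem_dom h.hσ' h.hμ' hx k) ρ hρ,
      h.hamCurve_zero_add_angleShift (hsub 0 hx) hρ]
    exact (hf.isT hρ).periodic _ (h.hamCurve_mem_dom h00 (hsub 0 hx) hρ t) k
  · intro x hx hxr ρ hρ
    rw [hF x hx ρ hρ]
    exact (hf.isT hρ).rhb.2 _ (h.hamCurve_mem_dom h00 (hsub 0 hx) hρ t)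
      (h.hamCurve_mem_reals h00 (hsub 0 hx) hxr hρ t)

end SmallHam

end HamiltonianFlow

/-! ### The time maps of an arbitrary Hamiltonian flow -/

section TimeMap

open Filter Topology Metric

variable {d : ℕ} {S : Modes d} {K m κ γ₁ σ μ σ' μ' ε δ c : ℝ} {p s : ℕ}
  {g : Y S (0, m) → Par p → ℂ}

namespace SmallHam

variable (h : SmallHam S K m κ γ₁ σ μ σ' μ' ε δ s g)

include h

theorem dom_subset_thickening (c : ℝ) :
    dom S (c, m) σ' μ' ⊆ thickening (2 * δ) (dom S (c, m) σ' μ') :=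
  self_subset_thickening (by linarith [h.hδ]) _

theorem isHamFlow_hamCurve :
    IsHamFlow S m σ μ σ' μ' g (fun t x ρ => extTI (hamCurve σ μ g 0 x ρ) t) := by
  intro ρ hρ x hx
  have h00 := h.zero_mem_Icc
  have hxT := h.dom_subset_thickening 0 hx
  have hu := h.isFlowCurve h00 hxT hρ
  refine ⟨?_, fun t ht => ⟨?_, hu.hasDerivWithinAt (h.continuousOn_Jd h00 hρ) ht⟩⟩
  · have h1 := extTI_apply (hamCurve σ μ g 0 x ρ) TI.zero
    rw [hu.apply_zero] at h1
    exact h1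
  · have h1 := extTI_apply (hamCurve σ μ g 0 x ρ) ⟨t, ht⟩
    change extTI (hamCurve σ μ g 0 x ρ) t = _ at h1
    change extTI (hamCurve σ μ g 0 x ρ) t ∈ _
    rw [h1]
    exact h.hamCurve_mem_dom h00 hxT hρ _

/-- By uniqueness any flow in the sense of `IsHamFlow` is given by `hamCurve` on the smaller domain;
it is therefore enough to establish all properties for `hamCurve`. -/
theorem isHamFlow_eq {Φ : ℝ → Y S (0, m) → Par p → Y S (0, m)}
    (hΦ : IsHamFlow S m σ μ σ' μ' g Φ) (t : TI) {x : Y S (0, m)} (hx : x ∈ dom S (0, m) σ' μ')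
    {ρ : Par p} (hρ : ρ ∈ parBall p) : Φ t x ρ = hamCurve σ μ g 0 x ρ t := by
  have h00 := h.zero_mem_Icc
  obtain ⟨u, hu, hut⟩ := isFlowCurve_of_hasDerivWithinAt (φ := fun τ => Φ τ x ρ)
    (X := fun x ρ => Jd S m (fun y => g y ρ) 0 x)
    (h.continuousOn_Jd h00 hρ) (hΦ ρ hρ x hx).1 (hΦ ρ hρ x hx).2
  rw [h.hamCurve_eq h00 hρ hu, hut]

section Fixed

variable {Ψ : Y S (0, m) → Par p → Y S (0, m)} {t : TI}
  (hΨ : ∀ x ∈ dom S (0, m) σ' μ', ∀ ρ ∈ parBall p, Ψ x ρ = hamCurve σ μ g 0 x ρ t)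

include hΨ

theorem coe_toY_eq (hc : c ∈ Icc 0 γ₁) {x : Y S (c, m)} (hx : x ∈ dom S (c, m) σ' μ') {ρ : Par p}
    (hρ : ρ ∈ parBall p) :
    (Ψ (toY S (0, m) x) ρ : S.Idx → C2) = hamCurve σ μ g c x ρ t := by
  rw [toY_eq_lowL hc.1, hΨ _ (lowL_mem_dom h.hσ' h.hμ' hc.1 hx) ρ hρ,
    ← h.lowL_hamCurve hc (h.dom_subset_thickening c hx) hρ, lowL_coe]

theorem lev_eq (hc : c ∈ Icc 0 γ₁) {x : Y S (c, m)} (hx : x ∈ dom S (c, m) σ' μ') {ρ : Par p}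
    (hρ : ρ ∈ parBall p) : lev S m Ψ c x ρ = hamCurve σ μ g c x ρ t := by
  rw [lev, h.coe_toY_eq hΨ hc hx hρ, toY_self]

theorem hasFDerivAt_lev (hc : c ∈ Icc 0 γ₁) {a b : Y S (c, m) → Par p → Mb S (c, m) K m κ}
    (hab : NearId (mbAlg S m h.hκ h.hK hc.1) s (thickening (2 * δ) (dom S (c, m) σ' μ'))
      (parBall p) (flowC p s * ε) (fun x ρ => hamCurve σ μ g c x ρ t) a b)
    {x : Y S (c, m)} (hx : x ∈ dom S (c, m) σ' μ') {ρ : Par p} (hρ : ρ ∈ parBall p) :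
    HasFDerivAt (fun y => lev S m Ψ c y ρ)
      (ContinuousLinearMap.id ℂ (Y S (c, m)) + Mb.act (a x ρ)) x := by
  have h1 := hab.hasFDerivAt x (h.dom_subset_thickening c hx) ρ hρ
  refine h1.congr_of_eventuallyEq ?_
  filter_upwards [(isOpen_dom h.hσ' h.hμ').mem_nhds hx] with y hy using h.lev_eq hΨ hc hy hρ

theorem isSymplecticFamily (hc : c ∈ Icc 0 γ₁) : IsSymplecticFamily S m s σ μ σ' μ' c Ψ := by
  obtain ⟨a, b, hab⟩ := h.nearId hc t
  have hsub := h.dom_subset_thickening c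
  have hmap : HolFam s (dom S (c, m) σ' μ') (parBall p) (lev S m Ψ c) :=
    (hab.map.mono le_rfl hsub Subset.rfl).congr fun x hx ρ hρ => h.lev_eq hΨ hc hx hρ
  refine ⟨fun x hx ρ hρ => ?_, fun x hx ρ hρ => ?_, fun x hx ρ hρ k => ?_, hmap.contDiffOn,
    hmap.hol, fun ρ hρ x hx hxr => ?_, fun ρ hρ x hx => ?_⟩
  · rw [h.coe_toY_eq hΨ hc hx hρ]
    exact (hamCurve σ μ g c x ρ t).2
  · rw [h.lev_eq hΨ hc hx hρ]
    exact h.hamCurve_mem_dom hc (hsub hx) hρ t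
  · rw [h.lev_eq hΨ hc hx hρ, h.lev_eq hΨ hc (add_angleShift_mem_dom h.hσ' h.hμ' hx k) hρ,
      h.hamCurve_add_angleShift hc (hsub hx) hρ]
  · rw [h.lev_eq hΨ hc hx hρ]
    exact h.hamCurve_mem_reals hc (hsub hx) hxr hρ t
  · have h1 := hab.hasFDerivAt x (hsub hx) ρ hρ
    rw [(h.hasFDerivAt_lev hΨ hc hab hx hρ).fderiv]
    exact isSymplecticOp_of_Omega (R := ContinuousLinearMap.id ℂ (Y S (c, m)) + Mb.act (b x ρ))
      (hab.left_inv x (hsub hx) ρ hρ) (hab.right_inv x (hsub hx) ρ hρ)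
      (fun v w => h.sympL_fderiv hc (hsub hx) hρ h1 v w)

theorem fderiv_lev_sub (hc : c ∈ Icc 0 γ₁) {a b : Y S (c, m) → Par p → Mb S (c, m) K m κ}
    (hab : NearId (mbAlg S m h.hκ h.hK hc.1) s (thickening (2 * δ) (dom S (c, m) σ' μ'))
      (parBall p) (flowC p s * ε) (fun x ρ => hamCurve σ μ g c x ρ t) a b)
    {x : Y S (c, m)} (hx : x ∈ dom S (c, m) σ' μ') {ρ : Par p} (hρ : ρ ∈ parBall p) :
    fderiv ℂ (fun y => lev S m Ψ c y ρ) x - ContinuousLinearMap.id ℂ (Y S (c, m)) = (a x ρ).1 := by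
  rw [(h.hasFDerivAt_lev hΨ hc hab hx hρ).fderiv, add_sub_cancel_left, Mb.act_apply]

theorem dlev_eq (hc : c ∈ Icc 0 γ₁) {a b : Y S (c, m) → Par p → Mb S (c, m) K m κ}
    (hab : NearId (mbAlg S m h.hκ h.hK hc.1) s (thickening (2 * δ) (dom S (c, m) σ' μ'))
      (parBall p) (flowC p s * ε) (fun x ρ => hamCurve σ μ g c x ρ t) a b)
    {x : Y S (c, m)} (hx : x ∈ dom S (c, m) σ' μ') {ρ : Par p} (hρ : ρ ∈ parBall p) :
    dlev S K m κ Ψ c x ρ = a x ρ := by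
  rw [dlev, h.fderiv_lev_sub hΨ hc hab hx hρ]
  exact toMb_eq (Mb.act_apply _)

theorem norm_pderiv_lev_sub_le (hc : c ∈ Icc 0 γ₁) {n : ℕ} (hn : n ≤ s) (k : Fin n → Fin p)
    {x : Y S (c, m)} (hx : x ∈ dom S (c, m) σ' μ') {ρ : Par p} (hρ : ρ ∈ parBall p) :
    ‖pderiv k (fun ρ' => lev S m Ψ c x ρ' - x) ρ‖ ≤ flowC p s * ε := by
  obtain ⟨a, b, hab⟩ := h.nearId hc t
  rw [pderiv_congr (isOpen_parBall p) (F' := fun ρ' => hamCurve σ μ g c x ρ' t - x)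
    (fun ρ hρ => by rw [h.lev_eq hΨ hc hx hρ]) k hρ]
  exact (norm_pderiv_le k _ ρ).trans
    ((hab.map_bdd x (h.dom_subset_thickening c hx)).bound n hn ρ hρ)

theorem fderiv_lev_sub_mem (hc : c ∈ Icc 0 γ₁) {x : Y S (c, m)} (hx : x ∈ dom S (c, m) σ' μ')
    {ρ : Par p} (hρ : ρ ∈ parBall p) :
    fderiv ℂ (fun y => lev S m Ψ c y ρ) x - ContinuousLinearMap.id ℂ (Y S (c, m)) ∈
      mbSubmodule S (c, m) K m κ := by
  obtain ⟨a, b, hab⟩ := h.nearId hc t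
  rw [h.fderiv_lev_sub hΨ hc hab hx hρ]
  exact (a x ρ).2

theorem contDiffOn_dlev (hc : c ∈ Icc 0 γ₁) :
    ContDiffOn ℝ s (fun y : Y S (c, m) × Par p => dlev S K m κ Ψ c y.1 y.2)
      (dom S (c, m) σ' μ' ×ˢ parBall p) := by
  obtain ⟨a, b, hab⟩ := h.nearId hc t
  exact (hab.holFam_a.mono le_rfl (h.dom_subset_thickening c) Subset.rfl).contDiffOn.congr
    fun y hy => h.dlev_eq hΨ hc hab hy.1 hy.2

theorem norm_pderiv_dlev_le (hc : c ∈ Icc 0 γ₁) {n : ℕ} (hn : n ≤ s) (k : Fin n → Fin p)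
    {x : Y S (c, m)} (hx : x ∈ dom S (c, m) σ' μ') {ρ : Par p} (hρ : ρ ∈ parBall p) :
    ‖pderiv k (fun ρ' => dlev S K m κ Ψ c x ρ') ρ‖ ≤ flowC p s * ε := by
  obtain ⟨a, b, hab⟩ := h.nearId hc t
  rw [pderiv_congr (isOpen_parBall p) (F' := a x) (fun ρ hρ => h.dlev_eq hΨ hc hab hx hρ) k hρ]
  exact (norm_pderiv_le k _ ρ).trans
    ((hab.a_bdd x (h.dom_subset_thickening c hx)).bound n hn ρ hρ)

/-- The norm of the composition of a function of class `T` with the flow. -/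
theorem normTD_comp_le {f : Y S (0, m) → Par p → ℂ} (hf : IsTD S K m κ s γ₁ σ μ f) :
    IsTD S K m κ s γ₁ σ' μ' (fun x ρ => f (Ψ x ρ) ρ) ∧
      normTD S K m κ s γ₁ σ' μ' (fun x ρ => f (Ψ x ρ) ρ) ≤
        ENNReal.ofReal (compC p s + pullC p s) * normTD S K m κ s γ₁ σ μ f := by
  have hC : 0 ≤ compC p s + pullC p s := by
    have := one_le_compC p s
    have : 0 ≤ pullC p s := by unfold pullC; positivity
    linarith
  set N := normTD S K m κ s γ₁ σ μ f with hN
  have hF : ∀ x ∈ dom S (0, m) σ' μ', ∀ ρ ∈ parBall p,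
      f (Ψ x ρ) ρ = f (hamCurve σ μ g 0 x ρ t) ρ := fun x hx ρ hρ => by rw [hΨ x hx ρ hρ]
  -- `isTD_comp` divides by a bound of the transported field and needs a strictly positive bound of
  -- `f`, although the norm of `f` may vanish. The bound `N + η` is used, followed by `η → 0`.
  have key : ∀ η : ℝ, 0 < η → _ := fun η hη =>
    h.isTD_comp hf (φ := N.toReal + η) (by positivity) (by linarith) hF
  refine ⟨(key 1 one_pos).1, ?_⟩
  have h1 : Tendsto (fun η : ℝ => ENNReal.ofReal ((compC p s + pullC p s) * (N.toReal + η)))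
      (𝓝[>] 0) (𝓝 (ENNReal.ofReal ((compC p s + pullC p s) * (N.toReal + 0)))) :=
    ((ENNReal.continuous_ofReal.comp (g := ENNReal.ofReal) (f := fun η : ℝ =>
      (compC p s + pullC p s) * (N.toReal + η)) (by fun_prop)).tendsto 0).mono_left
      nhdsWithin_le_nhds
  have h2 := ge_of_tendsto h1 (by
    filter_upwards [self_mem_nhdsWithin] with η hη using (key η hη).2)
  rwa [add_zero, ENNReal.ofReal_mul hC, ENNReal.ofReal_toReal hf.norm_lt_top.ne] at h2

end Fixed

end SmallHam

end TimeMap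

theorem proposition2p5 (d s nA nF p : ℕ) (hs : 1 ≤ s) (m : ℝ) :
    ∃ C : ℝ, 0 < C ∧
      ∀ (S : Modes d), S.A.card = nA → S.F.card = nF →
      ∀ (κ K γ₁ : ℝ), 0 ≤ κ → κ ≤ m → 4 ^ κ ≤ K → 0 ≤ γ₁ →
      ∀ (σ μ σ' μ' : ℝ), 0 < σ' → σ' < σ → 0 < μ' → μ' < μ → μ ≤ 1 →
      ∀ (g : Y S (0, m) → Par p → ℂ), IsTD S K m κ s γ₁ σ μ g →
        normTD S K m κ s γ₁ σ μ g ≤ ENNReal.ofReal (1 / C *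
          min (min (σ - σ') (μ - μ')) (min (σ / μ * (μ - μ')) (μ / σ * (σ - σ')))) →
        (∃ Φ : ℝ → Y S (0, m) → Par p → Y S (0, m), IsHamFlow S m σ μ σ' μ' g Φ) ∧
        ∀ Φ : ℝ → Y S (0, m) → Par p → Y S (0, m), IsHamFlow S m σ μ σ' μ' g Φ →
          ∀ t ∈ Set.Icc (-1 : ℝ) 1,
            (∀ c ∈ Set.Icc 0 γ₁,
              IsSymplecticFamily S m s σ μ σ' μ' c (Φ t) ∧
              (∀ n ≤ s, ∀ (k : Fin n → Fin p), ∀ x ∈ dom S (c, m) σ' μ', ∀ ρ ∈ parBall p,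
                ‖pderiv k (fun ρ' => lev S m (Φ t) c x ρ' - x) ρ‖ₑ ≤
                  ENNReal.ofReal C * normTD S K m κ s γ₁ σ μ g) ∧
              (∀ x ∈ dom S (c, m) σ' μ', ∀ ρ ∈ parBall p,
                fderiv ℂ (fun y => lev S m (Φ t) c y ρ) x -
                  ContinuousLinearMap.id ℂ (Y S (c, m)) ∈ mbSubmodule S (c, m) K m κ) ∧
              ContDiffOn ℝ s (fun y : Y S (c, m) × Par p => dlev S K m κ (Φ t) c y.1 y.2)
                (dom S (c, m) σ' μ' ×ˢ parBall p) ∧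
              (∀ n ≤ s, ∀ (k : Fin n → Fin p), ∀ x ∈ dom S (c, m) σ' μ', ∀ ρ ∈ parBall p,
                ‖pderiv k (fun ρ' => dlev S K m κ (Φ t) c x ρ') ρ‖ₑ ≤
                  ENNReal.ofReal C * normTD S K m κ s γ₁ σ μ g)) ∧
            ∀ f : Y S (0, m) → Par p → ℂ, IsTD S K m κ s γ₁ σ μ f →
              IsTD S K m κ s γ₁ σ' μ' (fun x ρ => f (Φ t x ρ) ρ) ∧
              normTD S K m κ s γ₁ σ' μ' (fun x ρ => f (Φ t x ρ) ρ) ≤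
                ENNReal.ofReal C * normTD S K m κ s γ₁ σ μ f := by
  have hfC := one_le_flowC p s
  have hcC := one_le_compC p s
  have hpC : 0 ≤ pullC p s := by unfold pullC; positivity
  -- With `δ = m₀ / 4` the requirement `flowC p s * ε ≤ δ / 2` is `8 * flowC p s * ε ≤ m₀`, which
  -- follows from `C * ε ≤ m₀`. The second summand is the constant for compositions `f ∘ Φ`.
  refine ⟨8 * flowC p s + (compC p s + pullC p s), by linarith, ?_⟩
  set C := 8 * flowC p s + (compC p s + pullC p s) with hCdef
  have hC : 0 < C := by linarith
  intro S _ _ κ K γ₁ hκ hκm hK hγ σ μ σ' μ' hσ' hσσ' hμ' hμμ' hμ1 g hg hgn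
  have hσ : 0 < σ := hσ'.trans hσσ'
  have hμ : 0 < μ := hμ'.trans hμμ'
  set m₀ := min (min (σ - σ') (μ - μ')) (min (σ / μ * (μ - μ')) (μ / σ * (σ - σ'))) with hm₀
  have hm₀0 : 0 < m₀ := by
    have h1 : 0 < σ - σ' := sub_pos.2 hσσ'
    have h2 : 0 < μ - μ' := sub_pos.2 hμμ'
    exact lt_min (lt_min h1 h2) (lt_min (by positivity) (by positivity))
  -- This is where `μ ≤ 1` enters: it gives `δ ≤ 1`, as the bounds of the flow and of the
  -- transported fields require.
  have hm₀1 : m₀ ≤ 1 := by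
    have h1 : m₀ ≤ μ - μ' := (min_le_left _ _).trans (min_le_right _ _)
    linarith
  have hε : (normTD S K m κ s γ₁ σ μ g).toReal ≤ 1 / C * m₀ :=
    ENNReal.toReal_le_of_le_ofReal (by positivity) hgn
  set ε := (normTD S K m κ s γ₁ σ μ g).toReal with hεdef
  have hε0 : 0 ≤ ε := ENNReal.toReal_nonneg
  have hεC : C * ε ≤ m₀ := by
    calc C * ε ≤ C * (1 / C * m₀) := by gcongr
      _ = m₀ := by field_simp
  -- A quarter of the minimum, because the flow argument consumes the distance `4δ` between the
  -- domains.
  have h : SmallHam S K m κ γ₁ σ μ σ' μ' ε (m₀ / 4) s g :=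
    { one_le := hs, hκ := hκ, hm := hκ.trans hκm, hK := hK, hγ := hγ, hσ' := hσ', hσ := hσ,
      hμ' := hμ', hμ := hμ, isTD := hg, hε := hε0, norm_le := le_rfl, hδ := by positivity,
      hδ1 := by linarith
      small := by
        have : 0 ≤ (compC p s + pullC p s) * ε := by positivity
        have : C * ε = 8 * (flowC p s * ε) + (compC p s + pullC p s) * ε := by rw [hCdef]; ring
        linarith
      le_min := by linarith }
  have hflow : ∀ {E : Type} [NormedAddCommGroup E] {x : E}, ‖x‖ ≤ flowC p s * ε →
      ‖x‖ₑ ≤ ENNReal.ofReal C * normTD S K m κ s γ₁ σ μ g := by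
    intro E _ x hx
    refine (enorm_le_ofReal_of_norm_le hx).trans ?_
    rw [ENNReal.ofReal_mul (by linarith), hεdef, ENNReal.ofReal_toReal hg.norm_lt_top.ne]
    gcongr
    linarith
  refine ⟨⟨_, h.isHamFlow_hamCurve⟩, fun Φ hΦ t ht => ?_⟩
  have hΨ : ∀ x ∈ dom S (0, m) σ' μ', ∀ ρ ∈ parBall p,
      Φ t x ρ = hamCurve σ μ g 0 x ρ ⟨t, ht⟩ := fun x hx ρ hρ => h.isHamFlow_eq hΦ ⟨t, ht⟩ hx hρ
  refine ⟨fun c hc => ⟨h.isSymplecticFamily hΨ hc, fun n hn k x hx ρ hρ =>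
    hflow (h.norm_pderiv_lev_sub_le hΨ hc hn k hx hρ), fun x hx ρ hρ =>
    h.fderiv_lev_sub_mem hΨ hc hx hρ, h.contDiffOn_dlev hΨ hc, fun n hn k x hx ρ hρ =>
    hflow (h.norm_pderiv_dlev_le hΨ hc hn k hx hρ)⟩, fun f hf => ?_⟩
  obtain ⟨h1, h2⟩ := h.normTD_comp_le hΨ hf
  refine ⟨h1, h2.trans ?_⟩
  gcongr
  linarith
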